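/- **Model.** Tile the plane by regular hexagons whose centres form the triangular lattice with unit spacing. A *flower* is a hexagon (its *iris*) together with its six neighbours (its *petals*). Fix a set of irises whose flowers are pairwise disjoint, which is periodic (invariant under the translations by $m$ and $m e^{i\pi/3}$ for some integer $m\ge 1$), and which is invariant under the rotation by $60^\circ$ about some hexagon centre. Hexagons outside all flowers are *fillers*. Let $a,s\ge 0$ with $2a+3s=1$ and $a^2\ge 2s^2$. Petals and fillers are independently blue or yellow with probability $1/2$ each. Given these, the irises are independent: an iris whose petals form a *trigger* (three blue and three yellow petals with exactly one pair of adjacent blue petals) is blue or yellow with probability $1/2$ each; any other iris is blue with probability $a$, yellow with probability $a$, and in each of three mixed states with probability $s$. In a mixed state the hexagon is cut into a blue and a yellow half by the segment joining the midpoints of two opposite sides, the blue half containing two of the three corners of the up-pointing triangle inscribed in the hexagon (the lattice is oriented so that one lattice direction is horizontal). **Exploration path.** Let $\Omega\subset\mathbb C$ be open, connected and bounded. For $\varepsilon>0$ let $\Omega_\varepsilon$ consist of all fillers and all whole flowers of the tiling which, scaled by $\varepsilon$, have their closure in $\Omega$. An *admissible discretization* of $\Omega$ at scale $\varepsilon$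 is a lattice connected component $C$ of $\Omega_\varepsilon$, two lattice connected subsets of the lattice boundary of $C$ (the hexagons of $C$ with a neighbour outside $C$, completed to whole flowers), each consisting of hexagons and halves of irises, one declared blue and the other yellow, such that this colouring has positive probability, and two vertices $a_\varepsilon,c_\varepsilon$ of hexagons at which the two parts join, the third hexagon at each of them lying in $C$ and not being covered by the colouring there. The *exploration path* $\gamma_\varepsilon$ is the interface that starts at $a_\varepsilon$, keeps blue on its right and yellow on its left, and ends at $c_\varepsilon$ (it is stopped earlier if it would have to look at a hexagon outside $C$, and reduced to the point $a_\varepsilon$ if it never stops; neither occurs when the two coloured parts make up the boundary). Let $\mu_\varepsilon$ be the law of the compact set $\gamma_\varepsilon$ when the configuration is conditioned on the colours of the boundary, a Borel probability measure on the space of nonempty compact subsets of $\mathbb C$ with the Hausdorff metric. For bounded $S\subset\mathbb C$ let $M(S)=\limsup_{\vartheta\to 0+}\log\mathcal N_S(\vartheta)/\log(1/\vartheta)$ be the upper Minkowski dimension, where $\mathcal N_S(\vartheta)$ is the least number of closed axis-parallel boxes of side $\vartheta$ that cover $S$. **Lemma (Admissibility).** Suppose that $M(\partial\Omega)<2$.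 Then there is $\psi'>0$ (depending only on the model and on $\Omega$) such that the following holds for every sequence $\varepsilon_n\to 0+$, all admissible discretizations of $\Omega$ at the scales $\varepsilon_n$ and every limit point $\mu'$ of the laws $\mu_{\varepsilon_n}$ in the weak topology. For $\mu'$-almost every compact set $K$ (the limiting exploration path), $$M(K)<2-\psi' ,$$ and moreover, for every closed $L\subset K$ (for instance an initial part of the path) and every connected component $U$ of $\Omega\setminus L$, $$M(\partial U)<2-\psi' .$$ -/

import Mathlib

open MeasureTheory ProbabilityTheory Filter Topology
open TopologicalSpace (NonemptyCompacts)

noncomputable section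

namespace BondTriangular

/-! ### Upper Minkowski dimension -/

/-- The closed axis-parallel box of side `r` with lower left corner `w`. -/
def box (w : ℂ) (r : ℝ) : Set ℂ :=
  {z | w.re ≤ z.re ∧ z.re ≤ w.re + r ∧ w.im ≤ z.im ∧ z.im ≤ w.im + r}

/-- The least number of boxes of side `r` needed to cover `S` (meaningful for bounded `S`). -/
def boxCount (S : Set ℂ) (r : ℝ) : ℕ :=
  sInf {n : ℕ | ∃ W : Finset ℂ, W.card = n ∧ S ⊆ ⋃ w ∈ W, box w r}

/-- The upper Minkowski dimension `limsup_{r → 0+} log N(r) / log (1 / r)`. -/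
def upperMinkowskiDim (S : Set ℂ) : EReal :=
  limsup (fun r : ℝ => ((Real.log (boxCount S r) / Real.log (1 / r) : ℝ) : EReal)) (𝓝[>] 0)

/-! ### The hexagonal tiling -/

/-- Hexagons of the tiling, in the basis `1, exp (iπ/3)` of the triangular lattice of centres. -/
abbrev Hex : Type := ℤ × ℤ

/-- The centre of a hexagon (unit lattice spacing). -/
def center (h : Hex) : ℂ := (h.1 : ℂ) + (h.2 : ℂ) * Complex.exp (Complex.I * (Real.pi / 3))

/-- The six lattice directions; direction `k` has angle `kπ/3`. The hexagon `h + dir k` is the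
neighbour of `h` across its side number `k`. -/
def dir (k : Fin 6) : Hex :=
  (![(1, 0), (0, 1), (-1, 1), (-1, 0), (0, -1), (1, -1)] : Fin 6 → Hex) k

/-- The vertex number `j` of the hexagon `h`, at angle `π/6 + jπ/3` from its centre: the point
where `h`, `h + dir j` and `h + dir (j + 1)` meet. -/
def vertex (h : Hex) (j : Fin 6) : ℂ :=
  (center h + center (h + dir j) + center (h + dir (j + 1))) / 3

/-- The midpoint of the side number `k` of the hexagon `h`. -/
def sideMid (h : Hex) (k : Fin 6) : ℂ := (center h + center (h + dir k)) / 2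

/-- The closed hexagon. -/
def cell (h : Hex) : Set ℂ := convexHull ℝ (Set.range (vertex h))

/-- A hexagon together with its six neighbours. -/
def flower (i : Hex) : Set Hex := {h | h = i ∨ ∃ k, h = i + dir k}

/-- Rotation of the lattice by the angle `π/3` about the origin. -/
def rot (h : Hex) : Hex := (-h.2, h.1 + h.2)

/-! ### The model -/

/-- A floral arrangement in the plane, with the parameters of the model. -/
structure FlowerModel where
  /-- the set of irises -/
  irises : Set Hex
  /-- two distinct irises are separated by at least two hexagons, i.e. flowers are disjoint -/
  separated : ∀ i ∈ irises, ∀ i' ∈ irises, i ≠ i' → Disjoint (flower i) (flower i')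
  periodic : ∃ m : ℤ, 0 < m ∧ ∀ h : Hex,
    (h + (m, 0) ∈ irises ↔ h ∈ irises) ∧ (h + (0, m) ∈ irises ↔ h ∈ irises)
  rotation : ∃ o : Hex, ∀ h : Hex, o + rot (h - o) ∈ irises ↔ h ∈ irises
  /-- probability of a blue iris, and of a yellow iris, off triggers -/
  a : ℝ
  /-- probability of each of the three mixed states of an iris, off triggers -/
  s : ℝ
  a_nonneg : 0 ≤ a
  s_nonneg : 0 ≤ s
  sum_eq_one : 2 * a + 3 * s = 1
  two_mul_sq_le : 2 * s ^ 2 ≤ a ^ 2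

/-- The states of a hexagon. -/
inductive HexState : Type
  | blue : HexState
  | yellow : HexState
  | split (i : Fin 3) : HexState

instance : MeasurableSpace HexState := ⊤
instance : DiscreteMeasurableSpace HexState := ⟨fun _ => trivial⟩
instance : Countable HexState :=
  Function.Injective.countable (f := fun σ : HexState =>
    match σ with | .blue => (0 : ℕ) | .yellow => 1 | .split i => 2 + i.val)
    (by intro σ σ' h; cases σ <;> cases σ' <;> simp at h ⊢ <;> omega)

/-- A hexagon is cut by the segments joining its centre to the midpoints of its sides into six
kites, one at each vertex. `σ.isBlue j` says whether the kite at the vertex `j` is blue (otherwise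
it is yellow). In a mixed state the hexagon is cut in two halves by the segment joining the
midpoints of two opposite sides, and the blue half holds two of the three corners
`1, 3, 5` of the up-pointing triangle inscribed in the hexagon. -/
def HexState.isBlue : HexState → Fin 6 → Bool
  | .blue, _ => true
  | .yellow, _ => false
  | .split i, j => decide (j ∈ (![{5, 0, 1}, {1, 2, 3}, {3, 4, 5}] : Fin 3 → Finset (Fin 6)) i)

/-- A trigger: three petals are blue and three are yellow, and exactly one pair of neighbouring
petals is blue. Here `p k` says that the petal number `k` is blue. -/
def IsTrigger (p : Fin 6 → Bool) : Prop :=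
  (Finset.univ.filter fun k => p k = true).card = 3 ∧
    (Finset.univ.filter fun k => p k = true ∧ p (k + 1) = true).card = 1

/-- A percolation configuration. -/
abbrev Config : Type := Hex → HexState

/-- A fair coin. -/
def coin : Measure Bool := (2⁻¹ : ENNReal) • Measure.dirac true + (2⁻¹ : ENNReal) • Measure.dirac false

instance : IsProbabilityMeasure coin := ⟨by simp [coin, ENNReal.inv_two_add_inv_two]⟩

namespace FlowerModel

variable (M : FlowerModel)

/-- The law of an iris off triggers. -/
def irisLaw : Measure HexState :=
  ENNReal.ofReal M.a • Measure.dirac HexState.blue +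
    ENNReal.ofReal M.a • Measure.dirac HexState.yellow +
    ∑ i : Fin 3, ENNReal.ofReal M.s • Measure.dirac (HexState.split i)

instance : IsProbabilityMeasure M.irisLaw := ⟨by
  have h := M.sum_eq_one
  have ha := M.a_nonneg
  have hs := M.s_nonneg
  simp only [irisLaw, Measure.add_apply, Measure.smul_apply,
    measure_univ, smul_eq_mul, mul_one, Fin.sum_univ_three]
  rw [← ENNReal.ofReal_add ha ha, ← ENNReal.ofReal_add hs hs,
    ← ENNReal.ofReal_add (by positivity) hs, ← ENNReal.ofReal_add (by positivity) (by positivity)]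
  rw [show M.a + M.a + (M.s + M.s + M.s) = 1 by linarith, ENNReal.ofReal_one]⟩

/-- Independent randomness: every hexagon carries a fair coin and a variable with the law
`irisLaw`. -/
def seedLaw : Measure (Hex → Bool × HexState) :=
  Measure.infinitePi fun _ => coin.prod M.irisLaw

open Classical in
/-- The configuration: petals and fillers are blue or yellow according to their coin; an iris uses
its coin if its petals form a trigger, and its own five-state variable otherwise. -/
def config (x : Hex → Bool × HexState) : Config := fun h =>
  if h ∈ M.irises ∧ ¬ IsTrigger (fun k => (x (h + dir k)).1) then (x h).2
  else if (x h).1 then HexState.blue else HexState.yellow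

/-- The law of the percolation configuration in the whole plane. -/
def law : Measure Config := M.seedLaw.map M.config

theorem measurable_config : Measurable M.config := by
  classical
  refine measurable_pi_iff.2 fun h => ?_
  have h1 : Measurable fun x : Hex → Bool × HexState =>
      ((fun k => (x (h + dir k)).1 : Fin 6 → Bool), x h) := by
    fun_prop
  have h2 : Measurable fun y : (Fin 6 → Bool) × (Bool × HexState) =>
      if h ∈ M.irises ∧ ¬ IsTrigger y.1 then y.2.2
      else if y.2.1 then HexState.blue else HexState.yellow := Measurable.of_discrete
  exact h2.comp h1

instance : IsProbabilityMeasure M.seedLaw := by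
  unfold seedLaw; infer_instance

instance : IsProbabilityMeasure M.law :=
  Measure.isProbabilityMeasure_map M.measurable_config.aemeasurable

/-- The flower of `h`, or `h` alone if `h` is a filler. -/
def block (h : Hex) : Set Hex := {h' | h' = h ∨ ∃ i ∈ M.irises, h ∈ flower i ∧ h' ∈ flower i}

/-- The discretization of `Ω` at scale `ε`: all fillers and all whole flowers which, scaled by `ε`,
lie with their closure in `Ω`. -/
def latticeDomain (Ω : Set ℂ) (ε : ℝ) : Set Hex :=
  {h | ∀ h' ∈ M.block h, ∀ z ∈ cell h', (ε : ℂ) * z ∈ Ω}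

end FlowerModel

/-- `C` is a lattice connected component of `D`. -/
def IsLatticeComponent (D C : Set Hex) : Prop :=
  ∃ h₀ ∈ D, C = {h | Relation.ReflTransGen (fun x y => y ∈ D ∧ ∃ k, y = x + dir k) h₀ h}

/-- The lattice boundary of `C`: the hexagons with a neighbour outside `C`, where a flower that is
met is taken as a whole. -/
def FlowerModel.latticeBoundary (M : FlowerModel) (C : Set Hex) : Set Hex :=
  {h | ∃ h' ∈ M.block h, h' ∈ C ∧ ∃ k, h' + dir k ∉ C}

/-! ### The exploration process -/

/-- The kite `(h, j)` is the sixth of the hexagon `h` at its vertex `j`. -/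
abbrev Kite : Type := Hex × Fin 6

/-- The four corners of a kite, in counterclockwise order. -/
inductive Corner : Type
  | ctr : Corner
  | lo : Corner
  | vtx : Corner
  | hi : Corner

/-- The next corner in counterclockwise order. -/
def Corner.succ : Corner → Corner
  | .ctr => .lo
  | .lo => .vtx
  | .vtx => .hi
  | .hi => .ctr

/-- A flag is a kite with one of its corners. -/
abbrev Flag : Type := Kite × Corner

/-- The position of the corner of a flag (unit lattice spacing). -/
def Flag.pos : Flag → ℂ
  | ((h, _), .ctr) => center h
  | ((h, j), .lo) => sideMid h j
  | ((h, j), .vtx) => vertex h j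
  | ((h, j), .hi) => sideMid h (j + 1)

/-- The next kite in clockwise order around the given corner. -/
def Flag.cw : Flag → Flag
  | ((h, j), .ctr) => ((h, j + 5), .ctr)
  | ((h, j), .lo) => ((h + dir j, j + 2), .hi)
  | ((h, j), .vtx) => ((h + dir (j + 1), j + 4), .vtx)
  | ((h, j), .hi) => ((h, j + 1), .lo)

/-- Whether a kite is blue in the configuration. -/
def blueAt (ω : Config) (q : Kite) : Bool := (ω q.1).isBlue q.2

/-- One elementary step of the exploration. The flag `f` is a yellow kite on the left of the path
with the corner at which the path has arrived. If the next kite clockwise around this corner is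
blue, then the path proceeds along the side between the two (blue on the right) to the next corner;
if it is yellow, then it becomes the kite on the left. -/
def explore (ω : Config) (f : Flag) : Flag :=
  if blueAt ω f.cw.1 then (f.1, f.2.succ) else f.cw

/-- The union of the segments joining successive points of a list that starts at `z`. -/
def polyline : ℂ → List ℂ → NonemptyCompacts ℂ
  | z, [] => ⟨⟨{z}, isCompact_singleton⟩, Set.singleton_nonempty z⟩
  | z, w :: l => ⟨⟨segment ℝ z w, by
      rw [← convexHull_pair (𝕜 := ℝ)]; exact (Set.toFinite {z, w}).isCompact_convexHull (𝕜 := ℝ)⟩,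
      ⟨z, left_mem_segment ℝ z w⟩⟩ ⊔ polyline w l

/-- A set of kites is lattice connected: any two are joined by a chain of kites of the set that
successively share a side. -/
def KiteConnected (A : Set Kite) : Prop :=
  ∀ q ∈ A, ∀ q' ∈ A,
    Relation.ReflTransGen (fun x y => y ∈ A ∧ ∃ c : Corner, y = (Flag.cw (x, c)).1) q q'

/-- The event that the kites of `B` are blue and those of `Y` are yellow. -/
def boundaryEvent (B Y : Set Kite) : Set Config :=
  {ω | (∀ q ∈ B, blueAt ω q = true) ∧ ∀ q ∈ Y, blueAt ω q = false}

/-- An admissible discretization of `Ω` at scale `ε`: a lattice component `comp`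
of the discretized domain, with the blue and the yellow part of its lattice boundary
(not every hexagon of the boundary has to be coloured), and two vertices of hexagons where the two
parts join. The vertices are given by the yellow kites `start` and `finish` that touch them. -/
structure AdmissibleDiscretization (M : FlowerModel) (Ω : Set ℂ) (ε : ℝ) where
  comp : Set Hex
  isComponent : IsLatticeComponent (M.latticeDomain Ω ε) comp
  blue : Set Kite
  yellow : Set Kite
  blue_subset : ∀ q ∈ blue, q.1 ∈ M.latticeBoundary comp
  yellow_subset : ∀ q ∈ yellow, q.1 ∈ M.latticeBoundary comp
  /-- the blue part consists of hexagons and halves of irises -/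
  blue_shape : ∀ h, ∃ σ : HexState, (h ∉ M.irises → ∀ i, σ ≠ .split i) ∧
    ∀ j, (h, j) ∈ blue ↔ σ.isBlue j = true
  /-- the yellow part consists of hexagons and halves of irises -/
  yellow_shape : ∀ h, ∃ σ : HexState, (h ∉ M.irises → ∀ i, σ ≠ .split i) ∧
    ∀ j, (h, j) ∈ yellow ↔ σ.isBlue j = false
  blue_connected : KiteConnected blue
  yellow_connected : KiteConnected yellow
  /-- the colouring of the boundary is consistent with the statistical rules of the model -/
  pos_prob : M.law (boundaryEvent blue yellow) ≠ 0
  start : Kite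
  finish : Kite
  /-- seen from the starting vertex towards the inside, yellow is on the left, blue on the right -/
  start_yellow : start ∈ yellow
  start_blue : (Flag.cw (Flag.cw (start, .vtx))).1 ∈ blue
  start_inner : (Flag.cw (start, .vtx)).1.1 ∈ comp ∧
    (Flag.cw (start, .vtx)).1 ∉ blue ∪ yellow
  /-- seen from the end vertex towards the outside, yellow is on the left, blue on the right -/
  finish_yellow : finish ∈ yellow
  finish_blue : (Flag.cw (finish, .vtx)).1 ∈ blue
  finish_inner : (Flag.cw (Flag.cw (finish, .vtx))).1.1 ∈ comp ∧
    (Flag.cw (Flag.cw (finish, .vtx))).1 ∉ blue ∪ yellow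

namespace AdmissibleDiscretization

variable {M : FlowerModel} {Ω : Set ℂ} {ε : ℝ} (D : AdmissibleDiscretization M Ω ε)

/-- The state of the exploration after `n` elementary steps. -/
def path (ω : Config) (n : ℕ) : Flag := (explore ω)^[n] (D.start, .vtx)

/-- The number of elementary steps until the exploration arrives at its end vertex (or would have
to look at a hexagon outside the domain, which does not happen if the two coloured parts make up
the whole boundary). -/
def length (ω : Config) : ℕ :=
  sInf {n : ℕ | D.path ω n = (D.finish, .vtx) ∨ (D.path ω n).cw.1.1 ∉ D.comp}

/-- The flags visited after the first one. -/
def flags (ω : Config) : List Flag :=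
  (List.range (D.length ω)).map fun n => D.path ω (n + 1)

/-- The exploration path at scale `ε`, as a compact subset of the plane. -/
def trace (ω : Config) : NonemptyCompacts ℂ :=
  polyline ((ε : ℂ) * Flag.pos (D.start, .vtx)) ((D.flags ω).map fun f => (ε : ℂ) * f.pos)

end AdmissibleDiscretization

/-- Borel sets for the Hausdorff metric on compact sets. -/
instance : MeasurableSpace (NonemptyCompacts ℂ) := borel _
instance : BorelSpace (NonemptyCompacts ℂ) := ⟨rfl⟩

instance : MeasurableSpace Corner := ⊤
instance : DiscreteMeasurableSpace Corner := ⟨fun _ => trivial⟩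
instance : Countable Corner :=
  Function.Injective.countable (f := fun c : Corner =>
    match c with | .ctr => (0 : ℕ) | .lo => 1 | .vtx => 2 | .hi => 3)
    (by intro c c' h; cases c <;> cases c' <;> simp_all)

theorem measurable_of_countable_index {α β ι : Type*} [MeasurableSpace α] [MeasurableSpace β]
    [Countable ι] [MeasurableSpace ι] [DiscreteMeasurableSpace ι] {f : ι → α → β} {g : α → ι}
    (hf : ∀ i, Measurable (f i)) (hg : Measurable g) : Measurable fun x => f (g x) x := by
  intro s hs
  have : (fun x => f (g x) x) ⁻¹' s = ⋃ i, (g ⁻¹' {i} ∩ f i ⁻¹' s) := by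
    ext x; simp
  rw [this]
  exact MeasurableSet.iUnion fun i => (hg (measurableSet_singleton i)).inter (hf i hs)

namespace AdmissibleDiscretization

variable {M : FlowerModel} {Ω : Set ℂ} {ε : ℝ} (D : AdmissibleDiscretization M Ω ε)

theorem measurable_path (n : ℕ) : Measurable fun ω => D.path ω n := by
  induction n with
  | zero => exact measurable_const
  | succ n ih =>
    have : (fun ω => D.path ω (n + 1)) = fun ω => explore ω (D.path ω n) := by
      funext ω; simp only [path, Function.iterate_succ_apply']
    rw [this]
    refine measurable_of_countable_index (f := fun f ω => explore ω f) (fun f => ?_) ih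
    have h2 : Measurable fun σ : HexState =>
        if σ.isBlue f.cw.1.2 then (f.1, f.2.succ) else f.cw := Measurable.of_discrete
    exact h2.comp (measurable_pi_apply f.cw.1.1)

theorem measurable_length : Measurable D.length := by
  refine measurable_to_countable' fun n => ?_
  have hP : ∀ n, MeasurableSet
      {ω | D.path ω n = (D.finish, Corner.vtx) ∨ (D.path ω n).cw.1.1 ∉ D.comp} := fun n =>
    D.measurable_path n (MeasurableSet.of_discrete
      (s := {f : Flag | f = (D.finish, Corner.vtx) ∨ f.cw.1.1 ∉ D.comp}))
  have hset : D.length ⁻¹' {n} =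
      ({ω | D.path ω n = (D.finish, Corner.vtx) ∨ (D.path ω n).cw.1.1 ∉ D.comp} ∩
        ⋂ m : ℕ, ⋂ _ : m < n,
          {ω | D.path ω m = (D.finish, Corner.vtx) ∨ (D.path ω m).cw.1.1 ∉ D.comp}ᶜ) ∪
      ({_ω | n = 0} ∩ ⋂ m : ℕ,
          {ω | D.path ω m = (D.finish, Corner.vtx) ∨ (D.path ω m).cw.1.1 ∉ D.comp}ᶜ) := by
    ext ω
    set S : Set ℕ := {n : ℕ | D.path ω n = (D.finish, Corner.vtx) ∨ (D.path ω n).cw.1.1 ∉ D.comp}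
      with hS
    have e1 : ω ∈ D.length ⁻¹' {n} ↔ sInf S = n := Iff.rfl
    have e2 : ∀ m, ω ∈ {ω | D.path ω m = (D.finish, Corner.vtx) ∨ (D.path ω m).cw.1.1 ∉ D.comp} ↔
      m ∈ S := fun m => Iff.rfl
    simp only [e1, Set.mem_union, Set.mem_inter_iff, Set.mem_iInter, Set.mem_compl_iff, e2,
      Set.mem_ofPred_eq (p := fun _ : Config => n = 0)]
    constructor
    · rintro rfl
      rcases S.eq_empty_or_nonempty with h | h
      · right; simp [h]
      · exact Or.inl ⟨Nat.sInf_mem h, fun m hm => Nat.notMem_of_lt_sInf hm⟩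
    · rintro (⟨h1, h2⟩ | ⟨rfl, h2⟩)
      · exact le_antisymm (Nat.sInf_le h1)
          (not_lt.1 fun hlt => h2 _ hlt (Nat.sInf_mem ⟨n, h1⟩))
      · rw [Set.eq_empty_of_forall_notMem h2, Nat.sInf_empty]
  rw [hset]
  exact ((hP n).inter (MeasurableSet.iInter fun m => MeasurableSet.iInter fun _ =>
    (hP m).compl)).union ((MeasurableSet.const _).inter (MeasurableSet.iInter fun m =>
    (hP m).compl))

theorem measurable_trace : Measurable D.trace := by
  refine measurable_of_countable_index (g := D.length) (f := fun N ω =>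
    polyline ((ε : ℂ) * Flag.pos (D.start, .vtx))
      (((List.range N).map fun n => D.path ω (n + 1)).map fun f => (ε : ℂ) * f.pos))
    (fun N => ?_) D.measurable_length
  have h1 : Measurable fun ω => fun i : Fin N => D.path ω (i + 1) :=
    measurable_pi_iff.2 fun i => D.measurable_path _
  have h2 : Measurable fun p : Fin N → Flag =>
      polyline ((ε : ℂ) * Flag.pos (D.start, .vtx))
        ((List.ofFn p).map fun f => (ε : ℂ) * f.pos) := Measurable.of_discrete
  convert h2.comp h1 using 2 with ω
  simp only [Function.comp]
  congr 2
  apply List.ext_getElem <;> simp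

/-- The law of the exploration path: the configuration has the law of the model, conditioned on the
colours of the boundary. -/
def explorationLaw : ProbabilityMeasure (NonemptyCompacts ℂ) :=
  ⟨(M.law[|boundaryEvent D.blue D.yellow]).map D.trace,
    haveI := cond_isProbabilityMeasure D.pos_prob
    Measure.isProbabilityMeasure_map D.measurable_trace.aemeasurable⟩

end AdmissibleDiscretization

end BondTriangular

end

/-!
A box of side `4 ^ (-k)` at distance at least `2 ^ (-k)` from the boundary of the domain is
unlikely to be met by the exploration path, with a probability at most a power of the ratio of the
two lengths. This holds uniformly in the scale, in the discretization and in the conditioning on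
the colours of the boundary (`FlowerModel.law_hits`). So few of these boxes are met
(`measureReal_farHits_le`), and the number of the remaining boxes is controlled by the dimension
of the boundary (`card_near_le`). To meet many boxes is an open event, so the bounds pass to a
limit point of the laws, and a Borel–Cantelli argument over `k` gives a bound for the box counts
of almost every limiting path (`exists_boxCount_le_ae`). A component of the complement of a closed
part `L` of the path has its frontier in the union of `L` and the frontier of the domain.

The path has yellow on its left, so a yellow connection follows it from its start, which is close
to the boundary of the domain (`AdmissibleDiscretization.path_attached`, `boundary_near`). If the
path comes close to an inner point, there is a yellow arm from this point to a large distance.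
Such an arm does not look at the boundary, which makes it independent of the conditioning
(`indep`, `explorationLaw_le`). All depends therefore on the one-arm bound `FlowerModel.one_arm`:
a yellow connection between the distances `r` and `R` has probability at most
`C * (r / R) ^ ψ`.

The one-arm bound is proved with rings, that is closed blue circuits, at scales with bounded
ratios, each present with a probability bounded from below. They lie in disjoint annuli and are
independent (`law_noRing`), and a yellow connection cannot cross them (`ring_meets`). The facts
used are these.

* Crossing. Two disjoint walks on the lattice cannot cross (`walks_cross`), and the blue and the
  yellow part of an iris do not help, since they do not separate each other (`clusters_cross`).
* Duality. Around a hexagonal domain with six sectors, there is a connection of one colour between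
  the even sectors that starts from the sector `0`, or one of the other colour between the odd
  ones that starts from the sector `1` (`chord_duality`). The reason is a discrete Stokes theorem
  for the transitions between what is reached in the two colours (`sum_boundary_eq_zero`).
* Symmetry. A sixth of a turn around a centre of rotation exchanges the colours (`Sym.turn`), so
  each of the four connections in the duality has probability at least `1 / 4` (`law_chord`).
* Positive association (`fkg`). The averages over the irises increase with the colours of the
  petals, since a trigger is averaged over blue and yellow exactly as the mixed states require
  (`resample_iris_le`), and `a ^ 2 ≥ 2 * s ^ 2` gives positive correlation over a single iris
  (`iris_correlation`). Hence there is with probability at least `1 / 256` a large cluster, which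
  touches all six sectors (`law_big`).

It remains to link large clusters to each other, although the law is only invariant under periods
and a sixth of a turn. A window describes where a large cluster touches the top side of its domain
with a good probability. If a window is wide and the one at the double scale is not much wider,
then a shifted large cluster lands between two landings of a smaller one and is linked to it
(`hasStep_of_window`). The windows cannot keep growing faster than the scale, so a wide window
gives links at a comparable scale (`exists_hasStep`). Links of large clusters are chained to long
horizontal tubes (`law_tube`), and three tubes form a ring (`law_ring`). Conversely a ring at some
scale forces a wide window at a comparable larger scale: a large cluster that lands in a narrow
window reaches close to a given point, and rings would link it to its images under turns
(`hasStep_of_narrow`), so that there would be rings at many scales, which makes such a landing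
unlikely (`exists_wide_window`). Starting from any scale, this yields the sequence of scales
(`exists_scales`).
-/

noncomputable section

namespace BondTriangular

/-! ### Crossing of lattice walks -/

/-- Two hexagons are equal or neighbours. -/
def Near (a b : Hex) : Prop :=
  -1 ≤ b.1 - a.1 ∧ b.1 - a.1 ≤ 1 ∧ -1 ≤ b.2 - a.2 ∧ b.2 - a.2 ≤ 1 ∧
    -1 ≤ b.1 - a.1 + (b.2 - a.2) ∧ b.1 - a.1 + (b.2 - a.2) ≤ 1

/-- The signed number of times the step from `z` to `z'` crosses the horizontal ray which starts at
the origin, goes to the right, and runs just below row `0`. -/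
def rayCross (z z' : ℤ × ℤ) : ℤ :=
  if z.2 = -1 ∧ z'.2 = 0 ∧ 0 < z'.1 then 1
  else if z.2 = 0 ∧ z'.2 = -1 ∧ 0 < z.1 then -1 else 0

theorem rayCross_eq_zero {z z' : ℤ × ℤ} (h : ¬ 0 < z.1 ∧ ¬ 0 < z'.1 ∨ 0 < z.2 ∨ z.2 < -1) :
    rayCross z z' = 0 := by
  unfold rayCross; split_ifs <;> omega

theorem rayCross_eq_zero' {z z' : ℤ × ℤ} (h : z.2 = 0 → ¬ 0 < z.1) (h' : z'.2 = 0 → ¬ 0 < z'.1) :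
    rayCross z z' = 0 := by
  unfold rayCross; split_ifs <;> omega

theorem rayCross_of_pos {z z' : ℤ × ℤ} (h : z.2 = 0 → 0 < z.1) (h' : z'.2 = 0 → 0 < z'.1) (hz : z'.2 ≤ z.2 + 1)
    (hz' : z.2 ≤ z'.2 + 1) :
    rayCross z z' = (if 0 ≤ z'.2 then 1 else 0) - (if 0 ≤ z.2 then 1 else 0) := by
  unfold rayCross; split_ifs <;> omega

theorem rayCross_square_aux : ∀ x ∈ Finset.Icc (-3 : ℤ) 3, ∀ y ∈ Finset.Icc (-3 : ℤ) 3,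
    ∀ a₁ ∈ Finset.Icc (-1 : ℤ) 1, ∀ a₂ ∈ Finset.Icc (-1 : ℤ) 1,
    -1 ≤ a₁ + a₂ → a₁ + a₂ ≤ 1 → ∀ b₁ ∈ Finset.Icc (-1 : ℤ) 1, ∀ b₂ ∈ Finset.Icc (-1 : ℤ) 1,
    -1 ≤ b₁ + b₂ → b₁ + b₂ ≤ 1 → ¬ (x = 0 ∧ y = 0) → ¬ (x + a₁ = 0 ∧ y + a₂ = 0) →
    ¬ (x - b₁ = 0 ∧ y - b₂ = 0) → ¬ (x + a₁ - b₁ = 0 ∧ y + a₂ - b₂ = 0) →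
    rayCross (x, y) (x + a₁, y + a₂) + rayCross (x + a₁, y + a₂) (x + a₁ - b₁, y + a₂ - b₂) =
      rayCross (x, y) (x - b₁, y - b₂) +
        rayCross (x - b₁, y - b₂) (x + a₁ - b₁, y + a₂ - b₂) := by
  unfold rayCross
  decide +kernel

/-- The crossing number is locally constant: it is a closed cochain away from the origin. -/
theorem rayCross_square {z : ℤ × ℤ} {a b : ℤ × ℤ} (ha : Near 0 a) (hb : Near 0 b)
    (h0 : z ≠ 0) (h1 : z + a ≠ 0) (h2 : z - b ≠ 0) (h3 : z + a - b ≠ 0) :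
    rayCross z (z + a) + rayCross (z + a) (z + a - b) =
      rayCross z (z - b) + rayCross (z - b) (z + a - b) := by
  obtain ⟨x, y⟩ := z
  obtain ⟨a1, a2⟩ := a
  obtain ⟨b1, b2⟩ := b
  simp only [Near, Prod.fst_zero, Prod.snd_zero, sub_zero] at ha hb
  simp only [ne_eq, Prod.mk_eq_zero, Prod.mk_add_mk, Prod.mk_sub_mk] at h0 h1 h2 h3
  simp only [Prod.mk_add_mk, Prod.mk_sub_mk]
  obtain ⟨p1, p2, p3, p4, p5, p6⟩ := ha
  obtain ⟨q1, q2, q3, q4, q5, q6⟩ := hb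
  by_cases hy : y < -3 ∨ 3 < y ∨ x < -3
  · rw [rayCross_eq_zero (by simp only; omega), rayCross_eq_zero (by simp only; omega),
      rayCross_eq_zero (by simp only; omega), rayCross_eq_zero (by simp only; omega)]
  by_cases hx : 3 < x
  · rw [rayCross_of_pos (by simp only; omega) (by simp only; omega) (by simp only; omega)
      (by simp only; omega), rayCross_of_pos (by simp only; omega) (by simp only; omega)
      (by simp only; omega) (by simp only; omega), rayCross_of_pos (by simp only; omega)
      (by simp only; omega) (by simp only; omega) (by simp only; omega),
      rayCross_of_pos (by simp only; omega) (by simp only; omega) (by simp only; omega)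
      (by simp only; omega)]
    ring
  · exact rayCross_square_aux x (by simp; omega) y (by simp; omega) a1 (by simp; omega) a2
      (by simp; omega) p5 p6 b1 (by simp; omega) b2 (by simp; omega) q5 q6 h0 h1 h2 h3

/-- Two pairs of neighbours of a hexagon do not separate each other on the ring of neighbours. -/
def NonInterleaved (k k' l l' : Fin 6) : Prop :=
  ¬ (((k < l ∧ l < k') ∨ (k' < l ∧ l < k)) ↔ ¬ ((k < l' ∧ l' < k') ∨ (k' < l' ∧ l' < k)))

instance (k k' l l' : Fin 6) : Decidable (NonInterleaved k k' l l') := by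
  unfold NonInterleaved; infer_instance

theorem rayCross_iris : ∀ k k' l l' : Fin 6, k ≠ l → k ≠ l' → k' ≠ l → k' ≠ l' →
    NonInterleaved k k' l l' →
    rayCross (dir k - dir l) (0 - dir l) + rayCross (0 - dir l) (dir k' - dir l) +
      (rayCross (dir k' - dir l) (dir k' - 0) + rayCross (dir k' - 0) (dir k' - dir l')) =
    rayCross (dir k - dir l) (dir k - 0) + rayCross (dir k - 0) (dir k - dir l') +
      (rayCross (dir k - dir l') (0 - dir l') + rayCross (0 - dir l') (dir k' - dir l')) := by
  decide +kernel

/-- A move of a walk: from `a` through `m` to `b`, by steps to equal or neighbouring hexagons. -/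
structure IsMove (a m b : Hex) : Prop where
  left : Near a m
  right : Near m b

/-- Two moves are disjoint; they may only pass through the same middle hexagon without crossing
each other. -/
structure MovesDisjoint (a m b a' m' b' : Hex) : Prop where
  aa : a ≠ a'
  am : a ≠ m'
  ab : a ≠ b'
  ma : m ≠ a'
  mb : m ≠ b'
  ba : b ≠ a'
  bm : b ≠ m'
  bb : b ≠ b'
  mm : m ≠ m' ∨ ∃ k k' l l', a = m + dir k ∧ b = m + dir k' ∧ a' = m' + dir l ∧ b' = m' + dir l' ∧
    NonInterleaved k k' l l'

/-- The signed number of crossings of the ray to the right of `Q` by a move. -/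
def moveCross (a m b Q : Hex) : ℤ := rayCross (a - Q) (m - Q) + rayCross (m - Q) (b - Q)

/-- The signed number of crossings of the ray to the left of `P` by a move, up to sign. -/
def moveCross' (P a m b : Hex) : ℤ := rayCross (P - a) (P - m) + rayCross (P - m) (P - b)

theorem near_sub {a b : Hex} (h : Near a b) : Near 0 (b - a) := by
  simpa [Near] using h

theorem rayCross_square' {p p' q q' : Hex} (hp : Near p p') (hq : Near q q')
    (h0 : p ≠ q) (h1 : p' ≠ q) (h2 : p ≠ q') (h3 : p' ≠ q') :
    rayCross (p - q) (p' - q) + rayCross (p' - q) (p' - q') =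
      rayCross (p - q) (p - q') + rayCross (p - q') (p' - q') := by
  have := rayCross_square (z := p - q) (near_sub hp) (near_sub hq) (sub_ne_zero.2 h0)
    (by rw [show p - q + (p' - p) = p' - q by abel]; exact sub_ne_zero.2 h1)
    (by rw [show p - q - (q' - q) = p - q' by abel]; exact sub_ne_zero.2 h2)
    (by rw [show p - q + (p' - p) - (q' - q) = p' - q' by abel]; exact sub_ne_zero.2 h3)
  rwa [show p - q + (p' - p) = p' - q by abel, show p - q - (q' - q) = p - q' by abel,
    show p' - q - (q' - q) = p' - q' by abel] at this

theorem moveCross_add {a m b a' m' b' : Hex} (hf : IsMove a m b) (hg : IsMove a' m' b')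
    (hd : MovesDisjoint a m b a' m' b') :
    moveCross a m b a' + moveCross' b a' m' b' = moveCross' a a' m' b' + moveCross a m b b' := by
  unfold moveCross moveCross'
  by_cases hm : m = m'
  · obtain ⟨k, k', l, l', rfl, rfl, rfl, rfl, h⟩ := hd.mm.resolve_left (not_not.2 hm)
    subst hm
    have := rayCross_iris k k' l l' (fun e => hd.aa (by rw [e])) (fun e => hd.ab (by rw [e]))
      (fun e => hd.ba (by rw [e])) (fun e => hd.bb (by rw [e])) h
    simpa only [add_sub_add_left_eq_sub, sub_add_cancel_left, add_sub_cancel_left, zero_sub,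
      sub_zero] using this
  · have h1 := rayCross_square' hf.left hg.left hd.aa hd.ma hd.am hm
    have h2 := rayCross_square' hf.right hg.left hd.ma hd.ba hm hd.bm
    have h3 := rayCross_square' hf.left hg.right hd.am hm hd.ab hd.mb
    have h4 := rayCross_square' hf.right hg.right hm hd.bm hd.mb hd.bb
    linarith

/-- The relation of being joined by a move of the given kind. -/
def Joined (F : Hex → Hex → Hex → Prop) (a b : Hex) : Prop := ∃ m, F a m b

/-- Two disjoint walks cannot cross: the first walk `P → P'` stays in the rows between `Q'` and `Q`,
and the second one `Q → Q'` passes to the left of `P` and to the right of `P'`. -/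
theorem walks_cross {F G : Hex → Hex → Hex → Prop} {P P' Q Q' : Hex}
    (hF : ∀ a m b, F a m b → IsMove a m b) (hG : ∀ a m b, G a m b → IsMove a m b)
    (hd : ∀ a m b a' m' b', F a m b → G a' m' b' → MovesDisjoint a m b a' m' b')
    (hFr : ∀ a m b, F a m b → (a.2 < Q.2 ∧ m.2 < Q.2 ∧ b.2 < Q.2) ∧
      (Q'.2 ≤ a.2 ∧ Q'.2 ≤ m.2 ∧ Q'.2 ≤ b.2))
    (hG1 : ∀ a m b, G a m b → (a.2 = P.2 → a.1 < P.1) ∧ (m.2 = P.2 → m.1 < P.1) ∧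
      (b.2 = P.2 → b.1 < P.1))
    (hG2 : ∀ a m b, G a m b → (a.2 = P'.2 → P'.1 < a.1) ∧ (m.2 = P'.2 → P'.1 < m.1) ∧
      (b.2 = P'.2 → P'.1 < b.1))
    (hQ : P.2 < Q.2) (hQ' : Q'.2 ≤ P.2)
    (f : Relation.ReflTransGen (Joined F) P P') (g : Relation.ReflTransGen (Joined G) Q Q') :
    False := by
  -- the crossing number of `f` with the ray of a moving point `g` changes only at the ends of `f`
  have key : ∀ R, Relation.ReflTransGen (Joined F) P R → ∃ w : Hex → ℤ,
      (w Q = 0 ∧ w Q' = 0) ∧ ∀ a m b, G a m b →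
        w a + moveCross' R a m b = moveCross' P a m b + w b := by
    intro R hR
    induction hR with
    | refl => exact ⟨0, ⟨rfl, rfl⟩, fun a m b _ => by simp⟩
    | @tail R R' _ hs ih =>
      obtain ⟨w, ⟨h1, h2⟩, h3⟩ := ih
      obtain ⟨m, hm⟩ := hs
      refine ⟨fun X => w X + moveCross R m R' X, ⟨?_, ?_⟩, ?_⟩
      · obtain ⟨⟨r1, r2, r3⟩, -⟩ := hFr _ _ _ hm
        simp only [h1, moveCross, rayCross, Prod.snd_sub, Prod.fst_sub]
        split_ifs <;> omega
      · obtain ⟨-, r1, r2, r3⟩ := hFr _ _ _ hm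
        simp only [h2, moveCross, rayCross, Prod.snd_sub, Prod.fst_sub]
        split_ifs <;> omega
      · intro a n b hab
        have e1 := h3 a n b hab
        have e2 := moveCross_add (hF _ _ _ hm) (hG _ _ _ hab) (hd _ _ _ _ _ _ hm hab)
        simp only
        linarith
  obtain ⟨w, ⟨h1, h2⟩, h3⟩ := key P' f
  -- the crossing number drops by one where the second walk comes down to the row of `P`, so it is
  -- `-1` at `Q'`, which lies outside the rows of the first walk
  have key2 : ∀ R, Relation.ReflTransGen (Joined G) Q R →
      w R = w Q - (if R.2 ≤ P.2 then 1 else 0) := by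
    intro R hR
    induction hR with
    | refl => simp [not_le.2 hQ]
    | @tail R R' _ hs ih =>
      obtain ⟨m, hm⟩ := hs
      have e := h3 _ _ _ hm
      obtain ⟨a1, a2, a3⟩ := hG1 _ _ _ hm
      obtain ⟨b1, b2, b3⟩ := hG2 _ _ _ hm
      obtain ⟨⟨n1, n2, n3, n4, n5, n6⟩, ⟨k1, k2, k3, k4, k5, k6⟩⟩ := hG _ _ _ hm
      have z : moveCross' P' R m R' = 0 := by
        simp only [moveCross']
        rw [rayCross_eq_zero' (by simp only [Prod.snd_sub, Prod.fst_sub]; omega)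
          (by simp only [Prod.snd_sub, Prod.fst_sub]; omega),
          rayCross_eq_zero' (by simp only [Prod.snd_sub, Prod.fst_sub]; omega)
          (by simp only [Prod.snd_sub, Prod.fst_sub]; omega), add_zero]
      have z' : moveCross' P R m R' =
          (if R'.2 ≤ P.2 then 1 else 0) - (if R.2 ≤ P.2 then 1 else 0) := by
        simp only [moveCross']
        rw [rayCross_of_pos (by simp only [Prod.snd_sub, Prod.fst_sub]; omega)
          (by simp only [Prod.snd_sub, Prod.fst_sub]; omega)
          (by simp only [Prod.snd_sub]; omega) (by simp only [Prod.snd_sub]; omega),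
          rayCross_of_pos (by simp only [Prod.snd_sub, Prod.fst_sub]; omega)
          (by simp only [Prod.snd_sub, Prod.fst_sub]; omega)
          (by simp only [Prod.snd_sub]; omega) (by simp only [Prod.snd_sub]; omega)]
        simp only [Prod.snd_sub, sub_nonneg]
        ring
      rw [z, z', ih] at e
      linarith
  have := key2 Q' g
  rw [h1, h2, if_pos hQ'] at this
  omega

/-! ### Flowers and percolation on the petals and fillers -/

theorem Near.refl (a : Hex) : Near a a := by simp [Near]

theorem Near.symm {a b : Hex} (h : Near a b) : Near b a := by
  unfold Near at *; omega

theorem near_add_dir (a : Hex) (k : Fin 6) : Near a (a + dir k) := by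
  fin_cases k <;> simp [Near, dir]

theorem near_iff {a b : Hex} : Near a b ↔ b = a ∨ ∃ k, b = a + dir k := by
  constructor
  · obtain ⟨x, y⟩ := a
    obtain ⟨x', y'⟩ := b
    rintro ⟨h1, h2, h3, h4, h5, h6⟩
    simp only at h1 h2 h3 h4 h5 h6
    obtain ⟨u, rfl⟩ : ∃ u, x' = x + u := ⟨x' - x, by ring⟩
    obtain ⟨v, rfl⟩ : ∃ v, y' = y + v := ⟨y' - y, by ring⟩
    simp only [add_sub_cancel_left] at h1 h2 h3 h4 h5 h6
    simp only [dir, Fin.exists_iff_castSucc, Prod.mk.injEq]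
    interval_cases u <;> interval_cases v <;> first | omega | simp
  · rintro (rfl | ⟨k, rfl⟩)
    · exact Near.refl _
    · exact near_add_dir _ _

theorem mem_flower {i h : Hex} : h ∈ flower i ↔ Near i h := near_iff.symm

/-- The one-coloured states. -/
def mono : Bool → HexState
  | true => .blue
  | false => .yellow

/-- The petal number `k` touches the part of colour `c` of an iris with state `σ`: one of the two
kites of the iris at its side number `k` has this colour. -/
def lk (c : Bool) (σ : HexState) (k : Fin 6) : Bool := (σ.isBlue k == c) || (σ.isBlue (k + 5) == c)

/-- A code for the states, to let finite checks be evaluated. -/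
def HexState.code : HexState → Fin 5
  | .blue => 0
  | .yellow => 1
  | .split i => ⟨2 + i.val, by omega⟩

/-- The state with a given code. -/
def HexState.ofCode : Fin 5 → HexState := ![.blue, .yellow, .split 0, .split 1, .split 2]

/-- The states are numbered. -/
def HexState.equivFin : HexState ≃ Fin 5 where
  toFun := HexState.code
  invFun := HexState.ofCode
  left_inv := by
    rintro (_ | _ | i)
    · rfl
    · rfl
    · fin_cases i <;> rfl
  right_inv := by decide

instance : DecidableEq HexState := HexState.equivFin.decidableEq

instance : Fintype HexState := Fintype.ofEquiv (Fin 5) HexState.equivFin.symm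

theorem lk_nonInterleaved : ∀ (σ : HexState) (c : Bool) (k k' l l' : Fin 6),
    (lk c σ k ∧ lk c σ k' ∧ lk (!c) σ l ∧ lk (!c) σ l' ∧ k ≠ l ∧ k ≠ l' ∧ k' ≠ l ∧ k' ≠ l') →
    NonInterleaved k k' l l' := by
  decide +kernel

theorem reflTransGen_symm {α : Type*} {r : α → α → Prop} (hr : ∀ a b, r a b → r b a) {a b : α}
    (h : Relation.ReflTransGen r a b) : Relation.ReflTransGen r b a := by
  induction h with
  | refl => exact .refl
  | tail _ h ih => exact ih.head (hr _ _ h)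

namespace FlowerModel

variable (M : FlowerModel)

open Classical in
/-- The iris of the flower of a hexagon, and a filler itself. -/
def base (h : Hex) : Hex := if H : ∃ i ∈ M.irises, Near i h then H.choose else h

variable {M}

theorem iris_unique {i i' h : Hex} (hi : i ∈ M.irises) (hi' : i' ∈ M.irises) (h1 : Near i h)
    (h2 : Near i' h) : i = i' := by
  by_contra hne
  exact Set.disjoint_left.1 (M.separated i hi i' hi' hne) (mem_flower.2 h1) (mem_flower.2 h2)

theorem base_eq {i h : Hex} (hi : i ∈ M.irises) (h1 : Near i h) : M.base h = i := by
  have H : ∃ i ∈ M.irises, Near i h := ⟨i, hi, h1⟩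
  rw [base, dif_pos H]
  exact iris_unique H.choose_spec.1 hi H.choose_spec.2 h1

theorem base_cases (h : Hex) : (M.base h ∈ M.irises ∧ Near (M.base h) h) ∨
    (M.base h = h ∧ ∀ i ∈ M.irises, ¬ Near i h) := by
  by_cases H : ∃ i ∈ M.irises, Near i h
  · obtain ⟨i, hi, h1⟩ := H
    rw [base_eq hi h1]
    exact Or.inl ⟨hi, h1⟩
  · refine Or.inr ⟨by rw [base, dif_neg H], fun i hi h1 => H ⟨i, hi, h1⟩⟩

theorem near_base (h : Hex) : Near (M.base h) h := by
  rcases base_cases (M := M) h with ⟨_, h1⟩ | ⟨h1, _⟩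
  · exact h1
  · rw [h1]; exact Near.refl h

theorem base_iris {i : Hex} (hi : i ∈ M.irises) : M.base i = i := base_eq hi (Near.refl i)

theorem base_base (h : Hex) : M.base (M.base h) = M.base h := by
  rcases base_cases (M := M) h with ⟨h1, _⟩ | ⟨h1, _⟩
  · exact base_iris h1
  · rw [h1, h1]

theorem base_petal {i : Hex} (hi : i ∈ M.irises) (k : Fin 6) : M.base (i + dir k) = i :=
  base_eq hi (near_add_dir i k)

theorem dir_ne_zero : ∀ k : Fin 6, dir k ≠ 0 := by decide

theorem petal_notMem {i : Hex} (hi : i ∈ M.irises) (k : Fin 6) : i + dir k ∉ M.irises := by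
  intro h
  have := iris_unique hi h (near_add_dir i k) (Near.refl _)
  exact dir_ne_zero k (by simpa using this.symm)

variable (M)

/-- A set of hexagons which is a union of whole flowers and of fillers. -/
def Saturated (D : Set Hex) : Prop := ∀ h, M.base h ∈ D ↔ h ∈ D

/-- The hexagon `h` is a petal or a filler of colour `c`. -/
def IsCol (c : Bool) (ω : Config) (h : Hex) : Prop := h ∉ M.irises ∧ ω h = mono c

/-- Two petals of the iris `m` are joined by the part of colour `c` of this iris. -/
def IrisLink (c : Bool) (ω : Config) (a m b : Hex) : Prop :=
  m ∈ M.irises ∧ ∃ k k', a = m + dir k ∧ b = m + dir k' ∧ lk c (ω m) k ∧ lk c (ω m) k'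

/-- A move between two petals or fillers of colour `c` in `D`: they are neighbours, or they are
joined through an iris. -/
def Move (c : Bool) (ω : Config) (D : Set Hex) (a m b : Hex) : Prop :=
  a ∈ D ∧ b ∈ D ∧ M.IsCol c ω a ∧ M.IsCol c ω b ∧ ((m = a ∧ Near a b) ∨ M.IrisLink c ω a m b)

/-- Two petals or fillers in `D` are connected in colour `c` in `D`. -/
def Conn (c : Bool) (ω : Config) (D : Set Hex) (a b : Hex) : Prop :=
  a ∈ D ∧ M.IsCol c ω a ∧ Relation.ReflTransGen (Joined (M.Move c ω D)) a b

variable {M} {c : Bool} {ω : Config} {D D' : Set Hex} {a b d m : Hex}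

theorem IrisLink.symm (h : M.IrisLink c ω a m b) : M.IrisLink c ω b m a := by
  obtain ⟨hm, k, k', h1, h2, h3, h4⟩ := h
  exact ⟨hm, k', k, h2, h1, h4, h3⟩

theorem IrisLink.near_left (h : M.IrisLink c ω a m b) : Near m a := by
  obtain ⟨_, k, k', rfl, _⟩ := h
  exact near_add_dir m k

theorem IrisLink.base_left (h : M.IrisLink c ω a m b) : M.base a = m := base_eq h.1 h.near_left

theorem IrisLink.base_right (h : M.IrisLink c ω a m b) : M.base b = m := h.symm.base_left

theorem joined_move_symm (h : Joined (M.Move c ω D) a b) : Joined (M.Move c ω D) b a := by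
  obtain ⟨m, h1, h2, h3, h4, ⟨rfl, h5⟩ | h5⟩ := h
  · exact ⟨b, h2, h1, h4, h3, Or.inl ⟨rfl, h5.symm⟩⟩
  · exact ⟨m, h2, h1, h4, h3, Or.inr h5.symm⟩

theorem Conn.refl (h1 : a ∈ D) (h2 : M.IsCol c ω a) : M.Conn c ω D a a := ⟨h1, h2, .refl⟩

theorem Conn.right (h : M.Conn c ω D a b) : b ∈ D ∧ M.IsCol c ω b := by
  obtain ⟨h1, h2, h3⟩ := h
  induction h3 with
  | refl => exact ⟨h1, h2⟩
  | tail _ h _ => obtain ⟨m, h⟩ := h; exact ⟨h.2.1, h.2.2.2.1⟩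

theorem Conn.symm (h : M.Conn c ω D a b) : M.Conn c ω D b a :=
  ⟨h.right.1, h.right.2, reflTransGen_symm (fun _ _ => joined_move_symm) h.2.2⟩

theorem Conn.trans (h : M.Conn c ω D a b) (h' : M.Conn c ω D b d) : M.Conn c ω D a d :=
  ⟨h.1, h.2.1, h.2.2.trans h'.2.2⟩

theorem Conn.mono (hD : D ⊆ D') (h : M.Conn c ω D a b) : M.Conn c ω D' a b := by
  refine ⟨hD h.1, h.2.1, Relation.ReflTransGen.mono ?_ _ _ h.2.2⟩
  rintro a b ⟨m, h1, h2, h3⟩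
  exact ⟨m, hD h1, hD h2, h3⟩

theorem Conn.step (h : M.Conn c ω D a b) (h' : M.Move c ω D b m d) : M.Conn c ω D a d :=
  ⟨h.1, h.2.1, h.2.2.tail ⟨m, h'⟩⟩

theorem Conn.near (ha : a ∈ D) (hb : b ∈ D) (h1 : M.IsCol c ω a) (h2 : M.IsCol c ω b)
    (h : Near a b) : M.Conn c ω D a b :=
  (Conn.refl ha h1).step ⟨ha, hb, h1, h2, Or.inl ⟨rfl, h⟩⟩

theorem Conn.iris (ha : a ∈ D) (hb : b ∈ D) (h1 : M.IsCol c ω a) (h2 : M.IsCol c ω b)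
    (h : M.IrisLink c ω a m b) : M.Conn c ω D a b :=
  (Conn.refl ha h1).step ⟨ha, hb, h1, h2, Or.inr h⟩

theorem IsCol.unique {c' : Bool} (h : M.IsCol c ω a) (h' : M.IsCol c' ω a) : c = c' := by
  have := h.2.symm.trans h'.2
  cases c <;> cases c' <;> simp_all [BondTriangular.mono]

/-! ### Crossing of clusters -/

variable (M)

/-- A move in the union of a set `X` of hexagons of colour `c` and a set `E`: it goes to a neighbour,
or through an iris between two hexagons of `X`. -/
def ExtMove (c : Bool) (ω : Config) (X E : Set Hex) (a m b : Hex) : Prop :=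
  a ∈ X ∪ E ∧ b ∈ X ∪ E ∧ ((m = a ∧ Near a b) ∨ (a ∈ X ∧ b ∈ X ∧ M.IrisLink c ω a m b))

variable {M}

theorem ExtMove.isMove {X E : Set Hex} (h : M.ExtMove c ω X E a m b) : IsMove a m b := by
  obtain ⟨_, _, ⟨rfl, h⟩ | ⟨_, _, h⟩⟩ := h
  · exact ⟨Near.refl _, h⟩
  · exact ⟨h.near_left.symm, h.symm.near_left⟩

theorem ExtMove.near {X E : Set Hex} (ha : a ∈ X ∪ E) (hb : b ∈ X ∪ E) (h : Near a b) :
    Joined (M.ExtMove c ω X E) a b := ⟨a, ha, hb, Or.inl ⟨rfl, h⟩⟩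

theorem ExtMove.symm {X E : Set Hex} (h : Joined (M.ExtMove c ω X E) a b) :
    Joined (M.ExtMove c ω X E) b a := by
  obtain ⟨m, h1, h2, ⟨rfl, h5⟩ | ⟨h3, h4, h5⟩⟩ := h
  · exact ⟨b, h2, h1, Or.inl ⟨rfl, h5.symm⟩⟩
  · exact ⟨m, h2, h1, Or.inr ⟨h4, h3, h5.symm⟩⟩

/-- The cluster of `a` is traversed by moves of the extended walk. -/
theorem Conn.ext {E X : Set Hex} (hX : ∀ b, M.Conn c ω D a b → b ∈ X)
    (h : M.Conn c ω D a b) : Relation.ReflTransGen (Joined (M.ExtMove c ω X E)) a b := by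
  obtain ⟨h1, h2, h3⟩ := h
  induction h3 with
  | refl => exact .refl
  | @tail x y hx hs ih =>
    have hcx : M.Conn c ω D a x := ⟨h1, h2, hx⟩
    have hcy : M.Conn c ω D a y := ⟨h1, h2, hx.tail hs⟩
    obtain ⟨m, _, _, _, _, h5⟩ := hs
    refine ih.tail ⟨m, Or.inl (hX _ hcx), Or.inl (hX _ hcy), ?_⟩
    rcases h5 with h5 | h5
    · exact Or.inl h5
    · exact Or.inr ⟨hX _ hcx, hX _ hcy, h5⟩

/-- Two walks in two coloured sets `X`, `X'` with extensions `E`, `E'` which have to cross: the sets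
have the same colour and they are linked. -/
theorem clusters_cross {c' : Bool} {X E X' E' : Set Hex} {P P' Q Q' : Hex}
    (hX : ∀ h ∈ X, M.IsCol c ω h) (hX' : ∀ h ∈ X', M.IsCol c' ω h)
    (hbE : ∀ h ∈ X, h ∉ E' ∧ M.base h ∉ E ∧ M.base h ∉ E')
    (hbE' : ∀ h ∈ X', h ∉ E ∧ M.base h ∉ E ∧ M.base h ∉ E')
    (hE : ∀ h ∈ E, h ∉ E')
    (hFr : ∀ h, h ∈ X ∨ h ∈ E ∨ (∃ g ∈ X, h = M.base g) → h.2 < Q.2 ∧ Q'.2 ≤ h.2)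
    (hG : ∀ h, h ∈ X' ∨ h ∈ E' ∨ (∃ g ∈ X', h = M.base g) →
      (h.2 = P.2 → h.1 < P.1) ∧ (h.2 = P'.2 → P'.1 < h.1))
    (hQ : P.2 < Q.2) (hQ' : Q'.2 ≤ P.2)
    (f : Relation.ReflTransGen (Joined (M.ExtMove c ω X E)) P P')
    (g : Relation.ReflTransGen (Joined (M.ExtMove c' ω X' E')) Q Q') :
    c = c' ∧ ∃ a ∈ X, ∃ b ∈ X', a = b ∨ ∃ m, M.IrisLink c ω a m b := by
  by_contra hcon
  rw [not_and] at hcon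
  have hXX : ∀ a ∈ X, ∀ b ∈ X', a ≠ b := by
    rintro a ha _ hb rfl
    exact hcon ((hX a ha).unique (hX' a hb)) ⟨a, ha, a, hb, Or.inl rfl⟩
  have hAB : ∀ a ∈ X ∪ E, ∀ b ∈ X' ∪ E', a ≠ b := by
    rintro a (ha | ha) b (hb | hb) rfl
    · exact hXX _ ha _ hb rfl
    · exact (hbE _ ha).1 hb
    · exact (hbE' _ hb).1 ha
    · exact hE _ ha hb
  -- an iris used by one of the walks does not lie on any of the two sets
  have hir : ∀ {c₀ a m b}, a ∈ X ∪ X' → M.IrisLink c₀ ω a m b → m ∉ X ∪ E ∧ m ∉ X' ∪ E' := by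
    intro c₀ a m b ha h
    have hb := h.base_left
    refine ⟨?_, ?_⟩ <;> rintro (hm | hm)
    · exact (hX m hm).1 h.1
    · rcases ha with ha | ha
      · exact (hbE a ha).2.1 (hb ▸ hm)
      · exact (hbE' a ha).2.1 (hb ▸ hm)
    · exact (hX' m hm).1 h.1
    · rcases ha with ha | ha
      · exact (hbE a ha).2.2 (hb ▸ hm)
      · exact (hbE' a ha).2.2 (hb ▸ hm)
  refine walks_cross (F := M.ExtMove c ω X E) (G := M.ExtMove c' ω X' E')
    (fun _ _ _ h => h.isMove) (fun _ _ _ h => h.isMove) ?_ ?_ ?_ ?_ hQ hQ' f g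
  · intro a m b a' m' b' h h'
    have e1 := hAB _ h.1 _ h'.1
    have e2 := hAB _ h.1 _ h'.2.1
    have e3 := hAB _ h.2.1 _ h'.1
    have e4 := hAB _ h.2.1 _ h'.2.1
    obtain ⟨ha, hb, h | ⟨h1, h2, h⟩⟩ := h <;> obtain ⟨ha', hb', h' | ⟨h1', h2', h'⟩⟩ := h'
    · obtain ⟨rfl, -⟩ := h
      obtain ⟨rfl, -⟩ := h'
      exact ⟨e1, e1, e2, e1, e2, e3, e3, e4, Or.inl e1⟩
    · obtain ⟨rfl, -⟩ := h
      have := (hir (Or.inr h1') h').1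
      have n1 : m ≠ m' := fun e => this (e ▸ ha)
      have n2 : b ≠ m' := fun e => this (e ▸ hb)
      exact ⟨e1, n1, e2, e1, e2, e3, n2, e4, Or.inl n1⟩
    · obtain ⟨rfl, -⟩ := h'
      have := (hir (Or.inl h1) h).2
      have n1 : m ≠ m' := fun e => this (e ▸ ha')
      have n2 : m ≠ b' := fun e => this (e ▸ hb')
      exact ⟨e1, e1, e2, n1, n2, e3, e3, e4, Or.inl n1⟩
    · have i1 := (hir (Or.inr h1') h').1
      have i2 := (hir (Or.inl h1) h).2
      refine ⟨e1, fun e => i1 (e ▸ ha), e2, fun e => i2 (e ▸ ha'), fun e => i2 (e ▸ hb'), e3,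
        fun e => i1 (e ▸ hb), e4, ?_⟩
      -- two moves through the same iris: with one colour they give a link between the sets, with two
      -- colours they do not separate each other on the ring of petals
      by_cases hm : m = m'
      · subst hm
        obtain ⟨hm, k, k', rfl, rfl, l1, l2⟩ := h
        obtain ⟨_, l, l', rfl, rfl, l3, l4⟩ := h'
        by_cases hc : c = c'
        · subst hc
          exact absurd ⟨_, h1, _, h1', Or.inr ⟨m, hm, k, l, rfl, rfl, l1, l3⟩⟩ (hcon rfl)
        · have hc' : c' = !c := by cases c <;> cases c' <;> simp_all
          subst hc'
          refine Or.inr ⟨k, k', l, l', rfl, rfl, rfl, rfl, lk_nonInterleaved _ c k k' l l' ⟨l1, l2, l3,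
            l4, ?_, ?_, ?_, ?_⟩⟩ <;> rintro rfl <;> simp at e1 e2 e3 e4
      · exact Or.inl hm
  · rintro a m b ⟨ha, hb, h⟩
    have h1 := hFr a (by rcases ha with h | h <;> simp [h])
    have h2 := hFr b (by rcases hb with h | h <;> simp [h])
    have h3 : m.2 < Q.2 ∧ Q'.2 ≤ m.2 := by
      rcases h with ⟨rfl, -⟩ | ⟨h, -, h'⟩
      · exact h1
      · exact hFr m (Or.inr (Or.inr ⟨a, h, h'.base_left.symm⟩))
    exact ⟨⟨h1.1, h3.1, h2.1⟩, h1.2, h3.2, h2.2⟩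
  all_goals
    rintro a m b ⟨ha, hb, h⟩
    have h1 := hG a (by rcases ha with h | h <;> simp [h])
    have h2 := hG b (by rcases hb with h | h <;> simp [h])
    have h3 : (m.2 = P.2 → m.1 < P.1) ∧ (m.2 = P'.2 → P'.1 < m.1) := by
      rcases h with ⟨rfl, -⟩ | ⟨h, -, h'⟩
      · exact h1
      · exact hG m (Or.inr (Or.inr ⟨a, h, h'.base_left.symm⟩))
    first
      | exact ⟨h1.1, h3.1, h2.1⟩
      | exact ⟨h1.2, h3.2, h2.2⟩

end FlowerModel

/-! ### A discrete Stokes theorem -/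

theorem dir_add_three : ∀ k : Fin 6, dir k + dir (k + 3) = 0 := by decide

theorem dir_add_two : ∀ k : Fin 6, dir k + dir (k + 2) = dir (k + 1) := by decide

theorem fin_six_add : ∀ k : Fin 6, k + 3 + 3 = k ∧ k + 4 = k + 1 + 3 ∧ k + 4 + 3 = k + 1 ∧
    k + 2 + 1 = k + 3 ∧ k + 5 = k + 2 + 3 ∧ k + 4 + 1 = k + 5 := by decide

section Stokes

variable (I : Set Hex) (t : Hex → Hex → ℤ)

/-- A primitive of `t` along the ring around `i`, starting from the petal number `0`. -/
def ringSum (i : Hex) (k : Fin 6) : ℤ :=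
  ∑ l ∈ Finset.univ.filter (· < k), t (i + dir l) (i + dir (l + 1))

open Classical in
/-- The cochain `t`, extended to the edges which end in a hexagon of `I`. -/
def edgeVal (h : Hex) (k : Fin 6) : ℤ :=
  if h ∈ I then ringSum t h k else if h + dir k ∈ I then -ringSum t (h + dir k) (k + 3)
  else t h (h + dir k)

variable {I t}

/-- As `t` sums to zero along the ring, the primitive is well defined around the ring. -/
theorem ringSum_succ {i : Hex} (hi : ∑ k, t (i + dir k) (i + dir (k + 1)) = 0) (k : Fin 6) :
    ringSum t i (k + 1) = ringSum t i k + t (i + dir k) (i + dir (k + 1)) := by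
  simp only [Fin.sum_univ_six] at hi
  fin_cases k <;> simp [ringSum, Finset.sum_filter, Fin.sum_univ_six] at hi ⊢ <;> linarith

theorem edgeVal_neg (hI : ∀ i ∈ I, ∀ k, i + dir k ∉ I) (ht : ∀ u v, t u v = -t v u) (h : Hex)
    (k : Fin 6) : edgeVal I t (h + dir k) (k + 3) = -edgeVal I t h k := by
  have e : h + dir k + dir (k + 3) = h := by rw [add_assoc, dir_add_three, add_zero]
  have e2 : k + 3 + 3 = k := (fin_six_add k).1
  unfold edgeVal
  rw [e, e2]
  by_cases h1 : h ∈ I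
  · rw [if_neg (hI h h1 k), if_pos h1, if_pos h1]
  · rw [if_neg h1, if_neg h1]
    by_cases h2 : h + dir k ∈ I
    · rw [if_pos h2, if_pos h2, neg_neg]
    · rw [if_neg h2, if_neg h2, ht]

/-- The extended cochain is closed on all triangles, also on those with a corner in `I`. -/
theorem edgeVal_triangle (hI : ∀ i ∈ I, ∀ k, i + dir k ∉ I)
    (hT : ∀ h k, h ∉ I → h + dir k ∉ I → h + dir (k + 1) ∉ I →
      t h (h + dir k) + t (h + dir k) (h + dir (k + 1)) + t (h + dir (k + 1)) h = 0)
    (hR : ∀ i ∈ I, ∑ k, t (i + dir k) (i + dir (k + 1)) = 0) (h : Hex) (k : Fin 6) :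
    edgeVal I t h k + edgeVal I t (h + dir k) (k + 2) + edgeVal I t (h + dir (k + 1)) (k + 4) =
      0 := by
  have e1 : h + dir k + dir (k + 2) = h + dir (k + 1) := by rw [add_assoc, dir_add_two]
  have e2 : h + dir (k + 1) + dir (k + 4) = h := by
    rw [add_assoc, (fin_six_add k).2.1, dir_add_three, add_zero]
  unfold edgeVal
  rw [e1, e2]
  by_cases h0 : h ∈ I
  · rw [if_pos h0, if_neg (hI h h0 _), if_neg (hI h h0 _), if_neg (hI h h0 _), if_pos h0,
      (fin_six_add k).2.2.1, ringSum_succ (hR h h0)]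
    ring
  rw [if_neg h0]
  by_cases h1 : h + dir k ∈ I
  · have a1 : h + dir (k + 1) = h + dir k + dir (k + 2) := e1.symm
    have a2 : h = h + dir k + dir (k + 3) := by rw [add_assoc, dir_add_three, add_zero]
    have h2 : h + dir (k + 1) ∉ I := by rw [a1]; exact hI _ h1 _
    rw [if_pos h1, if_pos h1, if_neg h2, if_neg h0]
    have := ringSum_succ (hR _ h1) (k + 2)
    rw [← a1, (fin_six_add k).2.2.2.1, ← a2] at this
    rw [this]; ring
  rw [if_neg h1, if_neg h1]
  by_cases h2 : h + dir (k + 1) ∈ I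
  · have a1 : h + dir k = h + dir (k + 1) + dir (k + 5) := by
      rw [add_assoc, ← dir_add_two k, add_assoc, (fin_six_add k).2.2.2.2.1, dir_add_three,
        add_zero]
    have a2 : h = h + dir (k + 1) + dir (k + 4) := e2.symm
    rw [if_pos h2, if_pos h2]
    have := ringSum_succ (hR _ h2) (k + 4)
    rw [(fin_six_add k).2.2.2.2.2, ← a1, ← a2] at this
    rw [← (fin_six_add k).2.2.2.2.1, this]; ring
  · rw [if_neg h2, if_neg h2, if_neg h0]
    exact hT h k h0 h1 h2

theorem edgeVal_square (hI : ∀ i ∈ I, ∀ k, i + dir k ∉ I) (ht : ∀ u v, t u v = -t v u)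
    (hT : ∀ h k, h ∉ I → h + dir k ∉ I → h + dir (k + 1) ∉ I →
      t h (h + dir k) + t (h + dir k) (h + dir (k + 1)) + t (h + dir (k + 1)) h = 0)
    (hR : ∀ i ∈ I, ∑ k, t (i + dir k) (i + dir (k + 1)) = 0) (h : Hex) :
    edgeVal I t h 0 + edgeVal I t (h + dir 0) 1 =
      edgeVal I t h 1 + edgeVal I t (h + dir 1) 0 := by
  have h1 := edgeVal_triangle hI hT hR h 0
  have h2 := edgeVal_triangle hI hT hR (h + dir 0) 1
  have h3 := edgeVal_neg hI ht h 1
  have h4 := edgeVal_neg hI ht (h + dir 1) 0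
  have h5 := edgeVal_neg hI ht (h + dir 0) 2
  have a1 : h + dir 0 + dir 1 = h + dir 1 + dir 0 := by abel
  have a2 : h + dir 0 + dir 2 = h + dir 1 := by rw [add_assoc]; rfl
  simp only [zero_add, show (1 : Fin 6) + 1 = 2 from rfl, show (1 : Fin 6) + 2 = 3 from rfl,
    show (1 : Fin 6) + 4 = 5 from rfl, show (1 : Fin 6) + 3 = 4 from rfl,
    show (2 : Fin 6) + 3 = 5 from rfl, a1, a2] at h1 h2 h3 h4 h5
  linarith

/-- A cochain that sums to zero on the triangles off `I` and on the rings around the hexagons of `I`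
sums to zero along the boundary of a parallelogram which avoids `I`. -/
theorem sum_boundary_eq_zero (hI : ∀ i ∈ I, ∀ k, i + dir k ∉ I) (ht : ∀ u v, t u v = -t v u)
    (hT : ∀ h k, h ∉ I → h + dir k ∉ I → h + dir (k + 1) ∉ I →
      t h (h + dir k) + t (h + dir k) (h + dir (k + 1)) + t (h + dir (k + 1)) h = 0)
    (hR : ∀ i ∈ I, ∑ k, t (i + dir k) (i + dir (k + 1)) = 0) (A B : ℤ) (p q : ℕ)
    (hb : ∀ j : ℕ, j ≤ p → (A + j, B) ∉ I ∧ (A + j, B + q) ∉ I)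
    (hb' : ∀ j : ℕ, j ≤ q → (A, B + j) ∉ I ∧ (A + p, B + j) ∉ I) :
    ∑ j ∈ Finset.range p, t (A + j, B) (A + j + 1, B) +
        ∑ j ∈ Finset.range q, t (A + p, B + j) (A + p, B + j + 1) =
      ∑ j ∈ Finset.range q, t (A, B + j) (A, B + j + 1) +
        ∑ j ∈ Finset.range p, t (A + j, B + q) (A + j + 1, B + q) := by
  have sq := edgeVal_square hI ht hT hR
  set E := edgeVal I t with hE
  have d0 : ∀ x y : ℤ, ((x, y) : Hex) + dir 0 = (x + 1, y) := fun x y => by simp [dir]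
  have d1 : ∀ x y : ℤ, ((x, y) : Hex) + dir 1 = (x, y + 1) := fun x y => by simp [dir]
  have row : ∀ (y : ℤ) (p : ℕ), ∑ j ∈ Finset.range p, E (A + j, y) 0 + E (A + p, y) 1 =
      E (A, y) 1 + ∑ j ∈ Finset.range p, E (A + j, y + 1) 0 := by
    intro y p
    induction p with
    | zero => simp
    | succ p ih =>
      have := sq (A + p, y)
      rw [d0, d1] at this
      rw [Finset.sum_range_succ, Finset.sum_range_succ]
      push_cast
      rw [← add_assoc A]
      linarith
  have all : ∀ q : ℕ, ∑ j ∈ Finset.range p, E (A + j, B) 0 +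
        ∑ j ∈ Finset.range q, E (A + p, B + j) 1 =
      ∑ j ∈ Finset.range q, E (A, B + j) 1 + ∑ j ∈ Finset.range p, E (A + j, B + q) 0 := by
    intro q
    induction q with
    | zero => simp
    | succ q ih =>
      have := row (B + q) p
      rw [Finset.sum_range_succ, Finset.sum_range_succ]
      push_cast
      rw [← add_assoc B]
      linarith
  have ev : ∀ h k, h ∉ I → h + dir k ∉ I → E h k = t h (h + dir k) := by
    intro h k h1 h2
    rw [hE, edgeVal, if_neg h1, if_neg h2]
  have := all q
  have c1 : ∀ x y : ℤ, (x, y) ∉ I → (x + 1, y) ∉ I → E (x, y) 0 = t (x, y) (x + 1, y) := by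
    intro x y h1 h2
    rw [ev _ _ h1 (by rwa [d0]), d0]
  have c2 : ∀ x y : ℤ, (x, y) ∉ I → (x, y + 1) ∉ I → E (x, y) 1 = t (x, y) (x, y + 1) := by
    intro x y h1 h2
    rw [ev _ _ h1 (by rwa [d1]), d1]
  have r1 : ∀ j ∈ Finset.range p, E (A + j, B) 0 = t (A + j, B) (A + j + 1, B) := fun j hj =>
    c1 _ _ (hb j (Finset.mem_range.1 hj).le).1
      (by simpa [add_assoc] using (hb (j + 1) (Finset.mem_range.1 hj)).1)
  have r2 : ∀ j ∈ Finset.range q, E (A + p, B + j) 1 = t (A + p, B + j) (A + p, B + j + 1) :=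
    fun j hj => c2 _ _ (hb' j (Finset.mem_range.1 hj).le).2
      (by simpa [add_assoc] using (hb' (j + 1) (Finset.mem_range.1 hj)).2)
  have r3 : ∀ j ∈ Finset.range q, E (A, B + j) 1 = t (A, B + j) (A, B + j + 1) := fun j hj =>
    c2 _ _ (hb' j (Finset.mem_range.1 hj).le).1
      (by simpa [add_assoc] using (hb' (j + 1) (Finset.mem_range.1 hj)).1)
  have r4 : ∀ j ∈ Finset.range p, E (A + j, B + q) 0 = t (A + j, B + q) (A + j + 1, B + q) :=
    fun j hj => c1 _ _ (hb j (Finset.mem_range.1 hj).le).2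
      (by simpa [add_assoc] using (hb (j + 1) (Finset.mem_range.1 hj)).2)
  rwa [Finset.sum_congr rfl r1, Finset.sum_congr rfl r2, Finset.sum_congr rfl r3,
    Finset.sum_congr rfl r4] at this

end Stokes

/-! ### Sectors around a hexagonal domain -/

/-- The hexagon of radius `n` around the origin. -/
def InHexagon (n : ℤ) (v : Hex) : Prop :=
  (-n ≤ v.1 ∧ v.1 ≤ n) ∧ (-n ≤ v.2 ∧ v.2 ≤ n) ∧ -n ≤ v.1 + v.2 ∧ v.1 + v.2 ≤ n

/-- The outside of the hexagon of radius `n` is cut into six sectors; the sector number `k` lies in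
the cone spanned by the directions `k` (included) and `k + 1` (excluded). -/
def InSector (n : ℤ) (k : Fin 6) (v : Hex) : Prop :=
  (![1 ≤ v.1 ∧ 0 ≤ v.2 ∧ n < v.1 + v.2, v.1 ≤ 0 ∧ 1 ≤ v.1 + v.2 ∧ n < v.2,
    1 ≤ v.2 ∧ v.1 + v.2 ≤ 0 ∧ v.1 < -n, v.1 ≤ -1 ∧ v.2 ≤ 0 ∧ v.1 + v.2 < -n,
    0 ≤ v.1 ∧ v.1 + v.2 ≤ -1 ∧ v.2 < -n, v.2 ≤ -1 ∧ 0 ≤ v.1 + v.2 ∧ n < v.1] : Fin 6 → Prop) k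

theorem inSector_rot {n : ℤ} {v : Hex} (k : Fin 6) :
    InSector n (k + 1) (rot v) ↔ InSector n k v := by
  fin_cases k <;> simp [InSector, rot] <;> omega

theorem inHexagon_rot {n : ℤ} {v : Hex} : InHexagon n (rot v) ↔ InHexagon n v := by
  simp only [InHexagon, rot]; omega

theorem inSector_or {n : ℤ} (hn : 0 ≤ n) {v : Hex} (h : ¬ InHexagon n v) : ∃ k, InSector n k v := by
  by_contra hcon
  push Not at hcon
  have h0 := hcon 0
  have h1 := hcon 1
  have h2 := hcon 2
  have h3 := hcon 3
  have h4 := hcon 4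
  have h5 := hcon 5
  simp [InSector] at h0 h1 h2 h3 h4 h5
  simp only [InHexagon] at h
  omega

theorem not_inSector {n : ℤ} {k : Fin 6} {v : Hex} (h : InSector n k v) : ¬ InHexagon n v := by
  fin_cases k <;> simp [InSector] at h <;> simp only [InHexagon] <;> omega

theorem inSector_far {n : ℤ} (hn : 10 ≤ n) {k : Fin 6} {v w : Hex} (h : InSector n k v)
    (hw : InSector n (k + 2) w ∨ InSector n (k + 4) w) (h1 : -3 ≤ w.1 - v.1 ∧ w.1 - v.1 ≤ 3)
    (h2 : -3 ≤ w.2 - v.2 ∧ w.2 - v.2 ≤ 3) : False := by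
  fin_cases k <;> simp [InSector] at h hw <;> omega

theorem inSector_unique {n : ℤ} {k k' : Fin 6} {v : Hex} (h : InSector n k v)
    (h' : InSector n k' v) : k = k' := by
  fin_cases k <;> fin_cases k' <;> first | rfl | (simp [InSector] at h h'; omega)

namespace FlowerModel

variable (M : FlowerModel)

/-- The flowers and fillers with their centre in the hexagon of radius `n` around `z`. -/
def hexDom (z : Hex) (n : ℤ) : Set Hex := {h | InHexagon n (M.base h - z)}

/-- The part of the complement of `hexDom z n` in the sector number `k`. -/
def sector (z : Hex) (n : ℤ) (k : Fin 6) : Set Hex := {h | InSector n k (M.base h - z)}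

/-- The hexagon `h` has a neighbour in the sector number `k`. -/
def Touch (z : Hex) (n : ℤ) (k : Fin 6) (h : Hex) : Prop := ∃ g ∈ M.sector z n k, Near h g

/-- A connection of colour `c` in `hexDom z n` between the sectors `k` and `k'`. -/
def Chord (c : Bool) (ω : Config) (z : Hex) (n : ℤ) (k k' : Fin 6) : Prop :=
  ∃ h h', M.Touch z n k h ∧ M.Touch z n k' h' ∧ M.Conn c ω (M.hexDom z n) h h'

/-- Only irises are in mixed states. -/
def Proper (ω : Config) : Prop := ∀ h, h ∉ M.irises → ∃ c, ω h = mono c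

variable {M}

theorem saturated_hexDom (z : Hex) (n : ℤ) : M.Saturated (M.hexDom z n) := by
  intro h; simp only [hexDom, Set.mem_ofPred_eq, base_base]

theorem base_near {u v : Hex} (h : Near u v) :
    (-3 ≤ (M.base v).1 - (M.base u).1 ∧ (M.base v).1 - (M.base u).1 ≤ 3) ∧
    (-3 ≤ (M.base v).2 - (M.base u).2 ∧ (M.base v).2 - (M.base u).2 ≤ 3) := by
  have h1 := near_base (M := M) u
  have h2 := near_base (M := M) v
  unfold Near at *
  omega

variable (M)

/-- The hexagons reached in colour `c` from the sector number `j`, and this sector. -/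
def Reach (c : Bool) (ω : Config) (z : Hex) (n : ℤ) (j : Fin 6) : Set Hex :=
  {h | h ∈ M.sector z n j ∨ ∃ g, M.Touch z n j g ∧ M.Conn c ω (M.hexDom z n) g h}

variable {M} {c : Bool} {ω : Config} {z : Hex} {n : ℤ} {j : Fin 6}

theorem sector_notMem {h : Hex} {k : Fin 6} (hs : h ∈ M.sector z n k) : h ∉ M.hexDom z n :=
  not_inSector hs

theorem reach_of_near (hn : 10 ≤ n) (h2 : ¬ M.Chord c ω z n j (j + 2))
    (h4 : ¬ M.Chord c ω z n j (j + 4)) {u v : Hex} (hu : u ∈ M.Reach c ω z n j) (huv : Near u v)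
    (hv : (v ∈ M.hexDom z n ∧ M.IsCol c ω v) ∨ v ∈ M.sector z n j ∨ v ∈ M.sector z n (j + 2) ∨
      v ∈ M.sector z n (j + 4)) : v ∈ M.Reach c ω z n j := by
  have hb := base_near (M := M) huv
  rcases hu with hu | ⟨g, hg, hu⟩
  · rcases hv with ⟨hv, hc⟩ | hv | hv
    · exact Or.inr ⟨v, ⟨u, hu, huv.symm⟩, Conn.refl hv hc⟩
    · exact Or.inl hv
    · exact (inSector_far hn hu hv (by simpa using hb.1) (by simpa using hb.2)).elim
  · rcases hv with ⟨hv, hc⟩ | hv | hv | hv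
    · exact Or.inr ⟨g, hg, hu.trans (Conn.near hu.right.1 hv hu.right.2 hc huv)⟩
    · exact Or.inl hv
    · exact (h2 ⟨g, u, hg, ⟨v, hv, huv⟩, hu⟩).elim
    · exact (h4 ⟨g, u, hg, ⟨v, hv, huv⟩, hu⟩).elim

end FlowerModel

/-! ### Transitions between the colours along rings and triangles -/

set_option synthInstance.maxSize 2000 in
set_option synthInstance.maxHeartbeats 400000 in
theorem ring_aux : ∀ (σ : HexState) (p₀ p₁ p₂ p₃ p₄ p₅ m₀ m₁ : Bool), (p₀ = p₁ → m₀ = m₁) →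
    ∀ m₂, (p₁ = p₂ → m₁ = m₂) → ∀ m₃, (p₂ = p₃ → m₂ = m₃) → ∀ m₄, (p₃ = p₄ → m₃ = m₄) →
    ∀ m₅, (p₄ = p₅ → m₄ = m₅) → (p₅ = p₀ → m₅ = m₀) →
    (∀ k k', (![p₀, p₁, p₂, p₃, p₄, p₅] k = ![p₀, p₁, p₂, p₃, p₄, p₅] k' ∧
      lk (![p₀, p₁, p₂, p₃, p₄, p₅] k) σ k ∧ lk (![p₀, p₁, p₂, p₃, p₄, p₅] k) σ k') →
      ![m₀, m₁, m₂, m₃, m₄, m₅] k = ![m₀, m₁, m₂, m₃, m₄, m₅] k') →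
    ∑ k, (((if !(![p₀, p₁, p₂, p₃, p₄, p₅] k) && ![m₀, m₁, m₂, m₃, m₄, m₅] k then 1 else 0) *
      (if ![p₀, p₁, p₂, p₃, p₄, p₅] (k + 1) && ![m₀, m₁, m₂, m₃, m₄, m₅] (k + 1) then 1 else 0) -
      (if ![p₀, p₁, p₂, p₃, p₄, p₅] k && ![m₀, m₁, m₂, m₃, m₄, m₅] k then 1 else 0) *
      (if !(![p₀, p₁, p₂, p₃, p₄, p₅] (k + 1)) && ![m₀, m₁, m₂, m₃, m₄, m₅] (k + 1)
        then 1 else 0) : ℤ)) = 0 := by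
  decide +kernel
/-- The case `c = true` of `ring_transitions`. The finitely many cases are checked by evaluation in
`ring_aux`, where each constraint on the marks stands right after the marks it involves, so that
most branches are cut early. -/
theorem ring_transitions_true (σ : HexState) (p m : Fin 6 → Bool)
    (h1 : ∀ k, p k = p (k + 1) → m k = m (k + 1))
    (h2 : ∀ k k', (p k = p k' ∧ lk (p k) σ k ∧ lk (p k) σ k') → m k = m k') :
    ∑ k, (((if !p k && m k then 1 else 0) * (if p (k + 1) && m (k + 1) then 1 else 0) -
      (if p k && m k then 1 else 0) * (if !p (k + 1) && m (k + 1) then 1 else 0) : ℤ)) = 0 := by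
  have e : ∀ f : Fin 6 → Bool, ![f 0, f 1, f 2, f 3, f 4, f 5] = f := by
    intro f; funext k; fin_cases k <;> rfl
  have := ring_aux σ (p 0) (p 1) (p 2) (p 3) (p 4) (p 5) (m 0) (m 1) (h1 0) (m 2) (h1 1) (m 3)
    (h1 2) (m 4) (h1 3) (m 5) (h1 4) (h1 5)
  rw [e, e] at this
  exact this h2

/-- The number of signed transitions between marked hexagons of different colours vanishes along the
ring around an iris, if the marks agree on petals which are linked. Here `p k` says that the petal
number `k` has the colour `c`, and `m k` that it is marked. -/
theorem ring_transitions (σ : HexState) (c : Bool) (p m : Fin 6 → Bool)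
    (h1 : ∀ k, p k = p (k + 1) → m k = m (k + 1))
    (h2 : ∀ k k', (p k = p k' ∧ lk (p k == c) σ k ∧ lk (p k == c) σ k') → m k = m k') :
    ∑ k, (((if !p k && m k then 1 else 0) * (if p (k + 1) && m (k + 1) then 1 else 0) -
      (if p k && m k then 1 else 0) * (if !p (k + 1) && m (k + 1) then 1 else 0) : ℤ)) = 0 := by
  cases c
  · have := ring_transitions_true σ (fun k => !p k) m (fun k h => h1 k (by simpa using h))
      fun k k' h => h2 k k' (by simpa using h)
    refine neg_eq_zero.1 ?_
    rw [← Finset.sum_neg_distrib]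
    refine Eq.trans (Finset.sum_congr rfl fun k _ => ?_) this
    simp only [Bool.not_not]
    ring
  · exact ring_transitions_true σ p m h1 fun k k' h => h2 k k' (by simpa using h)

/-- The analogue of `ring_transitions` for a triangle. -/
theorem triangle_transitions : ∀ p₁ p₂ p₃ m₁ m₂ m₃ : Bool, (p₁ = p₂ → m₁ = m₂) →
    (p₂ = p₃ → m₂ = m₃) → (p₁ = p₃ → m₁ = m₃) →
    (((if !p₁ && m₁ then 1 else 0) * (if p₂ && m₂ then 1 else 0) -
      (if p₁ && m₁ then 1 else 0) * (if !p₂ && m₂ then 1 else 0)) +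
    ((if !p₂ && m₂ then 1 else 0) * (if p₃ && m₃ then 1 else 0) -
      (if p₂ && m₂ then 1 else 0) * (if !p₃ && m₃ then 1 else 0)) +
    ((if !p₃ && m₃ then 1 else 0) * (if p₁ && m₁ then 1 else 0) -
      (if p₃ && m₃ then 1 else 0) * (if !p₁ && m₁ then 1 else 0)) : ℤ) = 0 := by
  decide

namespace FlowerModel

variable {M : FlowerModel} {c : Bool} {ω : Config} {z : Hex} {n : ℤ} {j : Fin 6}

/-! ### A duality between connections of the two colours -/

theorem reach_iris {a m b : Hex} (ha : a ∈ M.Reach c ω z n j) (hD : a ∈ M.hexDom z n)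
    (hcb : M.IsCol c ω b) (h : M.IrisLink c ω a m b) :
    b ∈ M.Reach c ω z n j := by
  have hbD : b ∈ M.hexDom z n := by
    rw [hexDom, Set.mem_ofPred_eq, h.base_right, ← h.base_left]; exact hD
  rcases ha with ha | ⟨g, hg, ha⟩
  · exact (sector_notMem ha hD).elim
  · exact Or.inr ⟨g, hg, ha.trans (Conn.iris hD hbD ha.right.2 hcb h)⟩

theorem reach_sector {k : Fin 6} {h : Hex} (hs : h ∈ M.sector z n k) :
    h ∈ M.Reach c ω z n j ↔ k = j := by
  constructor
  · rintro (h' | ⟨g, _, h'⟩)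
    · exact inSector_unique hs h'
    · exact (sector_notMem hs h'.right.1).elim
  · rintro rfl; exact Or.inl hs

/-- With the sectors coloured alternately, an iris-free hexagon `h` has the colour `c`. -/
def ColIn (M : FlowerModel) (c : Bool) (ω : Config) (z : Hex) (n : ℤ) (j : Fin 6) (h : Hex) : Prop :=
  (h ∈ M.hexDom z n ∧ M.IsCol c ω h) ∨ h ∈ M.sector z n j ∨ h ∈ M.sector z n (j + 2) ∨
    h ∈ M.sector z n (j + 4)

theorem colIn_or (hn : 10 ≤ n) (hω : M.Proper ω) (c : Bool) (z : Hex) {h : Hex}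
    (hh : h ∉ M.irises ∩ M.hexDom z n) :
    (M.ColIn c ω z n 0 h ∧ ¬ M.ColIn (!c) ω z n 1 h) ∨
      (¬ M.ColIn c ω z n 0 h ∧ M.ColIn (!c) ω z n 1 h) := by
  have key : ∀ k, h ∈ M.sector z n k → ∀ k', h ∈ M.sector z n k' ↔ k = k' := fun k hk k' =>
    ⟨fun hk' => inSector_unique hk hk', fun e => e ▸ hk⟩
  by_cases hD : h ∈ M.hexDom z n
  · have hi : h ∉ M.irises := fun hi => hh ⟨hi, hD⟩
    have hs : ∀ k, h ∉ M.sector z n k := fun k hk => sector_notMem hk hD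
    obtain ⟨c', hc'⟩ := hω h hi
    simp only [ColIn, hs, or_false, hD, true_and, IsCol, hi, not_false_eq_true, hc']
    cases c <;> cases c' <;> simp [mono]
  · obtain ⟨k, hk⟩ := inSector_or (by omega : (0 : ℤ) ≤ n) hD
    simp only [ColIn, hD, false_and, false_or, key k hk]
    clear hk
    revert k; decide

theorem reach_colIn {h : Hex} (hr : h ∈ M.Reach c ω z n j) : M.ColIn c ω z n j h := by
  rcases hr with h' | ⟨g, _, h'⟩
  · exact Or.inr (Or.inl h')
  · exact Or.inl h'.right

open Classical in
/-- Connections of the two colours through a hexagonal domain: there is one of colour `c` from the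
sector `0` to another even sector, or one of the other colour from the sector `1` to another odd
sector. Otherwise the transitions between what is reached from the sectors `0` and `1` would
sum to zero around a large parallelogram, while there is just one of them. -/
theorem chord_duality (hn : 10 ≤ n) (hω : M.Proper ω) (c : Bool) (z : Hex) :
    (M.Chord c ω z n 0 2 ∨ M.Chord c ω z n 0 4) ∨
      (M.Chord (!c) ω z n 1 3 ∨ M.Chord (!c) ω z n 1 5) := by
  by_contra hcon
  simp only [not_or] at hcon
  obtain ⟨⟨h02, h04⟩, h13, h15⟩ := hcon
  set I := M.irises ∩ M.hexDom z n with hI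
  -- the colour `p` with the sectors coloured alternately, the marks `m` on what is reached, and the
  -- cochain `t` of signed transitions between reached hexagons of different colours
  let p : Hex → Bool := fun u => decide (M.ColIn c ω z n 0 u)
  let m : Hex → Bool := fun u =>
    decide (u ∈ M.Reach c ω z n 0 ∨ u ∈ M.Reach (!c) ω z n 1)
  let s : Hex → ℤ := fun u => if p u && m u then 1 else 0
  let y : Hex → ℤ := fun u => if !p u && m u then 1 else 0
  let t : Hex → Hex → ℤ := fun u v => y u * s v - s u * y v
  have hIp : ∀ i ∈ I, ∀ k, i + dir k ∉ I := fun i hi k h => petal_notMem hi.1 k h.1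
  have hp : ∀ {u}, u ∉ I → p u = true → ¬ M.ColIn (!c) ω z n 1 u := by
    intro u hu h
    rcases colIn_or hn hω c z hu with h' | h'
    · exact h'.2
    · exact absurd (of_decide_eq_true h) h'.1
  have hp' : ∀ {u}, u ∉ I → p u = false → M.ColIn (!c) ω z n 1 u := by
    intro u hu h
    rcases colIn_or hn hω c z hu with h' | h'
    · exact absurd h'.1 (of_decide_eq_false h)
    · exact h'.2
  have hmS : ∀ {u}, u ∉ I → p u = true → m u = true → u ∈ M.Reach c ω z n 0 := by
    intro u hu h1 h2
    exact (of_decide_eq_true h2).resolve_right fun h => hp hu h1 (reach_colIn h)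
  have hmY : ∀ {u}, p u = false → m u = true → u ∈ M.Reach (!c) ω z n 1 := by
    intro u h1 h2
    exact (of_decide_eq_true h2).resolve_left fun h => of_decide_eq_false h1 (reach_colIn h)
  have hstep : ∀ u v, u ∉ I → v ∉ I → Near u v → p u = p v → m u = true → m v = true := by
    intro u v hu hv huv hpp hm
    cases h : p u
    · exact decide_eq_true (Or.inr (reach_of_near hn h13 h15 (hmY h hm) huv (hp' hv (hpp.symm.trans h))))
    · exact decide_eq_true (Or.inl (reach_of_near hn h02 h04 (hmS hu h hm) huv
        (show M.ColIn c ω z n 0 v from of_decide_eq_true (hpp.symm.trans h))))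
  have hnear : ∀ u v, u ∉ I → v ∉ I → Near u v → p u = p v → m u = m v := by
    intro u v hu hv huv hpp
    rw [Bool.eq_iff_iff]
    exact ⟨hstep u v hu hv huv hpp, hstep v u hv hu huv.symm hpp.symm⟩
  -- the cochain is closed on the triangles and on the rings around irises
  have hT : ∀ h k, h ∉ I → h + dir k ∉ I → h + dir (k + 1) ∉ I →
      t h (h + dir k) + t (h + dir k) (h + dir (k + 1)) + t (h + dir (k + 1)) h = 0 := by
    intro h k h0 h1 h2
    refine triangle_transitions (p h) (p (h + dir k)) (p (h + dir (k + 1))) (m h) (m (h + dir k))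
      (m (h + dir (k + 1))) (hnear _ _ h0 h1 (near_add_dir _ _)) (hnear _ _ h1 h2 ?_)
      (hnear _ _ h0 h2 (near_add_dir _ _))
    rw [← dir_add_two, ← add_assoc]
    exact near_add_dir _ _
  have hR : ∀ i ∈ I, ∑ k, t (i + dir k) (i + dir (k + 1)) = 0 := by
    intro i hi
    have hpD : ∀ k, i + dir k ∈ M.hexDom z n := by
      intro k
      rw [hexDom, Set.mem_ofPred_eq, base_petal hi.1, ← base_iris hi.1]; exact hi.2
    have hcol : ∀ k, M.IsCol (p (i + dir k) == c) ω (i + dir k) := by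
      intro k
      cases h : p (i + dir k)
      · rcases hp' (hIp i hi k) h with h' | h' | h' | h'
        · simpa using h'.2
        all_goals exact (sector_notMem h' (hpD k)).elim
      · rcases of_decide_eq_true h with h' | h' | h' | h'
        · simpa using h'.2
        all_goals exact (sector_notMem h' (hpD k)).elim
    have hl : ∀ k k', (p (i + dir k) = p (i + dir k') ∧ lk (p (i + dir k) == c) (ω i) k ∧
        lk (p (i + dir k) == c) (ω i) k') → m (i + dir k) = true → m (i + dir k') = true := by
      rintro k k' ⟨h1, h2, h3⟩ hm
      have hlink : M.IrisLink (p (i + dir k) == c) ω (i + dir k) i (i + dir k') :=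
        ⟨hi.1, k, k', rfl, rfl, h2, h3⟩
      have hc' := hcol k'
      rw [← h1] at hc'
      cases h : p (i + dir k)
      · rw [h, show (false == c) = !c by cases c <;> rfl] at hlink hc'
        exact decide_eq_true (Or.inr (reach_iris (hmY h hm) (hpD k) hc' hlink))
      · rw [h, show (true == c) = c by cases c <;> rfl] at hlink hc'
        exact decide_eq_true (Or.inl (reach_iris (hmS (hIp i hi k) h hm) (hpD k) hc' hlink))
    refine ring_transitions (ω i) c (fun k => p (i + dir k)) (fun k => m (i + dir k)) ?_ ?_
    · intro k hk
      refine hnear _ _ (hIp i hi k) (hIp i hi _) ?_ hk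
      rw [← dir_add_two, ← add_assoc]
      exact near_add_dir _ _
    · intro k k' h
      rw [Bool.eq_iff_iff]
      exact ⟨hl k k' h, hl k' k ⟨h.1.symm, h.1 ▸ h.2.2, h.1 ▸ h.2.1⟩⟩
  -- outside the domain only the sectors `0` and `1` are reached
  have hout : ∀ {u : Hex} {k : Fin 6}, u ∈ M.sector z n k →
      s u = (if k = 0 then 1 else 0) ∧ y u = (if k = 1 then 1 else 0) := by
    intro u k hu
    have e1 : ∀ k', u ∈ M.sector z n k' ↔ k = k' := fun k' =>
      ⟨fun hk' => inSector_unique hu hk', fun e => e ▸ hu⟩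
    have hD := sector_notMem hu
    simp only [s, y, p, m, reach_sector hu, ColIn, hD, false_and, false_or, e1]
    clear hu e1
    revert k; decide
  have hnI : ∀ {u : Hex} {k : Fin 6}, u ∈ M.sector z n k → u ∉ I := fun hu h => sector_notMem hu h.2
  -- the sectors of the sides of a large parallelogram
  have hN : ∀ u : Hex, -1 ≤ (M.base u).1 - u.1 ∧ (M.base u).1 - u.1 ≤ 1 ∧
      -1 ≤ (M.base u).2 - u.2 ∧ (M.base u).2 - u.2 ≤ 1 := by
    intro u; have := near_base (M := M) u; unfold Near at this; omega
  obtain ⟨N, hNn⟩ : ∃ N : ℕ, (N : ℤ) = n := ⟨n.toNat, by omega⟩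
  have hmem : ∀ u : Hex, u.1 - z.1 = -(n + 15) ∨ u.1 - z.1 = n + 15 ∨ u.2 - z.2 = -(n + 15) ∨
      u.2 - z.2 = n + 5 → ∃ k, u ∈ M.sector z n k := by
    intro u hu
    refine inSector_or (by omega) ?_
    have := hN u
    simp only [InHexagon, Prod.fst_sub, Prod.snd_sub]
    omega
  have hI' : ∀ u : Hex, u.1 - z.1 = -(n + 15) ∨ u.1 - z.1 = n + 15 ∨ u.2 - z.2 = -(n + 15) ∨
      u.2 - z.2 = n + 5 → u ∉ I := by
    intro u hu
    obtain ⟨k, hk⟩ := hmem u hu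
    exact hnI hk
  have hdec : ∀ u : Hex, (u.1 - z.1 = -(n + 15) ∨ u.1 - z.1 = n + 15 ∨ u.2 - z.2 = -(n + 15) ∨
      u.2 - z.2 = n + 5) → s u = (if u ∈ M.sector z n 0 then 1 else 0) ∧
        y u = (if u ∈ M.sector z n 1 then 1 else 0) := by
    intro u hu
    obtain ⟨k, hk⟩ := hmem u hu
    have e1 : ∀ k', u ∈ M.sector z n k' ↔ k = k' := fun k' =>
      ⟨fun hk' => inSector_unique hk hk', fun e => e ▸ hk⟩
    rw [e1, e1]
    convert hout hk
  have hsec0 : ∀ u, u ∈ M.sector z n 0 ↔ 1 ≤ (M.base u).1 - z.1 ∧ 0 ≤ (M.base u).2 - z.2 ∧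
      n < (M.base u).1 - z.1 + ((M.base u).2 - z.2) := fun u => Iff.rfl
  have hsec1 : ∀ u, u ∈ M.sector z n 1 ↔ (M.base u).1 - z.1 ≤ 0 ∧
      1 ≤ (M.base u).1 - z.1 + ((M.base u).2 - z.2) ∧ n < (M.base u).2 - z.2 := fun u => Iff.rfl
  have main := sum_boundary_eq_zero (t := t) hIp (fun u v => by simp only [t]; ring) hT hR
    (z.1 - (n + 15)) (z.2 - (n + 15)) (2 * N + 30) (2 * N + 20)
    (fun j hj => ⟨hI' _ (by simp only; omega), hI' _ (by simp only; push_cast; omega)⟩)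
    (fun j hj => ⟨hI' _ (by simp only; omega), hI' _ (by simp only; push_cast; omega)⟩)
  have t0 : ∀ u v : Hex, y u = 0 → y v = 0 → t u v = 0 := by
    intro u v h1 h2; simp only [t, h1, h2]; ring
  have z1 : ∀ j ∈ Finset.range (2 * N + 30), t (z.1 - (n + 15) + j, z.2 - (n + 15))
      (z.1 - (n + 15) + j + 1, z.2 - (n + 15)) = 0 := by
    intro j _
    apply t0 <;> rw [(hdec _ (by simp only; omega)).2, if_neg] <;> rw [hsec1]
    · have := hN (z.1 - (n + 15) + j, z.2 - (n + 15)); simp only at this; omega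
    · have := hN (z.1 - (n + 15) + j + 1, z.2 - (n + 15)); simp only at this; omega
  have z2 : ∀ j ∈ Finset.range (2 * N + 20), t (z.1 - (n + 15) + (2 * N + 30 : ℕ),
      z.2 - (n + 15) + j) (z.1 - (n + 15) + (2 * N + 30 : ℕ), z.2 - (n + 15) + j + 1) = 0 := by
    intro j _
    apply t0 <;> rw [(hdec _ (by simp only; push_cast; omega)).2, if_neg] <;> rw [hsec1]
    · have := hN (z.1 - (n + 15) + (2 * N + 30 : ℕ), z.2 - (n + 15) + j)
      simp only at this; push_cast at this ⊢; omega
    · have := hN (z.1 - (n + 15) + (2 * N + 30 : ℕ), z.2 - (n + 15) + j + 1)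
      simp only at this; push_cast at this ⊢; omega
  have z3 : ∀ j ∈ Finset.range (2 * N + 20), t (z.1 - (n + 15), z.2 - (n + 15) + j)
      (z.1 - (n + 15), z.2 - (n + 15) + j + 1) = 0 := by
    intro j hj
    rw [Finset.mem_range] at hj
    apply t0 <;> rw [(hdec _ (by simp only; omega)).2, if_neg] <;> rw [hsec1]
    · have := hN (z.1 - (n + 15), z.2 - (n + 15) + j)
      simp only at this; omega
    · have := hN (z.1 - (n + 15), z.2 - (n + 15) + j + 1)
      simp only at this; omega
  -- along the top side, the transitions telescope
  have z4 : ∀ j ∈ Finset.range (2 * N + 30), t (z.1 - (n + 15) + j,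
      z.2 - (n + 15) + (2 * N + 20 : ℕ)) (z.1 - (n + 15) + j + 1,
      z.2 - (n + 15) + (2 * N + 20 : ℕ)) =
      s (z.1 - (n + 15) + (j + 1 : ℕ), z.2 - (n + 15) + (2 * N + 20 : ℕ)) -
        s (z.1 - (n + 15) + j, z.2 - (n + 15) + (2 * N + 20 : ℕ)) := by
    intro j _
    rw [show z.1 - (n + 15) + ((j + 1 : ℕ) : ℤ) = z.1 - (n + 15) + j + 1 by push_cast; ring]
    set u : Hex := (z.1 - (n + 15) + j, z.2 - (n + 15) + (2 * N + 20 : ℕ)) with hu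
    set v : Hex := (z.1 - (n + 15) + j + 1, z.2 - (n + 15) + (2 * N + 20 : ℕ)) with hv
    have hu2 : u.2 - z.2 = n + 5 := by simp only [hu]; push_cast; omega
    have hv2 : v.2 - z.2 = n + 5 := by simp only [hv]; push_cast; omega
    have huv : v.1 = u.1 + 1 := rfl
    obtain ⟨su, yu⟩ := hdec u (by omega)
    obtain ⟨sv, yv⟩ := hdec v (by omega)
    have bu := hN u
    have bv := hN v
    simp only [t, su, sv, yu, yv, hsec0, hsec1]
    clear_value u v
    clear su sv yu yv main z1 z2 z3 t0 hdec hI' hmem hout hnI hR hT hnear hstep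
    split_ifs <;> omega
  rw [Finset.sum_congr rfl z1, Finset.sum_congr rfl z2, Finset.sum_congr rfl z3,
    Finset.sum_congr rfl z4, Finset.sum_range_sub (fun j : ℕ => s (z.1 - (n + 15) + j,
      z.2 - (n + 15) + (2 * N + 20 : ℕ)))] at main
  rw [(hdec _ (by simp only; push_cast; omega)).1, (hdec _ (by simp only; push_cast; omega)).1,
    if_pos, if_neg] at main
  · simp at main
  · rw [hsec0]
    have := hN (z.1 - (n + 15) + (0 : ℕ), z.2 - (n + 15) + (2 * N + 20 : ℕ))
    simp only at this; push_cast at this ⊢; omega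
  · rw [hsec0]
    have := hN (z.1 - (n + 15) + (2 * N + 30 : ℕ), z.2 - (n + 15) + (2 * N + 20 : ℕ))
    simp only at this; push_cast at this ⊢; omega

end FlowerModel

namespace FlowerModel

variable {M : FlowerModel} {c c' : Bool} {ω : Config} {z : Hex} {n : ℤ}

/-! ### Clusters which have to meet -/

theorem sector_unique {h : Hex} {k k' : Fin 6} (h1 : h ∈ M.sector z n k)
    (h2 : h ∈ M.sector z n k') : k = k' := inSector_unique h1 h2

theorem coord_base (u : Hex) : -1 ≤ (M.base u).1 - u.1 ∧ (M.base u).1 - u.1 ≤ 1 ∧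
    -1 ≤ (M.base u).2 - u.2 ∧ (M.base u).2 - u.2 ≤ 1 ∧
    -1 ≤ (M.base u).1 - u.1 + ((M.base u).2 - u.2) ∧
    (M.base u).1 - u.1 + ((M.base u).2 - u.2) ≤ 1 := by
  have := near_base (M := M) u; unfold Near at this; omega

/-- A walk that leaves `x` through `g` and `b` and then along the points of `p`. -/
theorem ext_path {X E : Set Hex} {x g b : Hex} (p : ℕ → Hex) (hx : x ∈ X) (hg : g ∈ E) (hb : b ∈ E)
    (hxg : Near x g) (hgb : Near g b) (hp0 : Near b (p 0)) (hp : ∀ t, Near (p t) (p (t + 1)))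
    (hpE : ∀ t, p t ∈ E) (T : ℕ) :
    Relation.ReflTransGen (Joined (M.ExtMove c ω X E)) x (p T) := by
  have h1 : Relation.ReflTransGen (Joined (M.ExtMove c ω X E)) x b :=
    (Relation.ReflTransGen.single (ExtMove.near (Or.inl hx) (Or.inr hg) hxg)).tail
      (ExtMove.near (Or.inr hg) (Or.inr hb) hgb)
  induction T with
  | zero => exact h1.tail (ExtMove.near (Or.inr hb) (Or.inr (hpE 0)) hp0)
  | succ T ih => exact ih.tail (ExtMove.near (Or.inr (hpE _)) (Or.inr (hpE _)) (hp T))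

theorem ext_symm {X E : Set Hex} {a b : Hex}
    (h : Relation.ReflTransGen (Joined (M.ExtMove c ω X E)) a b) :
    Relation.ReflTransGen (Joined (M.ExtMove c ω X E)) b a :=
  reflTransGen_symm (fun _ _ => ExtMove.symm) h

/-- The position of a hexagon in which a hexagon of the domain touches a sector. -/
theorem touch_coord {x g : Hex} (hx : x ∈ M.hexDom z n) (hg : Near x g) :
    (-(n + 4) ≤ (M.base g).1 - z.1 ∧ (M.base g).1 - z.1 ≤ n + 4) ∧
    (-(n + 4) ≤ (M.base g).2 - z.2 ∧ (M.base g).2 - z.2 ≤ n + 4) := by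
  have h1 := base_near (M := M) hg
  simp only [hexDom, Set.mem_ofPred_eq, InHexagon, Prod.fst_sub, Prod.snd_sub] at hx
  omega

/-- A connection that touches the sector `0` can be prolonged far to the right by a straight walk in
this sector. The walk avoids the lowest row of the sector, where a flower
may belong to the next sector. -/
theorem ext_right {X E : Set Hex} {x : Hex} (hn : 10 ≤ n) (hx : x ∈ X) (hD : x ∈ M.hexDom z n)
    (hT : M.Touch z n 0 x)
    (hE : ∀ h ∈ M.sector z n 0, -(n + 10) ≤ h.2 - z.2 → h.2 - z.2 ≤ n + 10 → h ∈ E) (R : ℤ) :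
    ∃ P : Hex, R ≤ P.1 ∧ Relation.ReflTransGen (Joined (M.ExtMove c ω X E)) x P := by
  obtain ⟨g, hg, hxg⟩ := hT
  have b1 := touch_coord hD hxg
  have b2 := coord_base (M := M) g
  have hbs : M.base g ∈ M.sector z n 0 := by rw [sector, Set.mem_ofPred_eq, base_base]; exact hg
  have hg' : 1 ≤ (M.base g).1 - z.1 ∧ 0 ≤ (M.base g).2 - z.2 ∧
    n < (M.base g).1 - z.1 + ((M.base g).2 - z.2) := hg
  set b := M.base g with hb
  obtain ⟨e, he⟩ : ∃ e : ℤ, (e = 0 ∧ 1 ≤ b.2 - z.2) ∨ (e = 1 ∧ b.2 = z.2) := by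
    by_cases h : b.2 = z.2
    · exact ⟨1, Or.inr ⟨rfl, h⟩⟩
    · exact ⟨0, Or.inl ⟨rfl, by omega⟩⟩
  refine ⟨_, ?_, ext_path (g := g) (b := b) (fun t : ℕ => ((b.1 + t, b.2 + e) : Hex)) hx
    (hE g hg (by omega) (by omega)) (hE b hbs (by omega) (by omega)) hxg
    (near_base g).symm ?_ ?_ ?_ (R - b.1).toNat⟩
  · simp only; omega
  · simp only [Near]; push_cast; omega
  · intro t; simp only [Near]; push_cast; omega
  · intro t
    have b3 := coord_base (M := M) (b.1 + t, b.2 + e)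
    refine hE _ ?_ (by simp only; omega) (by simp only; omega)
    by_cases ht : t = 0 ∧ e = 0
    · obtain ⟨rfl, rfl⟩ := ht
      simpa using hbs
    · simp only at b3
      simp only [sector, InSector, Set.mem_ofPred_eq, Prod.fst_sub, Prod.snd_sub, Matrix.cons_val]
      omega

/-- The analogue of `ext_right` for the sector `2` and a walk to the left. -/
theorem ext_left {X E : Set Hex} {x : Hex} (hn : 10 ≤ n) (hx : x ∈ X) (hD : x ∈ M.hexDom z n)
    (hT : M.Touch z n 2 x)
    (hE : ∀ h ∈ M.sector z n 2, -(n + 10) ≤ h.2 - z.2 → h.2 - z.2 ≤ n + 10 → h ∈ E) (R : ℤ) :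
    ∃ P : Hex, P.1 ≤ R ∧ Relation.ReflTransGen (Joined (M.ExtMove c ω X E)) x P := by
  obtain ⟨g, hg, hxg⟩ := hT
  have b1 := touch_coord hD hxg
  have b2 := coord_base (M := M) g
  have hbs : M.base g ∈ M.sector z n 2 := by rw [sector, Set.mem_ofPred_eq, base_base]; exact hg
  have hg' : 1 ≤ (M.base g).2 - z.2 ∧ (M.base g).1 - z.1 + ((M.base g).2 - z.2) ≤ 0 ∧
    (M.base g).1 - z.1 < -n := hg
  set b := M.base g with hb
  obtain ⟨e, he⟩ : ∃ e : ℤ, (e = 0 ∧ 2 ≤ b.2 - z.2) ∨ (e = 1 ∧ b.2 = z.2 + 1) := by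
    by_cases h : b.2 = z.2 + 1
    · exact ⟨1, Or.inr ⟨rfl, h⟩⟩
    · exact ⟨0, Or.inl ⟨rfl, by omega⟩⟩
  refine ⟨_, ?_, ext_path (g := g) (b := b) (fun t : ℕ => ((b.1 - t - e, b.2 + e) : Hex)) hx
    (hE g hg (by omega) (by omega)) (hE b hbs (by omega) (by omega)) hxg
    (near_base g).symm ?_ ?_ ?_ (b.1 - R).toNat⟩
  · simp only; omega
  · simp only [Near]; push_cast; omega
  · intro t; simp only [Near]; push_cast; omega
  · intro t
    have b3 := coord_base (M := M) (b.1 - t - e, b.2 + e)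
    refine hE _ ?_ (by simp only; omega) (by simp only; omega)
    by_cases ht : t = 0 ∧ e = 0
    · obtain ⟨rfl, rfl⟩ := ht
      simpa using hbs
    · simp only at b3
      simp only [sector, InSector, Set.mem_ofPred_eq, Prod.fst_sub, Prod.snd_sub, Matrix.cons_val]
      omega

/-- The analogue of `ext_right` for the sector `1` and a walk upwards. -/
theorem ext_up {X E : Set Hex} {x : Hex} (hn : 10 ≤ n) (hx : x ∈ X) (hD : x ∈ M.hexDom z n)
    (hT : M.Touch z n 1 x)
    (hE : ∀ h ∈ M.sector z n 1, -(n + 10) ≤ h.1 - z.1 → h.1 - z.1 ≤ n + 10 → h ∈ E) (R : ℤ) :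
    ∃ P : Hex, R ≤ P.2 ∧ Relation.ReflTransGen (Joined (M.ExtMove c ω X E)) x P := by
  obtain ⟨g, hg, hxg⟩ := hT
  have b1 := touch_coord hD hxg
  have b2 := coord_base (M := M) g
  have hbs : M.base g ∈ M.sector z n 1 := by rw [sector, Set.mem_ofPred_eq, base_base]; exact hg
  have hg' : (M.base g).1 - z.1 ≤ 0 ∧ 1 ≤ (M.base g).1 - z.1 + ((M.base g).2 - z.2) ∧
    n < (M.base g).2 - z.2 := hg
  set b := M.base g with hb
  obtain ⟨e, he⟩ : ∃ e : ℤ, (e = 0 ∧ b.1 - z.1 ≤ -1) ∨ (e = 1 ∧ b.1 = z.1) := by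
    by_cases h : b.1 = z.1
    · exact ⟨1, Or.inr ⟨rfl, h⟩⟩
    · exact ⟨0, Or.inl ⟨rfl, by omega⟩⟩
  refine ⟨_, ?_, ext_path (g := g) (b := b) (fun t : ℕ => ((b.1 - e, b.2 + t + e) : Hex)) hx
    (hE g hg (by omega) (by omega)) (hE b hbs (by omega) (by omega)) hxg
    (near_base g).symm ?_ ?_ ?_ (R - b.2).toNat⟩
  · simp only; omega
  · simp only [Near]; push_cast; omega
  · intro t; simp only [Near]; push_cast; omega
  · intro t
    have b3 := coord_base (M := M) (b.1 - e, b.2 + t + e)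
    refine hE _ ?_ (by simp only; omega) (by simp only; omega)
    by_cases ht : t = 0 ∧ e = 0
    · obtain ⟨rfl, rfl⟩ := ht
      simpa using hbs
    · simp only at b3
      simp only [sector, InSector, Set.mem_ofPred_eq, Prod.fst_sub, Prod.snd_sub, Matrix.cons_val]
      omega

/-- The analogue of `ext_right` for the sector `3` and a walk downwards. -/
theorem ext_down {X E : Set Hex} {x : Hex} (hn : 10 ≤ n) (hx : x ∈ X) (hD : x ∈ M.hexDom z n)
    (hT : M.Touch z n 3 x)
    (hE : ∀ h ∈ M.sector z n 3, -(n + 10) ≤ h.1 - z.1 → h.1 - z.1 ≤ n + 10 → h ∈ E) (R : ℤ) :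
    ∃ P : Hex, P.2 ≤ R ∧ Relation.ReflTransGen (Joined (M.ExtMove c ω X E)) x P := by
  obtain ⟨g, hg, hxg⟩ := hT
  have b1 := touch_coord hD hxg
  have b2 := coord_base (M := M) g
  have hbs : M.base g ∈ M.sector z n 3 := by rw [sector, Set.mem_ofPred_eq, base_base]; exact hg
  have hg' : (M.base g).1 - z.1 ≤ -1 ∧ (M.base g).2 - z.2 ≤ 0 ∧
    (M.base g).1 - z.1 + ((M.base g).2 - z.2) < -n := hg
  set b := M.base g with hb
  obtain ⟨e, he⟩ : ∃ e : ℤ, (e = 0 ∧ b.1 - z.1 ≤ -2) ∨ (e = 1 ∧ b.1 = z.1 - 1) := by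
    by_cases h : b.1 = z.1 - 1
    · exact ⟨1, Or.inr ⟨rfl, h⟩⟩
    · exact ⟨0, Or.inl ⟨rfl, by omega⟩⟩
  refine ⟨_, ?_, ext_path (g := g) (b := b) (fun t : ℕ => ((b.1 - e, b.2 - t) : Hex)) hx
    (hE g hg (by omega) (by omega)) (hE b hbs (by omega) (by omega)) hxg
    (near_base g).symm ?_ ?_ ?_ (b.2 - R).toNat⟩
  · simp only; omega
  · simp only [Near]; push_cast; omega
  · intro t; simp only [Near]; push_cast; omega
  · intro t
    have b3 := coord_base (M := M) (b.1 - e, b.2 - t)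
    refine hE _ ?_ (by simp only; omega) (by simp only; omega)
    by_cases ht : t = 0 ∧ e = 0
    · obtain ⟨rfl, rfl⟩ := ht
      simpa using hbs
    · simp only at b3
      simp only [sector, InSector, Set.mem_ofPred_eq, Prod.fst_sub, Prod.snd_sub, Matrix.cons_val]
      omega

/-- Two clusters of the same colour with a link between them coincide. -/
theorem conn_of_link {D : Set Hex} {x y a b : Hex} (ha : M.Conn c ω D x a)
    (hb : M.Conn c ω D y b) (h : a = b ∨ ∃ m, M.IrisLink c ω a m b) : M.Conn c ω D x y := by
  rcases h with rfl | ⟨m, h⟩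
  · exact ha.trans hb.symm
  · exact (ha.trans (Conn.iris ha.right.1 hb.right.1 ha.right.2 hb.right.2 h)).trans hb.symm

/-- A connection between the sectors `0` and `2` meets any connection of the same colour between the
sectors `1` and `3`. -/
theorem chords_meet (hn : 10 ≤ n) {x x' y y' : Hex} (hx : M.Conn c ω (M.hexDom z n) x x')
    (hy : M.Conn c ω (M.hexDom z n) y y') (h0 : M.Touch z n 0 x) (h2 : M.Touch z n 2 x')
    (h1 : M.Touch z n 1 y) (h3 : M.Touch z n 3 y') : M.Conn c ω (M.hexDom z n) x y := by
  set D := M.hexDom z n with hDdef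
  set X := {h | M.Conn c ω D x h} with hX
  set Y := {h | M.Conn c ω D y h} with hY
  -- the first cluster is prolonged to the right and to the left in `E`, the second one upwards and
  -- downwards in `E'`; the prolonged walks have to cross, and they can only do so in the domain
  set E := {h | (h ∈ M.sector z n 0 ∨ h ∈ M.sector z n 2) ∧ -(n + 10) ≤ h.2 - z.2 ∧
    h.2 - z.2 ≤ n + 10} with hE
  set E' := {h | (h ∈ M.sector z n 1 ∨ h ∈ M.sector z n 3) ∧ -(n + 10) ≤ h.1 - z.1 ∧
    h.1 - z.1 ≤ n + 10} with hE'
  have hED : ∀ h ∈ E, h ∉ D := by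
    rintro h ⟨h' | h', _⟩ <;> exact sector_notMem h'
  have hED' : ∀ h ∈ E', h ∉ D := by
    rintro h ⟨h' | h', _⟩ <;> exact sector_notMem h'
  have hsat := saturated_hexDom (M := M) z n
  obtain ⟨P, hP, fP⟩ := ext_right (c := c) (ω := ω) (X := X) (E := E) hn
    (Conn.refl hx.1 hx.2.1) hx.1 h0 (fun h h1 h2 h3 => ⟨Or.inl h1, h2, h3⟩) (z.1 + n + 20)
  obtain ⟨P', hP', fP'⟩ := ext_left (c := c) (ω := ω) (X := X) (E := E) hn hx hx.right.1 h2
    (fun h h1 h2 h3 => ⟨Or.inr h1, h2, h3⟩) (z.1 - n - 20)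
  obtain ⟨Q, hQ, fQ⟩ := ext_up (c := c) (ω := ω) (X := Y) (E := E') hn
    (Conn.refl hy.1 hy.2.1) hy.1 h1 (fun h h1 h2 h3 => ⟨Or.inl h1, h2, h3⟩) (z.2 + n + 20)
  obtain ⟨Q', hQ', fQ'⟩ := ext_down (c := c) (ω := ω) (X := Y) (E := E') hn hy hy.right.1 h3
    (fun h h1 h2 h3 => ⟨Or.inr h1, h2, h3⟩) (z.2 - n - 20)
  have hDc : ∀ h ∈ D, (-(n + 1) ≤ h.1 - z.1 ∧ h.1 - z.1 ≤ n + 1) ∧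
      (-(n + 1) ≤ h.2 - z.2 ∧ h.2 - z.2 ≤ n + 1) := by
    intro h hh
    have hb := coord_base (M := M) h
    simp only [hDdef, hexDom, Set.mem_ofPred_eq, InHexagon, Prod.fst_sub, Prod.snd_sub] at hh
    omega
  have hEr : ∀ h ∈ E, -(n + 10) ≤ h.2 - z.2 ∧ h.2 - z.2 ≤ n + 10 := fun h hh => hh.2
  have hEr' : ∀ h ∈ E', -(n + 10) ≤ h.1 - z.1 ∧ h.1 - z.1 ≤ n + 10 := fun h hh => hh.2
  have hPE : ∀ {x P : Hex} {X E : Set Hex}, x ∈ X → Relation.ReflTransGen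
      (Joined (M.ExtMove c ω X E)) x P → P ∈ X ∪ E := by
    intro x P X E hx h
    rcases h.cases_tail with rfl | ⟨_, _, m, h⟩
    · exact Or.inl hx
    · exact h.2.1
  have hPr : -(n + 10) ≤ P.2 - z.2 ∧ P.2 - z.2 ≤ n + 10 := by
    rcases hPE (Conn.refl hx.1 hx.2.1) fP with h | h
    · have := hDc P h.right.1; omega
    · exact hEr P h
  obtain ⟨-, a, ha, b, hb, hab⟩ := clusters_cross (M := M) (c := c) (c' := c) (ω := ω) (X := X)
    (E := E) (X' := Y) (E' := E') (P := P) (P' := P') (Q := Q) (Q' := Q')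
    (fun h hh => hh.right.2) (fun h hh => hh.right.2)
    (fun h hh => ⟨fun h' => hED' h h' hh.right.1, fun h' => hED _ h' ((hsat h).2 hh.right.1),
      fun h' => hED' _ h' ((hsat h).2 hh.right.1)⟩)
    (fun h hh => ⟨fun h' => hED h h' hh.right.1, fun h' => hED _ h' ((hsat h).2 hh.right.1),
      fun h' => hED' _ h' ((hsat h).2 hh.right.1)⟩)
    (by
      rintro h ⟨h1 | h1, _⟩ ⟨h2 | h2, _⟩ <;> 
        exact absurd (sector_unique h1 h2) (by decide))
    (by
      rintro h (hh | hh | ⟨g, hg, rfl⟩)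
      · have := hDc h hh.right.1; omega
      · have := hEr h hh; omega
      · have := hDc _ ((hsat g).2 hg.right.1); omega)
    (by
      rintro h (hh | hh | ⟨g, hg, rfl⟩)
      · have := hDc h hh.right.1; omega
      · have := hEr' h hh; omega
      · have := hDc _ ((hsat g).2 hg.right.1); omega)
    (by omega) (by omega)
    ((ext_symm fP).trans ((Conn.ext (fun _ h => h) hx).trans fP'))
    ((ext_symm fQ).trans ((Conn.ext (fun _ h => h) hy).trans fQ'))
  exact conn_of_link ha hb hab

/-- A cluster below the row `top` that reaches this row to the left and to the right of a point at
which another cluster reaches it, where the other cluster goes further down. -/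
theorem arch_meet {D D' D'' : Set Hex} {x x' y y' g g' k : Hex} {top bot : ℤ}
    (hDD : D ⊆ D'') (hDD' : D' ⊆ D'') (hx : M.Conn c ω D x x') (hy : M.Conn c ω D' y y')
    (hD : ∀ h ∈ D, bot ≤ (M.base h).2 ∧ (M.base h).2 ≤ top)
    (hD' : ∀ h ∈ D', (M.base h).2 ≤ top) (hxg : Near x g) (hxg' : Near x' g') (hyk : Near y k)
    (hg : top < (M.base g).2) (hg' : top < (M.base g').2) (hk : top < (M.base k).2)
    (h1 : (M.base g).1 + 3 ≤ (M.base k).1) (h2 : (M.base k).1 + 3 ≤ (M.base g').1)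
    (hy' : y'.2 < bot) : M.Conn c ω D'' x y := by
  set X := {h | M.Conn c ω D x h} with hX
  set Y := {h | M.Conn c ω D' y h} with hY
  -- vertical walks above the row `top` prolong the first cluster up to the row `H` and the second
  -- one, between them, up to the row `H + 2`
  obtain ⟨H, h3, h4, h5, h6⟩ : ∃ H : ℤ, top + 2 ≤ H ∧ (M.base g).2 ≤ H ∧ (M.base g').2 ≤ H ∧
      (M.base k).2 ≤ H := ⟨max (max (top + 2) (M.base g).2) (max (M.base g').2 (M.base k).2),
        by omega, by omega, by omega, by omega⟩
  set E := {h : Hex | top < (M.base h).2 ∧ ((-1 ≤ h.1 - (M.base g).1 ∧ h.1 - (M.base g).1 ≤ 1) ∨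
    (-1 ≤ h.1 - (M.base g').1 ∧ h.1 - (M.base g').1 ≤ 1)) ∧ h.2 ≤ H + 1} with hE
  set E' := {h : Hex | top < (M.base h).2 ∧ (-1 ≤ h.1 - (M.base k).1 ∧ h.1 - (M.base k).1 ≤ 1)}
    with hE'
  have up : ∀ {x g : Hex} {X E : Set Hex} (T : ℕ), top < (M.base g).2 → Near x g → x ∈ X → g ∈ E →
      (∀ t : ℕ, t ≤ T → ((M.base g).1, (M.base g).2 + t) ∈ E) →
      Relation.ReflTransGen (Joined (M.ExtMove c ω X E)) x ((M.base g).1, (M.base g).2 + T) := by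
    intro x g X E T _ hxg hx hgE hE
    have h1 : Relation.ReflTransGen (Joined (M.ExtMove c ω X E)) x (M.base g) :=
      (Relation.ReflTransGen.single (ExtMove.near (Or.inl hx) (Or.inr hgE) hxg)).tail
        (ExtMove.near (Or.inr hgE) (Or.inr (by simpa using hE 0 (Nat.zero_le _)))
          (near_base g).symm)
    induction T with
    | zero => simpa using h1
    | succ T ih =>
      refine (ih fun t ht => hE t (by omega)).tail (ExtMove.near (Or.inr (hE T (by omega)))
        (Or.inr (hE (T + 1) le_rfl)) ?_)
      simp only [Near]; push_cast; omega
  have hcol : ∀ {g : Hex}, top < (M.base g).2 → ∀ t : ℕ,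
      top < (M.base ((M.base g).1, (M.base g).2 + t)).2 := by
    intro g hg t
    by_cases ht : t = 0
    · subst ht; simp [base_base, hg]
    · have := coord_base (M := M) ((M.base g).1, (M.base g).2 + t)
      simp only at this; omega
  have bg := coord_base (M := M) g
  have bg' := coord_base (M := M) g'
  have bk := coord_base (M := M) k
  have ux := coord_base (M := M) x
  have ux' := coord_base (M := M) x'
  have uy := coord_base (M := M) y
  have dx := hD x hx.1
  have dx' := hD x' hx.right.1
  have dy := hD' y hy.1
  have nx := hxg
  have nx' := hxg'
  have ny := hyk
  unfold Near at nx nx' ny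
  have hgE : g ∈ E := ⟨hg, Or.inl (by omega), by omega⟩
  have hgE' : g' ∈ E := ⟨hg', Or.inr (by omega), by omega⟩
  have hkE : k ∈ E' := ⟨hk, by omega⟩
  have f1 := up (X := X) (E := E) (H - (M.base g).2).toNat hg hxg (Conn.refl hx.1 hx.2.1) hgE
    fun t ht => ⟨hcol hg t, Or.inl (by simp only; omega), by simp only; omega⟩
  have f2 := up (X := X) (E := E) (H - (M.base g').2).toNat hg' hxg' hx hgE'
    fun t ht => ⟨hcol hg' t, Or.inr (by simp only; omega), by simp only; omega⟩
  have f3 := up (X := Y) (E := E') (H + 2 - (M.base k).2).toNat hk hyk (Conn.refl hy.1 hy.2.1) hkE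
    fun t ht => ⟨hcol hk t, by simp only; omega⟩
  rw [show ((M.base g).1, (M.base g).2 + ((H - (M.base g).2).toNat : ℤ)) = ((M.base g).1, H) by
    rw [Prod.mk.injEq]; omega] at f1
  rw [show ((M.base g').1, (M.base g').2 + ((H - (M.base g').2).toNat : ℤ)) = ((M.base g').1, H) by
    rw [Prod.mk.injEq]; omega] at f2
  rw [show ((M.base k).1, (M.base k).2 + ((H + 2 - (M.base k).2).toNat : ℤ)) =
    ((M.base k).1, H + 2) by rw [Prod.mk.injEq]; omega] at f3
  have hbX : ∀ h ∈ X, ∀ A : Set Hex, (∀ u ∈ A, top < (M.base u).2) → h ∉ A ∧ M.base h ∉ A := by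
    intro h hh A hA
    have := hD h hh.right.1
    exact ⟨fun h' => by have := hA _ h'; omega, fun h' => by
      have := hA _ h'; rw [base_base] at this; omega⟩
  have hbY : ∀ h ∈ Y, ∀ A : Set Hex, (∀ u ∈ A, top < (M.base u).2) → h ∉ A ∧ M.base h ∉ A := by
    intro h hh A hA
    have := hD' h hh.right.1
    exact ⟨fun h' => by have := hA _ h'; omega, fun h' => by
      have := hA _ h'; rw [base_base] at this; omega⟩
  obtain ⟨-, a, ha, b, hb, hab⟩ := clusters_cross (M := M) (c := c) (c' := c) (ω := ω) (X := X)
    (E := E) (X' := Y) (E' := E') (P := ((M.base g').1, H)) (P' := ((M.base g).1, H))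
    (Q := ((M.base k).1, H + 2)) (Q' := y')
    (fun h hh => hh.right.2) (fun h hh => hh.right.2)
    (fun h hh => ⟨(hbX h hh E' fun u hu => hu.1).1, (hbX h hh E fun u hu => hu.1).2,
      (hbX h hh E' fun u hu => hu.1).2⟩)
    (fun h hh => ⟨(hbY h hh E fun u hu => hu.1).1, (hbY h hh E fun u hu => hu.1).2,
      (hbY h hh E' fun u hu => hu.1).2⟩)
    (by
      rintro h ⟨_, hh, _⟩ ⟨_, hh'⟩; omega)
    (by
      rintro h (hh | hh | ⟨u, hh, rfl⟩)
      · have := hD h hh.right.1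
        have := coord_base (M := M) h
        simp only; omega
      · have := hh.1
        have := hh.2.2
        have := coord_base (M := M) h
        simp only; omega
      · have := hD u hh.right.1
        simp only; omega)
    (by
      rintro h (hh | hh | ⟨u, hh, rfl⟩)
      · have := hD' h hh.right.1
        have := coord_base (M := M) h
        simp only; omega
      · have := hh.2
        simp only; omega
      · have := hD' u hh.right.1
        simp only; omega)
    (by simp only; omega) (by simp only; omega)
    ((ext_symm f2).trans ((ext_symm (Conn.ext (fun _ h => h) hx)).trans f1))
    ((ext_symm f3).trans (Conn.ext (fun _ h => h) hy))
  exact conn_of_link (ha.mono hDD) (hb.mono hDD') hab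

/-- Two clusters which cross each other: the first one stays between the rows of the ends of the
second one, which passes between the ends of the first one. -/
theorem conn_cross {D D' D'' : Set Hex} {P P' Q Q' : Hex} (hsD : M.Saturated D)
    (hsD' : M.Saturated D') (hDD : D ⊆ D'') (hDD' : D' ⊆ D'')
    (hP : M.Conn c ω D P P') (hQ : M.Conn c' ω D' Q Q')
    (hD : ∀ h ∈ D, h.2 < Q.2 ∧ Q'.2 ≤ h.2)
    (hD' : ∀ h ∈ D', (h.2 = P.2 → h.1 < P.1) ∧ (h.2 = P'.2 → P'.1 < h.1)) :
    c = c' ∧ M.Conn c ω D'' P Q := by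
  obtain ⟨rfl, a, ha, b, hb, hab⟩ := clusters_cross (M := M) (c := c) (c' := c') (ω := ω)
    (X := {h | M.Conn c ω D P h}) (E := ∅) (X' := {h | M.Conn c' ω D' Q h}) (E' := ∅) (P := P)
    (P' := P') (Q := Q) (Q' := Q') (fun h hh => hh.right.2) (fun h hh => hh.right.2)
    (by simp) (by simp) (by simp)
    (by
      rintro h (hh | hh | ⟨g, hg, rfl⟩)
      · exact hD h hh.right.1
      · exact hh.elim
      · exact hD _ ((hsD g).2 hg.right.1))
    (by
      rintro h (hh | hh | ⟨g, hg, rfl⟩)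
      · exact hD' h hh.right.1
      · exact hh.elim
      · exact hD' _ ((hsD' g).2 hg.right.1))
    (hD P hP.1).1 (hD P hP.1).2 (Conn.ext (fun _ h => h) hP) (Conn.ext (fun _ h => h) hQ)
  exact ⟨rfl, conn_of_link (ha.mono hDD) (hb.mono hDD') hab⟩

/-- A connection which leaves a saturated set `D` contains a connection in `D` to a neighbour of the
complement. -/
theorem Conn.exit {D D' : Set Hex} {a b : Hex} (hD : M.Saturated D) (h : M.Conn c ω D' a b)
    (ha : a ∈ D) (hb : b ∉ D) : ∃ y g, M.Conn c ω D a y ∧ Near y g ∧ g ∉ D := by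
  by_contra hcon
  push Not at hcon
  have key : M.Conn c ω D a b := by
    obtain ⟨h1, h2, h3⟩ := h
    clear hb
    induction h3 with
    | refl => exact Conn.refl ha h2
    | tail _ hs ih =>
      obtain ⟨m, _, _, c1, c2, h5⟩ := hs
      rcases h5 with ⟨rfl, h5⟩ | h5
      · exact ih.trans (Conn.near ih.right.1 (hcon _ _ ih h5) c1 c2 h5)
      · refine ih.trans (Conn.iris ih.right.1 ?_ c1 c2 h5)
        rw [← hD, h5.base_right, ← h5.base_left, hD]
        exact ih.right.1
  exact hb key.right.1

end FlowerModel

/-! ### Symmetries of the configurations -/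

theorem HexState.ext_isBlue : ∀ σ σ' : HexState, (∀ j, σ.isBlue j = σ'.isBlue j) → σ = σ' := by
  decide

theorem mono_isBlue : ∀ c j, (mono c).isBlue j = c := by decide

theorem fin_six_add_five : ∀ k r : Fin 6, k + r + 5 = k + 5 + r := by decide

/-- A symmetry of the model: a symmetry `φ` of the lattice that turns directions by `r` sixths of a
turn and preserves the irises, with a map of the states that turns the kites accordingly,
exchanges the colours if `f = true`, and preserves the weights. -/
structure Sym (M : FlowerModel) where
  φ : Hex ≃ Hex
  r : Fin 6
  f : Bool
  st : HexState ≃ HexState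
  map_dir : ∀ h k, φ (h + dir k) = φ h + dir (k + r)
  mem_irises : ∀ h, φ h ∈ M.irises ↔ h ∈ M.irises
  isBlue_st : ∀ σ j, (st σ).isBlue (j + r) = (σ.isBlue j ^^ f)
  law : ∀ σ, M.irisLaw {st σ} = M.irisLaw {σ}

namespace Sym

variable {M : FlowerModel} (g : Sym M)

/-- The action on configurations. -/
def act (ω : Config) : Config := fun h => g.st (ω (g.φ.symm h))

theorem act_apply (ω : Config) (h : Hex) : g.act ω (g.φ h) = g.st (ω h) := by simp [act]

theorem st_mono (c : Bool) : g.st (mono c) = mono (c ^^ g.f) := by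
  refine HexState.ext_isBlue _ _ fun j => ?_
  have := g.isBlue_st (mono c) (j - g.r)
  rw [sub_add_cancel] at this
  rw [this, mono_isBlue, mono_isBlue]

theorem lk_st (c : Bool) (σ : HexState) (k : Fin 6) :
    lk (c ^^ g.f) (g.st σ) (k + g.r) = lk c σ k := by
  unfold lk
  rw [g.isBlue_st, fin_six_add_five, g.isBlue_st]
  cases c <;> cases g.f <;> simp

theorem near_iff (a b : Hex) : Near (g.φ a) (g.φ b) ↔ Near a b := by
  rw [BondTriangular.near_iff, BondTriangular.near_iff]
  constructor
  · rintro (h | ⟨k, h⟩)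
    · exact Or.inl (g.φ.injective h)
    · refine Or.inr ⟨k - g.r, g.φ.injective ?_⟩
      rw [h, g.map_dir, sub_add_cancel]
  · rintro (rfl | ⟨k, rfl⟩)
    · exact Or.inl rfl
    · exact Or.inr ⟨_, g.map_dir _ _⟩

theorem base (h : Hex) : M.base (g.φ h) = g.φ (M.base h) := by
  rcases FlowerModel.base_cases (M := M) h with ⟨h1, h2⟩ | ⟨h1, h2⟩
  · exact FlowerModel.base_eq ((g.mem_irises _).2 h1) ((g.near_iff _ _).2 h2)
  · rcases FlowerModel.base_cases (M := M) (g.φ h) with ⟨h3, h4⟩ | ⟨h3, _⟩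
    · obtain ⟨i, hi⟩ := g.φ.surjective (M.base (g.φ h))
      rw [← hi] at h3 h4
      exact (h2 i ((g.mem_irises _).1 h3) ((g.near_iff _ _).1 h4)).elim
    · rw [h3, h1]

theorem isCol (c : Bool) (ω : Config) (h : Hex) :
    M.IsCol (c ^^ g.f) (g.act ω) (g.φ h) ↔ M.IsCol c ω h := by
  unfold FlowerModel.IsCol
  rw [g.mem_irises, act_apply, ← g.st_mono, g.st.apply_eq_iff_eq]

theorem irisLink (c : Bool) (ω : Config) (a m b : Hex) :
    M.IrisLink (c ^^ g.f) (g.act ω) (g.φ a) (g.φ m) (g.φ b) ↔ M.IrisLink c ω a m b := by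
  unfold FlowerModel.IrisLink
  rw [g.mem_irises, act_apply]
  refine and_congr_right fun _ => ⟨?_, ?_⟩
  · rintro ⟨k, k', h1, h2, h3, h4⟩
    refine ⟨k - g.r, k' - g.r, g.φ.injective ?_, g.φ.injective ?_, ?_, ?_⟩
    · rw [g.map_dir, sub_add_cancel, h1]
    · rw [g.map_dir, sub_add_cancel, h2]
    · rwa [← g.lk_st, sub_add_cancel]
    · rwa [← g.lk_st, sub_add_cancel]
  · rintro ⟨k, k', rfl, rfl, h3, h4⟩
    exact ⟨_, _, g.map_dir _ _, g.map_dir _ _, by rwa [g.lk_st], by rwa [g.lk_st]⟩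

theorem move (c : Bool) (ω : Config) (D : Set Hex) (a m b : Hex) :
    M.Move (c ^^ g.f) (g.act ω) D (g.φ a) (g.φ m) (g.φ b) ↔ M.Move c ω (g.φ ⁻¹' D) a m b := by
  unfold FlowerModel.Move
  rw [g.isCol, g.isCol, g.irisLink, g.near_iff, g.φ.apply_eq_iff_eq]
  rfl

theorem conn (c : Bool) (ω : Config) (D : Set Hex) (a b : Hex) :
    M.Conn (c ^^ g.f) (g.act ω) D (g.φ a) (g.φ b) ↔ M.Conn c ω (g.φ ⁻¹' D) a b := by
  unfold FlowerModel.Conn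
  rw [g.isCol]
  refine and_congr_right fun _ => and_congr_right fun _ => ⟨fun h => ?_, fun h => ?_⟩
  · have := Relation.ReflTransGen.lift (p := Joined (M.Move c ω (g.φ ⁻¹' D))) g.φ.symm
      (fun x y ⟨m, hm⟩ => ⟨g.φ.symm m, by
        rw [← g.move, g.φ.apply_symm_apply, g.φ.apply_symm_apply, g.φ.apply_symm_apply]
        exact hm⟩) _ _ h
    simpa [Function.onFun] using this
  · exact Relation.ReflTransGen.lift g.φ (fun x y ⟨m, hm⟩ => ⟨g.φ m, (g.move _ _ _ _ _ _).2 hm⟩) _ _ h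

theorem conn_apply {c : Bool} {ω : Config} {D D' : Set Hex} {a b : Hex}
    (h : M.Conn c ω D a b) (hD : ∀ h, g.φ h ∈ D' ↔ h ∈ D) :
    M.Conn (c ^^ g.f) (g.act ω) D' (g.φ a) (g.φ b) := by
  rw [g.conn, show g.φ ⁻¹' D' = D from Set.ext hD]
  exact h

end Sym

/-- A translation by a period. -/
def FlowerModel.IsPeriod (M : FlowerModel) (v : Hex) : Prop := ∀ h, h + v ∈ M.irises ↔ h ∈ M.irises

/-- A point around which the irises are invariant under rotations by a sixth of a turn. -/
def FlowerModel.IsPivot (M : FlowerModel) (q : Hex) : Prop :=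
  ∀ h, q + rot (h - q) ∈ M.irises ↔ h ∈ M.irises

/-- The translation by a period. -/
def Sym.translation {M : FlowerModel} {v : Hex} (hv : M.IsPeriod v) : Sym M where
  φ := Equiv.addRight v
  r := 0
  f := false
  st := Equiv.refl _
  map_dir h k := by simp; abel
  mem_irises h := hv h
  isBlue_st σ j := by simp
  law σ := rfl

/-- The inverse of `rot`. -/
def rotEquiv : Hex ≃ Hex where
  toFun := rot
  invFun h := (h.1 + h.2, -h.1)
  left_inv h := by simp [rot]
  right_inv h := by simp [rot]

theorem rot_add (a b : Hex) : rot (a + b) = rot a + rot b := by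
  simp only [rot, Prod.fst_add, Prod.snd_add, Prod.mk_add_mk, Prod.mk.injEq]
  constructor <;> ring

theorem rot_sub (a b : Hex) : rot (a - b) = rot a - rot b := by
  simp only [rot, Prod.fst_sub, Prod.snd_sub, Prod.mk_sub_mk, Prod.mk.injEq]
  constructor <;> ring

theorem rot_dir : ∀ k, rot (dir k) = dir (k + 1) := by decide

/-- The map of the states that goes with the rotation by a sixth of a turn: it exchanges the
colours, since the halves of an iris are not preserved. -/
def turnState : HexState → HexState
  | .blue => .yellow
  | .yellow => .blue
  | .split i => .split (i + 2)

theorem turnState_bijective : Function.Bijective turnState := by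
  rw [Fintype.bijective_iff_injective_and_card]
  exact ⟨by unfold Function.Injective; decide, rfl⟩

theorem FlowerModel.irisLaw_singleton (M : FlowerModel) (σ : HexState) :
    M.irisLaw {σ} = ENNReal.ofReal (match σ with | .split _ => M.s | _ => M.a) := by
  have h : ∀ τ : HexState, ({σ} : Set HexState).indicator (1 : HexState → ENNReal) τ =
      if τ = σ then 1 else 0 := by
    intro τ; simp [Set.indicator_apply]
  simp only [irisLaw, Measure.add_apply, Measure.smul_apply, Measure.dirac_apply, h, smul_eq_mul, Fin.sum_univ_three]
  rcases σ with _ | _ | i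
  · simp
  · simp
  · fin_cases i <;> simp

/-- The rotation by a sixth of a turn around a pivot, which exchanges the colours. -/
def Sym.turn {M : FlowerModel} {q : Hex} (hq : M.IsPivot q) : Sym M where
  φ := (Equiv.subRight q).trans (rotEquiv.trans (Equiv.addLeft q))
  r := 1
  f := true
  st := Equiv.ofBijective turnState turnState_bijective
  map_dir h k := by
    change q + rot (h + dir k - q) = q + rot (h - q) + dir (k + 1)
    rw [add_sub_right_comm, rot_add, rot_dir, add_assoc]
  mem_irises h := hq h
  isBlue_st := by
    have : ∀ σ j, (turnState σ).isBlue (j + 1) = (σ.isBlue j ^^ true) := by decide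
    exact this
  law σ := by
    change M.irisLaw {turnState σ} = _
    rw [M.irisLaw_singleton, M.irisLaw_singleton]
    cases σ <;> rfl

/-- The composition of two symmetries. -/
def Sym.comp {M : FlowerModel} (g g' : Sym M) : Sym M where
  φ := g'.φ.trans g.φ
  r := g'.r + g.r
  f := g'.f ^^ g.f
  st := g'.st.trans g.st
  map_dir h k := by simp [g.map_dir, g'.map_dir, add_assoc]
  mem_irises h := by simp [g.mem_irises, g'.mem_irises]
  isBlue_st σ j := by
    simp only [Equiv.trans_apply, ← add_assoc, g.isBlue_st, g'.isBlue_st, Bool.xor_assoc]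
  law σ := by simp [g.law, g'.law]

/-- The rotation by a third of a turn around a pivot. -/
def Sym.third {M : FlowerModel} {q : Hex} (hq : M.IsPivot q) : Sym M :=
  (Sym.turn hq).comp (Sym.turn hq)

theorem Sym.turn_apply {M : FlowerModel} {q : Hex} (hq : M.IsPivot q) (h : Hex) :
    (Sym.turn hq).φ h = q + rot (h - q) := rfl

theorem Sym.third_apply {M : FlowerModel} {q : Hex} (hq : M.IsPivot q) (h : Hex) :
    (Sym.third hq).φ h = q + rot (rot (h - q)) := by
  change q + rot (q + rot (h - q) - q) = _
  rw [add_sub_cancel_left]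

theorem Sym.translation_apply {M : FlowerModel} {v : Hex} (hv : M.IsPeriod v) (h : Hex) :
    (Sym.translation hv).φ h = h + v := rfl

@[simp] theorem Sym.turn_f {M : FlowerModel} {q : Hex} (hq : M.IsPivot q) :
    (Sym.turn hq).f = true := rfl

theorem Sym.conn_of_f {M : FlowerModel} (g : Sym M) (hf : g.f = false) (c : Bool) (ω : Config)
    (D : Set Hex) (a b : Hex) :
    M.Conn c (g.act ω) D (g.φ a) (g.φ b) ↔ M.Conn c ω (g.φ ⁻¹' D) a b := by
  have := g.conn c ω D a b
  rwa [hf, Bool.xor_false] at this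

namespace FlowerModel

variable {M : FlowerModel}

/-! ### Clusters that touch all six sectors -/

variable (M)

/-- The hexagon `h` has the colour `c`, and in `hexDom z n` it is connected in this colour to all six
sectors. -/
def Big (c : Bool) (ω : Config) (z : Hex) (n : ℤ) (h : Hex) : Prop :=
  ∀ k, ∃ g, M.Conn c ω (M.hexDom z n) h g ∧ M.Touch z n k g

variable {M} {c : Bool} {ω : Config} {z : Hex} {n : ℤ}

theorem Big.self {h : Hex} (hh : M.Big c ω z n h) : M.Conn c ω (M.hexDom z n) h h := by
  obtain ⟨g, hg, _⟩ := hh 0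
  exact Conn.refl hg.1 hg.2.1

theorem Big.of_conn {h h' : Hex} (hh : M.Big c ω z n h) (hc : M.Conn c ω (M.hexDom z n) h h') :
    M.Big c ω z n h' := fun k => by
  obtain ⟨g, hg, hk⟩ := hh k
  exact ⟨g, hc.symm.trans hg, hk⟩

theorem Big.unique (hn : 10 ≤ n) {h h' : Hex} (hh : M.Big c ω z n h) (hh' : M.Big c ω z n h') :
    M.Conn c ω (M.hexDom z n) h h' := by
  obtain ⟨x, hx, h0⟩ := hh 0
  obtain ⟨x', hx', h2⟩ := hh 2
  obtain ⟨y, hy, h1⟩ := hh' 1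
  obtain ⟨y', hy', h3⟩ := hh' 3
  exact (hx.trans (chords_meet hn (hx.symm.trans hx') (hy.symm.trans hy') h0 h2 h1 h3)).trans
    hy.symm

theorem touch_turn {q : Hex} (hq : M.IsPivot q) (k : Fin 6) (h : Hex) :
    M.Touch ((Sym.turn hq).φ z) n (k + 1) ((Sym.turn hq).φ h) ↔ M.Touch z n k h := by
  unfold Touch
  rw [(Sym.turn hq).φ.surjective.exists]
  refine exists_congr fun g => and_congr ?_ (Sym.near_iff _ _ _)
  simp only [sector, Set.mem_ofPred_eq, Sym.base]
  rw [← inSector_rot k, Sym.turn_apply, Sym.turn_apply, add_sub_add_left_eq_sub, ← rot_sub,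
    sub_sub_sub_cancel_right]

theorem mem_hexDom_turn {q : Hex} (hq : M.IsPivot q) (h : Hex) :
    (Sym.turn hq).φ h ∈ M.hexDom ((Sym.turn hq).φ z) n ↔ h ∈ M.hexDom z n := by
  simp only [hexDom, Set.mem_ofPred_eq, Sym.base]
  rw [← inHexagon_rot (v := M.base h - z), Sym.turn_apply, Sym.turn_apply, add_sub_add_left_eq_sub,
    ← rot_sub, sub_sub_sub_cancel_right]

theorem chord_turn {q : Hex} (hq : M.IsPivot q) (k k' : Fin 6) :
    M.Chord (!c) ((Sym.turn hq).act ω) ((Sym.turn hq).φ z) n (k + 1) (k' + 1) ↔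
      M.Chord c ω z n k k' := by
  unfold Chord
  rw [(Sym.turn hq).φ.surjective.exists]
  refine exists_congr fun h => ?_
  rw [(Sym.turn hq).φ.surjective.exists]
  refine exists_congr fun h' => ?_
  rw [touch_turn, touch_turn]
  have := (Sym.turn hq).conn c ω (M.hexDom ((Sym.turn hq).φ z) n) h h'
  rw [Sym.turn_f, Bool.xor_true, show (Sym.turn hq).φ ⁻¹' M.hexDom ((Sym.turn hq).φ z) n =
    M.hexDom z n from Set.ext fun h => mem_hexDom_turn hq h] at this
  rw [this]

theorem big_turn {q : Hex} (hq : M.IsPivot q) (h : Hex) :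
    M.Big (!c) ((Sym.turn hq).act ω) ((Sym.turn hq).φ z) n ((Sym.turn hq).φ h) ↔
      M.Big c ω z n h := by
  unfold Big
  rw [(Equiv.addRight (1 : Fin 6)).surjective.forall]
  refine forall_congr' fun k => ?_
  rw [(Sym.turn hq).φ.surjective.exists]
  refine exists_congr fun g => ?_
  rw [Equiv.coe_addRight, touch_turn]
  have := (Sym.turn hq).conn c ω (M.hexDom ((Sym.turn hq).φ z) n) h g
  rw [Sym.turn_f, Bool.xor_true, show (Sym.turn hq).φ ⁻¹' M.hexDom ((Sym.turn hq).φ z) n =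
    M.hexDom z n from Set.ext fun h => mem_hexDom_turn hq h] at this
  rw [this]

theorem Chord.symm {k k' : Fin 6} (h : M.Chord c ω z n k k') : M.Chord c ω z n k' k := by
  obtain ⟨x, x', h1, h2, h3⟩ := h
  exact ⟨x', x, h2, h1, h3.symm⟩

/-- Two connections between the sectors `k` and `k + 2` and between the sectors `k + 1` and `k + 3`
around a pivot meet. -/
theorem chords_meet_turn (hq : M.IsPivot z) (hn : 10 ≤ n) (k : Fin 6) {x x' y y' : Hex}
    (hx : M.Conn c ω (M.hexDom z n) x x') (hy : M.Conn c ω (M.hexDom z n) y y')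
    (h0 : M.Touch z n k x) (h2 : M.Touch z n (k + 2) x') (h1 : M.Touch z n (k + 1) y)
    (h3 : M.Touch z n (k + 3) y') : M.Conn c ω (M.hexDom z n) x y := by
  have hz : (Sym.turn hq).φ z = z := by simp [Sym.turn_apply, rot]
  have hD : (Sym.turn hq).φ ⁻¹' M.hexDom z n = M.hexDom z n := by
    have := fun h => mem_hexDom_turn (z := z) (n := n) hq h
    rw [hz] at this
    exact Set.ext this
  have hT : ∀ {k h}, M.Touch z n k h → M.Touch z n (k + 1) ((Sym.turn hq).φ h) := by
    intro k h hh
    have := (touch_turn (z := z) (n := n) hq k h).2 hh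
    rwa [hz] at this
  obtain ⟨j, hj⟩ : ∃ j : ℕ, k + j • (1 : Fin 6) = 0 :=
    ⟨6 - k.val, by clear h0 h1 h2 h3; revert k; decide⟩
  induction j generalizing k c ω x x' y y' with
  | zero =>
    obtain rfl : k = 0 := by simpa using hj
    exact chords_meet hn hx hy h0 h2 h1 h3
  | succ j ih =>
    have e := (Sym.turn hq).conn c ω (M.hexDom z n)
    rw [hD] at e
    refine (e _ _).1 (ih (k + 1) ((e _ _).2 hx) ((e _ _).2 hy) (hT h0) ?_ ?_ ?_ ?_)
    · rw [add_right_comm]; exact hT h2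
    · exact hT h1
    · rw [add_right_comm]; exact hT h3
    · rw [← hj, succ_nsmul']; abel

/-- Four connections between sectors at distance two belong to one cluster. -/
theorem exists_big_of_chords (hq : M.IsPivot z) (hn : 10 ≤ n) (h02 : M.Chord c ω z n 0 2)
    (h13 : M.Chord c ω z n 1 3) (h24 : M.Chord c ω z n 2 4) (h35 : M.Chord c ω z n 3 5) :
    ∃ h, M.Big c ω z n h := by
  obtain ⟨a, a', ha, ha', hA⟩ := h02
  obtain ⟨b, b', hb, hb', hB⟩ := h13
  obtain ⟨d, d', hd, hd', hC⟩ := h24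
  obtain ⟨e, e', he, he', hE⟩ := h35
  have h1 := chords_meet hn hA hB ha ha' hb hb'
  have h2 := chords_meet_turn hq hn 1 hB hC hb hb' hd hd'
  have h3 := chords_meet_turn hq hn 2 hC hE hd hd' he he'
  refine ⟨a, fun k => ?_⟩
  have k1 : M.Conn c ω (M.hexDom z n) a d := h1.trans h2
  have k2 : M.Conn c ω (M.hexDom z n) a e := k1.trans h3
  fin_cases k
  · exact ⟨a, Conn.refl hA.1 hA.2.1, ha⟩
  · exact ⟨b, h1, hb⟩
  · exact ⟨a', hA, ha'⟩
  · exact ⟨b', h1.trans hB, hb'⟩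
  · exact ⟨d', k1.trans hC, hd'⟩
  · exact ⟨e', k2.trans hE, he'⟩

end FlowerModel

/-! ### Resampling of coordinates of a product measure -/

section Resample

set_option linter.unusedSectionVars false

variable {ι T : Type*} [DecidableEq ι] [Fintype T] [MeasurableSpace T] [MeasurableSingletonClass T]
  (ν : Measure T) [IsProbabilityMeasure ν]

/-- The average of `F` over the coordinate `i`. -/
def resample (i : ι) (F : (ι → T) → ℝ) (x : ι → T) : ℝ :=
  ∑ u, ν.real {u} * F (Function.update x i u)

/-- The average of `F` over the coordinates in a list. -/
def resampleList (l : List ι) (F : (ι → T) → ℝ) : (ι → T) → ℝ := l.foldr (resample ν) F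

variable {ν}

theorem sum_weights : ∑ u, ν.real {u} = 1 := by simp

theorem resample_of_dependsOn {i : ι} {F : (ι → T) → ℝ} {S : Set ι} (hF : DependsOn F S)
    (hi : i ∉ S) : resample ν i F = F := by
  funext x
  unfold resample
  rw [Finset.sum_congr rfl fun u _ => by
    rw [hF (y := x) fun j hj => Function.update_of_ne (ne_of_mem_of_not_mem hj hi) _ _],
    ← Finset.sum_mul, sum_weights, one_mul]

theorem dependsOn_resample {i : ι} {F : (ι → T) → ℝ} {S : Set ι} (hF : DependsOn F S) :
    DependsOn (resample ν i F) (S \ {i}) := by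
  intro x y h
  unfold resample
  refine Finset.sum_congr rfl fun u _ => ?_
  congr 1
  refine hF fun j hj => ?_
  by_cases hji : j = i
  · subst hji; simp
  · rw [Function.update_of_ne hji, Function.update_of_ne hji]
    exact h j ⟨hj, hji⟩

theorem dependsOn_resampleList (l : List ι) {F : (ι → T) → ℝ} {S : Set ι} (hF : DependsOn F S) :
    DependsOn (resampleList ν l F) (S \ {i | i ∈ l}) := by
  induction l with
  | nil => simpa [resampleList] using hF
  | cons i l ih =>
    have := dependsOn_resample (ν := ν) (i := i) ih
    refine this.mono ?_
    rintro j ⟨⟨h1, h2⟩, h3⟩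
    simp only [Set.mem_sdiff, Set.mem_ofPred_eq, List.mem_cons, not_or]
    exact ⟨h1, h3, h2⟩

theorem resample_mul_left {i : ι} {F G : (ι → T) → ℝ} {S : Set ι} (hF : DependsOn F S)
    (hi : i ∉ S) : resample ν i (F * G) = F * resample ν i G := by
  funext x
  simp only [resample, Pi.mul_apply, Finset.mul_sum]
  refine Finset.sum_congr rfl fun u _ => ?_
  rw [hF (y := x) fun j hj => Function.update_of_ne (ne_of_mem_of_not_mem hj hi) _ _]
  ring

theorem resampleList_mul_left {l : List ι} {F G : (ι → T) → ℝ} {S : Set ι} (hF : DependsOn F S)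
    (hi : ∀ i ∈ l, i ∉ S) : resampleList ν l (F * G) = F * resampleList ν l G := by
  induction l with
  | nil => rfl
  | cons i l ih =>
    change resample ν i (resampleList ν l (F * G)) = F * resample ν i (resampleList ν l G)
    rw [ih fun j hj => hi j (List.mem_cons_of_mem _ hj),
      resample_mul_left hF (hi i List.mem_cons_self)]

theorem resample_comm (i j : ι) (F : (ι → T) → ℝ) :
    resample ν i (resample ν j F) = resample ν j (resample ν i F) := by
  by_cases hij : i = j
  · rw [hij]
  funext x
  simp only [resample, Finset.mul_sum]
  rw [Finset.sum_comm]
  refine Finset.sum_congr rfl fun u _ => Finset.sum_congr rfl fun v _ => ?_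
  rw [Function.update_comm hij]
  ring

theorem resample_self (i : ι) (F : (ι → T) → ℝ) :
    resample ν i (resample ν i F) = resample ν i F :=
  resample_of_dependsOn (S := Set.univ \ {i})
    (dependsOn_resample (dependsOn_univ F)) (by simp)

theorem resampleList_comm (l : List ι) (i : ι) (F : (ι → T) → ℝ) :
    resampleList ν l (resample ν i F) = resample ν i (resampleList ν l F) := by
  induction l with
  | nil => rfl
  | cons j l ih =>
    change resample ν j (resampleList ν l (resample ν i F)) =
      resample ν i (resample ν j (resampleList ν l F))
    rw [ih, resample_comm]

theorem resampleList_of_mem {l : List ι} {i : ι} (hi : i ∈ l) (F : (ι → T) → ℝ) :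
    resampleList ν l (resample ν i F) = resampleList ν l F := by
  rw [resampleList_comm]
  induction l with
  | nil => simp at hi
  | cons j l ih =>
    change resample ν i (resample ν j (resampleList ν l F)) = resample ν j (resampleList ν l F)
    rcases List.mem_cons.1 hi with rfl | hi
    · exact resample_self _ _
    · rw [resample_comm, ih hi]

theorem resample_mono {i : ι} {F G : (ι → T) → ℝ} (h : F ≤ G) : resample ν i F ≤ resample ν i G :=
  fun _ => Finset.sum_le_sum fun _ _ => mul_le_mul_of_nonneg_left (h _) measureReal_nonneg

theorem resampleList_mono {l : List ι} {F G : (ι → T) → ℝ} (h : F ≤ G) :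
    resampleList ν l F ≤ resampleList ν l G := by
  induction l with
  | nil => exact h
  | cons i l ih => exact resample_mono ih

/-- Averaging over `i` commutes with fixing another coordinate. -/
theorem resampleList_update {l : List ι} {h : ι} (hl : h ∉ l) (u : T) (F : (ι → T) → ℝ)
    (x : ι → T) : resampleList ν l F (Function.update x h u) =
      resampleList ν l (fun y => F (Function.update y h u)) x := by
  induction l generalizing x with
  | nil => rfl
  | cons i l ih =>
    change resample ν i (resampleList ν l F) _ = resample ν i (resampleList ν l _) x
    simp only [resample]
    refine Finset.sum_congr rfl fun v _ => ?_
    rw [← ih (fun h => hl (List.mem_cons_of_mem _ h)), Function.update_comm]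
    rintro rfl
    exact hl List.mem_cons_self

theorem measurable_update_pair (i : ι) :
    Measurable fun p : (ι → T) × T => Function.update p.1 i p.2 := by
  refine measurable_pi_iff.2 fun j => ?_
  by_cases h : j = i
  · subst h; simpa using measurable_snd
  · simp only [Function.update_of_ne h]
    exact (measurable_pi_apply j).comp measurable_fst

theorem measurePreserving_update (i : ι) :
    MeasurePreserving (fun p : (ι → T) × T => Function.update p.1 i p.2)
      ((Measure.infinitePi fun _ => ν).prod ν) (Measure.infinitePi fun _ => ν) := by
  refine ⟨measurable_update_pair i, Measure.eq_infinitePi _ fun s t ht => ?_⟩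
  rw [Measure.map_apply (measurable_update_pair i)
    (MeasurableSet.pi s.countable_toSet fun j _ => ht j)]
  have : (fun p : (ι → T) × T => Function.update p.1 i p.2) ⁻¹' (Set.pi s t) =
      (Set.pi (s.erase i) t) ×ˢ (if i ∈ s then t i else Set.univ) := by
    ext ⟨x, u⟩
    simp only [Set.mem_preimage, Set.mem_pi, Set.mem_prod, Finset.coe_erase, Set.mem_sdiff,
      Finset.mem_coe, Set.mem_singleton_iff]
    constructor
    · intro h
      refine ⟨fun j hj => ?_, ?_⟩
      · have := h j hj.1
        rwa [Function.update_of_ne hj.2] at this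
      · split_ifs with hi
        · simpa using h i hi
        · trivial
    · rintro ⟨h1, h2⟩ j hj
      by_cases hji : j = i
      · subst hji; rw [if_pos hj] at h2; simpa using h2
      · rw [Function.update_of_ne hji]; exact h1 j ⟨hj, hji⟩
  rw [this, Measure.prod_prod, Measure.infinitePi_pi _ fun j _ => ht j]
  split_ifs with hi
  · rw [Finset.prod_erase_mul _ _ hi]
  · rw [Finset.erase_eq_of_notMem hi]; simp

theorem measurable_resample {i : ι} {F : (ι → T) → ℝ} (hF : Measurable F) :
    Measurable (resample ν i F) := by
  unfold resample
  refine Finset.measurable_sum _ fun u _ => ?_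
  exact (hF.comp ((measurable_update_pair i).comp (measurable_id.prodMk measurable_const))).const_mul
    _

theorem abs_resample_le {i : ι} {F : (ι → T) → ℝ} {C : ℝ} (hC : ∀ x, |F x| ≤ C) (x : ι → T) :
    |resample ν i F x| ≤ C := by
  unfold resample
  refine (Finset.abs_sum_le_sum_abs _ _).trans ?_
  calc _ ≤ ∑ u, ν.real {u} * C := Finset.sum_le_sum fun u _ => by
        rw [abs_mul, abs_of_nonneg measureReal_nonneg]
        exact mul_le_mul_of_nonneg_left (hC _) measureReal_nonneg
    _ = C := by rw [← Finset.sum_mul, sum_weights, one_mul]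

theorem integral_resample {i : ι} {F : (ι → T) → ℝ} (hF : Measurable F) {C : ℝ}
    (hC : ∀ x, |F x| ≤ C) :
    ∫ x, resample ν i F x ∂(Measure.infinitePi fun _ => ν) =
      ∫ x, F x ∂(Measure.infinitePi fun _ => ν) := by
  have hp := measurePreserving_update (ν := ν) i
  have hint : Integrable (fun p : (ι → T) × T => F (Function.update p.1 i p.2))
      ((Measure.infinitePi fun _ => ν).prod ν) :=
    Integrable.of_bound (hF.comp (measurable_update_pair i)).aestronglyMeasurable C
      (Filter.Eventually.of_forall fun p => by rw [Real.norm_eq_abs]; exact hC _)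
  have e : ∫ x, F x ∂(Measure.infinitePi fun _ => ν) = ∫ p : (ι → T) × T,
      F (Function.update p.1 i p.2) ∂((Measure.infinitePi fun _ => ν).prod ν) := by
    conv_lhs => rw [← hp.map_eq]
    exact integral_map hp.measurable.aemeasurable hF.aestronglyMeasurable
  rw [e, integral_prod _ hint]
  refine integral_congr_ae (Filter.Eventually.of_forall fun x => ?_)
  simp only [resample]
  rw [integral_fintype Integrable.of_finite]
  simp

theorem integral_resampleList {l : List ι} {F : (ι → T) → ℝ} (hF : Measurable F) {C : ℝ}
    (hC : ∀ x, |F x| ≤ C) :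
    ∫ x, resampleList ν l F x ∂(Measure.infinitePi fun _ => ν) =
      ∫ x, F x ∂(Measure.infinitePi fun _ => ν) := by
  induction l with
  | nil => rfl
  | cons i l ih =>
    have key : Measurable (resampleList ν l F) ∧ ∀ x, |resampleList ν l F x| ≤ C := by
      clear ih
      induction l with
      | nil => exact ⟨hF, hC⟩
      | cons i l ih => exact ⟨measurable_resample ih.1, abs_resample_le ih.2⟩
    exact (integral_resample key.1 key.2).trans ih

/-- A function of finitely many coordinates has a constant average over these coordinates. -/
theorem resampleList_eq_integral {l : List ι} {F : (ι → T) → ℝ} (hF : Measurable F) {C : ℝ}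
    (hC : ∀ x, |F x| ≤ C) {S : Set ι} (hS : DependsOn F S) (hl : ∀ i ∈ S, i ∈ l) (x : ι → T) :
    resampleList ν l F x = ∫ x, F x ∂(Measure.infinitePi fun _ => ν) := by
  rw [← integral_resampleList (l := l) hF hC]
  have h : ∀ y, resampleList ν l F y = resampleList ν l F x := fun y =>
    dependsOn_resampleList l hS fun j hj => (hj.2 (hl j hj.1)).elim
  simp [h]

/-- A class of functions that is stable under averages over the coordinates in a list and
whose members are positively correlated in each of these coordinates is positively correlated in all
of them. -/
theorem resampleList_mul_le {𝒞 : ((ι → T) → ℝ) → Prop} {l : List ι}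
    (hst : ∀ i ∈ l, ∀ F, 𝒞 F → 𝒞 (resample ν i F))
    (hco : ∀ i ∈ l, ∀ F G, 𝒞 F → 𝒞 G →
      resample ν i F * resample ν i G ≤ resample ν i (F * G))
    {F G : (ι → T) → ℝ} (hF : 𝒞 F) (hG : 𝒞 G) :
    resampleList ν l F * resampleList ν l G ≤ resampleList ν l (F * G) := by
  have key : (𝒞 (resampleList ν l F) ∧ 𝒞 (resampleList ν l G)) ∧
      resampleList ν l F * resampleList ν l G ≤ resampleList ν l (F * G) := by
    induction l with
    | nil => exact ⟨⟨hF, hG⟩, le_rfl⟩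
    | cons i l ih =>
      obtain ⟨⟨h1, h2⟩, h3⟩ := ih (fun j hj => hst j (List.mem_cons_of_mem _ hj))
        fun j hj => hco j (List.mem_cons_of_mem _ hj)
      exact ⟨⟨hst i List.mem_cons_self _ h1, hst i List.mem_cons_self _ h2⟩,
        (hco i List.mem_cons_self _ _ h1 h2).trans (resample_mono h3)⟩
  exact key.2

end Resample

/-! ### An order on the configurations -/

namespace FlowerModel

variable (M : FlowerModel)

/-- The configuration `ω'` is at least as connected in blue as `ω`: its petals and fillers are blue
where those of `ω` are, and blue petals that are linked through an iris in `ω` are connected within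
the same flower in `ω'`. -/
def FLE (ω ω' : Config) : Prop :=
  (∀ h, M.IsCol true ω h → M.IsCol true ω' h) ∧ ∀ i a b, M.IsCol true ω a → M.IsCol true ω b →
    M.IrisLink true ω a i b → M.Conn true ω' (flower i) a b

/-- An event that is preserved if the configuration becomes more connected in blue. -/
def Increasing (A : Set Config) : Prop := ∀ ω ω', M.FLE ω ω' → ω ∈ A → ω' ∈ A

variable {M} {ω ω' : Config} {D : Set Hex}

theorem flower_subset {i a : Hex} (hD : M.Saturated D) (hi : i ∈ M.irises) (h : Near i a)
    (ha : a ∈ D) : flower i ⊆ D := by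
  intro b hb
  rw [← hD, base_eq hi (mem_flower.1 hb), ← base_eq hi h, hD]
  exact ha

theorem Conn.of_fle (hD : M.Saturated D) (h : M.FLE ω ω') {a b : Hex}
    (hc : M.Conn true ω D a b) : M.Conn true ω' D a b := by
  obtain ⟨h1, h2, h3⟩ := hc
  induction h3 with
  | refl => exact Conn.refl h1 (h.1 _ h2)
  | tail _ hs ih =>
    obtain ⟨m, d1, d2, c1, c2, h5⟩ := hs
    refine ih.trans ?_
    rcases h5 with ⟨rfl, h5⟩ | h5
    · exact Conn.near d1 d2 (h.1 _ c1) (h.1 _ c2) h5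
    · exact (h.2 m _ _ c1 c2 h5).mono (flower_subset hD h5.1 h5.near_left d1)

/-- A part of the boundary of a flower: the petals from `k` to `l`, in one of the two directions, all
belong to `p`. -/
def run (p : Fin 6 → Bool) (k l : Fin 6) : Bool :=
  p k && p l && (l == k || l == k + 1 || k == l + 1 || (l == k + 2 && p (k + 1)) ||
    (k == l + 2 && p (l + 1)) || (l == k + 3 && p (k + 1) && p (k + 2)) ||
    (k == l + 3 && p (l + 1) && p (l + 2)))

/-- Petals of `p` that are linked by the blue part of `σ` are connected in the flower with the blue
petals `p'` and the iris in the state `σ'`. -/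
def linkLE (p p' : Fin 6 → Bool) (σ σ' : HexState) : Bool :=
  decide (∀ k k', (p k && p k' && lk true σ k && lk true σ k') = true → (run p' k k' ||
    decide (∃ l l', (run p' k l && lk true σ' l && lk true σ' l' && run p' l' k') = true)) = true)

theorem conn_of_run {i : Hex} (hi : i ∈ M.irises) {p : Fin 6 → Bool}
    (hp : ∀ k, p k = true → ω (i + dir k) = .blue) {k l : Fin 6} (h : run p k l = true) :
    M.Conn true ω (flower i) (i + dir k) (i + dir l) := by
  have hc : ∀ k, p k = true → M.IsCol true ω (i + dir k) := fun k hk =>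
    ⟨petal_notMem hi k, hp k hk⟩
  have hf : ∀ k, i + dir k ∈ flower i := fun k => Or.inr ⟨k, rfl⟩
  have hs : ∀ k, p k = true → p (k + 1) = true →
      M.Conn true ω (flower i) (i + dir k) (i + dir (k + 1)) := by
    intro k h1 h2
    refine Conn.near (hf _) (hf _) (hc _ h1) (hc _ h2) ?_
    rw [← dir_add_two, ← add_assoc]
    exact near_add_dir _ _
  have a2 : ∀ k : Fin 6, k + 2 = k + 1 + 1 := by decide
  have a3 : ∀ k : Fin 6, k + 3 = k + 1 + 1 + 1 := by decide
  simp only [run, Bool.and_eq_true, Bool.or_eq_true, beq_iff_eq] at h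
  obtain ⟨⟨h1, h2⟩, h⟩ := h
  rcases h with (((((rfl | rfl) | rfl) | ⟨rfl, h3⟩) | ⟨rfl, h3⟩) | ⟨⟨rfl, h3⟩, h4⟩) |
    ⟨⟨rfl, h3⟩, h4⟩
  · exact Conn.refl (hf _) (hc _ h1)
  · exact hs _ h1 h2
  · exact (hs _ h2 h1).symm
  · rw [a2] at h2 ⊢
    exact (hs _ h1 h3).trans (hs _ h3 h2)
  · rw [a2] at h1 ⊢
    exact ((hs _ h2 h3).trans (hs _ h3 h1)).symm
  · rw [a3] at h2 ⊢
    rw [a2] at h4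
    exact ((hs _ h1 h3).trans (hs _ h3 h4)).trans (hs _ h4 h2)
  · rw [a3] at h1 ⊢
    rw [a2] at h4
    exact (((hs _ h2 h3).trans (hs _ h3 h4)).trans (hs _ h4 h1)).symm

/-- Two configurations that differ at most in one flower are compared within this flower. -/
theorem fle_of_flower {i : Hex} (h1 : ∀ h, h ∉ M.irises → ω h = .blue → ω' h = .blue)
    (h2 : ∀ j ∈ M.irises, j ≠ i → ω j = ω' j)
    (h3 : i ∈ M.irises → linkLE (fun k => decide (ω (i + dir k) = .blue))
      (fun k => decide (ω' (i + dir k) = .blue)) (ω i) (ω' i) = true) : M.FLE ω ω' := by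
  have hc : ∀ h, M.IsCol true ω h → M.IsCol true ω' h := fun h hh => ⟨hh.1, h1 h hh.1 hh.2⟩
  refine ⟨hc, ?_⟩
  rintro j a b ha hb hl
  have hl' := hl
  obtain ⟨hj, k, k', rfl, rfl, l1, l2⟩ := hl
  have hf : ∀ k, j + dir k ∈ flower j := fun k => Or.inr ⟨k, rfl⟩
  by_cases hji : j = i
  · subst hji
    have hrun : ∀ {k l}, run (fun k => decide (ω' (j + dir k) = .blue)) k l = true →
        M.Conn true ω' (flower j) (j + dir k) (j + dir l) := fun h =>
      conn_of_run hj (fun k hk => of_decide_eq_true hk) h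
    have h := of_decide_eq_true (h3 hj) k k'
      (by
        have e1 : ω (j + dir k) = .blue := ha.2
        have e2 : ω (j + dir k') = .blue := hb.2
        simp [e1, e2, l1, l2])
    rw [Bool.or_eq_true] at h
    rcases h with h | h
    · exact hrun h
    · obtain ⟨l, l', h⟩ := of_decide_eq_true h
      simp only [Bool.and_eq_true] at h
      obtain ⟨⟨⟨r1, r2⟩, r3⟩, r4⟩ := h
      have c1 := hrun r1
      have c2 := hrun r4
      exact (c1.trans (Conn.iris (hf l) (hf l') c1.right.2 c2.2.1
        ⟨hj, l, l', rfl, rfl, r2, r3⟩)).trans c2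
  · refine Conn.iris (hf k) (hf k') (hc _ ha) (hc _ hb) ⟨hj, k, k', rfl, rfl, ?_, ?_⟩
    · rwa [← h2 j hj hji]
    · rwa [← h2 j hj hji]

instance (p : Fin 6 → Bool) : Decidable (IsTrigger p) := by unfold IsTrigger; infer_instance

theorem run_self {p : Fin 6 → Bool} {k : Fin 6} (h : p k = true) : run p k k = true := by
  simp [run, h]

theorem linkLE_of_le {p p' : Fin 6 → Bool} {σ σ' : HexState} (hp : ∀ k, p k = true → p' k = true)
    (hσ : ∀ k, lk true σ k = true → lk true σ' k = true) : linkLE p p' σ σ' = true := by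
  refine decide_eq_true fun k k' h => ?_
  simp only [Bool.and_eq_true] at h
  rw [Bool.or_eq_true, decide_eq_true_iff]
  exact Or.inr ⟨k, k', by
    simp [run_self (hp k h.1.1.1), run_self (hp k' h.1.1.2), hσ k h.1.2, hσ k' h.2]⟩

/-- If the petals form a trigger, and one more petal becomes blue, then at least two mixed states of
the iris connect what a blue iris connects before. -/
theorem linkLE_of_trigger : ∀ (p : Fin 6 → Bool) (k : Fin 6), IsTrigger p ∧ p k = false →
    ∃ j, linkLE p (Function.update p k true) .blue (.split j) = true ∧
      linkLE p (Function.update p k true) .blue (.split (j + 1)) = true := by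
  decide +kernel

/-- If the petals form a trigger once a petal becomes blue, then at most one mixed state of the iris
connects more than what is connected after this without a blue iris. -/
theorem linkLE_to_trigger : ∀ (p : Fin 6 → Bool) (k : Fin 6),
    IsTrigger (Function.update p k true) ∧ p k = false →
    ∃ j, linkLE p (Function.update p k true) (.split (j + 1)) .yellow = true ∧
      linkLE p (Function.update p k true) (.split (j + 2)) .yellow = true := by
  decide +kernel

end FlowerModel

/-! ### Positive association -/

theorem sum_hexState (F : HexState → ℝ) :
    ∑ σ, F σ = F .blue + F .yellow + F (.split 0) + F (.split 1) + F (.split 2) := by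
  rw [← Equiv.sum_comp HexState.equivFin.symm, Fin.sum_univ_five]
  rfl

theorem coin_singleton (b : Bool) : coin {b} = 2⁻¹ := by
  cases b <;> simp [coin]

/-- The discordance of two triples with values in `[0, F]` and `[0, G]`. -/
theorem discordance_le {F G x₁ x₂ x₃ y₁ y₂ y₃ : ℝ} (h1 : 0 ≤ x₁ ∧ x₁ ≤ F) (h2 : 0 ≤ x₂ ∧ x₂ ≤ F)
    (h3 : 0 ≤ x₃ ∧ x₃ ≤ F) (k1 : 0 ≤ y₁ ∧ y₁ ≤ G) (k2 : 0 ≤ y₂ ∧ y₂ ≤ G) (k3 : 0 ≤ y₃ ∧ y₃ ≤ G) :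
    -(2 * (F * G)) ≤ (x₁ - x₂) * (y₁ - y₂) + (x₂ - x₃) * (y₂ - y₃) + (x₁ - x₃) * (y₁ - y₃) := by
  have sorted : ∀ {x₁ x₂ x₃ y₁ y₂ y₃ : ℝ}, 0 ≤ x₃ → x₁ ≤ F → x₂ ≤ x₁ → x₃ ≤ x₂ →
      (0 ≤ y₁ ∧ y₁ ≤ G) → (0 ≤ y₂ ∧ y₂ ≤ G) → (0 ≤ y₃ ∧ y₃ ≤ G) →
      -(2 * (F * G)) ≤ (x₁ - x₂) * (y₁ - y₂) + (x₂ - x₃) * (y₂ - y₃) + (x₁ - x₃) * (y₁ - y₃) := by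
    intro x₁ x₂ x₃ y₁ y₂ y₃ a1 a2 a3 a4 b1 b2 b3
    have e1 := mul_nonneg (sub_nonneg.2 a3)
      (by linarith : 0 ≤ 2 * G + ((y₁ - y₂) + (y₁ - y₃)))
    have e2 := mul_nonneg (sub_nonneg.2 a4)
      (by linarith : 0 ≤ 2 * G + ((y₂ - y₃) + (y₁ - y₃)))
    have e3 := mul_nonneg (by linarith : 0 ≤ F - (x₁ - x₃)) (by linarith : 0 ≤ 2 * G)
    linarith
  rcases le_total x₁ x₂ with a | a <;> rcases le_total x₂ x₃ with b | b <;>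
    rcases le_total x₁ x₃ with d | d
  · linarith [sorted h1.1 h3.2 b a k3 k2 k1]
  · linarith [sorted h1.1 h3.2 b a k3 k2 k1]
  · linarith [sorted h1.1 h2.2 b d k2 k3 k1]
  · linarith [sorted h3.1 h2.2 a d k2 k1 k3]
  · linarith [sorted h2.1 h3.2 d a k3 k1 k2]
  · linarith [sorted h2.1 h1.2 d b k1 k3 k2]
  · linarith [sorted h3.1 h1.2 a b k1 k2 k3]
  · linarith [sorted h3.1 h1.2 a b k1 k2 k3]

/-- Positive correlation of two functions on the states of an iris that increase from yellow to
mixed states and from mixed states to blue. -/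
theorem iris_correlation {a s fB fY f₀ f₁ f₂ gB gY g₀ g₁ g₂ : ℝ} (ha : 0 ≤ a) (hs : 0 ≤ s)
    (h1 : 2 * a + 3 * s = 1) (h2 : 2 * s ^ 2 ≤ a ^ 2) (p₀ : fY ≤ f₀ ∧ f₀ ≤ fB)
    (p₁ : fY ≤ f₁ ∧ f₁ ≤ fB) (p₂ : fY ≤ f₂ ∧ f₂ ≤ fB) (q₀ : gY ≤ g₀ ∧ g₀ ≤ gB)
    (q₁ : gY ≤ g₁ ∧ g₁ ≤ gB) (q₂ : gY ≤ g₂ ∧ g₂ ≤ gB) :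
    (a * fB + a * fY + s * f₀ + s * f₁ + s * f₂) * (a * gB + a * gY + s * g₀ + s * g₁ + s * g₂) ≤
      a * (fB * gB) + a * (fY * gY) + s * (f₀ * g₀) + s * (f₁ * g₁) + s * (f₂ * g₂) := by
  have d := discordance_le (F := fB - fY) (G := gB - gY) (x₁ := f₀ - fY) (x₂ := f₁ - fY)
    (x₃ := f₂ - fY) (y₁ := g₀ - gY) (y₂ := g₁ - gY) (y₃ := g₂ - gY) ⟨by linarith, by linarith⟩
    ⟨by linarith, by linarith⟩ ⟨by linarith, by linarith⟩ ⟨by linarith, by linarith⟩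
    ⟨by linarith, by linarith⟩ ⟨by linarith, by linarith⟩
  have d' := mul_le_mul_of_nonneg_left d (sq_nonneg s)
  have FG : 0 ≤ (fB - fY) * (gB - gY) := mul_nonneg (by linarith) (by linarith)
  have e := mul_le_mul_of_nonneg_right h2 FG
  have as : 0 ≤ a * s := mul_nonneg ha hs
  have t : ∀ {f g}, fY ≤ f ∧ f ≤ fB → gY ≤ g ∧ g ≤ gB →
      0 ≤ a * s * ((fB - f) * (gB - g) + (f - fY) * (g - gY)) := fun {f g} hf hg =>
    mul_nonneg as (add_nonneg (mul_nonneg (by linarith) (by linarith))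
      (mul_nonneg (by linarith) (by linarith)))
  have t0 := t p₀ q₀
  have t1 := t p₁ q₁
  have t2 := t p₂ q₂
  -- the covariance is the sum over the pairs of states
  have key : a * (fB * gB) + a * (fY * gY) + s * (f₀ * g₀) + s * (f₁ * g₁) + s * (f₂ * g₂) -
      (a * fB + a * fY + s * f₀ + s * f₁ + s * f₂) * (a * gB + a * gY + s * g₀ + s * g₁ + s * g₂) =
      a ^ 2 * ((fB - fY) * (gB - gY)) +
      (a * s * ((fB - f₀) * (gB - g₀) + (f₀ - fY) * (g₀ - gY)) +
        a * s * ((fB - f₁) * (gB - g₁) + (f₁ - fY) * (g₁ - gY)) +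
        a * s * ((fB - f₂) * (gB - g₂) + (f₂ - fY) * (g₂ - gY))) +
      s ^ 2 * ((f₀ - f₁) * (g₀ - g₁) + (f₁ - f₂) * (g₁ - g₂) + (f₀ - f₂) * (g₀ - g₂)) := by
    linear_combination
      -(a * (fB * gB) + a * (fY * gY) + s * (f₀ * g₀) + s * (f₁ * g₁) + s * (f₂ * g₂)) * h1
  have d'' : s ^ 2 * ((f₀ - fY - (f₁ - fY)) * (g₀ - gY - (g₁ - gY)) +
      (f₁ - fY - (f₂ - fY)) * (g₁ - gY - (g₂ - gY)) +
      (f₀ - fY - (f₂ - fY)) * (g₀ - gY - (g₂ - gY))) =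
      s ^ 2 * ((f₀ - f₁) * (g₀ - g₁) + (f₁ - f₂) * (g₁ - g₂) + (f₀ - f₂) * (g₀ - g₂)) := by ring
  rw [d''] at d'
  linarith

namespace FlowerModel

variable (M : FlowerModel)

/-- The weight of a state off triggers. -/
def weight (σ : HexState) : ℝ := match σ with | .split _ => M.s | _ => M.a

theorem real_singleton (b : Bool) (σ : HexState) :
    (coin.prod M.irisLaw).real {(b, σ)} = 1 / 2 * M.weight σ := by
  have h : ({(b, σ)} : Set (Bool × HexState)) = {b} ×ˢ {σ} := by simp
  rw [h, measureReal_def, Measure.prod_prod, coin_singleton, irisLaw_singleton, ENNReal.toReal_mul,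
    ENNReal.toReal_ofReal]
  · cases σ <;> simp [weight]
  · cases σ <;> simp [M.a_nonneg, M.s_nonneg]

theorem resample_eq (i : Hex) (F : (Hex → Bool × HexState) → ℝ) (x : Hex → Bool × HexState) :
    resample (coin.prod M.irisLaw) i F x =
      1 / 2 * ∑ σ, M.weight σ * (F (Function.update x i (true, σ)) +
        F (Function.update x i (false, σ))) := by
  rw [resample, Fintype.sum_prod_type, Fintype.sum_bool, ← Finset.sum_add_distrib, Finset.mul_sum]
  refine Finset.sum_congr rfl fun σ _ => ?_
  rw [M.real_singleton, M.real_singleton]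
  ring

open Classical in
/-- The state of the iris `i` if its own variables have the value `v`. -/
def eff (x : Hex → Bool × HexState) (i : Hex) (v : Bool × HexState) : HexState :=
  if IsTrigger (fun k => (x (i + dir k)).1) then mono v.1 else v.2

variable {M}

theorem config_iris {x : Hex → Bool × HexState} {i : Hex} (hi : i ∈ M.irises) :
    M.config x i = eff x i (x i) := by
  unfold config eff
  by_cases h : IsTrigger fun k => (x (i + dir k)).1
  · rw [if_neg (by simp [h]), if_pos h]; cases (x i).1 <;> rfl
  · rw [if_pos ⟨hi, h⟩, if_neg h]

theorem config_of_notMem {x : Hex → Bool × HexState} {h : Hex} (hh : h ∉ M.irises) :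
    M.config x h = mono (x h).1 := by
  unfold config
  rw [if_neg (by simp [hh])]; cases (x h).1 <;> rfl

theorem proper_config (x : Hex → Bool × HexState) : M.Proper (M.config x) := fun _ hh =>
  ⟨_, config_of_notMem hh⟩

theorem eff_congr {x y : Hex → Bool × HexState} {i : Hex} (h : ∀ k, x (i + dir k) = y (i + dir k))
    (v : Bool × HexState) : eff x i v = eff y i v := by
  unfold eff; simp only [h]

theorem add_dir_ne (i : Hex) (k : Fin 6) : i + dir k ≠ i := by
  simpa using dir_ne_zero k

theorem eff_update_iris {x : Hex → Bool × HexState} {i j : Hex} (hi : i ∈ M.irises)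
    (hj : j ∈ M.irises) (u v : Bool × HexState) : eff (Function.update x j u) i v = eff x i v :=
  eff_congr (fun k => Function.update_of_ne (fun e => petal_notMem hi k (by rw [e]; exact hj)) _ _) v

theorem config_update_iris {x : Hex → Bool × HexState} {i : Hex} (hi : i ∈ M.irises)
    (v : Bool × HexState) :
    M.config (Function.update x i v) = Function.update (M.config x) i (eff x i v) := by
  funext h
  by_cases hh : h = i
  · subst hh
    rw [config_iris hi, eff_update_iris hi hi, Function.update_self, Function.update_self]
  · rw [Function.update_of_ne hh]
    by_cases h' : h ∈ M.irises
    · rw [config_iris h', config_iris h', eff_update_iris h' hi, Function.update_of_ne hh]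
    · rw [config_of_notMem h', config_of_notMem h', Function.update_of_ne hh]

/-- The states of an iris, ordered from yellow to blue with the mixed states in between. -/
def StateLE (σ σ' : HexState) : Prop := σ = .yellow ∨ σ' = .blue ∨ σ = σ'

variable (M)

/-- The functions that increase with the states of the irises when the petals are fixed. -/
def IrisMono (F : (Hex → Bool × HexState) → ℝ) : Prop :=
  ∀ i ∈ M.irises, ∀ x u u', StateLE (eff x i u) (eff x i u') →
    F (Function.update x i u) ≤ F (Function.update x i u')

/-- The functions that increase with the coins of the petals and fillers. -/
def CoinMono (F : (Hex → Bool × HexState) → ℝ) : Prop :=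
  ∀ h ∉ M.irises, ∀ x (u u' : Bool × HexState), (u.1 = true → u'.1 = true) →
    F (Function.update x h u) ≤ F (Function.update x h u')

variable {M}

theorem IrisMono.resample {F : (Hex → Bool × HexState) → ℝ} (hF : M.IrisMono F) {j : Hex}
    (hj : j ∈ M.irises) : M.IrisMono (resample (coin.prod M.irisLaw) j F) := by
  intro i hi x u u' h
  refine Finset.sum_le_sum fun v _ => mul_le_mul_of_nonneg_left ?_ measureReal_nonneg
  by_cases hij : j = i
  · subst hij; rw [Function.update_idem, Function.update_idem]
  · rw [Function.update_comm (Ne.symm hij), Function.update_comm (Ne.symm hij)]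
    refine hF i hi _ u u' ?_
    rwa [eff_update_iris hi hj, eff_update_iris hi hj]

theorem CoinMono.resample {F : (Hex → Bool × HexState) → ℝ} (hF : M.CoinMono F) (j : Hex) :
    M.CoinMono (resample (coin.prod M.irisLaw) j F) := by
  intro i hi x u u' h
  refine Finset.sum_le_sum fun v _ => mul_le_mul_of_nonneg_left ?_ measureReal_nonneg
  by_cases hij : j = i
  · subst hij; rw [Function.update_idem, Function.update_idem]
  · rw [Function.update_comm (Ne.symm hij), Function.update_comm (Ne.symm hij)]
    exact hF i hi _ u u' h

/-- Positive correlation of functions of a coin. -/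
theorem coin_correlation {F G : (Hex → Bool × HexState) → ℝ} {h : Hex} {x : Hex → Bool × HexState}
    {fT fF gT gF : ℝ} (h1 : ∀ σ, F (Function.update x h (true, σ)) = fT)
    (h2 : ∀ σ, F (Function.update x h (false, σ)) = fF)
    (h3 : ∀ σ, G (Function.update x h (true, σ)) = gT)
    (h4 : ∀ σ, G (Function.update x h (false, σ)) = gF) (h5 : fF ≤ fT) (h6 : gF ≤ gT) :
    resample (coin.prod M.irisLaw) h F x * resample (coin.prod M.irisLaw) h G x ≤
      resample (coin.prod M.irisLaw) h (F * G) x := by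
  have hs := M.sum_eq_one
  have e : ∀ {F : (Hex → Bool × HexState) → ℝ} {fT fF : ℝ},
      (∀ σ, F (Function.update x h (true, σ)) = fT) →
      (∀ σ, F (Function.update x h (false, σ)) = fF) →
      BondTriangular.resample (coin.prod M.irisLaw) h F x = 1 / 2 * (fT + fF) := by
    intro F fT fF h1 h2
    rw [M.resample_eq, sum_hexState]
    simp only [h1, h2, weight]
    linear_combination (1 / 2 * (fT + fF)) * hs
  rw [e h1 h2, e h3 h4, e (F := F * G) (fT := fT * gT) (fF := fF * gF)
    (fun σ => by rw [Pi.mul_apply, h1, h3]) (fun σ => by rw [Pi.mul_apply, h2, h4])]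
  nlinarith [mul_nonneg (sub_nonneg.2 h5) (sub_nonneg.2 h6)]

theorem IrisMono.correlation {F G : (Hex → Bool × HexState) → ℝ} (hF : M.IrisMono F)
    (hG : M.IrisMono G) {i : Hex} (hi : i ∈ M.irises) :
    BondTriangular.resample (coin.prod M.irisLaw) i F *
      BondTriangular.resample (coin.prod M.irisLaw) i G ≤
      BondTriangular.resample (coin.prod M.irisLaw) i (F * G) := by
  intro x
  rw [Pi.mul_apply]
  have eqF : ∀ {F : (Hex → Bool × HexState) → ℝ}, M.IrisMono F → ∀ u u', eff x i u = eff x i u' →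
      F (Function.update x i u) = F (Function.update x i u') := fun hF u u' h =>
    le_antisymm (hF i hi x u u' (Or.inr (Or.inr h))) (hF i hi x u' u (Or.inr (Or.inr h.symm)))
  by_cases ht : IsTrigger fun k => (x (i + dir k)).1
  · have he : ∀ v, eff x i v = mono v.1 := fun v => by unfold eff; rw [if_pos ht]
    refine coin_correlation (fT := F (Function.update x i (true, .blue)))
      (fF := F (Function.update x i (false, .blue))) (gT := G (Function.update x i (true, .blue)))
      (gF := G (Function.update x i (false, .blue)))
      (fun σ => eqF hF _ _ (by rw [he, he])) (fun σ => eqF hF _ _ (by rw [he, he]))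
      (fun σ => eqF hG _ _ (by rw [he, he])) (fun σ => eqF hG _ _ (by rw [he, he]))
      (hF i hi x _ _ (Or.inl (by rw [he]; rfl))) (hG i hi x _ _ (Or.inl (by rw [he]; rfl)))
  · have he : ∀ v, eff x i v = v.2 := fun v => by unfold eff; rw [if_neg ht]
    have e : ∀ {F : (Hex → Bool × HexState) → ℝ}, M.IrisMono F → ∀ b σ,
        F (Function.update x i (b, σ)) = F (Function.update x i (true, σ)) := fun hF b σ =>
      eqF hF _ _ (by rw [he, he])
    have lo : ∀ {F : (Hex → Bool × HexState) → ℝ}, M.IrisMono F → ∀ j,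
        F (Function.update x i (true, .yellow)) ≤ F (Function.update x i (true, .split j)) ∧
        F (Function.update x i (true, .split j)) ≤ F (Function.update x i (true, .blue)) :=
      fun hF j => ⟨hF i hi x _ _ (Or.inl (by rw [he])),
        hF i hi x _ _ (Or.inr (Or.inl (by rw [he])))⟩
    have key := iris_correlation M.a_nonneg M.s_nonneg M.sum_eq_one M.two_mul_sq_le (lo hF 0)
      (lo hF 1) (lo hF 2) (lo hG 0) (lo hG 1) (lo hG 2)
    rw [M.resample_eq, M.resample_eq, M.resample_eq, sum_hexState, sum_hexState, sum_hexState]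
    simp only [Pi.mul_apply, e hF false, e hG false, weight]
    refine le_trans (le_of_eq ?_) (key.trans (le_of_eq ?_)) <;> ring

theorem CoinMono.correlation {F G : (Hex → Bool × HexState) → ℝ} (hF : M.CoinMono F)
    (hG : M.CoinMono G) {h : Hex} (hh : h ∉ M.irises) :
    BondTriangular.resample (coin.prod M.irisLaw) h F *
      BondTriangular.resample (coin.prod M.irisLaw) h G ≤
      BondTriangular.resample (coin.prod M.irisLaw) h (F * G) := by
  intro x
  rw [Pi.mul_apply]
  have e : ∀ {F : (Hex → Bool × HexState) → ℝ}, M.CoinMono F → ∀ b σ,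
      F (Function.update x h (b, σ)) = F (Function.update x h (b, .blue)) := fun hF b σ =>
    le_antisymm (hF h hh x _ _ (by simp)) (hF h hh x _ _ (by simp))
  exact coin_correlation (fun σ => e hF _ σ) (fun σ => e hF _ σ) (fun σ => e hG _ σ)
    (fun σ => e hG _ σ) (hF h hh x _ _ (by simp)) (hG h hh x _ _ (by simp))

/-- The average over an iris, in terms of the configuration. -/
theorem resample_config {G : Config → ℝ} {i : Hex} (hi : i ∈ M.irises)
    (x : Hex → Bool × HexState) :
    BondTriangular.resample (coin.prod M.irisLaw) i (fun x => G (M.config x)) x =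
      if IsTrigger (fun k => (x (i + dir k)).1) then
        1 / 2 * (G (Function.update (M.config x) i .blue) +
          G (Function.update (M.config x) i .yellow))
      else M.a * G (Function.update (M.config x) i .blue) +
        M.a * G (Function.update (M.config x) i .yellow) +
        M.s * G (Function.update (M.config x) i (.split 0)) +
        M.s * G (Function.update (M.config x) i (.split 1)) +
        M.s * G (Function.update (M.config x) i (.split 2)) := by
  rw [M.resample_eq, sum_hexState]
  simp only [config_update_iris hi, weight]
  split_ifs with ht
  · have he : ∀ v, eff x i v = mono v.1 := fun v => by unfold eff; rw [if_pos ht]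
    simp only [he, mono]
    linear_combination (1 / 2 * (G (Function.update (M.config x) i .blue) +
          G (Function.update (M.config x) i .yellow))) * M.sum_eq_one
  · have he : ∀ v, eff x i v = v.2 := fun v => by unfold eff; rw [if_neg ht]
    simp only [he]
    ring

end FlowerModel

/-! ### Positive association, independence and invariance of the law -/

namespace FlowerModel

variable {M : FlowerModel}

theorem lk_of_stateLE : ∀ σ σ' : HexState, σ = .yellow ∨ σ' = .blue ∨ σ = σ' →
    ∀ k, lk true σ k = true → lk true σ' k = true := by
  decide +kernel

theorem irisMono_config {G : Config → ℝ} (hG : ∀ ω ω', M.FLE ω ω' → G ω ≤ G ω') :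
    M.IrisMono fun x => G (M.config x) := by
  intro i hi x u u' h
  simp only [config_update_iris hi]
  have hne : ∀ k : Fin 6, i + dir k ≠ i := add_dir_ne i
  refine hG _ _ (fle_of_flower (i := i) (fun h hh => ?_) (fun j _ hj => ?_) fun _ => ?_)
  · have : h ≠ i := fun e => hh (e ▸ hi)
    rw [Function.update_of_ne this, Function.update_of_ne this]
    exact id
  · rw [Function.update_of_ne hj, Function.update_of_ne hj]
  · rw [Function.update_self, Function.update_self]
    refine linkLE_of_le (fun k hk => ?_) (lk_of_stateLE _ _ h)
    rw [Function.update_of_ne (hne k)] at hk ⊢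
    exact hk

theorem config_congr {x y : Hex → Bool × HexState} {h : Hex} (h1 : x h = y h)
    (h2 : h ∈ M.irises → ∀ k, x (h + dir k) = y (h + dir k)) : M.config x h = M.config y h := by
  by_cases hi : h ∈ M.irises
  · rw [config_iris hi, config_iris hi, eff_congr (h2 hi), h1]
  · rw [config_of_notMem hi, config_of_notMem hi, h1]

/-- The configuration depends on the variable of a petal or filler only through its coin. -/
theorem config_update_coin {h : Hex} (hh : h ∉ M.irises) (x : Hex → Bool × HexState)
    {u u' : Bool × HexState} (hu : u.1 = u'.1) :
    M.config (Function.update x h u) = M.config (Function.update x h u') := by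
  have key : ∀ g, (Function.update x h u g).1 = (Function.update x h u' g).1 := by
    intro g
    by_cases hg : g = h
    · subst hg; simpa using hu
    · rw [Function.update_of_ne hg, Function.update_of_ne hg]
  funext g
  by_cases hg : g ∈ M.irises
  · rw [config_iris hg, config_iris hg]
    have : g ≠ h := fun e => hh (e ▸ hg)
    unfold eff
    simp only [key, Function.update_of_ne this]
  · rw [config_of_notMem hg, config_of_notMem hg, key]

theorem update_coin_petal (x : Hex → Bool × HexState) (i : Hex) (k : Fin 6) (u : Bool × HexState) :
    (fun k' => (Function.update x (i + dir k) u (i + dir k')).1) =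
      Function.update (fun k' => (x (i + dir k')).1) k u.1 := by
  have inj : ∀ k k' : Fin 6, dir k = dir k' → k = k' := by decide
  funext k'
  by_cases h : k' = k
  · subst h; simp
  · rw [Function.update_of_ne h, Function.update_of_ne]
    exact fun e => h (inj _ _ (add_left_cancel e))

/-- The inequality for the averages if a trigger with values `fB`, `fY` turns into another pattern: two
mixed states do at least as well as blue, and the third one as well as yellow. -/
theorem avg_of_trigger {a s fB fY f'B f'Y g₀ g₁ g₂ : ℝ} (hs : 0 ≤ s) (ha : 0 ≤ a)
    (h1 : 2 * a + 3 * s = 1) (hYB : fY ≤ fB) (hB : fB ≤ f'B) (hY : fY ≤ f'Y) (h0 : fB ≤ g₀)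
    (h1' : fB ≤ g₁) (h2 : fY ≤ g₂) :
    1 / 2 * (fB + fY) ≤ a * f'B + a * f'Y + s * g₀ + s * g₁ + s * g₂ := by
  have a1 := mul_le_mul_of_nonneg_left hB ha
  have a2 := mul_le_mul_of_nonneg_left hY ha
  have a3 := mul_le_mul_of_nonneg_left h0 hs
  have a4 := mul_le_mul_of_nonneg_left h1' hs
  have a5 := mul_le_mul_of_nonneg_left h2 hs
  have a6 := mul_le_mul_of_nonneg_left hYB hs
  have e : 1 / 2 * (fB + fY) = a * fB + a * fY + 3 / 2 * (s * fB) + 3 / 2 * (s * fY) := by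
    linear_combination (-(1 / 2) * (fB + fY)) * h1
  linarith

/-- The inequality for the averages if a pattern turns into a trigger with values `f'B`, `f'Y`: two
mixed states do no better than yellow, and the third one no better than blue. -/
theorem avg_to_trigger {a s fB fY f'B f'Y g₀ g₁ g₂ : ℝ} (hs : 0 ≤ s) (ha : 0 ≤ a)
    (h1 : 2 * a + 3 * s = 1) (hYB : f'Y ≤ f'B) (hB : fB ≤ f'B) (hY : fY ≤ f'Y) (h0 : g₀ ≤ f'Y)
    (h1' : g₁ ≤ f'Y) (h2 : g₂ ≤ f'B) :
    a * fB + a * fY + s * g₀ + s * g₁ + s * g₂ ≤ 1 / 2 * (f'B + f'Y) := by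
  have a1 := mul_le_mul_of_nonneg_left hB ha
  have a2 := mul_le_mul_of_nonneg_left hY ha
  have a3 := mul_le_mul_of_nonneg_left h0 hs
  have a4 := mul_le_mul_of_nonneg_left h1' hs
  have a5 := mul_le_mul_of_nonneg_left h2 hs
  have a6 := mul_le_mul_of_nonneg_left hYB hs
  have e : 1 / 2 * (f'B + f'Y) = a * f'B + a * f'Y + 3 / 2 * (s * f'B) + 3 / 2 * (s * f'Y) := by
    linear_combination (-(1 / 2) * (f'B + f'Y)) * h1
  linarith

/-- The average over the states of an iris increases with the coins of its petals. Where the change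
of a petal makes the petals a trigger, or undoes a trigger, this comes from the fact that the mixed
states connect the petals in the right proportions. -/
theorem resample_iris_le {G : Config → ℝ} (hG : ∀ ω ω', M.FLE ω ω' → G ω ≤ G ω') {i : Hex}
    (hi : i ∈ M.irises) (k : Fin 6) (x : Hex → Bool × HexState) (σ σ' : HexState) :
    BondTriangular.resample (coin.prod M.irisLaw) i (fun x => G (M.config x))
        (Function.update x (i + dir k) (false, σ)) ≤
      BondTriangular.resample (coin.prod M.irisLaw) i (fun x => G (M.config x))
        (Function.update x (i + dir k) (true, σ')) := by
  rw [resample_config hi, resample_config hi, update_coin_petal, update_coin_petal]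
  set x₁ := Function.update x (i + dir k) (false, σ) with hx₁
  set x₂ := Function.update x (i + dir k) (true, σ') with hx₂
  set p := Function.update (fun k' => (x (i + dir k')).1) k false with hp
  have hp' : Function.update (fun k' => (x (i + dir k')).1) k true = Function.update p k true := by
    rw [hp, Function.update_idem]
  have hpk : p k = false := by simp [hp]
  have hq₁ : (fun k' => (x₁ (i + dir k')).1) = p := update_coin_petal x i k _
  have hq₂ : (fun k' => (x₂ (i + dir k')).1) = Function.update p k true :=
    (update_coin_petal x i k _).trans hp'
  rw [show ((true, σ') : Bool × HexState).1 = true from rfl, hp']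
  have petal : ∀ (y : Hex → Bool × HexState) (τ : HexState),
      (fun k' => decide (Function.update (M.config y) i τ (i + dir k') = .blue)) =
        fun k' => (y (i + dir k')).1 := by
    intro y τ
    funext k'
    rw [Function.update_of_ne (add_dir_ne i k'), config_of_notMem (petal_notMem hi k')]
    cases (y (i + dir k')).1 <;> rfl
  have le : ∀ τ τ', linkLE p (Function.update p k true) τ τ' = true →
      G (Function.update (M.config x₁) i τ) ≤ G (Function.update (M.config x₂) i τ') := by
    intro τ τ' h
    refine hG _ _ (fle_of_flower (i := i) (fun g hg => ?_) (fun j hj hji => ?_) fun _ => ?_)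
    · have : g ≠ i := fun e => hg (e ▸ hi)
      rw [Function.update_of_ne this, Function.update_of_ne this, config_of_notMem hg,
        config_of_notMem hg]
      by_cases hgk : g = i + dir k
      · subst hgk; intro; simp [hx₂, mono]
      · rw [hx₁, hx₂, Function.update_of_ne hgk, Function.update_of_ne hgk]; exact id
    · rw [Function.update_of_ne hji, Function.update_of_ne hji]
      have hne : ∀ g, Near j g → g ≠ i + dir k := by
        rintro g h rfl
        exact hji (iris_unique hj hi h (near_add_dir i k))
      refine config_congr ?_ fun _ k' => ?_
      · rw [hx₁, hx₂, Function.update_of_ne (hne _ (Near.refl _)),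
          Function.update_of_ne (hne _ (Near.refl _))]
      · rw [hx₁, hx₂, Function.update_of_ne (hne _ (near_add_dir _ _)),
          Function.update_of_ne (hne _ (near_add_dir _ _))]
    · rw [petal, petal, hq₁, hq₂, Function.update_self, Function.update_self]
      exact h
  have hpp : ∀ k', p k' = true → Function.update p k true k' = true := by
    intro k' h
    by_cases e : k' = k
    · subst e; simp
    · rwa [Function.update_of_ne e]
  have same : ∀ τ, G (Function.update (M.config x₁) i τ) ≤ G (Function.update (M.config x₂) i τ) :=
    fun τ => le _ _ (linkLE_of_le hpp fun _ => id)
  have low : ∀ τ, G (Function.update (M.config x₁) i .yellow) ≤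
      G (Function.update (M.config x₂) i τ) :=
    fun τ => le _ _ (linkLE_of_le hpp (lk_of_stateLE _ _ (Or.inl rfl)))
  have high : ∀ τ, G (Function.update (M.config x₁) i τ) ≤
      G (Function.update (M.config x₂) i .blue) :=
    fun τ => le _ _ (linkLE_of_le hpp (lk_of_stateLE _ _ (Or.inr (Or.inl rfl))))
  have one : ∀ y : Hex → Bool × HexState, G (Function.update (M.config y) i .yellow) ≤
      G (Function.update (M.config y) i .blue) := by
    intro y
    refine hG _ _ (fle_of_flower (i := i) (fun g hg => ?_) (fun j _ hji => ?_) fun _ => ?_)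
    · have : g ≠ i := fun e => hg (e ▸ hi)
      rw [Function.update_of_ne this, Function.update_of_ne this]; exact id
    · rw [Function.update_of_ne hji, Function.update_of_ne hji]
    · rw [petal, petal, Function.update_self, Function.update_self]
      exact linkLE_of_le (fun _ => id) (lk_of_stateLE _ _ (Or.inl rfl))
  have ha := M.a_nonneg
  have hs := M.s_nonneg
  have h1 := M.sum_eq_one
  -- the cases: trigger before and after, only before, only after, at neither time
  split_ifs with t₁ t₂ t₂
  · linarith [same .blue, same .yellow]
  · obtain ⟨j, hj, hj'⟩ := linkLE_of_trigger p k ⟨t₁, hpk⟩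
    have k1 := le _ _ hj
    have k2 := le _ _ hj'
    have A := @avg_of_trigger M.a M.s _ _ _ _ _ _
      (G (Function.update (M.config x₂) i (.split (j + 2)))) hs ha h1 (one x₁) (same .blue)
      (same .yellow) k1 k2 (low _)
    fin_cases j
    · exact A.trans (le_of_eq (by simp only [Fin.zero_eta, Fin.reduceAdd]))
    · exact A.trans (le_of_eq (by
        simp only [Fin.mk_one, Fin.isValue, Fin.reduceAdd]; ring))
    · exact A.trans (le_of_eq (by simp only [Fin.reduceFinMk, Fin.isValue, Fin.reduceAdd]; ring))
  · obtain ⟨j, hj, hj'⟩ := linkLE_to_trigger p k ⟨t₂, hpk⟩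
    have k1 := le _ _ hj
    have k2 := le _ _ hj'
    have A := @avg_to_trigger M.a M.s _ _ _ _ _ _
      (G (Function.update (M.config x₁) i (.split j))) hs ha h1 (one x₂) (same .blue)
      (same .yellow) k1 k2 (high _)
    refine le_trans (le_of_eq ?_) A
    fin_cases j
    · simp only [Fin.zero_eta, Fin.reduceAdd]; ring
    · simp only [Fin.mk_one, Fin.isValue, Fin.reduceAdd]; ring
    · simp only [Fin.reduceFinMk, Fin.isValue, Fin.reduceAdd]
  · have e : ∀ τ, M.a * G (Function.update (M.config x₁) i τ) ≤
        M.a * G (Function.update (M.config x₂) i τ) := fun τ =>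
      mul_le_mul_of_nonneg_left (same τ) ha
    have e' : ∀ τ, M.s * G (Function.update (M.config x₁) i τ) ≤
        M.s * G (Function.update (M.config x₂) i τ) := fun τ =>
      mul_le_mul_of_nonneg_left (same τ) hs
    linarith [e .blue, e .yellow, e' (.split 0), e' (.split 1), e' (.split 2)]

theorem dependsOn_config {α : Type*} {G : Config → α} {S : Set Hex} (hS : M.Saturated S)
    (hG : DependsOn G S) : DependsOn (fun x => G (M.config x)) S := by
  intro x y h
  refine hG fun g hg => config_congr (h g hg) fun hi k => h _ ?_
  rw [← hS, base_petal hi]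
  exact hg

/-- The average over all irises that matter increases with the coins. -/
theorem coinMono_resampleList {G : Config → ℝ} (hG : ∀ ω ω', M.FLE ω ω' → G ω ≤ G ω') {S : Set Hex}
    (hS : M.Saturated S) (hGS : DependsOn G S) {l : List Hex}
    (hl : ∀ i, i ∈ l ↔ i ∈ M.irises ∧ i ∈ S) :
    M.CoinMono (resampleList (coin.prod M.irisLaw) l fun x => G (M.config x)) := by
  rintro h hh x ⟨b, σ⟩ ⟨b', σ'⟩ hu
  have hhl : h ∉ l := fun e => hh ((hl h).1 e).1
  rw [resampleList_update hhl, resampleList_update hhl]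
  by_cases hb : b = b'
  · refine resampleList_mono (fun y => le_of_eq ?_) x
    simp only
    rw [config_update_coin hh y (u := (b, σ)) (u' := (b', σ')) hb]
  obtain ⟨rfl, rfl⟩ : b = false ∧ b' = true := by
    cases b <;> cases b' <;> simp_all
  by_cases hhS : h ∈ S
  · rcases base_cases (M := M) h with ⟨h1, h2⟩ | ⟨h1, h2⟩
    · rw [near_iff] at h2
      obtain h2 | ⟨k, h2⟩ := h2
      · exact (hh (h2 ▸ h1)).elim
      have hbl : M.base h ∈ l := (hl _).2 ⟨h1, (hS h).2 hhS⟩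
      rw [← resampleList_update hhl (false, σ) fun x => G (M.config x),
        ← resampleList_update hhl (true, σ') fun x => G (M.config x), ← resampleList_of_mem hbl,
        resampleList_update hhl, resampleList_update hhl]
      refine resampleList_mono (fun y => ?_) x
      generalize M.base h = i at h1 h2 hbl
      subst h2
      exact resample_iris_le hG h1 k y _ _
    · refine resampleList_mono (fun y => hG _ _ (fle_of_flower (i := h) (fun g hg => ?_)
        (fun j hj _ => ?_) fun hi => (hh hi).elim)) x
      · rw [config_of_notMem hg, config_of_notMem hg]
        by_cases e : g = h
        · subst e; intro; simp [mono]
        · rw [Function.update_of_ne e, Function.update_of_ne e]; exact id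
      · have hne : ∀ g, Near j g → g ≠ h := by
          rintro g e rfl
          exact h2 j hj e
        refine config_congr ?_ fun _ k' => ?_
        · rw [Function.update_of_ne (hne _ (Near.refl _)), Function.update_of_ne (hne _ (Near.refl _))]
        · rw [Function.update_of_ne (hne _ (near_add_dir _ _)),
            Function.update_of_ne (hne _ (near_add_dir _ _))]
  · refine resampleList_mono (fun y => le_of_eq (dependsOn_config hS hGS fun g hg => ?_)) x
    have e : g ≠ h := fun e => hhS (e ▸ hg)
    rw [Function.update_of_ne e, Function.update_of_ne e]

end FlowerModel

/-- The event `A` depends only on the states of the hexagons in `S`. -/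
def Local (A : Set Config) (S : Set Hex) : Prop := DependsOn (fun ω => ω ∈ A) S

theorem Local.mono {A : Set Config} {S S' : Set Hex} (h : Local A S) (hS : S ⊆ S') : Local A S' :=
  DependsOn.mono hS h

theorem Local.iff {A : Set Config} {S : Set Hex} (h : Local A S) {ω ω' : Config}
    (hω : ∀ h ∈ S, ω h = ω' h) : ω ∈ A ↔ ω' ∈ A := iff_of_eq (h hω)

theorem Local.inter {A B : Set Config} {S S' : Set Hex} (h : Local A S) (h' : Local B S') :
    Local (A ∩ B) (S ∪ S') := fun _ _ e => propext (and_congr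
  (h.iff fun g hg => e g (Or.inl hg)) (h'.iff fun g hg => e g (Or.inr hg)))

theorem Local.compl {A : Set Config} {S : Set Hex} (h : Local A S) : Local Aᶜ S :=
  fun _ _ e => propext (not_congr (h.iff e))

theorem Local.measurableSet {A : Set Config} {S : Set Hex} (h : Local A S) (hS : S.Finite) :
    MeasurableSet A := by
  have := hS.to_subtype
  have e : A = S.domRestrict ⁻¹' (S.domRestrict '' A : Set (S → HexState)) := by
    refine Set.Subset.antisymm (Set.subset_preimage_image _ _) ?_
    rintro ω ⟨ω', h1, h2⟩
    exact (h.iff fun g hg => congrFun h2 ⟨g, hg⟩).1 h1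
  rw [e]
  exact (measurable_pi_iff.2 fun g => measurable_pi_apply g.1) (Set.toFinite _).measurableSet

theorem Local.preimage {M : FlowerModel} {A : Set Config} {S : Set Hex} (h : Local A S) (g : Sym M) :
    Local (g.act ⁻¹' A) (g.φ ⁻¹' S) := by
  intro ω ω' e
  refine propext (h.iff (ω := g.act ω) (ω' := g.act ω') fun x hx => ?_)
  simp only [Sym.act]
  rw [e]
  simpa using hx

theorem dependsOn_indicator {A : Set Config} {S : Set Hex} (h : Local A S) :
    DependsOn (A.indicator (1 : Config → ℝ)) S := by
  classical
  intro x y e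
  rw [Set.indicator_apply, Set.indicator_apply]
  simp only [h.iff e, Pi.one_apply]

namespace FlowerModel

variable (M : FlowerModel)

theorem law_real {A : Set Config} (hA : MeasurableSet A) :
    M.law.real A = ∫ x, A.indicator (1 : Config → ℝ) (M.config x) ∂M.seedLaw := by
  rw [law, map_measureReal_apply M.measurable_config hA]
  rw [← integral_indicator_one (M.measurable_config hA)]
  rfl

theorem abs_indicator_le (A : Set Config) (ω : Config) : |A.indicator (1 : Config → ℝ) ω| ≤ 1 := by
  by_cases h : ω ∈ A <;> simp [h]

variable {M}

theorem resampleList_indicator {A : Set Config} {S : Set Hex} (hS : M.Saturated S) (hf : S.Finite)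
    (hA : Local A S) {l : List Hex} (hl : ∀ i ∈ S, i ∈ l) (x : Hex → Bool × HexState) :
    resampleList (coin.prod M.irisLaw) l (fun x => A.indicator (1 : Config → ℝ) (M.config x)) x =
      M.law.real A := by
  have hm := hA.measurableSet hf
  rw [M.law_real hm]
  exact resampleList_eq_integral
    ((measurable_const.indicator hm).comp M.measurable_config) (fun x => abs_indicator_le A _)
    (dependsOn_config hS (dependsOn_indicator hA)) hl x

/-- Increasing events that depend on finitely many flowers and fillers are positively
correlated. -/
theorem fkg {A B : Set Config} {S : Set Hex} (hS : M.Saturated S) (hf : S.Finite)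
    (hA : M.Increasing A) (hB : M.Increasing B) (hAS : Local A S) (hBS : Local B S) :
    M.law.real A * M.law.real B ≤ M.law.real (A ∩ B) := by
  classical
  have hmono : ∀ {A : Set Config}, M.Increasing A → ∀ ω ω', M.FLE ω ω' →
      A.indicator (1 : Config → ℝ) ω ≤ A.indicator (1 : Config → ℝ) ω' := by
    intro A hA ω ω' h
    by_cases h1 : ω ∈ A
    · simp [h1, hA ω ω' h h1]
    · rw [Set.indicator_of_notMem h1]
      exact Set.indicator_nonneg (fun _ _ => zero_le_one) _
  set ν := coin.prod M.irisLaw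
  set f : Set Config → (Hex → Bool × HexState) → ℝ := fun A x =>
    A.indicator (1 : Config → ℝ) (M.config x) with hfdef
  set l := (hf.toFinset.filter (· ∈ M.irises)).toList with hl
  set l' := (hf.toFinset.filter (· ∉ M.irises)).toList with hl'
  have ml : ∀ i, i ∈ l ↔ i ∈ M.irises ∧ i ∈ S := by intro i; simp [hl, and_comm]
  have ml' : ∀ i, i ∈ l' ↔ i ∉ M.irises ∧ i ∈ S := by intro i; simp [hl', and_comm]
  have mll : ∀ i ∈ S, i ∈ l' ++ l := by
    intro i hi
    rw [List.mem_append, ml, ml']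
    by_cases h : i ∈ M.irises <;> simp [h, hi]
  have app : ∀ F : (Hex → Bool × HexState) → ℝ,
      resampleList ν l' (resampleList ν l F) = resampleList ν (l' ++ l) F := by
    intro F; simp [resampleList, List.foldr_append]
  -- correlation over the irises when the petals are fixed, and then over the coins, with the averages
  -- over the irises as increasing functions
  have h1 : resampleList ν l (f A) * resampleList ν l (f B) ≤ resampleList ν l (f A * f B) :=
    resampleList_mul_le (𝒞 := M.IrisMono) (fun i hi F hF => hF.resample ((ml i).1 hi).1)
      (fun i hi F G hF hG => hF.correlation hG ((ml i).1 hi).1) (irisMono_config (hmono hA))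
      (irisMono_config (hmono hB))
  have h2 := resampleList_mul_le (ν := ν) (𝒞 := M.CoinMono) (l := l')
      (fun i _ F hF => hF.resample i) (fun i hi F G hF hG => hF.correlation hG ((ml' i).1 hi).1)
      (coinMono_resampleList (hmono hA) hS (dependsOn_indicator hAS) ml)
      (coinMono_resampleList (hmono hB) hS (dependsOn_indicator hBS) ml)
  have h3 := h2.trans (resampleList_mono h1) (fun _ => (true, .blue))
  rw [Pi.mul_apply, app, app, app] at h3
  have e : f A * f B = f (A ∩ B) := by
    funext x
    simp only [hfdef, Pi.mul_apply, Set.inter_indicator_one]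
  have hAB : Local (A ∩ B) S := (hAS.inter hBS).mono (by simp)
  rw [e, resampleList_indicator hS hf hAS mll, resampleList_indicator hS hf hBS mll,
    resampleList_indicator hS hf hAB mll] at h3
  exact h3

/-- Events that depend on disjoint sets of flowers and fillers are independent. -/
theorem indep {A B : Set Config} {S : Set Hex} (hS : M.Saturated S) (hf : S.Finite)
    (hA : Local A S) (hB : MeasurableSet B) (hBS : Local B Sᶜ) :
    M.law.real (A ∩ B) = M.law.real A * M.law.real B := by
  have hm := hA.measurableSet hf
  have hS' : M.Saturated Sᶜ := fun h => not_congr (hS h)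
  set ν := coin.prod M.irisLaw with hν
  set l := hf.toFinset.toList with hl
  have ml : ∀ i, i ∈ l ↔ i ∈ S := by intro i; simp [hl]
  set f : Set Config → (Hex → Bool × HexState) → ℝ := fun A x =>
    A.indicator (1 : Config → ℝ) (M.config x) with hfdef
  have hfm : ∀ {A : Set Config}, MeasurableSet A → Measurable (f A) := fun h =>
    (measurable_const.indicator h).comp M.measurable_config
  have e : f B * f A = f (A ∩ B) := by
    funext x
    simp only [hfdef, Pi.mul_apply, Set.inter_indicator_one, mul_comm]
  have key : resampleList ν l (f (A ∩ B)) = fun x => f B x * M.law.real A := by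
    rw [← e, resampleList_mul_left (S := Sᶜ) (dependsOn_config hS' (dependsOn_indicator hBS))
      fun i hi => not_not.2 ((ml i).1 hi)]
    funext x
    rw [Pi.mul_apply, resampleList_indicator hS hf hA fun i hi => (ml i).2 hi]
  rw [M.law_real (hm.inter hB), M.law_real hB]
  have h := integral_resampleList (ν := ν) (l := l) (hfm (hm.inter hB)) (C := 1)
    (fun x => abs_indicator_le (A ∩ B) _)
  rw [key, integral_mul_const] at h
  rw [mul_comm]
  exact h.symm

end FlowerModel

theorem isTrigger_symm : ∀ (p : Fin 6 → Bool) (r : Fin 6) (f : Bool),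
    IsTrigger (fun k => (p (k - r) ^^ f)) ↔ IsTrigger p := by
  decide +kernel

namespace Sym

variable {M : FlowerModel} (g : Sym M)

/-- The map of the variables that goes with a symmetry. -/
def seedMap (u : Bool × HexState) : Bool × HexState := (u.1 ^^ g.f, g.st u.2)

/-- The action of a symmetry on families of variables. -/
def seed (x : Hex → Bool × HexState) : Hex → Bool × HexState := fun h => g.seedMap (x (g.φ.symm h))

theorem seed_apply (x : Hex → Bool × HexState) (h : Hex) :
    g.seed x (g.φ h) = g.seedMap (x h) := by simp [seed]

theorem config_seed (x : Hex → Bool × HexState) : M.config (g.seed x) = g.act (M.config x) := by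
  funext h
  obtain ⟨h, rfl⟩ := g.φ.surjective h
  rw [act_apply]
  by_cases hi : h ∈ M.irises
  · rw [FlowerModel.config_iris hi, FlowerModel.config_iris ((g.mem_irises _).2 hi), seed_apply]
    have e : (fun k => (g.seed x (g.φ h + dir k)).1) =
        fun k => ((fun k => (x (h + dir k)).1) (k - g.r) ^^ g.f) := by
      funext k
      have : g.φ h + dir k = g.φ (h + dir (k - g.r)) := by rw [g.map_dir, sub_add_cancel]
      rw [this, seed_apply]
      rfl
    unfold FlowerModel.eff
    have ht := isTrigger_symm (fun k => (x (h + dir k)).1) g.r g.f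
    rw [e]
    by_cases h' : IsTrigger fun k => (x (h + dir k)).1
    · rw [if_pos h', if_pos (ht.2 h'), g.st_mono]; rfl
    · rw [if_neg h', if_neg (mt ht.1 h')]; rfl
  · rw [FlowerModel.config_of_notMem hi,
      FlowerModel.config_of_notMem (mt (g.mem_irises _).1 hi), seed_apply, g.st_mono]
    rfl

theorem measurable_seed : Measurable g.seed :=
  measurable_pi_iff.2 fun _ => (Measurable.of_discrete (f := g.seedMap)).comp (measurable_pi_apply _)

theorem map_seedMap : (coin.prod M.irisLaw).map g.seedMap = coin.prod M.irisLaw := by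
  have inj : Function.Injective g.seedMap := by
    rintro ⟨b, σ⟩ ⟨b', σ'⟩ h
    simp only [seedMap, Prod.mk.injEq, Bool.xor_left_inj, EmbeddingLike.apply_eq_iff_eq] at h
    rw [h.1, h.2]
  refine Measure.ext_of_singleton fun u => ?_
  obtain ⟨⟨b, σ⟩, rfl⟩ := (Finite.injective_iff_surjective.1 inj) u
  rw [Measure.map_apply Measurable.of_discrete (measurableSet_singleton _),
    ← Set.image_singleton, inj.preimage_image]
  have e : ∀ b σ, (coin.prod M.irisLaw) {((b, σ) : Bool × HexState)} = 2⁻¹ * M.irisLaw {σ} := by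
    intro b σ
    rw [← Set.singleton_prod_singleton, Measure.prod_prod, coin_singleton]
  rw [Set.image_singleton]
  change _ = (coin.prod M.irisLaw) {(b ^^ g.f, g.st σ)}
  rw [e, e, g.law]

theorem map_seedLaw : M.seedLaw.map g.seed = M.seedLaw := by
  refine Measure.eq_infinitePi _ fun s t ht => ?_
  rw [Measure.map_apply g.measurable_seed (MeasurableSet.pi s.countable_toSet fun j _ => ht j)]
  have e : g.seed ⁻¹' (Set.pi s t) =
      Set.pi ((s.map g.φ.symm.toEmbedding : Finset Hex) : Set Hex)
        fun j => g.seedMap ⁻¹' t (g.φ j) := by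
    ext x
    simp only [Set.mem_preimage, Set.mem_pi, Finset.mem_coe, seed, Finset.mem_map_equiv,
      Equiv.symm_symm]
    rw [g.φ.surjective.forall]
    simp only [g.φ.symm_apply_apply]
  rw [e, FlowerModel.seedLaw, Measure.infinitePi_pi _ fun j _ =>
    (Measurable.of_discrete (f := g.seedMap)) (ht _), Finset.prod_map]
  refine Finset.prod_congr rfl fun i _ => ?_
  rw [Equiv.coe_toEmbedding, g.φ.apply_symm_apply,
    ← Measure.map_apply Measurable.of_discrete (ht i), g.map_seedMap]

theorem measurable_act : Measurable g.act :=
  measurable_pi_iff.2 fun _ => (Measurable.of_discrete (f := g.st)).comp (measurable_pi_apply _)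

theorem map_law : M.law.map g.act = M.law := by
  conv_rhs => rw [FlowerModel.law, ← g.map_seedLaw]
  rw [FlowerModel.law, Measure.map_map g.measurable_act M.measurable_config,
    Measure.map_map M.measurable_config g.measurable_seed]
  congr 1
  funext x
  exact (g.config_seed x).symm

theorem law_preimage {A : Set Config} (hA : MeasurableSet A) :
    M.law.real (g.act ⁻¹' A) = M.law.real A := by
  conv_rhs => rw [← g.map_law]
  rw [map_measureReal_apply g.measurable_act hA]

end Sym

theorem FlowerModel.law_proper (M : FlowerModel) : ∀ᵐ ω ∂M.law, M.Proper ω := by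
  have h : {ω | M.Proper ω} = ⋂ h : Hex, {ω | h ∉ M.irises → ∃ c, ω h = mono c} := by
    ext ω; simp [Proper]
  have hm : MeasurableSet {ω | M.Proper ω} := by
    rw [h]
    refine MeasurableSet.iInter fun h => ?_
    have := (measurable_pi_apply (X := fun _ : Hex => HexState) h) (MeasurableSet.of_discrete
      (s := {σ : HexState | h ∉ M.irises → ∃ c, σ = mono c}))
    exact this
  rw [law, ae_map_iff M.measurable_config.aemeasurable hm]
  exact Filter.Eventually.of_forall fun x => proper_config x

/-! ### Events about blue connections in finite domains -/

namespace FlowerModel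

variable {M : FlowerModel} {c : Bool} {ω ω' : Config} {D : Set Hex}

theorem Conn.congr (hD : M.Saturated D) (h : ∀ g ∈ D, ω g = ω' g) {a b : Hex}
    (hc : M.Conn c ω D a b) : M.Conn c ω' D a b := by
  obtain ⟨h1, h2, h3⟩ := hc
  have e : ∀ {g}, g ∈ D → M.IsCol c ω g → M.IsCol c ω' g := fun hg hc => ⟨hc.1, by
    rw [← h _ hg]; exact hc.2⟩
  refine ⟨h1, e h1 h2, Relation.ReflTransGen.mono ?_ _ _ h3⟩
  rintro x y ⟨m, d1, d2, c1, c2, h5⟩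
  refine ⟨m, d1, d2, e d1 c1, e d2 c2, h5.imp_right ?_⟩
  intro hl
  have hm : m ∈ D := by rw [← hl.base_left, hD]; exact d1
  obtain ⟨hi, k, k', rfl, rfl, l1, l2⟩ := hl
  exact ⟨hi, k, k', rfl, rfl, by rwa [← h m hm], by rwa [← h m hm]⟩

variable (M)

/-- The event `A` is expressed monotonically by blue connections in saturated subsets of `S`. -/
def UpIn (A : Set Config) (S : Set Hex) : Prop := ∀ ω ω' : Config,
  (∀ D, M.Saturated D → D ⊆ S → ∀ a b, M.Conn true ω D a b → M.Conn true ω' D a b) →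
    ω ∈ A → ω' ∈ A

/-- The event `A` is expressed monotonically by blue connections in a finite domain. -/
def Up (A : Set Config) : Prop := ∃ S, M.Saturated S ∧ S.Finite ∧ M.UpIn A S

variable {M} {A B : Set Config} {S S' : Set Hex}

theorem UpIn.mono (h : M.UpIn A S) (hS : S ⊆ S') : M.UpIn A S' := fun ω ω' hω =>
  h ω ω' fun D h1 h2 => hω D h1 (h2.trans hS)

theorem UpIn.inter (h : M.UpIn A S) (h' : M.UpIn B S) : M.UpIn (A ∩ B) S := fun ω ω' hω hA =>
  ⟨h ω ω' hω hA.1, h' ω ω' hω hA.2⟩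

theorem UpIn.increasing (h : M.UpIn A S) : M.Increasing A := fun ω ω' hω =>
  h ω ω' fun _ hD _ _ _ hc => hc.of_fle hD hω

theorem UpIn.local (h : M.UpIn A S) : Local A S := fun ω ω' hω => propext
  ⟨h ω ω' fun _ hD hS _ _ hc => hc.congr hD fun g hg => hω g (hS hg),
    h ω' ω fun _ hD hS _ _ hc => hc.congr hD fun g hg => (hω g (hS hg)).symm⟩

theorem Saturated.preimage (hS : M.Saturated S) (g : Sym M) : M.Saturated (g.φ ⁻¹' S) := by
  intro h
  rw [Set.mem_preimage, ← g.base, hS, Set.mem_preimage]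

theorem UpIn.preimage (h : M.UpIn A S) (g : Sym M) (hf : g.f = false) :
    M.UpIn (g.act ⁻¹' A) (g.φ ⁻¹' S) := by
  intro ω ω' hω hA
  refine h _ _ (fun D hD hDS a b hc => ?_) hA
  obtain ⟨a, rfl⟩ := g.φ.surjective a
  obtain ⟨b, rfl⟩ := g.φ.surjective b
  rw [g.conn_of_f hf] at hc ⊢
  exact hω _ (hD.preimage g) (Set.preimage_mono hDS) _ _ hc

theorem Up.inter (h : M.Up A) (h' : M.Up B) : M.Up (A ∩ B) := by
  obtain ⟨S, h1, h2, h3⟩ := h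
  obtain ⟨S', h1', h2', h3'⟩ := h'
  exact ⟨S ∪ S', fun g => or_congr (h1 g) (h1' g), h2.union h2',
    (h3.mono Set.subset_union_left).inter (h3'.mono Set.subset_union_right)⟩

theorem Up.preimage (h : M.Up A) (g : Sym M) (hf : g.f = false) : M.Up (g.act ⁻¹' A) := by
  obtain ⟨S, h1, h2, h3⟩ := h
  exact ⟨_, h1.preimage g, h2.preimage g.φ.injective.injOn, h3.preimage g hf⟩

theorem Up.measurableSet (h : M.Up A) : MeasurableSet A := by
  obtain ⟨S, h1, h2, h3⟩ := h
  exact h3.local.measurableSet h2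

theorem Up.fkg (h : M.Up A) (h' : M.Up B) :
    M.law.real A * M.law.real B ≤ M.law.real (A ∩ B) := by
  obtain ⟨S, h1, h2, h3⟩ := h
  obtain ⟨S', h1', h2', h3'⟩ := h'
  exact FlowerModel.fkg (S := S ∪ S') (fun g => or_congr (h1 g) (h1' g)) (h2.union h2')
    h3.increasing h3'.increasing (h3.local.mono Set.subset_union_left)
    (h3'.local.mono Set.subset_union_right)

/-- The law of a preimage, in the form of a bound. -/
theorem Up.le_preimage (h : M.Up A) (g : Sym M) {p : ℝ} (hp : p ≤ M.law.real A) :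
    p ≤ M.law.real (g.act ⁻¹' A) := by
  rwa [g.law_preimage h.measurableSet]

theorem Up.le_inter (h : M.Up A) (h' : M.Up B) {p q : ℝ} (hp : 0 ≤ p) (h1 : p ≤ M.law.real A)
    (h2 : q ≤ M.law.real B) : p * q ≤ M.law.real (A ∩ B) :=
  (mul_le_mul_of_nonneg_left h2 hp).trans
    ((mul_le_mul_of_nonneg_right h1 measureReal_nonneg).trans (h.fkg h'))

theorem Up.univ : M.Up (Set.univ : Set Config) :=
  ⟨∅, fun _ => Iff.rfl, Set.finite_empty, fun _ _ _ _ => trivial⟩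

theorem Up.le_iInter {p : ℝ} (hp : 0 ≤ p) (A : ℕ → Set Config) (h : ∀ i, M.Up (A i))
    (hA : ∀ i, p ≤ M.law.real (A i)) (T : ℕ) :
    M.Up {ω | ∀ i < T, ω ∈ A i} ∧ p ^ T ≤ M.law.real {ω | ∀ i < T, ω ∈ A i} := by
  induction T with
  | zero =>
    have e : {ω : Config | ∀ i < 0, ω ∈ A i} = Set.univ := by ext; simp
    rw [e]
    exact ⟨Up.univ, by simp⟩
  | succ T ih =>
    have e : {ω : Config | ∀ i < T + 1, ω ∈ A i} = {ω | ∀ i < T, ω ∈ A i} ∩ A T := by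
      ext ω
      simp only [Set.mem_ofPred_eq, Set.mem_inter_iff, Nat.lt_succ_iff_lt_or_eq, or_imp, forall_and,
        forall_eq]
    rw [e, pow_succ]
    exact ⟨ih.1.inter (h T), ih.1.le_inter (h T) (pow_nonneg hp _) ih.2 (hA T)⟩

theorem real_mono {A B : Set Config} (h : A ⊆ B) : M.law.real A ≤ M.law.real B :=
  measureReal_mono h

theorem finite_hexDom (z : Hex) (n : ℤ) : (M.hexDom z n).Finite := by
  refine ((Set.finite_Icc (z.1 - n - 1) (z.1 + n + 1)).prod
    (Set.finite_Icc (z.2 - n - 1) (z.2 + n + 1))).subset fun h hh => ?_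
  have := coord_base (M := M) h
  simp only [hexDom, Set.mem_ofPred_eq, InHexagon, Prod.fst_sub, Prod.snd_sub] at hh
  simp only [Set.mem_prod, Set.mem_Icc]
  omega

theorem hexDom_subset {z z' : Hex} {n n' : ℤ} (h : InHexagon (n' - n) (z - z')) :
    M.hexDom z n ⊆ M.hexDom z' n' := by
  intro g hg
  simp only [hexDom, Set.mem_ofPred_eq, InHexagon, Prod.fst_sub, Prod.snd_sub] at h hg ⊢
  omega

theorem Big.imp {z : Hex} {n : ℤ} {h : Hex}
    (hω : ∀ a b, M.Conn true ω (M.hexDom z n) a b → M.Conn true ω' (M.hexDom z n) a b)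
    (hh : M.Big true ω z n h) : M.Big true ω' z n h := fun k => by
  obtain ⟨g, hg, hk⟩ := hh k
  exact ⟨g, hω _ _ hg, hk⟩

theorem upIn_chord (z : Hex) (n : ℤ) (k k' : Fin 6) :
    M.UpIn {ω | M.Chord true ω z n k k'} (M.hexDom z n) := by
  rintro ω ω' hω ⟨h, h', h1, h2, h3⟩
  exact ⟨h, h', h1, h2, hω _ (saturated_hexDom z n) subset_rfl _ _ h3⟩

theorem up_of_hexDom {z : Hex} {n : ℤ} (h : M.UpIn A (M.hexDom z n)) : M.Up A :=
  ⟨_, saturated_hexDom z n, finite_hexDom z n, h⟩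

theorem local_chord (c : Bool) (z : Hex) (n : ℤ) (k k' : Fin 6) :
    Local {ω | M.Chord c ω z n k k'} (M.hexDom z n) := by
  have key : ∀ ω ω' : Config, (∀ h ∈ M.hexDom z n, ω h = ω' h) → M.Chord c ω z n k k' →
      M.Chord c ω' z n k k' := by
    rintro ω ω' hω ⟨h, h', h1, h2, h3⟩
    exact ⟨h, h', h1, h2, h3.congr (saturated_hexDom z n) hω⟩
  exact fun ω ω' hω => propext ⟨key ω ω' hω, key ω' ω fun h hh => (hω h hh).symm⟩

/-! ### Clusters that touch all six sectors have a good chance -/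

theorem law_chord_turn {q : Hex} (hq : M.IsPivot q) (n : ℤ) (c : Bool) (k k' : Fin 6) :
    M.law.real {ω | M.Chord (!c) ω q n (k + 1) (k' + 1)} =
      M.law.real {ω | M.Chord c ω q n k k'} := by
  have hz : (Sym.turn hq).φ q = q := by simp [Sym.turn_apply, rot]
  rw [← (Sym.turn hq).law_preimage ((local_chord _ q n _ _).measurableSet (finite_hexDom q n))]
  congr 1
  ext ω
  have := chord_turn (c := c) (ω := ω) (z := q) (n := n) hq k k'
  rw [hz] at this
  exact this

theorem law_chord_symm (z : Hex) (n : ℤ) (c : Bool) (k k' : Fin 6) :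
    M.law.real {ω | M.Chord c ω z n k k'} = M.law.real {ω | M.Chord c ω z n k' k} := by
  congr 1
  ext ω
  exact ⟨Chord.symm, Chord.symm⟩

/-- The four events of `chord_duality` have the same probability around a centre of rotation, since a
sixth of a turn exchanges the colours; so this probability is at least `1 / 4`. -/
theorem law_chord {q : Hex} (hq : M.IsPivot q) {n : ℤ} (hn : 10 ≤ n) (c : Bool) :
    1 / 4 ≤ M.law.real {ω | M.Chord c ω q n 0 2} := by
  have m : ∀ c k k', MeasurableSet {ω | M.Chord c ω q n k k'} := fun c k k' =>
    (local_chord c q n k k').measurableSet (finite_hexDom q n)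
  have h : (1 : ℝ) ≤ M.law.real (({ω | M.Chord c ω q n 0 2} ∪ {ω | M.Chord c ω q n 0 4}) ∪
      ({ω | M.Chord (!c) ω q n 1 3} ∪ {ω | M.Chord (!c) ω q n 1 5})) := by
    have e : M.law.real (({ω | M.Chord c ω q n 0 2} ∪ {ω | M.Chord c ω q n 0 4}) ∪
      ({ω | M.Chord (!c) ω q n 1 3} ∪ {ω | M.Chord (!c) ω q n 1 5})) = M.law.real Set.univ := by
      refine measureReal_congr ?_
      filter_upwards [M.law_proper] with ω hω
      exact propext ⟨fun _ => trivial, fun _ => chord_duality hn hω c q⟩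
    rw [e, probReal_univ]
  have u := (measureReal_union_le (μ := M.law) ({ω | M.Chord c ω q n 0 2} ∪
    {ω | M.Chord c ω q n 0 4}) ({ω | M.Chord (!c) ω q n 1 3} ∪ {ω | M.Chord (!c) ω q n 1 5}))
  have u1 := measureReal_union_le (μ := M.law) {ω | M.Chord c ω q n 0 2} {ω | M.Chord c ω q n 0 4}
  have u2 := measureReal_union_le (μ := M.law) {ω | M.Chord (!c) ω q n 1 3}
    {ω | M.Chord (!c) ω q n 1 5}
  have t := law_chord_turn hq n
  have e1 := t c 0 2
  have e2 := t c 0 4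
  -- the connections between `4` and `0` come from those between `0` and `2` by two thirds of a turn
  have e3 : M.law.real {ω | M.Chord c ω q n 0 4} = M.law.real {ω | M.Chord c ω q n 0 2} := by
    have a1 := t c 0 2
    have a2 := t (!c) 1 3
    have a3 := t c 2 4
    have a4 := t (!c) 3 5
    rw [Bool.not_not] at a2 a4
    rw [law_chord_symm]
    simp only [Fin.isValue, Fin.reduceAdd] at a1 a2 a3 a4
    rw [← a1, ← a2, ← a3, ← a4]
  simp only [Fin.isValue, Fin.reduceAdd, zero_add] at e1 e2
  rw [e1] at u2
  rw [e2] at u2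
  rw [e3] at u1 u2
  linarith

/-- The probability that there is a blue cluster that touches all six sectors: four connections, each of
probability at least `1 / 4`, are positively correlated. -/
theorem law_big {q : Hex} (hq : M.IsPivot q) {n : ℤ} (hn : 10 ≤ n) :
    1 / 256 ≤ M.law.real {ω | ∃ h, M.Big true ω q n h} := by
  have t := law_chord_turn hq n
  have up : ∀ k k', M.Up {ω | M.Chord true ω q n k k'} := fun k k' =>
    up_of_hexDom (upIn_chord q n k k')
  have h0 := law_chord hq hn true
  have h1 : 1 / 4 ≤ M.law.real {ω | M.Chord true ω q n 1 3} := by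
    have := t false 0 2
    simp only [Fin.isValue, Fin.reduceAdd, zero_add, Bool.not_false] at this
    rw [this]; exact law_chord hq hn false
  have h2 : 1 / 4 ≤ M.law.real {ω | M.Chord true ω q n 2 4} := by
    have a1 := t true 0 2
    have a2 := t false 1 3
    simp only [Fin.isValue, Fin.reduceAdd, zero_add, Bool.not_false, Bool.not_true] at a1 a2
    rw [a2, a1]; exact h0
  have h3 : 1 / 4 ≤ M.law.real {ω | M.Chord true ω q n 3 5} := by
    have a1 := t true 1 3
    have a2 := t false 2 4
    simp only [Fin.isValue, Fin.reduceAdd, Bool.not_false, Bool.not_true] at a1 a2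
    rw [a2, a1]; exact h1
  have h := ((up 0 2).inter (up 1 3)).le_inter ((up 2 4).inter (up 3 5)) (by positivity)
    ((up 0 2).le_inter (up 1 3) (by positivity) h0 h1)
    ((up 2 4).le_inter (up 3 5) (by positivity) h2 h3)
  refine le_trans (by norm_num) (h.trans (real_mono ?_))
  rintro ω ⟨⟨a0, a1⟩, a2, a3⟩
  exact exists_big_of_chords hq hn a0 a1 a2 a3

end FlowerModel

/-! ### A grid of centres of symmetry -/

/-- Periods `(m, 0)`, `(0, m)` and a centre of rotation. -/
structure Grid (M : FlowerModel) where
  m : ℤ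
  o : Hex
  pos : 0 < m
  period : ∀ h : Hex, (h + (m, 0) ∈ M.irises ↔ h ∈ M.irises) ∧ (h + (0, m) ∈ M.irises ↔ h ∈ M.irises)
  pivot : M.IsPivot o

namespace Grid

variable {M : FlowerModel} (G : Grid M)

/-- The translates of the centre of rotation by periods. -/
def pts : Set Hex := {q | G.m ∣ q.1 - G.o.1 ∧ G.m ∣ q.2 - G.o.2}

theorem isPeriod {v : Hex} (h1 : G.m ∣ v.1) (h2 : G.m ∣ v.2) : M.IsPeriod v := by
  obtain ⟨x, hx⟩ := h1
  obtain ⟨y, hy⟩ := h2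
  obtain ⟨v1, v2⟩ := v
  simp only at hx hy
  subst hx hy
  have e1 : ∀ x : ℤ, ∀ h : Hex, h + (G.m * x, 0) ∈ M.irises ↔ h ∈ M.irises := by
    intro x
    induction x with
    | zero => intro h; rw [mul_zero, show ((0, 0) : Hex) = 0 from rfl, add_zero]
    | succ i ih =>
      intro h
      rw [← ih h, ← (G.period (h + (G.m * i, 0))).1, add_assoc]
      simp [mul_add]
    | pred i ih =>
      intro h
      rw [← ih h, ← (G.period (h + (G.m * (-i - 1), 0))).1, add_assoc]
      simp [mul_sub]
  have e2 : ∀ y : ℤ, ∀ h : Hex, h + (0, G.m * y) ∈ M.irises ↔ h ∈ M.irises := by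
    intro x
    induction x with
    | zero => intro h; rw [mul_zero, show ((0, 0) : Hex) = 0 from rfl, add_zero]
    | succ i ih =>
      intro h
      rw [← ih h, ← (G.period (h + (0, G.m * i))).2, add_assoc]
      simp [mul_add]
    | pred i ih =>
      intro h
      rw [← ih h, ← (G.period (h + (0, G.m * (-i - 1)))).2, add_assoc]
      simp [mul_sub]
  intro h
  rw [← e1 x h, ← e2 y (h + (G.m * x, 0)), add_assoc]
  simp

theorem isPivot {q : Hex} (hq : q ∈ G.pts) : M.IsPivot q := by
  obtain ⟨v, rfl⟩ : ∃ v, q = G.o + v := ⟨q - G.o, by abel⟩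
  obtain ⟨h1, h2⟩ := hq
  simp only [Prod.fst_add, Prod.snd_add, add_sub_cancel_left] at h1 h2
  intro h
  have hv : M.IsPeriod (v - rot v) := G.isPeriod (by
      simp only [rot, Prod.fst_sub, sub_neg_eq_add]; exact dvd_add h1 h2)
    (by simpa [rot] using h1)
  have e : G.o + v + rot (h - (G.o + v)) = G.o + rot (h - G.o) + (v - rot v) := by
    rw [← sub_sub, rot_sub]; abel
  rw [e, hv, G.pivot]

theorem o_mem : G.o ∈ G.pts := by simp [pts]

theorem add_mem {q v : Hex} (hq : q ∈ G.pts) (h1 : G.m ∣ v.1) (h2 : G.m ∣ v.2) : q + v ∈ G.pts := by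
  refine ⟨?_, ?_⟩
  · rw [Prod.fst_add, add_sub_right_comm]; exact dvd_add hq.1 h1
  · rw [Prod.snd_add, add_sub_right_comm]; exact dvd_add hq.2 h2

theorem sub_period {q q' : Hex} (hq : q ∈ G.pts) (hq' : q' ∈ G.pts) : M.IsPeriod (q' - q) :=
  G.isPeriod (by simpa using dvd_sub hq'.1 hq.1) (by simpa using dvd_sub hq'.2 hq.2)

/-- The model has a grid of centres of symmetry. -/
theorem exists_grid (M : FlowerModel) : Nonempty (Grid M) := by
  obtain ⟨m, hm, h⟩ := M.periodic
  obtain ⟨o, ho⟩ := M.rotation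
  exact ⟨⟨m, o, hm, h, ho⟩⟩

end Grid

namespace FlowerModel

variable {M : FlowerModel} {c : Bool} {ω : Config} {z v : Hex} {n : ℤ}

theorem mem_hexDom_translation (hv : M.IsPeriod v) (h : Hex) :
    h + v ∈ M.hexDom (z + v) n ↔ h ∈ M.hexDom z n := by
  have := (Sym.translation hv).base h
  rw [Sym.translation_apply, Sym.translation_apply] at this
  simp only [hexDom, Set.mem_ofPred_eq, this, add_sub_add_right_eq_sub]

theorem mem_sector_translation (hv : M.IsPeriod v) (k : Fin 6) (h : Hex) :
    h + v ∈ M.sector (z + v) n k ↔ h ∈ M.sector z n k := by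
  have := (Sym.translation hv).base h
  rw [Sym.translation_apply, Sym.translation_apply] at this
  simp only [sector, Set.mem_ofPred_eq, this, add_sub_add_right_eq_sub]

theorem conn_translation (hv : M.IsPeriod v) {D D' : Set Hex} (hD : ∀ h, h + v ∈ D' ↔ h ∈ D)
    (a b : Hex) :
    M.Conn c ((Sym.translation hv).act ω) D' (a + v) (b + v) ↔ M.Conn c ω D a b := by
  have := (Sym.translation hv).conn_of_f rfl c ω D' a b
  rw [Sym.translation_apply, Sym.translation_apply] at this
  rw [this, show (Sym.translation hv).φ ⁻¹' D' = D from Set.ext hD]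

theorem near_add (a b v : Hex) : Near (a + v) (b + v) ↔ Near a b := by
  simp [Near]

theorem touch_translation (hv : M.IsPeriod v) (k : Fin 6) (h : Hex) :
    M.Touch (z + v) n k (h + v) ↔ M.Touch z n k h := by
  unfold Touch
  rw [(Equiv.addRight v).surjective.exists]
  refine exists_congr fun g => ?_
  rw [Equiv.coe_addRight, near_add, mem_sector_translation hv]

theorem big_translation (hv : M.IsPeriod v) (h : Hex) :
    M.Big c ((Sym.translation hv).act ω) (z + v) n (h + v) ↔ M.Big c ω z n h := by
  unfold Big
  refine forall_congr' fun k => ?_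
  rw [(Equiv.addRight v).surjective.exists]
  refine exists_congr fun g => ?_
  rw [Equiv.coe_addRight, touch_translation hv,
    conn_translation hv fun h => mem_hexDom_translation hv h]

end FlowerModel

/-! ### Links between large clusters -/

namespace Sym

variable {M : FlowerModel}

/-- A symmetry that preserves the colours and the hexagonal domains with their sectors, up to a
permutation of the sectors. -/
structure Rigid (g : Sym M) : Prop where
  f_eq : g.f = false
  dom : ∀ z n, g.φ ⁻¹' M.hexDom (g.φ z) n = M.hexDom z n
  big : ∀ ω z n h, M.Big true (g.act ω) (g.φ z) n (g.φ h) ↔ M.Big true ω z n h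

theorem rigid_third {q : Hex} (hq : M.IsPivot q) : (third hq).Rigid where
  f_eq := rfl
  dom _ _ := Set.ext fun h => (FlowerModel.mem_hexDom_turn hq _).trans
    (FlowerModel.mem_hexDom_turn hq h)
  big _ _ _ h := (FlowerModel.big_turn (c := false) hq _).trans
    (FlowerModel.big_turn (c := true) hq h)

end Sym

namespace FlowerModel

variable (M : FlowerModel)

/-- The large blue clusters of `hexDom z n` and `hexDom z' n'` are connected in the union of
`hexDom z N` and `hexDom z' N'`. -/
def Linked (z : Hex) (n N : ℤ) (z' : Hex) (n' N' : ℤ) : Set Config :=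
  {ω | ∃ h h', M.Big true ω z n h ∧ M.Big true ω z' n' h' ∧
    M.Conn true ω (M.hexDom z N ∪ M.hexDom z' N') h h'}

/-- The large blue cluster of `hexDom z n` touches the sector `1` at a place with first coordinate
in `J`, relative to `z`. -/
def Landing (z : Hex) (n : ℤ) (J : Set ℤ) : Set Config :=
  {ω | ∃ h g, M.Big true ω z n h ∧ g ∈ M.sector z n 1 ∧ Near h g ∧ (M.base g).1 - z.1 ∈ J}

variable {M} {z z' : Hex} {n n' N N' : ℤ} {J J' : Set ℤ}

theorem saturated_union {D D' : Set Hex} (h : M.Saturated D) (h' : M.Saturated D') :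
    M.Saturated (D ∪ D') := fun g => or_congr (h g) (h' g)

theorem up_linked : M.Up (M.Linked z n N z' n' N') := by
  refine ⟨(M.hexDom z n ∪ M.hexDom z' n') ∪ (M.hexDom z N ∪ M.hexDom z' N'),
    saturated_union (saturated_union (saturated_hexDom _ _) (saturated_hexDom _ _))
      (saturated_union (saturated_hexDom _ _) (saturated_hexDom _ _)),
    ((finite_hexDom _ _).union (finite_hexDom _ _)).union
      ((finite_hexDom _ _).union (finite_hexDom _ _)), ?_⟩
  rintro ω ω' hω ⟨h, h', h1, h2, h3⟩
  refine ⟨h, h', h1.imp (hω _ (saturated_hexDom _ _) ?_), h2.imp (hω _ (saturated_hexDom _ _) ?_),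
    hω _ (saturated_union (saturated_hexDom _ _) (saturated_hexDom _ _))
      Set.subset_union_right _ _ h3⟩
  · exact fun _ h => Or.inl (Or.inl h)
  · exact fun _ h => Or.inl (Or.inr h)

theorem law_linked {g : Sym M} (hg : g.Rigid) :
    M.law.real (M.Linked (g.φ z) n N (g.φ z') n' N') = M.law.real (M.Linked z n N z' n' N') := by
  rw [← g.law_preimage up_linked.measurableSet]
  congr 1
  ext ω
  simp only [Linked, Set.mem_preimage, Set.mem_ofPred_eq]
  rw [g.φ.surjective.exists]
  refine exists_congr fun h => ?_
  rw [g.φ.surjective.exists]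
  refine exists_congr fun h' => ?_
  rw [hg.big, hg.big, g.conn_of_f hg.f_eq, Set.preimage_union, hg.dom, hg.dom]

theorem linked_symm : M.Linked z n N z' n' N' = M.Linked z' n' N' z n N := by
  have key : ∀ z n N z' n' N', M.Linked z n N z' n' N' ⊆ M.Linked z' n' N' z n N := by
    rintro z n N z' n' N' ω ⟨h, h', h1, h2, h3⟩
    rw [Set.union_comm] at h3
    exact ⟨h', h, h2, h1, h3.symm⟩
  exact (key _ _ _ _ _ _).antisymm (key _ _ _ _ _ _)

theorem upIn_landing : M.UpIn (M.Landing z n J) (M.hexDom z n) := by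
  rintro ω ω' hω ⟨h, g, h1, h2⟩
  exact ⟨h, g, h1.imp (hω _ (saturated_hexDom _ _) subset_rfl), h2⟩

theorem up_landing : M.Up (M.Landing z n J) := up_of_hexDom upIn_landing

theorem law_landing_add {v : Hex} (hv : M.IsPeriod v) :
    M.law.real (M.Landing (z + v) n J) = M.law.real (M.Landing z n J) := by
  rw [← (Sym.translation hv).law_preimage up_landing.measurableSet]
  congr 1
  ext ω
  simp only [Landing, Set.mem_preimage, Set.mem_ofPred_eq]
  rw [(Equiv.addRight v).surjective.exists]
  refine exists_congr fun h => ?_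
  rw [(Equiv.addRight v).surjective.exists]
  refine exists_congr fun g => ?_
  have := (Sym.translation hv).base g
  rw [Sym.translation_apply, Sym.translation_apply] at this
  rw [Equiv.coe_addRight, big_translation hv, near_add, mem_sector_translation hv, this,
    Prod.fst_add, Prod.fst_add, add_sub_add_right_eq_sub]

theorem law_landing (G : Grid M) {q q' : Hex} (hq : q ∈ G.pts) (hq' : q' ∈ G.pts) :
    M.law.real (M.Landing q n J) = M.law.real (M.Landing q' n J) := by
  have := law_landing_add (z := q) (n := n) (J := J) (G.sub_period hq hq')
  rwa [add_sub_cancel, eq_comm] at this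

theorem landing_mono (h : ∀ t ∈ J, -(n + 4) ≤ t → t ≤ 0 → t ∈ J') :
    M.Landing z n J ⊆ M.Landing z n J' := by
  rintro ω ⟨x, g, h1, h2, h3, h4⟩
  have b := touch_coord (M := M) h1.self.1 h3
  exact ⟨x, g, h1, h2, h3, h _ h4 b.1.1 h2.1⟩

theorem landing_union : M.Landing z n (J ∪ J') = M.Landing z n J ∪ M.Landing z n J' := by
  ext ω
  constructor
  · rintro ⟨x, g, h1, h2, h3, h4 | h4⟩
    · exact Or.inl ⟨x, g, h1, h2, h3, h4⟩
    · exact Or.inr ⟨x, g, h1, h2, h3, h4⟩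
  · rintro (⟨x, g, h1, h2, h3, h4⟩ | ⟨x, g, h1, h2, h3, h4⟩)
    · exact ⟨x, g, h1, h2, h3, Or.inl h4⟩
    · exact ⟨x, g, h1, h2, h3, Or.inr h4⟩

theorem law_landing_union :
    M.law.real (M.Landing z n (J ∪ J')) ≤
      M.law.real (M.Landing z n J) + M.law.real (M.Landing z n J') := by
  rw [landing_union]; exact measureReal_union_le _ _

theorem law_landing_univ (hz : M.IsPivot z) (hn : 10 ≤ n) :
    1 / 256 ≤ M.law.real (M.Landing z n Set.univ) := by
  refine (law_big hz hn).trans (real_mono ?_)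
  rintro ω ⟨h, hh⟩
  obtain ⟨x, hx, g, hg, hxg⟩ := hh 1
  exact ⟨x, g, hh.of_conn hx, hg, hxg, trivial⟩

/-- The window `[l, r]` in which the large cluster touches the sector `1` with a good probability,
while it also does so to the left and to the right of the window with a good probability. -/
structure Window (M : FlowerModel) (q : Hex) (n l r : ℤ) : Prop where
  le : l ≤ r
  left_ge : -(n + 4) ≤ l
  right_le : r ≤ 0
  left : 1 / 1024 ≤ M.law.real (M.Landing q n (Set.Iic l))
  right : 1 / 1024 ≤ M.law.real (M.Landing q n (Set.Ici r))
  mid : 1 / 512 ≤ M.law.real (M.Landing q n (Set.Icc l r))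

theorem Window.of_mem (G : Grid M) {q q' : Hex} (hq : q ∈ G.pts) (hq' : q' ∈ G.pts) {l r : ℤ}
    (h : M.Window q n l r) : M.Window q' n l r where
  le := h.le
  left_ge := h.left_ge
  right_le := h.right_le
  left := by rw [law_landing G hq' hq]; exact h.left
  right := by rw [law_landing G hq' hq]; exact h.right
  mid := by rw [law_landing G hq' hq]; exact h.mid

/-- The window extends from the least `l` to the greatest `r` such that landing to the left of `l`, and
to the right of `r`, has probability at least `1 / 1024`. What lies outside then has probability
less than `2 / 1024`, which leaves `1 / 256 - 1 / 512` for the window. -/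
theorem exists_window {q : Hex} (hq : M.IsPivot q) (hn : 10 ≤ n) : ∃ l r, M.Window q n l r := by
  have hU := law_landing_univ hq hn
  have emp : ∀ {J : Set ℤ}, (∀ t ∈ J, -(n + 4) ≤ t → t ≤ 0 → False) →
      M.law.real (M.Landing q n J) ≤ 0 := by
    intro J hJ
    have : M.Landing q n J ⊆ ∅ := by
      refine (landing_mono (J' := ∅) hJ).trans ?_
      rintro ω ⟨x, g, _, _, _, h4⟩
      exact h4
    simpa using real_mono (M := M) this
  obtain ⟨l, hl, hl'⟩ := Int.exists_least_of_bdd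
    (P := fun t => 1 / 1024 ≤ M.law.real (M.Landing q n (Set.Iic t)))
    ⟨-(n + 4), fun t ht => by
      by_contra hcon
      have := emp (J := Set.Iic t) fun t' (h : t' ≤ t) h1 _ => by omega
      linarith⟩
    ⟨0, (by norm_num : (1 : ℝ) / 1024 ≤ 1 / 256).trans (hU.trans
      (real_mono (landing_mono fun t _ _ h => h)))⟩
  obtain ⟨r, hr, hr'⟩ := Int.exists_greatest_of_bdd
    (P := fun t => 1 / 1024 ≤ M.law.real (M.Landing q n (Set.Ici t)))
    ⟨0, fun t ht => by
      by_contra hcon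
      have := emp (J := Set.Ici t) fun t' (h : t ≤ t') h1 _ => by omega
      linarith⟩
    ⟨-(n + 4), (by norm_num : (1 : ℝ) / 1024 ≤ 1 / 256).trans (hU.trans
      (real_mono (landing_mono fun t _ h _ => h)))⟩
  have a1 : M.law.real (M.Landing q n (Set.Iic (l - 1))) < 1 / 1024 := by
    by_contra hcon
    have := hl' (l - 1) (not_lt.1 hcon)
    omega
  have a2 : M.law.real (M.Landing q n (Set.Ici (r + 1))) < 1 / 1024 := by
    by_contra hcon
    have := hr' (r + 1) (not_lt.1 hcon)
    omega
  have a3 : M.law.real (M.Landing q n Set.univ) ≤ M.law.real (M.Landing q n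
      ((Set.Iic (l - 1) ∪ Set.Ici (r + 1)) ∪ Set.Icc l r)) := by
    refine real_mono (landing_mono fun t _ _ _ => ?_)
    simp only [Set.mem_union, Set.mem_Iic, Set.mem_Ici, Set.mem_Icc]
    omega
  have a4 := a3.trans law_landing_union
  have a5 := law_landing_union (M := M) (z := q) (n := n) (J := Set.Iic (l - 1))
    (J' := Set.Ici (r + 1))
  have mid : 1 / 512 ≤ M.law.real (M.Landing q n (Set.Icc l r)) := by linarith
  refine ⟨l, r, ?_, ?_, ?_, hl, hr, mid⟩
  · by_contra hcon
    have := emp (J := Set.Icc l r) fun t ht _ _ => by have := ht.1; have := ht.2; omega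
    linarith
  · by_contra hcon
    have := emp (J := Set.Iic l) fun t (ht : t ≤ l) _ _ => by omega
    linarith
  · by_contra hcon
    have := emp (J := Set.Ici r) fun t (ht : r ≤ t) _ _ => by omega
    linarith

/-- A part of the window of about a sixteenth of its length in which the large cluster lands with a
good probability. -/
theorem exists_short_window {q : Hex} {l r : ℤ} (h : M.Window q n l r) :
    ∃ j, l ≤ j ∧ j ≤ r + 16 ∧
      1 / 8192 ≤ M.law.real (M.Landing q n (Set.Icc j (j + ((r - l) / 16 + 1)))) := by
  set ℓ := (r - l) / 16 + 1 with hℓ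
  have key : ∀ k : ℕ, M.law.real (M.Landing q n (Set.Ico l (l + k * ℓ))) ≤
      ∑ i ∈ Finset.range k, M.law.real (M.Landing q n (Set.Icc (l + i * ℓ) (l + i * ℓ + ℓ))) := by
    intro k
    induction k with
    | zero =>
      have : M.Landing q n (Set.Ico l (l + (0 : ℕ) * ℓ)) ⊆ ∅ := by
        rintro ω ⟨x, g, _, _, _, h4⟩
        simp at h4
      simpa using real_mono (M := M) this
    | succ k ih =>
      rw [Finset.sum_range_succ]
      refine le_trans ?_ (law_landing_union.trans (add_le_add_left ih _))
      refine real_mono (landing_mono fun t ht _ _ => ?_)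
      simp only [Set.mem_Icc, Set.mem_Ico, Nat.cast_add, Nat.cast_one, Set.mem_union] at ht ⊢
      rw [show l + ((k : ℤ) + 1) * ℓ = l + k * ℓ + ℓ by ring] at ht
      omega
  -- the window is covered by sixteen parts, and `1 / 8192` is a sixteenth of `1 / 512`
  by_contra hcon
  push Not at hcon
  have h2 : M.law.real (M.Landing q n (Set.Icc l r)) ≤
      M.law.real (M.Landing q n (Set.Ico l (l + (16 : ℕ) * ℓ))) := by
    refine real_mono (landing_mono fun t ht _ _ => ?_)
    simp only [Set.mem_Icc, Set.mem_Ico] at ht ⊢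
    push_cast
    omega
  have h3 : ∑ i ∈ Finset.range 16,
      M.law.real (M.Landing q n (Set.Icc (l + i * ℓ) (l + i * ℓ + ℓ))) <
        ∑ i ∈ Finset.range 16, (1 / 8192 : ℝ) := by
    refine Finset.sum_lt_sum_of_nonempty (by simp) fun i hi => ?_
    rw [Finset.mem_range] at hi
    have hle := h.le
    refine hcon _ ?_ ?_
    · have : 0 ≤ (i : ℤ) * ℓ := by positivity
      omega
    · have : (i : ℤ) * ℓ ≤ 15 * ℓ := mul_le_mul_of_nonneg_right (by omega) (by omega)
      omega
  have h4 := (h2.trans (key 16)).trans_lt h3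
  have h5 := h.mid
  norm_num at h4 h5
  linarith

theorem Linked.trans {z₁ z₂ z₃ : Hex} {n₁ n₂ n₃ N₁ N₂ N₃ N₂' N L : ℤ} {ω : Config} (hn : 10 ≤ n₂)
    (h : ω ∈ M.Linked z₁ n₁ N₁ z₂ n₂ N₂) (h' : ω ∈ M.Linked z₂ n₂ N₂' z₃ n₃ N₃)
    (h1 : M.hexDom z₁ N₁ ⊆ M.hexDom z₁ N ∪ M.hexDom z₃ L)
    (h2 : M.hexDom z₂ n₂ ⊆ M.hexDom z₁ N ∪ M.hexDom z₃ L)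
    (h3 : M.hexDom z₂ N₂ ⊆ M.hexDom z₁ N ∪ M.hexDom z₃ L)
    (h4 : M.hexDom z₂ N₂' ⊆ M.hexDom z₁ N ∪ M.hexDom z₃ L)
    (h5 : M.hexDom z₃ N₃ ⊆ M.hexDom z₁ N ∪ M.hexDom z₃ L) : ω ∈ M.Linked z₁ n₁ N z₃ n₃ L := by
  obtain ⟨a, b, ha, hb, hab⟩ := h
  obtain ⟨b', d, hb', hd, hbd⟩ := h'
  exact ⟨a, d, ha, hd, ((hab.mono (Set.union_subset h1 h3)).trans
    ((hb.unique hn hb').mono h2)).trans (hbd.mono (Set.union_subset h4 h5))⟩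

/-- A large cluster that lands in the gap between two landings of a second one is linked to it. -/
theorem linked_of_landing {ω : Config} {x : Hex} {n τ l r : ℤ} {J : Set ℤ} (hn : 10 ≤ n)
    (h1 : ω ∈ M.Landing x n (Set.Iic l)) (h2 : ω ∈ M.Landing x n (Set.Ici r))
    (h3 : ω ∈ M.Landing (x + (τ, -n)) (2 * n) J) (hJ : ∀ t ∈ J, l + 3 ≤ t + τ ∧ t + τ + 3 ≤ r) :
    ω ∈ M.Linked x n n (x + (τ, -n)) (2 * n) (2 * n) := by
  obtain ⟨a, g, ha, hg, hag, hgl⟩ := h1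
  obtain ⟨a', g', ha', hg', hag', hgr⟩ := h2
  obtain ⟨b, k, hb, hk, hbk, hkJ⟩ := h3
  -- the second cluster also touches the sector `4`, below the first domain
  obtain ⟨b', hbb', k', hk', hbk'⟩ := hb 4
  have e := hJ _ hkJ
  have cb := base_near (M := M) hbk'
  have cb' := coord_base (M := M) b'
  simp only [sector, InSector, Set.mem_ofPred_eq, Prod.fst_sub, Prod.snd_sub, Matrix.cons_val,
    Prod.snd_add, Prod.fst_add, Set.mem_Iic, Set.mem_Ici] at hg hg' hk hk' hgl hgr e
  refine ⟨a, b, ha, hb, arch_meet (top := x.2 + n) (bot := x.2 - n) Set.subset_union_left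
    Set.subset_union_right (ha.unique hn ha') hbb' ?_ ?_ hag hag' hbk ?_ ?_ ?_ ?_ ?_ ?_⟩
  · intro h hh
    simp only [hexDom, Set.mem_ofPred_eq, InHexagon, Prod.fst_sub, Prod.snd_sub] at hh
    omega
  · intro h hh
    simp only [hexDom, Set.mem_ofPred_eq, InHexagon, Prod.fst_sub, Prod.snd_sub, Prod.fst_add,
      Prod.snd_add] at hh
    omega
  all_goals omega

variable (M) in
/-- The steps `u` between centres of symmetry such that the large clusters around `z` and `z + u` are
linked with probability at least `p`. -/
def IsStep (G : Grid M) (n : ℤ) (p : ℝ) (u : Hex) : Prop :=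
  (G.m ∣ u.1 ∧ G.m ∣ u.2) ∧ ∀ z ∈ G.pts, p ≤ M.law.real (M.Linked z n (4 * n) (z + u) n (4 * n))

theorem third_self {x : Hex} (hx : M.IsPivot x) : (Sym.third hx).φ x = x := by
  rw [Sym.third_apply]
  ext <;> simp [BondTriangular.rot]

theorem rot_rot_rot (u : Hex) : rot (rot (rot u)) = -u := by
  ext <;> simp [rot]

/-- A sixth of a turn of a step comes from minus two thirds of a turn and an exchange of the
ends. -/
theorem IsStep.rot {G : Grid M} {n : ℤ} {p : ℝ} {u : Hex} (h : M.IsStep G n p u) :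
    M.IsStep G n p (rot u) := by
  have third : ∀ {u}, M.IsStep G n p u → M.IsStep G n p (BondTriangular.rot (BondTriangular.rot u)) := by
    intro u h
    refine ⟨⟨?_, ?_⟩, fun z hz => ?_⟩
    · simp only [BondTriangular.rot]; exact (dvd_add h.1.1 h.1.2).neg_right
    · simpa [BondTriangular.rot] using h.1.1
    · have hq := G.isPivot hz
      have := h.2 z hz
      rwa [← law_linked (Sym.rigid_third hq), third_self, Sym.third_apply,
        add_sub_cancel_left] at this
  have neg : ∀ {u}, M.IsStep G n p u → M.IsStep G n p (-u) := by
    intro u h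
    refine ⟨⟨by simpa using h.1.1, by simpa using h.1.2⟩, fun z hz => ?_⟩
    rw [linked_symm]
    have := h.2 (z + -u) (G.add_mem hz (by simpa using h.1.1) (by simpa using h.1.2))
    rwa [neg_add_cancel_right] at this
  have := neg (third (third h))
  rw [rot_rot_rot] at this
  convert this using 1
  ext <;> simp [BondTriangular.rot]

theorem IsStep.exists_inSector {G : Grid M} {n k : ℤ} {p : ℝ} {u : Hex} (h : M.IsStep G n p u)
    (hk : 0 ≤ k) (hu : ¬ InHexagon k u) (hu' : InHexagon (7 * n) u) :
    ∃ a b, 1 ≤ a ∧ 0 ≤ b ∧ k < a + b ∧ a + b ≤ 7 * n ∧ M.IsStep G n p (a, b) := by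
  obtain ⟨i, hi⟩ := inSector_or hk hu
  obtain ⟨j, hj⟩ : ∃ j : ℕ, i + j • (1 : Fin 6) = 0 :=
    ⟨6 - i.val, by clear hi; revert i; decide⟩
  induction j generalizing u i with
  | zero =>
    obtain rfl : i = 0 := by simpa using hj
    simp only [InSector, Matrix.cons_val] at hi
    simp only [InHexagon] at hu'
    exact ⟨u.1, u.2, by omega, by omega, by omega, by omega, h⟩
  | succ j ih =>
    exact ih h.rot (mt inHexagon_rot.1 hu) (inHexagon_rot.2 hu') (i + 1) ((inSector_rot i).2 hi)
      (by rw [← hj, succ_nsmul']; abel)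

variable (M) in
/-- There is a step of size comparable to `n` in the sector `0`. -/
def HasStep (G : Grid M) (n : ℤ) (p : ℝ) : Prop :=
  ∃ a b, 1 ≤ a ∧ 0 ≤ b ∧ n ≤ 2 * (a + b) ∧ a + b ≤ 7 * n ∧ M.IsStep G n p (a, b)

theorem third_shift {x : Hex} (hx : M.IsPivot x) (τ h : ℤ) :
    (Sym.third hx).φ (x + (τ, -h)) = x + (τ, -h) + (h - 2 * τ, τ + h) := by
  rw [Sym.third_apply]
  ext <;> simp [BondTriangular.rot] <;> ring

/-- If the large cluster at `x + w` is linked to the one at its image under a third of a turn around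
`x`, then this gives a step. -/
theorem hasStep_of_third {G : Grid M} {n τ h : ℤ} {p : ℝ} (h1 : G.m ∣ τ) (h2 : G.m ∣ h)
    (hn : 1 ≤ n) (h3 : n ≤ 2 * h) (h4 : h ≤ n) (h5 : -(3 * n) ≤ τ ∧ τ ≤ 3 * n)
    (H : ∀ x (hx : x ∈ G.pts), p ≤ M.law.real (M.Linked (x + (τ, -h)) n (4 * n)
      ((Sym.third (G.isPivot hx)).φ (x + (τ, -h))) n (4 * n))) : M.HasStep G n p := by
  -- the difference between the two centres; a turn moves it to the sector `0`
  have hs : M.IsStep G n p (h - 2 * τ, τ + h) := by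
    refine ⟨⟨dvd_sub h2 (h1.mul_left 2), dvd_add h1 h2⟩, fun z hz => ?_⟩
    have hx : z - (τ, -h) ∈ G.pts := by
      rw [sub_eq_add_neg]
      exact G.add_mem hz (by simpa using h1) (by simpa using h2)
    have := H _ hx
    rwa [third_shift, sub_add_cancel] at this
  obtain ⟨a, b, ha, hb, hab, hab', hs'⟩ := hs.exists_inSector (k := h) (by omega)
    (by simp only [InHexagon]; omega) (by simp only [InHexagon]; omega)
  exact ⟨a, b, ha, hb, by omega, hab', hs'⟩

/-- If a window at the scale `2 n` is not too large compared with one at the scale `n`, then a large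
cluster can be shifted such that it lands in the gap between two landings of another one. -/
theorem hasStep_of_window {G : Grid M} {n l r l' r' : ℤ} (hn : 40 ≤ n) (hmn : G.m ∣ n)
    (h : ∀ q ∈ G.pts, M.Window q n l r) (h' : ∀ q ∈ G.pts, M.Window q (2 * n) l' r')
    (hlen : (r' - l') / 16 + 8 + G.m ≤ r - l) : M.HasStep G (2 * n) (2⁻¹ ^ 66) := by
  obtain ⟨j, hj1, hj2, hj⟩ := exists_short_window (h' _ G.o_mem)
  have w := h _ G.o_mem
  have w' := h' _ G.o_mem
  have b1 := w.left_ge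
  have b2 := w.right_le
  have b3 := w'.left_ge
  have b4 := w'.right_le
  have b5 := w.le
  have hm := G.pos
  -- the shift by the period `τ` moves the short window into the gap between `l` and `r`
  set τ := G.m * ((l + 3 - j) / G.m + 1) with hτ
  have t1 : l + 3 - j < τ := by
    have := Int.lt_ediv_add_one_mul_self (l + 3 - j) hm
    rw [hτ]; linarith
  have t2 : τ ≤ l + 3 - j + G.m := by
    have := Int.ediv_mul_le (l + 3 - j) hm.ne'
    rw [hτ]; linarith
  have hdvd : G.m ∣ τ := dvd_mul_right _ _
  refine hasStep_of_third (τ := τ) (h := n) hdvd hmn (by omega) le_rfl (by omega) (by omega)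
    fun x hx => ?_
  have hq := G.isPivot hx
  have hz : x + (τ, -n) ∈ G.pts := G.add_mem hx hdvd (by simpa using hmn)
  set J := Set.Icc j (j + ((r' - l') / 16 + 1)) with hJ
  -- two landings of probability `2⁻¹ ^ 10` and one of probability `2⁻¹ ^ 13`
  have p1 : (2⁻¹ : ℝ) ^ 33 ≤ M.law.real (M.Linked x n n (x + (τ, -n)) (2 * n) (2 * n)) := by
    have c1 := (h x hx).left
    have c2 := (h x hx).right
    have c3 : 1 / 8192 ≤ M.law.real (M.Landing (x + (τ, -n)) (2 * n) J) := by
      rw [law_landing G hz G.o_mem]; exact hj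
    have := (up_landing.inter up_landing).le_inter up_landing (by norm_num)
      (up_landing.le_inter up_landing (by norm_num) c1 c2) c3
    refine le_trans (by norm_num) (this.trans (real_mono ?_))
    rintro ω ⟨⟨e1, e2⟩, e3⟩
    refine linked_of_landing (by omega) e1 e2 e3 fun t ht => ?_
    rw [hJ, Set.mem_Icc] at ht
    omega
  -- the image under a third of a turn around `x`, so that two shifted clusters are linked through
  -- the one around `x`
  have p2 : (2⁻¹ : ℝ) ^ 33 ≤ M.law.real (M.Linked x n n ((Sym.third hq).φ (x + (τ, -n))) (2 * n)
      (2 * n)) := by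
    have := law_linked (Sym.rigid_third hq) (z := x) (z' := x + (τ, -n)) (n := n) (N := n)
      (n' := 2 * n) (N' := 2 * n)
    rw [third_self] at this
    rwa [this]
  have := up_linked.le_inter up_linked (by positivity) p1 p2
  refine le_trans (by norm_num) (this.trans (real_mono ?_))
  rintro ω ⟨e1, e2⟩
  rw [linked_symm] at e1
  have s1 : M.hexDom x n ⊆ M.hexDom (x + (τ, -n)) (4 * (2 * n)) :=
    hexDom_subset (by simp only [sub_add_cancel_left, InHexagon, Prod.neg_mk]; omega)
  refine Linked.trans (by omega) e1 e2 ?_ ?_ ?_ ?_ ?_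
  · exact (hexDom_subset (by simp only [sub_self, InHexagon, Prod.fst_zero, Prod.snd_zero]; omega)).trans
      Set.subset_union_left
  · exact s1.trans Set.subset_union_left
  · exact s1.trans Set.subset_union_left
  · exact s1.trans Set.subset_union_left
  · exact (hexDom_subset (by simp only [sub_self, InHexagon, Prod.fst_zero, Prod.snd_zero]; omega)).trans
      Set.subset_union_right

end FlowerModel

/-! ### Tubes and rings -/

namespace FlowerModel

variable (M : FlowerModel)

/-- A long horizontal strip below `q`. -/
def strip (q : Hex) (s : ℤ) : Set Hex :=
  {h | (-(12 * s) ≤ (M.base h).2 - q.2 ∧ (M.base h).2 - q.2 ≤ -(8 * s)) ∧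
    -(2000 * s) ≤ (M.base h).1 - q.1 ∧ (M.base h).1 - q.1 ≤ 2000 * s}

/-- A blue connection in the strip that passes below `q`. -/
def Tube (q : Hex) (s : ℤ) : Set Config :=
  {ω | ∃ P P', P.1 - q.1 ≤ -(30 * s) ∧ 30 * s ≤ P'.1 - q.1 ∧ M.Conn true ω (M.strip q s) P P'}

variable {M} {q : Hex} {s n : ℤ}

theorem saturated_strip : M.Saturated (M.strip q s) := by
  intro h; simp only [strip, Set.mem_ofPred_eq, base_base]

theorem strip_subset (_ : 0 ≤ s) : M.strip q s ⊆ M.hexDom q (2012 * s) := by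
  intro h hh
  simp only [strip, hexDom, InHexagon, Set.mem_ofPred_eq, Prod.fst_sub, Prod.snd_sub] at hh ⊢
  omega

theorem disjoint_strip (hs : 1 ≤ s) {h : Hex} (hh : h ∈ M.strip q s) :
    h ∉ M.hexDom q (7 * s) := by
  simp only [strip, hexDom, InHexagon, Set.mem_ofPred_eq, Prod.fst_sub, Prod.snd_sub] at hh ⊢
  omega

theorem upIn_tube : M.UpIn (M.Tube q s) (M.strip q s) := by
  rintro ω ω' hω ⟨P, P', h1, h2, h3⟩
  exact ⟨P, P', h1, h2, hω _ saturated_strip subset_rfl _ _ h3⟩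

theorem up_tube (hs : 0 ≤ s) : M.Up (M.Tube q s) :=
  ⟨_, saturated_strip, (finite_hexDom q _).subset (strip_subset hs), upIn_tube⟩

theorem law_tube_add {v : Hex} (hv : M.IsPeriod v) (hs : 0 ≤ s) :
    M.law.real (M.Tube (q + v) s) = M.law.real (M.Tube q s) := by
  rw [← (Sym.translation hv).law_preimage (up_tube hs).measurableSet]
  congr 1
  ext ω
  simp only [Tube, Set.mem_preimage, Set.mem_ofPred_eq]
  rw [(Equiv.addRight v).surjective.exists]
  refine exists_congr fun h => ?_
  rw [(Equiv.addRight v).surjective.exists]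
  refine exists_congr fun g => ?_
  rw [Equiv.coe_addRight, conn_translation (D := M.strip q s) hv]
  · simp only [Prod.fst_add, add_sub_add_right_eq_sub]
  · intro h
    have := (Sym.translation hv).base h
    rw [Sym.translation_apply, Sym.translation_apply] at this
    simp only [strip, Set.mem_ofPred_eq, this, Prod.fst_add, Prod.snd_add, add_sub_add_right_eq_sub]

/-- The points of a chain of steps near a horizontal line: it goes up to the right if it is not above
the line, and down to the right if it is. -/
def chain (q : Hex) (a b : ℤ) : ℕ → Hex
  | 0 => q
  | i + 1 => chain q a b i + if (chain q a b i).2 ≤ q.2 then (a, b) else (a + b, -a)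

theorem chain_bounds {a b : ℤ} (ha : 1 ≤ a) (hb : 0 ≤ b) (i : ℕ) :
    (-a ≤ (chain q a b i).2 - q.2 ∧ (chain q a b i).2 - q.2 ≤ b) ∧
    i * (a + b) ≤ 2 * ((chain q a b i).1 - q.1) + ((chain q a b i).2 - q.2) ∧
    0 ≤ (chain q a b i).1 - q.1 ∧ (chain q a b i).1 - q.1 ≤ i * (a + b) := by
  induction i with
  | zero => simp [chain]; omega
  | succ i ih =>
    have e : ((i + 1 : ℕ) : ℤ) * (a + b) = i * (a + b) + (a + b) := by push_cast; ring
    rw [e, chain]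
    generalize (i : ℤ) * (a + b) = t at *
    split_ifs with h <;> simp only [Prod.fst_add, Prod.snd_add] <;> omega

/-- A step gives tubes, since a chain of steps stays near a line. A step has size between `n / 2` and
`7 * n`, so 2600 steps advance by at least `620 * n`, the length of a tube at the scale `10 * n`, and
by at most `18200 * n`, which keeps them in the strip. -/
theorem law_tube {G : Grid M} {p : ℝ} (hn : 10 ≤ n) (hm : G.m ∣ n) (hp : 0 ≤ p)
    (h : M.HasStep G n p) (hq : q ∈ G.pts) : p ^ 2600 ≤ M.law.real (M.Tube q (10 * n)) := by
  obtain ⟨a, b, ha, hb, hab, hab', hst⟩ := h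
  have hst' : M.IsStep G n p (a + b, -a) := by
    have := hst.rot.rot.rot.rot.rot
    convert this using 1
    ext <;> simp [BondTriangular.rot, add_comm]
  set q₀ : Hex := q + (-(32 * (10 * n)), -(10 * (10 * n))) with hq₀
  have hmem : ∀ i, chain q₀ a b i ∈ G.pts := by
    intro i
    induction i with
    | zero =>
      exact G.add_mem hq ((hm.mul_left 10).mul_left 32).neg_right
        ((hm.mul_left 10).mul_left 10).neg_right
    | succ i ih =>
      rw [chain]
      split_ifs
      · exact G.add_mem ih hst.1.1 hst.1.2
      · exact G.add_mem ih hst'.1.1 hst'.1.2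
  have hlink : ∀ i, p ≤ M.law.real (M.Linked (chain q₀ a b i) n (4 * n) (chain q₀ a b (i + 1)) n
      (4 * n)) := by
    intro i
    rw [chain]
    split_ifs
    · exact hst.2 _ (hmem i)
    · exact hst'.2 _ (hmem i)
  refine (Up.le_iInter hp _ (fun i => up_linked) hlink 2600).2.trans (real_mono ?_)
  intro ω hω
  have sub : ∀ i ≤ 2600, M.hexDom (chain q₀ a b i) (4 * n) ⊆ M.strip q (10 * n) := by
    intro i hi h hh
    have cb := chain_bounds (q := q₀) ha hb i
    have : (i : ℤ) * (a + b) ≤ 2600 * (a + b) := mul_le_mul_of_nonneg_right (by omega) (by omega)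
    simp only [strip, hexDom, InHexagon, Set.mem_ofPred_eq, Prod.fst_sub, Prod.snd_sub] at hh ⊢
    simp only [hq₀, Prod.fst_add, Prod.snd_add] at cb
    rw [← hq₀] at cb
    omega
  have n4 : ∀ i, M.hexDom (chain q₀ a b i) n ⊆ M.hexDom (chain q₀ a b i) (4 * n) := fun i =>
    hexDom_subset (by simp only [sub_self, InHexagon, Prod.fst_zero, Prod.snd_zero]; omega)
  -- consecutive links share the large cluster of a domain, which is unique; there is nothing to
  -- be said before the first link, hence the alternative `T = 0`
  have key : ∀ T ≤ 2600, ∃ h h', (T = 0 ∨ M.Big true ω q₀ n h) ∧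
      (T = 0 ∨ M.Big true ω (chain q₀ a b T) n h') ∧
      (T = 0 ∨ M.Conn true ω (M.strip q (10 * n)) h h') := by
    intro T hT
    induction T with
    | zero => exact ⟨0, 0, by simp⟩
    | succ T ih =>
      obtain ⟨x, y, hx, hy, hxy⟩ := ih (by omega)
      obtain ⟨x', y', hx', hy', hxy'⟩ := hω T (by omega)
      have c2 := hxy'.mono (Set.union_subset (sub T (by omega)) (sub (T + 1) hT))
      rcases Nat.eq_zero_or_pos T with rfl | hT0
      · exact ⟨x', y', Or.inr hx', Or.inr hy', Or.inr c2⟩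
      · have hne : T ≠ 0 := by omega
        have c1 := ((hy.resolve_left hne).unique hn hx').mono ((n4 T).trans (sub T (by omega)))
        exact ⟨x, y', Or.inr (hx.resolve_left hne), Or.inr hy',
          Or.inr (((hxy.resolve_left hne).trans c1).trans c2)⟩
  obtain ⟨x, y, hx, hy, hxy⟩ := key 2600 le_rfl
  replace hx := (hx.resolve_left (by norm_num)).self.1
  replace hy := (hy.resolve_left (by norm_num)).self.1
  have cb := chain_bounds (q := q₀) ha hb 2600
  have e1 := coord_base (M := M) x
  have e2 := coord_base (M := M) y
  refine ⟨x, y, ?_, ?_, hxy.resolve_left (by norm_num)⟩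
  · simp only [hexDom, InHexagon, Set.mem_ofPred_eq, Prod.fst_sub, Prod.snd_sub, hq₀, Prod.fst_add,
      Prod.snd_add] at hx
    omega
  · simp only [hexDom, InHexagon, Set.mem_ofPred_eq, Prod.fst_sub, Prod.snd_sub] at hy
    simp only [hq₀, Prod.fst_add, Prod.snd_add] at cb
    rw [← hq₀] at cb
    push_cast at cb
    omega

/-- A connection that crosses the strip between the ends of a tube has the colour of the tube and is
connected to it. -/
theorem tube_meets {c : Bool} {ω : Config} {P P' Q Q' : Hex} {D D' : Set Hex} (hs : 10 ≤ s)
    (hP : P.1 - q.1 ≤ -(30 * s)) (hP' : 30 * s ≤ P'.1 - q.1)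
    (hPP : M.Conn true ω (M.strip q s) P P') (hD : M.Saturated D) (hQQ : M.Conn c ω D Q Q')
    (hDx : ∀ h ∈ D, -(28 * s) ≤ (M.base h).1 - q.1 ∧ (M.base h).1 - q.1 ≤ 28 * s)
    (hQ : -(7 * s) ≤ Q.2 - q.2) (hQ' : Q'.2 - q.2 ≤ 4 - 13 * s) (h1 : M.strip q s ⊆ D')
    (h2 : D ⊆ D') : c = true ∧ M.Conn true ω D' P Q := by
  have := conn_cross saturated_strip hD h1 h2 hPP.symm hQQ
    (fun h hh => by
      have := coord_base (M := M) h
      simp only [strip, Set.mem_ofPred_eq] at hh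
      omega)
    (fun h hh => by
      have := coord_base (M := M) h
      have := hDx h hh
      omega)
  exact ⟨this.1.symm, (hPP.mono h1).trans this.2⟩

/-- Three tubes around a centre of rotation. -/
def Ring (hq : M.IsPivot q) (s : ℤ) : Set Config :=
  M.Tube q s ∩ ((Sym.third hq).act ⁻¹' M.Tube q s ∩
    (Sym.third hq).act ⁻¹' ((Sym.third hq).act ⁻¹' M.Tube q s))

theorem third_hexDom (hq : M.IsPivot q) (n : ℤ) (h : Hex) :
    (Sym.third hq).φ h ∈ M.hexDom q n ↔ h ∈ M.hexDom q n := by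
  have := (Sym.rigid_third hq).dom q n
  rw [third_self] at this
  exact Set.ext_iff.1 this h

theorem third_conn (hq : M.IsPivot q) {c : Bool} {ω : Config} {n : ℤ} {a b : Hex} :
    M.Conn c ((Sym.third hq).act ω) (M.hexDom q n) ((Sym.third hq).φ a) ((Sym.third hq).φ b) ↔
      M.Conn c ω (M.hexDom q n) a b := by
  rw [(Sym.third hq).conn_of_f rfl, show (Sym.third hq).φ ⁻¹' M.hexDom q n = M.hexDom q n from
    Set.ext (third_hexDom hq n)]

theorem third_coord (hq : M.IsPivot q) (h : Hex) :
    ((Sym.third hq).φ h).1 - q.1 = -((h.1 - q.1) + (h.2 - q.2)) ∧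
      ((Sym.third hq).φ h).2 - q.2 = h.1 - q.1 := by
  rw [Sym.third_apply]
  simp only [rot, Prod.fst_add, Prod.snd_add, Prod.fst_sub, Prod.snd_sub]
  omega

/-- Consecutive tubes of a ring are connected. -/
theorem tube_tube (hq : M.IsPivot q) (hs : 10 ≤ s) {ω : Config} {P P' R R' : Hex}
    (hP : P.1 - q.1 ≤ -(30 * s)) (hP' : 30 * s ≤ P'.1 - q.1)
    (hPP : M.Conn true ω (M.strip q s) P P')
    (hR : R.1 - q.1 ≤ -(30 * s)) (hR' : 30 * s ≤ R'.1 - q.1)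
    (hRR : M.Conn true ((Sym.third hq).act ω) (M.strip q s) R R') :
    M.Conn true ((Sym.third hq).act ω) (M.hexDom q (2012 * s)) ((Sym.third hq).φ P) R := by
  obtain ⟨Q, rfl⟩ := (Sym.third hq).φ.surjective R
  obtain ⟨Q', rfl⟩ := (Sym.third hq).φ.surjective R'
  rw [third_conn]
  rw [(Sym.third hq).conn_of_f rfl] at hRR
  have hco := third_coord hq
  have hx : ∀ h ∈ (Sym.third hq).φ ⁻¹' M.strip q s,
      -(12 * s) ≤ (M.base h).1 - q.1 ∧ (M.base h).1 - q.1 ≤ -(8 * s) := by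
    intro h hh
    have := hco (M.base h)
    simp only [strip, Set.mem_preimage, Set.mem_ofPred_eq, Sym.base] at hh
    omega
  have b1 := hx _ hRR.1
  have b2 := hx _ hRR.right.1
  have e1 := coord_base (M := M) Q
  have e2 := coord_base (M := M) Q'
  have c1 := hco Q
  have c2 := hco Q'
  refine (tube_meets hs hP hP' hPP (saturated_strip.preimage _) hRR (fun h hh => ?_) (by omega)
    (by omega) (strip_subset (by omega)) fun h hh => ?_).2
  · have := hx h hh; omega
  · exact (third_hexDom hq _ h).1 (strip_subset (by omega) hh)

/-- A triangle in the middle of a ring, bounded by lines outside the tubes. -/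
def triangle (M : FlowerModel) (q : Hex) (s : ℤ) : Set Hex :=
  {h | -(13 * s) < (M.base h).2 - q.2 ∧ (M.base h).1 - q.1 + ((M.base h).2 - q.2) < 13 * s ∧
    -(13 * s) < (M.base h).1 - q.1}

theorem third_triangle (hq : M.IsPivot q) (h : Hex) :
    (Sym.third hq).φ h ∈ M.triangle q s ↔ h ∈ M.triangle q s := by
  have := third_coord hq (M.base h)
  simp only [triangle, Set.mem_ofPred_eq, Sym.base]
  omega

/-- A connection in the triangle from the middle to the lower side meets the lower tube. -/
theorem side_meets {c : Bool} {ω : Config} {P P' Q Q' g : Hex} (hs : 10 ≤ s)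
    (hP : P.1 - q.1 ≤ -(30 * s)) (hP' : 30 * s ≤ P'.1 - q.1)
    (hPP : M.Conn true ω (M.strip q s) P P') (hQ : Q ∈ M.hexDom q (4 * s))
    (hQQ : M.Conn c ω (M.triangle q s) Q Q') (hg : Near Q' g)
    (hy : (M.base g).2 - q.2 ≤ -(13 * s)) :
    c = true ∧ M.Conn true ω (M.hexDom q (2012 * s)) P Q := by
  have e1 := coord_base (M := M) Q
  have e2 := coord_base (M := M) Q'
  have e3 := base_near (M := M) hg
  simp only [hexDom, InHexagon, Set.mem_ofPred_eq, Prod.fst_sub, Prod.snd_sub] at hQ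
  refine tube_meets hs hP hP' hPP (fun h => by simp only [triangle, Set.mem_ofPred_eq, base_base])
    hQQ (fun h hh => ?_) (by omega) (by omega) (strip_subset (by omega)) fun h hh => ?_
  · simp only [triangle, Set.mem_ofPred_eq] at hh; omega
  · simp only [triangle, hexDom, InHexagon, Set.mem_ofPred_eq, Prod.fst_sub, Prod.snd_sub] at hh ⊢
    omega

/-- Any connection from the inside of a ring to the outside is blue and is connected to the
ring. -/
theorem ring_meets (hq : M.IsPivot q) (hs : 10 ≤ s) {ω : Config} (hω : ω ∈ M.Ring hq s) :
    ∃ P, ∀ c D a b, a ∈ M.hexDom q (4 * s) → b ∉ M.hexDom q (30 * s) → M.Conn c ω D a b →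
      c = true ∧ M.Conn true ω (M.hexDom q (2012 * s)) P a := by
  obtain ⟨⟨P, P', p1, p2, p3⟩, ⟨Q, Q', q1, q2, q3⟩, ⟨R, R', r1, r2, r3⟩⟩ := hω
  set g := Sym.third hq
  have pq := tube_tube hq hs p1 p2 p3 q1 q2 q3
  have qr := tube_tube hq hs q1 q2 q3 r1 r2 r3
  refine ⟨P, fun c D a b ha hb hab => ?_⟩
  have hT : M.Saturated (M.triangle q s) := fun h => by
    simp only [triangle, Set.mem_ofPred_eq, base_base]
  obtain ⟨y, k, hy, hyk, hk⟩ := hab.exit hT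
    (by
      simp only [hexDom, InHexagon, triangle, Set.mem_ofPred_eq, Prod.fst_sub, Prod.snd_sub] at ha ⊢
      omega)
    (by
      simp only [hexDom, InHexagon, triangle, Set.mem_ofPred_eq, Prod.fst_sub, Prod.snd_sub] at hb ⊢
      omega)
  have turn : ∀ {ω : Config} {a y : Hex}, M.Conn c ω (M.triangle q s) a y →
      M.Conn c (g.act ω) (M.triangle q s) (g.φ a) (g.φ y) := by
    intro ω a y h
    rw [g.conn_of_f rfl, show g.φ ⁻¹' M.triangle q s = M.triangle q s from
      Set.ext (third_triangle hq)]
    exact h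
  have co : (g.φ (M.base k)).1 - q.1 = _ ∧ (g.φ (M.base k)).2 - q.2 = _ :=
    third_coord hq (M.base k)
  have co' : (g.φ (g.φ (M.base k))).1 - q.1 = _ ∧ (g.φ (g.φ (M.base k))).2 - q.2 = _ :=
    third_coord hq (g.φ (M.base k))
  -- the connection leaves the triangle through one of the sides, which is turned to the bottom
  have hcases : (M.base k).2 - q.2 ≤ -(13 * s) ∨ (M.base (g.φ k)).2 - q.2 ≤ -(13 * s) ∨
      (M.base (g.φ (g.φ k))).2 - q.2 ≤ -(13 * s) := by
    simp only [triangle, Set.mem_ofPred_eq] at hk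
    rw [g.base, g.base, g.base]
    omega
  rcases hcases with h | h | h
  · exact side_meets hs p1 p2 p3 ha hy hyk h
  · obtain ⟨h1, h2⟩ := side_meets hs q1 q2 q3 ((third_hexDom hq _ _).2 ha) (turn hy)
      ((g.near_iff _ _).2 hyk) h
    exact ⟨h1, (third_conn hq).1 (pq.trans h2)⟩
  · obtain ⟨h1, h2⟩ := side_meets hs r1 r2 r3
      ((third_hexDom hq _ _).2 ((third_hexDom hq _ _).2 ha)) (turn (turn hy))
      ((g.near_iff _ _).2 ((g.near_iff _ _).2 hyk)) h
    exact ⟨h1, (third_conn hq).1 (pq.trans ((third_conn hq).1 (qr.trans h2)))⟩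

theorem up_ring (hq : M.IsPivot q) (hs : 0 ≤ s) : M.Up (M.Ring hq s) :=
  (up_tube hs).inter (((up_tube hs).preimage _ rfl).inter
    (((up_tube hs).preimage _ rfl).preimage _ rfl))

theorem law_ring (hq : M.IsPivot q) (hs : 0 ≤ s) {p : ℝ} (hp : 0 ≤ p)
    (h : p ≤ M.law.real (M.Tube q s)) : p ^ 3 ≤ M.law.real (M.Ring hq s) := by
  have u := up_tube (M := M) (q := q) hs
  have u1 := u.preimage (Sym.third hq) rfl
  have u2 := u1.preimage (Sym.third hq) rfl
  refine le_trans (le_of_eq (by ring)) (u.le_inter (u1.inter u2) hp h (u1.le_inter u2 hp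
    (u.le_preimage _ h) (u1.le_preimage _ (u.le_preimage _ h))))

/-- The annulus in which a ring lies. -/
def annulus (M : FlowerModel) (q : Hex) (s : ℤ) : Set Hex :=
  M.hexDom q (2012 * s) \ M.hexDom q (7 * s)

theorem saturated_annulus : M.Saturated (M.annulus q s) := fun h =>
  and_congr (saturated_hexDom _ _ h) (not_congr (saturated_hexDom _ _ h))

theorem finite_annulus : (M.annulus q s).Finite := (finite_hexDom _ _).subset Set.sdiff_subset

theorem local_ring (hq : M.IsPivot q) (hs : 1 ≤ s) : Local (M.Ring hq s) (M.annulus q s) := by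
  have h0 : M.strip q s ⊆ M.annulus q s := fun h hh =>
    ⟨strip_subset (by omega) hh, disjoint_strip hs hh⟩
  have hA : (Sym.third hq).φ ⁻¹' M.annulus q s = M.annulus q s := by
    ext h
    exact and_congr (third_hexDom hq _ h) (not_congr (third_hexDom hq _ h))
  have u : Local (M.Tube q s) (M.annulus q s) := upIn_tube.local.mono h0
  have u1 := u.preimage (Sym.third hq)
  rw [hA] at u1
  have u2 := u1.preimage (Sym.third hq)
  rw [hA] at u2
  exact (u.inter (u1.inter u2)).mono (by simp)

end FlowerModel

/-! ### Rings at all scales -/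

namespace FlowerModel

variable {M : FlowerModel} {q : Hex}

theorem scale_lt {sc : ℕ → ℤ} (h10 : ∀ i, 10 ≤ sc i) (hg : ∀ i, 300 * sc i ≤ sc (i + 1)) {i j : ℕ}
    (h : i < j) : 300 * sc i ≤ sc j := by
  induction j with
  | zero => omega
  | succ j ih =>
    rcases Nat.lt_succ_iff_lt_or_eq.1 h with h | rfl
    · have := ih h; have := hg j; have := h10 j; omega
    · exact hg i

/-- There are no rings at the first `J` scales. -/
def NoRing (hq : M.IsPivot q) (sc : ℕ → ℤ) (J : ℕ) : Set Config := {ω | ∀ i < J, ω ∉ M.Ring hq (sc i)}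

/-- The region that contains the rings at the first `J` scales. -/
def rings (M : FlowerModel) (q : Hex) (sc : ℕ → ℤ) (J : ℕ) : Set Hex :=
  {h | ∃ i < J, h ∈ M.annulus q (sc i)}

theorem saturated_rings {sc : ℕ → ℤ} {J : ℕ} : M.Saturated (M.rings q sc J) := fun h =>
  exists_congr fun _ => and_congr_right fun _ => saturated_annulus h

theorem finite_rings {sc : ℕ → ℤ} {J : ℕ} : (M.rings q sc J).Finite := by
  have : M.rings q sc J = ⋃ i ∈ Finset.range J, M.annulus q (sc i) := by
    ext h; simp [rings]
  rw [this]
  exact Set.Finite.biUnion (Finset.finite_toSet _) fun _ _ => finite_annulus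

theorem local_noRing (hq : M.IsPivot q) {sc : ℕ → ℤ} (h10 : ∀ i, 10 ≤ sc i) (J : ℕ) :
    Local (M.NoRing hq sc J) (M.rings q sc J) := by
  intro ω ω' h
  refine propext (forall_congr' fun i => forall_congr' fun hi => not_congr ?_)
  exact (local_ring hq (by have := h10 i; omega)).iff fun g hg => h g ⟨i, hi, hg⟩

/-- The rings at different scales lie in disjoint annuli, so they are independent. -/
theorem law_noRing (hq : M.IsPivot q) {sc : ℕ → ℤ} (h10 : ∀ i, 10 ≤ sc i)
    (hg : ∀ i, 300 * sc i ≤ sc (i + 1)) {p : ℝ} {J : ℕ}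
    (hp : ∀ i < J, p ≤ M.law.real (M.Ring hq (sc i))) :
    M.law.real (M.NoRing hq sc J) ≤ (1 - p) ^ J := by
  induction J with
  | zero => simp [NoRing]
  | succ J ih =>
    have e : M.NoRing hq sc (J + 1) = (M.Ring hq (sc J))ᶜ ∩ M.NoRing hq sc J := by
      ext ω
      simp only [NoRing, Set.mem_ofPred_eq, Set.mem_inter_iff, Set.mem_compl_iff,
        Nat.lt_succ_iff_lt_or_eq, or_imp, forall_and, forall_eq, and_comm]
    have hl := local_ring (M := M) hq (s := sc J) (by have := h10 J; omega)
    have hpJ := hp J (Nat.lt_succ_self J)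
    rw [e, indep saturated_annulus finite_annulus hl.compl
      ((local_noRing hq h10 J).measurableSet finite_rings) ((local_noRing hq h10 J).mono ?_),
      pow_succ', measureReal_compl (hl.measurableSet finite_annulus), probReal_univ]
    · have h1 : M.law.real (M.Ring hq (sc J)) ≤ 1 := measureReal_le_one
      exact mul_le_mul (by linarith) (ih fun i hi => hp i (by omega)) measureReal_nonneg
        (by linarith)
    · rintro h ⟨i, hi, h1, _⟩ ⟨_, h4⟩
      have := scale_lt h10 hg hi
      refine h4 (hexDom_subset ?_ h1)
      have := h10 i
      simp only [sub_self, InHexagon, Prod.fst_zero, Prod.snd_zero]; omega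

/-- A yellow connection excludes the rings at all scales which it crosses. -/
theorem noRing_of_arm (hq : M.IsPivot q) {sc : ℕ → ℤ} (h10 : ∀ i, 10 ≤ sc i) {J : ℕ} {r R : ℤ}
    (hr : ∀ i < J, r ≤ 4 * sc i) (hR : ∀ i < J, 30 * sc i ≤ R) {ω : Config} {a b : Hex} {D : Set Hex}
    (ha : a ∈ M.hexDom q r) (hb : b ∉ M.hexDom q R) (h : M.Conn false ω D a b) :
    ω ∈ M.NoRing hq sc J := by
  intro i hi hω
  obtain ⟨P, hP⟩ := ring_meets hq (h10 i) hω
  have := hr i hi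
  have := hR i hi
  exact absurd (hP false D a b
    (hexDom_subset (by simp only [sub_self, InHexagon, Prod.fst_zero, Prod.snd_zero]; omega) ha)
    (fun h' => hb (hexDom_subset
      (by simp only [sub_self, InHexagon, Prod.fst_zero, Prod.snd_zero]; omega) h')) h).1 (by simp)

/-- A large cluster that lands near `x` gives a connection from near `x` to far away. -/
theorem arm_of_landing {ω : Config} {x : Hex} {τ N s : ℤ} {J : Set ℤ} (hs : 10 ≤ s) (hN : 30 * s ≤ N)
    (h : ω ∈ M.Landing (x + (τ, -N)) N J) (hJ : ∀ t ∈ J, 0 ≤ t + τ ∧ t + τ ≤ 2 * s) :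
    ∃ a b, M.Big true ω (x + (τ, -N)) N a ∧ a ∈ M.hexDom x (4 * s) ∧ b ∉ M.hexDom x N ∧
      M.Conn true ω (M.hexDom (x + (τ, -N)) N) a b := by
  obtain ⟨a, g, ha, hg, hag, hJg⟩ := h
  obtain ⟨b, hab, k, hk, hbk⟩ := ha 4
  have e := hJ _ hJg
  have c1 := base_near (M := M) hag
  have c2 := base_near (M := M) hbk
  have d1 := ha.self.1
  refine ⟨a, b, ha, ?_, ?_, hab⟩
  · simp only [sector, hexDom, InHexagon, InSector, Set.mem_ofPred_eq, Prod.fst_sub, Prod.snd_sub,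
      Prod.fst_add, Prod.snd_add, Matrix.cons_val] at *
    omega
  · simp only [sector, hexDom, InHexagon, InSector, Set.mem_ofPred_eq, Prod.fst_sub, Prod.snd_sub,
      Prod.fst_add, Prod.snd_add, Matrix.cons_val] at *
    omega

/-- If the window is narrow, then a ring around the place of landing links large clusters. -/
theorem hasStep_of_narrow {G : Grid M} {s N l r : ℤ} {p : ℝ} (hs : 10 ≤ s) (hms : G.m ≤ s)
    (hN : 2012 * s ≤ N) (hmN : G.m ∣ N) (hp : 0 ≤ p) (hT : ∀ q ∈ G.pts, p ≤ M.law.real (M.Tube q s))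
    (hw : ∀ q ∈ G.pts, M.Window q N l r) (hlr : r - l < s) :
    M.HasStep G N (p ^ 3 * (1 / 512 * (1 / 512))) ∧ ∃ τ, G.m ∣ τ ∧ ∀ x, ∀ ω,
      ω ∈ M.Landing (x + (τ, -N)) N (Set.Icc l r) → ∃ a b, a ∈ M.hexDom x (4 * s) ∧
        b ∉ M.hexDom x N ∧ M.Conn true ω Set.univ a b := by
  have w := hw _ G.o_mem
  have b1 := w.left_ge
  have b2 := w.right_le
  have b3 := w.le
  have hm := G.pos
  -- the shift by the period `τ` moves the place of landing close to `x`
  set τ := -(G.m * (l / G.m)) with hτ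
  have t1 : 0 ≤ l + τ := by
    have := Int.ediv_mul_le l hm.ne'
    rw [hτ]; linarith
  have t2 : l + τ < G.m := by
    have := Int.lt_ediv_add_one_mul_self l hm
    rw [hτ]; linarith
  have hdvd : G.m ∣ τ := (dvd_mul_right _ _).neg_right
  have hJ : ∀ t ∈ Set.Icc l r, 0 ≤ t + τ ∧ t + τ ≤ 2 * s := by
    intro t ht
    rw [Set.mem_Icc] at ht
    omega
  refine ⟨hasStep_of_third (τ := τ) (h := N) hdvd hmN (by omega) (by omega) le_rfl (by omega)
    fun x hx => ?_, τ, hdvd, fun x ω h => ?_⟩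
  · have hq := G.isPivot hx
    set z := x + (τ, -N) with hz
    have hzp : z ∈ G.pts := G.add_mem hx hdvd (by simpa using hmN)
    have c1 := (hw z hzp).mid
    have u := up_landing (M := M) (z := z) (n := N) (J := Set.Icc l r)
    have := (up_ring hq (by omega : 0 ≤ s)).le_inter (u.inter (u.preimage (Sym.third hq) rfl))
      (by positivity) (law_ring hq (by omega) hp (hT x hx))
      (u.le_inter (u.preimage (Sym.third hq) rfl) (by norm_num) c1 (u.le_preimage _ c1))
    refine this.trans ?_
    rw [← (Sym.third hq).law_preimage (up_linked (M := M)).measurableSet]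
    refine real_mono ?_
    rintro ω ⟨hω, h1, h2⟩
    obtain ⟨P, hP⟩ := ring_meets hq hs hω
    obtain ⟨a, b, ha, hax, hbx, hab⟩ := arm_of_landing hs (by omega) h1 hJ
    obtain ⟨a', b', ha', hax', hbx', hab'⟩ := arm_of_landing hs (by omega) h2 hJ
    obtain ⟨a', rfl⟩ := (Sym.third hq).φ.surjective a'
    obtain ⟨b', rfl⟩ := (Sym.third hq).φ.surjective b'
    rw [(Sym.third hq).conn_of_f rfl] at hab'
    have out : ∀ {b}, b ∉ M.hexDom x N → b ∉ M.hexDom x (30 * s) := fun hb h' => hb (hexDom_subset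
      (by simp only [sub_self, InHexagon, Prod.fst_zero, Prod.snd_zero]; omega) h')
    have k1 := (hP _ _ _ _ hax (out hbx) hab).2
    have k2 := (hP _ _ _ _ ((third_hexDom hq _ _).1 hax')
      (out (mt (third_hexDom hq _ _).2 hbx')) hab').2
    refine ⟨_, _, ha', ((Sym.rigid_third hq).big _ _ _ _).2 ha, ?_⟩
    refine ((third_conn hq).2 (k2.symm.trans k1)).mono (Set.Subset.trans
      (hexDom_subset (n' := 4 * N) ?_) Set.subset_union_left)
    simp only [hz, sub_add_cancel_left, InHexagon, Prod.neg_mk]; omega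
  · obtain ⟨a, b, _, ha, hb, hab⟩ := arm_of_landing hs (by omega) h hJ
    exact ⟨a, b, ha, hb, hab.mono (Set.subset_univ _)⟩

/-- A tube at the scale `s` forces a wide window at a comparable scale. Otherwise there
would be rings at many scales, which contradicts the fact that a large cluster lands in a narrow
window. -/
theorem exists_wide_window (G : Grid M) {l r : ℤ → ℤ}
    (hw : ∀ n, 10 ≤ n → ∀ q ∈ G.pts, M.Window q n (l n) (r n)) {p : ℝ} (hp : 0 < p) :
    ∃ C : ℤ, 1 ≤ C ∧ ∀ s, 10 ≤ s → G.m ≤ s → G.m ∣ s → (∀ q ∈ G.pts, p ≤ M.law.real (M.Tube q s)) →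
      ∃ N, G.m ∣ N ∧ 2012 * s ≤ N ∧ N ≤ C * s ∧ s ≤ r N - l N := by
  -- a lower bound for tubes at all scales with a narrow window; with `J` of these scales, rings are
  -- absent with a probability below the one of landing in the window
  set p₂ : ℝ := (p ^ 3 * (1 / 512 * (1 / 512))) ^ 2600 with hp₂
  have hp₂0 : 0 < p₂ := by positivity
  have hp₃ : 1 - p₂ ^ 3 < 1 := sub_lt_self _ (by positivity)
  obtain ⟨J, hJ⟩ := exists_pow_lt_of_lt_one (by norm_num : (0 : ℝ) < 1 / 512) hp₃
  refine ⟨2012 * 300 ^ J, ?_, fun s hs hms hdvd hT => ?_⟩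
  · have : (1 : ℤ) ≤ 300 ^ J := one_le_pow₀ (by norm_num)
    omega
  by_contra hcon
  push Not at hcon
  set N : ℕ → ℤ := fun i => 2012 * 300 ^ i * s with hN
  have hNs : ∀ i, N (i + 1) = 300 * N i := fun i => by simp only [hN]; ring
  have hN0 : N 0 = 2012 * s := by simp [hN]
  have hNge : ∀ i, 2012 * s ≤ N i := by
    intro i
    induction i with
    | zero => omega
    | succ i ih => rw [hNs]; omega
  have hNmono : Monotone N := monotone_nat_of_le_succ fun i => by
    rw [hNs]; have := hNge i; omega
  have hNd : ∀ i, G.m ∣ N i := fun i => hdvd.mul_left _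
  have hnar : ∀ i ≤ J, r (N i) - l (N i) < s := fun i hi => hcon _ (hNd i) (hNge i) (hNmono hi)
  have hstep := fun i (hi : i ≤ J) => hasStep_of_narrow hs hms (hNge i) (hNd i) hp.le hT
    (hw (N i) (by have := hNge i; omega)) (hnar i hi)
  have hq := G.pivot
  have h10 : ∀ i, 10 ≤ 10 * N i := fun i => by have := hNge i; omega
  have hlaw := law_noRing hq (sc := fun i => 10 * N i) h10 (fun i => by rw [hNs]; omega)
    (p := p₂ ^ 3) (J := J) fun i hi => law_ring hq (by have := hNge i; omega) hp₂0.le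
      (law_tube (by have := hNge i; omega) (hNd i) (by positivity) (hstep i hi.le).1 G.o_mem)
  obtain ⟨τ, hτ, harm⟩ := (hstep J le_rfl).2
  have hmid := (hw (N J) (by have := hNge J; omega) _
    (G.add_mem G.o_mem (v := (τ, -N J)) hτ (by simpa using hNd J))).mid
  rw [← (Sym.turn hq).law_preimage ((local_noRing hq h10 J).measurableSet finite_rings)] at hlaw
  -- a sixth of a turn makes the blue connection a yellow one, which excludes the rings
  have hsub : M.Landing (G.o + (τ, -N J)) (N J) (Set.Icc (l (N J)) (r (N J))) ⊆
      (Sym.turn hq).act ⁻¹' M.NoRing hq (fun i => 10 * N i) J := by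
    intro ω hω
    obtain ⟨a, b, ha, hb, hab⟩ := harm _ _ hω
    have hz : (Sym.turn hq).φ G.o = G.o := by simp [Sym.turn_apply, rot]
    have hd : ∀ n h, (Sym.turn hq).φ h ∈ M.hexDom G.o n ↔ h ∈ M.hexDom G.o n := by
      intro n h
      have := mem_hexDom_turn (z := G.o) (n := n) hq h
      rwa [hz] at this
    refine noRing_of_arm hq h10 (r := 4 * s) (R := N J) (fun i _ => ?_) (fun i hi => ?_)
      ((hd _ _).2 ha) (mt (hd _ _).1 hb)
      ((Sym.turn hq).conn_apply (D' := Set.univ) hab fun _ => by simp)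
    · have := hNge i; omega
    · have := hNmono (Nat.succ_le_of_lt hi)
      rw [Nat.succ_eq_add_one, hNs] at this
      omega
  exact absurd (hmid.trans ((real_mono hsub).trans hlaw)) (not_le.2 hJ)

/-- A wide window leads to a step at a comparable scale, since the windows cannot grow faster than
the scale for long. -/
theorem exists_hasStep (G : Grid M) {l r : ℤ → ℤ}
    (hw : ∀ n, 10 ≤ n → ∀ q ∈ G.pts, M.Window q n (l n) (r n)) (C : ℤ) :
    ∃ C' : ℤ, 1 ≤ C' ∧ ∀ s N, 40 ≤ s → 16 + 2 * G.m ≤ s → G.m ∣ N → s ≤ N → N ≤ C * s →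
      s ≤ r N - l N → ∃ n, G.m ∣ n ∧ N ≤ n ∧ n ≤ C' * N ∧ M.HasStep G n (2⁻¹ ^ 66) := by
  obtain ⟨J, hJ⟩ : ∃ J : ℕ, 2 * C < 4 ^ J :=
    ⟨(2 * C).toNat, by
      have h1 : (2 * C).toNat < 4 ^ (2 * C).toNat := Nat.lt_pow_self (by norm_num)
      have h2 : ((2 * C).toNat : ℤ) < 4 ^ (2 * C).toNat := by exact_mod_cast h1
      omega⟩
  refine ⟨2 ^ (J + 1), one_le_pow₀ (by norm_num), fun s N hs hms hdvd hsN hNC hwide => ?_⟩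
  by_contra hcon
  push Not at hcon
  have hge : ∀ i : ℕ, N ≤ 2 ^ i * N := fun i => by
    have : (1 : ℤ) ≤ 2 ^ i := one_le_pow₀ (by norm_num)
    nlinarith
  -- without a step, the window grows at least by the factor `8` when the scale doubles, but it is
  -- never much longer than the scale
  have key : ∀ i ≤ J, 8 ^ i * s ≤ r (2 ^ i * N) - l (2 ^ i * N) := by
    intro i hi
    induction i with
    | zero => simpa using hwide
    | succ i ih =>
      have ih := ih (by omega)
      have h1 := hge i
      have h2 : s ≤ 8 ^ i * s := by
        have : (1 : ℤ) ≤ 8 ^ i := one_le_pow₀ (by norm_num)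
        nlinarith
      have e : (2 : ℤ) ^ (i + 1) * N = 2 * (2 ^ i * N) := by ring
      have e8 : (8 : ℤ) ^ (i + 1) * s = 8 * (8 ^ i * s) := by ring
      have hno := hcon (2 ^ (i + 1) * N) (hdvd.mul_left _) (hge _)
        (mul_le_mul_of_nonneg_right (pow_le_pow_right₀ (by norm_num) (by omega)) (by omega))
      rw [e] at hno ⊢
      rw [e8]
      have hm := G.pos
      by_contra hlt
      refine hno (hasStep_of_window (by omega) (hdvd.mul_left _) (hw _ (by omega))
        (hw (2 * (2 ^ i * N)) (by omega)) ?_)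
      omega
  have h1 := key J le_rfl
  have h2 := hge J
  have w := hw (2 ^ J * N) (by omega) _ G.o_mem
  have b1 := w.left_ge
  have b2 := w.right_le
  have e1 : (8 : ℤ) ^ J = 4 ^ J * 2 ^ J := by rw [← mul_pow]; norm_num
  have h3 : (4 : ℤ) ^ J * 2 ^ J * s ≤ 2 * (2 ^ J * (C * s)) := by
    have : (2 : ℤ) ^ J * N ≤ 2 ^ J * (C * s) := mul_le_mul_of_nonneg_left hNC (by positivity)
    rw [← e1]; omega
  have h4 : 2 * C * (2 ^ J * s) < 4 ^ J * (2 ^ J * s) :=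
    mul_lt_mul_of_pos_right hJ (by positivity)
  linarith

/-- With positive probability, everything in a finite domain is blue, and then there is a tube. -/
theorem tube_pos (q : Hex) {s : ℤ} (hs : 10 ≤ s) : 0 < M.law.real (M.Tube q s) := by
  set F := (finite_hexDom (M := M) q (2012 * s)).toFinset with hF
  set A : Set Config := {ω | ∀ h ∈ F, h ∉ M.irises → ω h = .blue} with hA
  have hAl : Local A (F : Set Hex) := fun ω ω' h => propext (forall_congr' fun g =>
    forall_congr' fun hg => by rw [h g hg])
  have hpos : 0 < M.law.real A := by
    rw [law, map_measureReal_apply M.measurable_config (hAl.measurableSet F.finite_toSet)]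
    have hsub : Set.pi (F : Set Hex) (fun _ => ({true} : Set Bool) ×ˢ (Set.univ : Set HexState)) ⊆
        M.config ⁻¹' A := by
      intro x hx h hh hi
      have := (hx h hh).1
      rw [config_of_notMem hi, Set.mem_singleton_iff.1 this]
      rfl
    refine lt_of_lt_of_le ?_ (measureReal_mono hsub)
    rw [measureReal_def, seedLaw, Measure.infinitePi_pi _ fun _ _ => MeasurableSet.of_discrete]
    simp [Measure.prod_prod, coin_singleton]
  refine hpos.trans_le (real_mono fun ω hω => ?_)
  have hcol : ∀ h : Hex, h ∉ M.irises → -(32 * s) ≤ h.1 - q.1 → h.1 - q.1 ≤ 32 * s →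
      -(11 * s) ≤ h.2 - q.2 → h.2 - q.2 ≤ -(9 * s) → h ∈ M.strip q s ∧ M.IsCol true ω h := by
    intro h hi h1 h2 h3 h4
    have e := coord_base (M := M) h
    have hst : h ∈ M.strip q s := by
      simp only [strip, Set.mem_ofPred_eq]; omega
    refine ⟨hst, hi, hω h ?_ hi⟩
    rw [hF, Set.Finite.mem_toFinset]
    exact strip_subset (by omega) hst
  set pt : ℤ → Hex := fun t => (q.1 + t, q.2 - 10 * s) with hpt
  have nbr : ∀ {t i : ℤ}, pt t ∈ M.irises → Near (pt t) (q.1 + t + i, q.2 - 10 * s) → i ≠ 0 →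
      ((q.1 + t + i, q.2 - 10 * s) : Hex) ∉ M.irises := by
    intro t i hi hn h0 hi'
    have := iris_unique hi hi' hn (Near.refl _)
    simp only [hpt, Prod.mk.injEq] at this
    omega
  have hnear : ∀ t i : ℤ, -1 ≤ i → i ≤ 1 → Near (pt t) (q.1 + t + i, q.2 - 10 * s) := by
    intro t i h1 h2; simp only [Near, hpt]; omega
  -- the last point of the row up to `t` that is not an iris
  set e : ℤ → Hex := fun t => by classical exact if pt t ∈ M.irises then pt (t - 1) else pt t
    with he
  have e1 : ∀ t, pt t ∈ M.irises → e t = pt (t - 1) := fun t h => by simp only [he, if_pos h]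
  have e2 : ∀ t, pt t ∉ M.irises → e t = pt t := fun t h => by simp only [he, if_neg h]
  have hprev : ∀ t, pt t ∈ M.irises → pt (t - 1) ∉ M.irises := by
    intro t h
    have := nbr h (hnear t (-1) (by omega) (by omega)) (by omega)
    rwa [show ((q.1 + t + -1, q.2 - 10 * s) : Hex) = pt (t - 1) from
      Prod.ext (by simp only [hpt]; ring) rfl] at this
  have hnext : ∀ t, pt t ∈ M.irises → pt (t + 1) ∉ M.irises := by
    intro t h
    have := nbr h (hnear t 1 (by omega) (by omega)) (by omega)
    rwa [show ((q.1 + t + 1, q.2 - 10 * s) : Hex) = pt (t + 1) from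
      Prod.ext (by simp only [hpt]; ring) rfl] at this
  have hcp : ∀ t, pt t ∉ M.irises → -(32 * s) ≤ t → t ≤ 32 * s →
      pt t ∈ M.strip q s ∧ M.IsCol true ω (pt t) := fun t h h1 h2 =>
    hcol _ h (by simp only [hpt]; omega) (by simp only [hpt]; omega) (by simp only [hpt]; omega)
      (by simp only [hpt]; omega)
  have hec : ∀ t, -(31 * s) ≤ t → t ≤ 31 * s → e t ∈ M.strip q s ∧ M.IsCol true ω (e t) := by
    intro t h1 h2
    by_cases h : pt t ∈ M.irises
    · rw [e1 t h]; exact hcp _ (hprev t h) (by omega) (by omega)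
    · rw [e2 t h]; exact hcp _ h (by omega) (by omega)
  -- a walk along a row, which passes above the irises on it
  have hstep : ∀ t, -(31 * s) ≤ t → t + 1 ≤ 31 * s → M.Conn true ω (M.strip q s) (e t) (e (t + 1)) := by
    intro t h1 h2
    have c1 := hec t h1 (by omega)
    have c2 := hec (t + 1) (by omega) h2
    by_cases h : pt t ∈ M.irises
    · have pu : ∀ i : ℤ, -1 ≤ i → i ≤ 0 → ((q.1 + t + i, q.2 - 10 * s + 1) : Hex) ∈ M.strip q s ∧
          M.IsCol true ω (q.1 + t + i, q.2 - 10 * s + 1) := by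
        intro i h3 h4
        refine hcol _ (fun hi' => ?_) (by simp only; omega) (by simp only; omega)
          (by simp only; omega) (by simp only; omega)
        have := iris_unique h hi' (by simp only [Near, hpt]; omega) (Near.refl _)
        simp only [hpt, Prod.mk.injEq] at this
        omega
      rw [e1 t h] at c1 ⊢
      rw [e2 _ (hnext t h)] at c2 ⊢
      have u1 := pu (-1) (by omega) (by omega)
      have u2 := pu 0 (by omega) (by omega)
      exact ((Conn.near c1.1 u1.1 c1.2 u1.2 (by simp only [Near, hpt]; omega)).trans
        (Conn.near u1.1 u2.1 u1.2 u2.2 (by simp only [Near]; omega))).trans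
        (Conn.near u2.1 c2.1 u2.2 c2.2 (by simp only [Near, hpt]; omega))
    · rw [e2 t h] at c1 ⊢
      by_cases h' : pt (t + 1) ∈ M.irises
      · rw [e1 _ h', add_sub_cancel_right]
        exact Conn.refl c1.1 c1.2
      · rw [e2 _ h'] at c2 ⊢
        exact Conn.near c1.1 c2.1 c1.2 c2.2 (by simp only [Near, hpt]; omega)
  have hall : ∀ k : ℕ, k ≤ 62 * s → M.Conn true ω (M.strip q s) (e (-(31 * s))) (e (-(31 * s) + k)) := by
    intro k hk
    induction k with
    | zero =>
      have := hec (-(31 * s)) le_rfl (by omega)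
      simpa using Conn.refl this.1 this.2
    | succ k ih =>
      have := hstep (-(31 * s) + k) (by omega) (by push_cast at hk; omega)
      rw [add_assoc] at this
      exact (ih (by push_cast at hk; omega)).trans (by exact_mod_cast this)
  have hex : ∀ t, t - 1 ≤ (e t).1 - q.1 ∧ (e t).1 - q.1 ≤ t := by
    intro t
    by_cases h : pt t ∈ M.irises
    · rw [e1 t h]; simp only [hpt]; omega
    · rw [e2 t h]; simp only [hpt]; omega
  have h1 := hex (-(31 * s))
  have h2 := hex (-(31 * s) + (62 * s).toNat)
  exact ⟨_, _, by omega, by omega, hall (62 * s).toNat (by omega)⟩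

/-- There are scales of comparable ratios at which the tubes have probabilities bounded from
below. -/
theorem exists_scales (G : Grid M) : ∃ (p : ℝ) (B : ℤ) (sc : ℕ → ℤ), 0 < p ∧ p ≤ 1 / 2 ∧ 1 < B ∧
    (∀ i, 10 ≤ sc i) ∧ (∀ i, 300 * sc i ≤ sc (i + 1)) ∧ (∀ i, sc (i + 1) ≤ B * sc i) ∧
    ∀ i, ∀ q ∈ G.pts, p ≤ M.law.real (M.Tube q (sc i)) := by
  have hwin : ∀ n, ∃ l r, 10 ≤ n → ∀ q ∈ G.pts, M.Window q n l r := by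
    intro n
    by_cases hn : 10 ≤ n
    · obtain ⟨l, r, h⟩ := exists_window G.pivot hn
      exact ⟨l, r, fun _ q hq => h.of_mem G G.o_mem hq⟩
    · exact ⟨0, 0, fun h => absurd h hn⟩
  choose l r hw using hwin
  have hm := G.pos
  set s₀ : ℤ := 60 * G.m with hs₀
  set p₁ : ℝ := ((2⁻¹ : ℝ) ^ 66) ^ 2600 with hp₁
  have hp₁0 : 0 < p₁ := by positivity
  have hp₁1 : p₁ ≤ 1 / 2 := by
    rw [hp₁, ← pow_mul, one_div]
    exact pow_le_of_le_one (by norm_num) (by norm_num) (by norm_num)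
  set p := min p₁ (M.law.real (M.Tube G.o s₀)) with hp
  have hp0 : 0 < p := lt_min hp₁0 (tube_pos _ (by omega))
  obtain ⟨C, hC, hwide⟩ := exists_wide_window G hw hp0
  obtain ⟨C', hC', hstep⟩ := exists_hasStep G hw C
  -- from a tube to a wide window, from there to a step, and from the step to a larger tube
  have next : ∀ s : {s : ℤ // (s₀ ≤ s ∧ G.m ∣ s) ∧ ∀ q ∈ G.pts, p ≤ M.law.real (M.Tube q s)},
      ∃ s' : {s : ℤ // (s₀ ≤ s ∧ G.m ∣ s) ∧ ∀ q ∈ G.pts, p ≤ M.law.real (M.Tube q s)},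
        300 * s.1 ≤ s'.1 ∧ s'.1 ≤ 10 * C' * C * s.1 := by
    rintro ⟨s, ⟨h1, h2⟩, h3⟩
    obtain ⟨N, n1, n2, n3, n4⟩ := hwide s (by omega) (by omega) h2 h3
    obtain ⟨n, k1, k2, k3, k4⟩ := hstep s N (by omega) (by omega) n1 (by omega) n3 n4
    refine ⟨⟨10 * n, ⟨by omega, k1.mul_left _⟩, fun q hq => (min_le_left _ _).trans
      (law_tube (by omega) k1 (by positivity) k4 hq)⟩, by simp only; omega, ?_⟩
    have : C' * N ≤ C' * (C * s) := mul_le_mul_of_nonneg_left n3 (by omega)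
    simp only
    linarith
  choose f hf1 hf2 using next
  have base : ∀ q ∈ G.pts, p ≤ M.law.real (M.Tube q s₀) := by
    intro q hq
    have := law_tube_add (M := M) (q := G.o) (s := s₀) (G.sub_period G.o_mem hq) (by omega)
    rw [add_sub_cancel] at this
    rw [this]
    exact min_le_right _ _
  let S : ℕ → {s : ℤ // (s₀ ≤ s ∧ G.m ∣ s) ∧ ∀ q ∈ G.pts, p ≤ M.law.real (M.Tube q s)} := fun i =>
    f^[i] ⟨s₀, ⟨le_rfl, dvd_mul_left _ _⟩, base⟩
  have hS : ∀ i, S (i + 1) = f (S i) := fun i => Function.iterate_succ_apply' _ _ _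
  refine ⟨p, 10 * C' * C, fun i => (S i).1, hp0, (min_le_left _ _).trans hp₁1, by nlinarith,
    fun i => by have := (S i).2.1.1; simp only; omega, fun i => ?_, fun i => ?_, fun i => (S i).2.2⟩
  · simp only [hS]; exact hf1 _
  · simp only [hS]; exact hf2 _

end FlowerModel

/-! ### The one-arm bound -/

namespace FlowerModel

variable {M : FlowerModel}

theorem exists_grid_point (G : Grid M) (x : Hex) :
    ∃ q ∈ G.pts, (0 ≤ x.1 - q.1 ∧ x.1 - q.1 < G.m) ∧ 0 ≤ x.2 - q.2 ∧ x.2 - q.2 < G.m := by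
  have hm := G.pos
  refine ⟨G.o + (G.m * ((x.1 - G.o.1) / G.m), G.m * ((x.2 - G.o.2) / G.m)),
    G.add_mem G.o_mem (dvd_mul_right _ _) (dvd_mul_right _ _), ?_⟩
  have a1 := Int.ediv_mul_le (x.1 - G.o.1) hm.ne'
  have a2 := Int.lt_ediv_add_one_mul_self (x.1 - G.o.1) hm
  have a3 := Int.ediv_mul_le (x.2 - G.o.2) hm.ne'
  have a4 := Int.lt_ediv_add_one_mul_self (x.2 - G.o.2) hm
  simp only [Prod.fst_add, Prod.snd_add]
  refine ⟨⟨?_, ?_⟩, ?_, ?_⟩ <;> linarith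

/-- The event `N` depends on finitely many flowers and fillers at distance at most `R` from `x`, and
it holds whenever there is a yellow connection from the distance `r` to the distance `R`. -/
structure ArmEvent (M : FlowerModel) (x : Hex) (r R : ℤ) (N : Set Config) : Prop where
  loc : ∃ S, M.Saturated S ∧ S.Finite ∧ S ⊆ M.hexDom x R ∧ Local N S
  arm : ∀ ω a b, ∀ D : Set Hex, a ∈ M.hexDom x r → b ∉ M.hexDom x R → M.Conn false ω D a b → ω ∈ N

/-- The probability of a yellow connection between two distances decays like a power of their
ratio. -/
theorem one_arm (M : FlowerModel) : ∃ C ψ : ℝ, 0 < C ∧ 0 < ψ ∧ ∀ (x : Hex) (r R : ℤ), 1 ≤ r → 1 ≤ R →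
    ∃ N, M.ArmEvent x r R N ∧ M.law.real N ≤ C * ((r : ℝ) / R) ^ ψ := by
  obtain ⟨G⟩ := Grid.exists_grid M
  obtain ⟨p, B, sc, hp, hp1, hB, h10, hg, hgB, hT⟩ := exists_scales G
  have hm := G.pos
  set δ : ℝ := 1 - p ^ 3 with hδ
  have hp3 : 0 < p ^ 3 := by positivity
  have hp3' : p ^ 3 ≤ 1 / 8 := by
    calc p ^ 3 ≤ (1 / 2) ^ 3 := pow_le_pow_left₀ hp.le hp1 3
      _ = 1 / 8 := by norm_num
  have hδ0 : 0 < δ := by rw [hδ]; linarith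
  have hδ1 : δ < 1 := by rw [hδ]; linarith
  have hBr : (1 : ℝ) < B := by exact_mod_cast hB
  -- the exponent for which `δ = B ^ (-ψ)`
  set ψ : ℝ := -Real.log δ / Real.log B with hψ
  have hlogB : 0 < Real.log B := Real.log_pos hBr
  have hψ0 : 0 < ψ := div_pos (neg_pos.2 (Real.log_neg hδ0 hδ1)) hlogB
  set A : ℤ := sc 0 + B * (1 + 2 * G.m) with hA
  set K : ℤ := 2012 * A + 2 * G.m with hK
  have hA1 : 1 ≤ A := by
    have := h10 0
    have : 0 ≤ B * (1 + 2 * G.m) := by positivity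
    omega
  have hK1 : 1 ≤ K := by omega
  have hKr : (0 : ℝ) < K := by exact_mod_cast (by omega : 0 < K)
  refine ⟨(B * K : ℝ) ^ ψ, ψ, by positivity, hψ0, fun x r R hr hR => ?_⟩
  have hrr : (0 : ℝ) < r := by exact_mod_cast (by omega : 0 < r)
  have hRr : (0 : ℝ) < R := by exact_mod_cast (by omega : 0 < R)
  rw [← Real.mul_rpow (by positivity) (by positivity)]
  by_cases hsmall : (R : ℝ) / r < K
  · -- nothing is claimed at comparable distances
    refine ⟨Set.univ, ⟨⟨∅, fun _ => Iff.rfl, Set.finite_empty, Set.empty_subset _,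
      fun _ _ _ => rfl⟩, fun _ _ _ _ _ _ _ => trivial⟩, ?_⟩
    rw [probReal_univ]
    refine Real.one_le_rpow ?_ hψ0.le
    rw [div_lt_iff₀ hrr] at hsmall
    rw [← mul_div_assoc, one_le_div hRr]
    nlinarith [mul_pos hKr hrr]
  -- the number of scales that fit between the two distances
  obtain ⟨J, hJ1, hJ2⟩ := exists_nat_pow_near ((one_le_div hKr).2 (not_lt.1 hsmall)) hBr
  -- the first scale that is larger than `r`
  have hlarge : ∀ i : ℕ, (i : ℤ) ≤ sc i := by
    intro i
    induction i with
    | zero => have := h10 0; push_cast; omega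
    | succ i ih => have := hg i; have := h10 i; push_cast; omega
  have hex : ∃ a, r + 2 * G.m ≤ 4 * sc a := ⟨(r + 2 * G.m).toNat, by
    have := hlarge (r + 2 * G.m).toNat; omega⟩
  classical
  obtain ⟨a, ha, hamin⟩ : ∃ a, r + 2 * G.m ≤ 4 * sc a ∧ ∀ b < a, 4 * sc b < r + 2 * G.m :=
    ⟨Nat.find hex, Nat.find_spec hex, fun b hb => not_le.1 (Nat.find_min hex hb)⟩
  have haA : sc a ≤ A * r := by
    have e : A * r = sc 0 * r + B * ((1 + 2 * G.m) * r) := by rw [hA]; ring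
    rcases a with _ | a
    · have h0 := h10 0
      have : 0 ≤ B * ((1 + 2 * G.m) * r) := by positivity
      nlinarith
    · have h1 := hamin a (Nat.lt_succ_self a)
      have h2 := hgB a
      have h0 : 0 ≤ sc 0 * r := by have := h10 0; positivity
      have h3 : sc a ≤ (1 + 2 * G.m) * r := by
        have := h10 a
        nlinarith
      have h4 : B * sc a ≤ B * ((1 + 2 * G.m) * r) := mul_le_mul_of_nonneg_left h3 (by omega)
      omega
  have hscB : ∀ i, sc (a + i) ≤ B ^ i * sc a := by
    intro i
    induction i with
    | zero => simp
    | succ i ih =>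
      calc sc (a + (i + 1)) ≤ B * sc (a + i) := hgB _
        _ ≤ B * (B ^ i * sc a) := mul_le_mul_of_nonneg_left ih (by omega)
        _ = B ^ (i + 1) * sc a := by ring
  have hJK : B ^ J * (K * r) ≤ R := by
    have : (B : ℝ) ^ J * (K * r) ≤ R := by
      rw [div_div, le_div_iff₀ (by positivity)] at hJ1
      linarith
    exact_mod_cast this
  have hout : ∀ i < J, 2012 * sc (a + i) + 2 * G.m ≤ R := by
    intro i hi
    have h1 : B ^ i * sc a ≤ B ^ J * (A * r) :=
      mul_le_mul (pow_le_pow_right₀ (by omega) hi.le) haA (by have := h10 a; omega) (by positivity)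
    have h2 := hscB i
    have h3 : (1 : ℤ) ≤ B ^ J := one_le_pow₀ (by omega)
    have h4 : 2 * G.m ≤ B ^ J * (2 * G.m * r) :=
      (le_mul_of_one_le_right (by omega) hr).trans (le_mul_of_one_le_left (by positivity) h3)
    have h5 : B ^ J * (K * r) = 2012 * (B ^ J * (A * r)) + B ^ J * (2 * G.m * r) := by rw [hK]; ring
    omega
  obtain ⟨q, hqp, hq1, hq2⟩ := exists_grid_point G x
  have hq := G.isPivot hqp
  have h10' : ∀ i, 10 ≤ sc (a + i) := fun i => h10 _
  refine ⟨M.NoRing hq (fun i => sc (a + i)) J, ⟨⟨_, saturated_rings, finite_rings, ?_,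
    local_noRing hq h10' J⟩, fun ω u v D hu hv h => ?_⟩, ?_⟩
  · rintro h ⟨i, hi, hh, _⟩
    refine hexDom_subset ?_ hh
    have := hout i hi
    simp only [InHexagon, Prod.fst_sub, Prod.snd_sub]
    omega
  · refine noRing_of_arm hq h10' (r := r + 2 * G.m) (R := R - 2 * G.m) (fun i _ => ?_)
      (fun i hi => ?_) (hexDom_subset ?_ hu) (fun h' => hv (hexDom_subset ?_ h')) h
    · rcases Nat.eq_zero_or_pos i with rfl | hi
      · exact ha
      · have := scale_lt h10 hg (show a < a + i by omega)
        have := h10 a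
        omega
    · have := hout i hi; have := h10' i; omega
    · simp only [InHexagon, Prod.fst_sub, Prod.snd_sub]; omega
    · simp only [InHexagon, Prod.fst_sub, Prod.snd_sub]; omega
  · refine (law_noRing hq h10' (fun i => hg _) (p := p ^ 3) fun i _ =>
      law_ring hq (by have := h10' i; omega) hp.le (hT _ _ hqp)).trans ?_
    have e : δ = ((B : ℝ)⁻¹) ^ ψ := by
      rw [Real.inv_rpow (by positivity), ← Real.rpow_neg (by positivity), hψ,
        Real.rpow_def_of_pos (by positivity), neg_div, neg_neg, mul_div_cancel₀ _ hlogB.ne',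
        Real.exp_log hδ0]
    rw [← hδ, e, ← Real.rpow_natCast, ← Real.rpow_mul (by positivity), mul_comm ψ,
      Real.rpow_mul (by positivity), Real.rpow_natCast]
    refine Real.rpow_le_rpow (by positivity) ?_ hψ0.le
    rw [inv_pow, inv_le_iff_one_le_mul₀ (by positivity)]
    rw [div_div, div_lt_iff₀ (by positivity)] at hJ2
    rw [mul_div_assoc', div_mul_eq_mul_div, one_le_div hRr]
    rw [pow_succ] at hJ2
    nlinarith

end FlowerModel

/-! ### Geometry of the tiling -/

theorem center_re (h : Hex) : (center h).re = h.1 + h.2 / 2 := by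
  have e : Complex.exp (Complex.I * (Real.pi / 3)) = Complex.exp ((Real.pi / 3 : ℝ) * Complex.I) := by
    congr 1; push_cast; ring
  simp only [center, e, Complex.add_re, Complex.mul_re, Complex.exp_ofReal_mul_I_re,
    Complex.exp_ofReal_mul_I_im, Complex.intCast_re, Complex.intCast_im, Real.cos_pi_div_three]
  ring

theorem center_im (h : Hex) : (center h).im = h.2 * (√3 / 2) := by
  have e : Complex.exp (Complex.I * (Real.pi / 3)) = Complex.exp ((Real.pi / 3 : ℝ) * Complex.I) := by
    congr 1; push_cast; ring
  simp only [center, e, Complex.add_im, Complex.mul_im, Complex.exp_ofReal_mul_I_re,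
    Complex.exp_ofReal_mul_I_im, Complex.intCast_re, Complex.intCast_im, Real.sin_pi_div_three]
  ring

theorem center_sub (h g : Hex) : center (h - g) = center h - center g := by
  simp only [center, Prod.fst_sub, Prod.snd_sub, Int.cast_sub]; ring

theorem norm_center_le (h : Hex) : ‖center h‖ ≤ |(h.1 : ℝ)| + |(h.2 : ℝ)| := by
  have e : Complex.exp (Complex.I * (Real.pi / 3)) = Complex.exp ((Real.pi / 3 : ℝ) * Complex.I) := by
    congr 1; push_cast; ring
  refine (norm_add_le _ _).trans (le_of_eq ?_)
  rw [norm_mul, e, Complex.norm_exp_ofReal_mul_I, mul_one, Complex.norm_intCast,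
    Complex.norm_intCast]

theorem sqrt_three_bounds : 1 ≤ √3 ∧ √3 ≤ 2 :=
  ⟨Real.one_le_sqrt.2 (by norm_num), (Real.sqrt_le_left (by norm_num)).2 (by norm_num)⟩

theorem coord_le_norm_center (h : Hex) : |(h.1 : ℝ)| ≤ 2 * ‖center h‖ ∧
    |(h.2 : ℝ)| ≤ 2 * ‖center h‖ ∧ |(h.1 : ℝ) + h.2| ≤ 2 * ‖center h‖ := by
  have h1 := abs_le.1 (Complex.abs_re_le_norm (center h))
  have h2 := abs_le.1 (Complex.abs_im_le_norm (center h))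
  rw [center_re] at h1
  rw [center_im] at h2
  have h3 := sqrt_three_bounds.1
  have h4 : |(h.2 : ℝ)| ≤ 2 * ‖center h‖ := by
    rw [abs_le]
    constructor <;> nlinarith [norm_nonneg (center h)]
  have h5 := abs_le.1 h4
  refine ⟨abs_le.2 ⟨by linarith, by linarith⟩, h4, abs_le.2 ⟨by linarith, by linarith⟩⟩

theorem exists_hex_near (w : ℂ) : ∃ x : Hex, ‖center x - w‖ ≤ 2 := by
  have h3 : (0 : ℝ) < √3 := by positivity
  set Y := w.im * 2 / √3 with hY
  set X := w.re - Y / 2 with hX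
  refine ⟨(⌊X⌋, ⌊Y⌋), ?_⟩
  have e : center (⌊X⌋, ⌊Y⌋) - w =
      ((⌊X⌋ - X : ℝ) : ℂ) + ((⌊Y⌋ - Y : ℝ) : ℂ) * Complex.exp ((Real.pi / 3 : ℝ) * Complex.I) := by
    apply Complex.ext
    · rw [Complex.sub_re, center_re]
      simp only [Complex.add_re, Complex.mul_re, Complex.exp_ofReal_mul_I_re,
        Complex.exp_ofReal_mul_I_im, Complex.ofReal_re, Complex.ofReal_im, Real.cos_pi_div_three]
      rw [hX]; ring
    · rw [Complex.sub_im, center_im]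
      simp only [Complex.add_im, Complex.mul_im, Complex.exp_ofReal_mul_I_re,
        Complex.exp_ofReal_mul_I_im, Complex.ofReal_re, Complex.ofReal_im, Real.sin_pi_div_three]
      rw [hY]; field_simp; ring
  rw [e]
  refine (norm_add_le _ _).trans ?_
  rw [norm_mul, Complex.norm_exp_ofReal_mul_I, mul_one, Complex.norm_real, Complex.norm_real,
    Real.norm_eq_abs, Real.norm_eq_abs]
  have a1 := Int.floor_le X
  have a2 := Int.lt_floor_add_one X
  have a3 := Int.floor_le Y
  have a4 := Int.lt_floor_add_one Y
  have b1 : |(⌊X⌋ : ℝ) - X| ≤ 1 := abs_le.2 ⟨by linarith, by linarith⟩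
  have b2 : |(⌊Y⌋ : ℝ) - Y| ≤ 1 := abs_le.2 ⟨by linarith, by linarith⟩
  linarith

theorem norm_center_near {g h : Hex} (hn : Near g h) : ‖center h - center g‖ ≤ 2 := by
  rw [← center_sub]
  refine (norm_center_le _).trans ?_
  unfold Near at hn
  have h1 : |((h - g).1 : ℝ)| ≤ 1 := by
    rw [abs_le]; simp only [Prod.fst_sub]; exact ⟨by exact_mod_cast hn.1, by exact_mod_cast hn.2.1⟩
  have h2 : |((h - g).2 : ℝ)| ≤ 1 := by
    rw [abs_le]; simp only [Prod.snd_sub]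
    exact ⟨by exact_mod_cast hn.2.2.1, by exact_mod_cast hn.2.2.2.1⟩
  linarith

theorem norm_center_add_dir (h : Hex) (k : Fin 6) : ‖center (h + dir k) - center h‖ ≤ 2 :=
  norm_center_near (near_add_dir h k)

theorem norm_vertex (h : Hex) (j : Fin 6) : ‖vertex h j - center h‖ ≤ 2 := by
  have e : vertex h j - center h =
      (1 / 3 : ℝ) • ((center (h + dir j) - center h) + (center (h + dir (j + 1)) - center h)) := by
    rw [vertex, Complex.real_smul]; push_cast; ring
  rw [e, norm_smul]
  have := norm_add_le (center (h + dir j) - center h) (center (h + dir (j + 1)) - center h)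
  have h1 := norm_center_add_dir h j
  have h2 := norm_center_add_dir h (j + 1)
  rw [Real.norm_of_nonneg (by norm_num)]
  linarith

theorem norm_sideMid (h : Hex) (j : Fin 6) : ‖sideMid h j - center h‖ ≤ 2 := by
  have e : sideMid h j - center h = (1 / 2 : ℝ) • (center (h + dir j) - center h) := by
    rw [sideMid, Complex.real_smul]; push_cast; ring
  rw [e, norm_smul, Real.norm_of_nonneg (by norm_num)]
  have h1 := norm_center_add_dir h j
  linarith

theorem norm_pos (f : Flag) : ‖f.pos - center f.1.1‖ ≤ 2 := by
  obtain ⟨⟨h, j⟩, c⟩ := f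
  cases c
  · simp [Flag.pos]
  · exact norm_sideMid h j
  · exact norm_vertex h j
  · exact norm_sideMid h (j + 1)

theorem norm_cell {h : Hex} {z : ℂ} (hz : z ∈ cell h) : ‖z - center h‖ ≤ 2 := by
  have : cell h ⊆ Metric.closedBall (center h) 2 := by
    refine convexHull_min ?_ (convex_closedBall _ _)
    rintro _ ⟨j, rfl⟩
    rw [Metric.mem_closedBall, dist_eq_norm]
    exact norm_vertex h j
  have := this hz
  rwa [Metric.mem_closedBall, dist_eq_norm] at this

/-- A connected set that meets a set and its complement meets the frontier. -/
theorem exists_mem_frontier {X : Type*} [TopologicalSpace X] {s t : Set X} (hs : IsPreconnected s)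
    {x y : X} (hx : x ∈ s) (hxt : x ∈ t) (hy : y ∈ s) (hyt : y ∉ t) : ∃ w ∈ s, w ∈ frontier t := by
  by_contra! hcon
  have h1 : ∀ w ∈ s, w ∈ closure t → w ∈ interior t := fun w hw hc =>
    by_contra fun hi => hcon w hw ⟨hc, hi⟩
  obtain ⟨w, _, hw, hw'⟩ := hs (interior t) (closure t)ᶜ isOpen_interior isClosed_closure.isOpen_compl
    (fun w hw => or_iff_not_imp_right.2 fun h => h1 w hw (not_not.1 h))
    ⟨x, hx, h1 x hx (subset_closure hxt)⟩
    ⟨y, hy, fun hc => hyt (interior_subset (h1 y hy hc))⟩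
  exact hw' (subset_closure (interior_subset hw))

/-! ### The exploration path produces yellow connections -/

/-- Kites that share a side belong to one hexagon or touch the common side of two neighbours. -/
theorem cw_cases : ∀ (j : Fin 6) (h : Hex) (c : Corner),
    (Flag.cw ((h, j), c)).1.1 = h ∨ ∃ k, (Flag.cw ((h, j), c)).1.1 = h + dir k ∧
      (j = k ∨ j = k + 5) ∧
        ((Flag.cw ((h, j), c)).1.2 = k + 3 ∨ (Flag.cw ((h, j), c)).1.2 = k + 3 + 5) := by
  intro j h c
  have e1 : ∀ j : Fin 6, j + 2 = j + 3 + 5 := by decide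
  have e2 : ∀ j : Fin 6, j = j + 1 + 5 := by decide
  have e3 : ∀ j : Fin 6, j + 4 = j + 1 + 3 := by decide
  cases c
  · exact Or.inl rfl
  · exact Or.inr ⟨j, rfl, Or.inl rfl, Or.inr (e1 j)⟩
  · exact Or.inr ⟨j + 1, rfl, Or.inr (e2 j), Or.inl (e3 j)⟩
  · exact Or.inl rfl

theorem fin_six_add_three : ∀ k : Fin 6, dir (k + 3) = -dir k := by decide

theorem lk_of_blueAt {ω : Config} {h : Hex} {j k : Fin 6} (hb : blueAt ω (h, j) = false)
    (hj : j = k ∨ j = k + 5) : lk false (ω h) k = true := by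
  unfold blueAt at hb
  simp only at hb
  rcases hj with rfl | rfl <;> simp [lk, hb]

namespace FlowerModel

variable {M : FlowerModel} {ω : Config}

theorem Proper.isCol (hω : M.Proper ω) {h : Hex} (hh : h ∉ M.irises) {j : Fin 6}
    (hb : blueAt ω (h, j) = false) : M.IsCol false ω h := by
  obtain ⟨c, hc⟩ := hω h hh
  unfold blueAt at hb
  simp only [hc, mono_isBlue] at hb
  exact ⟨hh, hb ▸ hc⟩

/-- The hexagon `h` has not been left, or a yellow connection joins its neighbourhood to the hexagon
of the yellow kite `q`; if this is an iris, the connection ends at a petal that touches the yellow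
part. -/
def Attached (M : FlowerModel) (ω : Config) (h : Hex) (q : Kite) : Prop :=
  q.1 = h ∨ ∃ a b, Near h a ∧ M.Conn false ω Set.univ a b ∧ ((q.1 ∉ M.irises ∧ b = q.1) ∨
    (q.1 ∈ M.irises ∧ ∃ k, b = q.1 + dir k ∧ lk false (ω q.1) k = true))

theorem Attached.near {h : Hex} {q : Kite} (hq : M.Attached ω h q) : q.1 = h ∨
    ∃ a b, Near h a ∧ Near q.1 b ∧ M.Conn false ω Set.univ a b := by
  rcases hq with hq | ⟨a, b, h1, h2, ⟨_, rfl⟩ | ⟨_, k, rfl, _⟩⟩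
  · exact Or.inl hq
  · exact Or.inr ⟨a, _, h1, Near.refl _, h2⟩
  · exact Or.inr ⟨a, _, h1, near_add_dir _ _, h2⟩

theorem Attached.step (hω : M.Proper ω) {h : Hex} {q : Kite} {c : Corner} (hq : M.Attached ω h q)
    (hy : blueAt ω q = false) (hy' : blueAt ω (Flag.cw (q, c)).1 = false) :
    M.Attached ω h (Flag.cw (q, c)).1 := by
  obtain ⟨g, j⟩ := q
  have hcase := cw_cases j g c
  generalize (Flag.cw ((g, j), c)).1 = q' at hcase hy' ⊢
  obtain ⟨g', j'⟩ := q'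
  simp only at hcase
  unfold Attached at hq ⊢
  simp only at hq ⊢
  rcases hcase with rfl | ⟨k, rfl, hj, hj'⟩
  · exact hq
  have l1 := lk_of_blueAt hy hj
  have l2 := lk_of_blueAt hy' hj'
  by_cases hg : g ∈ M.irises
  · -- from an iris to a petal
    have hp := petal_notMem hg k
    have hc := hω.isCol hp hy'
    right
    rcases hq with rfl | ⟨a, b, h1, h2, ⟨h3, _⟩ | ⟨_, k', rfl, h4⟩⟩
    · exact ⟨_, _, near_add_dir _ _, Conn.refl trivial hc, Or.inl ⟨hp, rfl⟩⟩
    · exact absurd hg h3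
    · exact ⟨a, _, h1, h2.trans (Conn.iris trivial trivial h2.right.2 hc
        ⟨hg, k', k, rfl, rfl, h4, l1⟩), Or.inl ⟨hp, rfl⟩⟩
  · have hc := hω.isCol hg hy
    obtain ⟨a, h1, h2⟩ : ∃ a, Near h a ∧ M.Conn false ω Set.univ a g := by
      rcases hq with rfl | ⟨a, b, h1, h2, ⟨_, rfl⟩ | ⟨h3, _⟩⟩
      · exact ⟨g, Near.refl _, Conn.refl trivial hc⟩
      · exact ⟨a, h1, h2⟩
      · exact absurd h3 hg
    right
    by_cases hg' : g + dir k ∈ M.irises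
    · refine ⟨a, g, h1, h2, Or.inr ⟨hg', k + 3, ?_, l2⟩⟩
      rw [fin_six_add_three, add_neg_cancel_right]
    · exact ⟨a, _, h1, h2.trans (Conn.near trivial trivial hc (hω.isCol hg' hy')
        (near_add_dir _ _)), Or.inl ⟨hg', rfl⟩⟩

end FlowerModel

theorem polyline_mem {p : ℂ} (N : ℕ) (g : ℕ → ℂ)
    (hp : p ∈ polyline (g 0) ((List.range N).map fun n => g (n + 1))) :
    p = g 0 ∨ ∃ n < N, p ∈ segment ℝ (g n) (g (n + 1)) := by
  induction N generalizing g with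
  | zero => exact Or.inl hp
  | succ N ih =>
    rw [List.range_succ_eq_map, List.map_cons, List.map_map, polyline] at hp
    rcases hp with hp | hp
    · exact Or.inr ⟨0, Nat.succ_pos _, hp⟩
    · rcases ih (fun n => g (n + 1)) hp with rfl | ⟨n, hn, hp⟩
      · exact Or.inr ⟨0, Nat.succ_pos _, right_mem_segment ℝ _ _⟩
      · exact Or.inr ⟨n + 1, by omega, hp⟩

namespace AdmissibleDiscretization

variable {M : FlowerModel} {Ω : Set ℂ} {ε : ℝ} (D : AdmissibleDiscretization M Ω ε) {ω : Config}

theorem path_succ (ω : Config) (n : ℕ) : D.path ω (n + 1) = explore ω (D.path ω n) :=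
  Function.iterate_succ_apply' _ _ _

/-- The path has yellow on its left, and consecutive yellow kites around a vertex are connected; so a
yellow connection follows the path from its start. -/
theorem path_attached (hω : M.Proper ω) (hE : ω ∈ boundaryEvent D.blue D.yellow) (n : ℕ) :
    blueAt ω (D.path ω n).1 = false ∧ M.Attached ω D.start.1 (D.path ω n).1 := by
  induction n with
  | zero => exact ⟨hE.2 _ D.start_yellow, Or.inl rfl⟩
  | succ n ih =>
    rw [path_succ, explore]
    split_ifs with h
    · exact ih
    · rw [Bool.not_eq_true] at h
      exact ⟨h, ih.2.step hω ih.1 h⟩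

theorem path_mem (ω : Config) {n : ℕ} (hn : n ≤ D.length ω) :
    (D.path ω n).1.1 = D.start.1 ∨ (D.path ω n).1.1 ∈ D.comp := by
  induction n with
  | zero => exact Or.inl rfl
  | succ n ih =>
    have h : n ∉ {n : ℕ | D.path ω n = (D.finish, .vtx) ∨ (D.path ω n).cw.1.1 ∉ D.comp} :=
      Nat.notMem_of_lt_sInf hn
    simp only [Set.mem_ofPred_eq, not_or, not_not] at h
    rw [path_succ, explore]
    split_ifs
    · exact ih (by omega)
    · exact Or.inr h.2

/-- Each point of the path is close to a hexagon that is visited. -/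
theorem trace_near (hε : 0 ≤ ε) {p : ℂ} (hp : p ∈ D.trace ω) :
    ∃ n ≤ D.length ω, ‖p - ε * center (D.path ω n).1.1‖ ≤ 4 * ε := by
  have e : D.trace ω = polyline (ε * (D.path ω 0).pos) ((List.range (D.length ω)).map fun n =>
      (ε : ℂ) * (D.path ω (n + 1)).pos) := by
    rw [trace, flags, List.map_map]; rfl
  rw [e] at hp
  have near : ∀ f : Flag, ∀ h : Hex, ‖center f.1.1 - center h‖ ≤ 2 →
      (ε : ℂ) * f.pos ∈ Metric.closedBall ((ε : ℂ) * center h) (4 * ε) := by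
    intro f h hh
    rw [Metric.mem_closedBall, dist_eq_norm, ← mul_sub, norm_mul, Complex.norm_real,
      Real.norm_of_nonneg hε, mul_comm]
    refine mul_le_mul_of_nonneg_right ?_ hε
    have := norm_add_le (f.pos - center f.1.1) (center f.1.1 - center h)
    rw [sub_add_sub_cancel] at this
    linarith [norm_pos f]
  have n0 : ∀ f : Flag, (ε : ℂ) * f.pos ∈ Metric.closedBall ((ε : ℂ) * center f.1.1) (4 * ε) :=
    fun f => near f _ (by simp)
  rcases polyline_mem _ (fun n => (ε : ℂ) * (D.path ω n).pos) hp with rfl | ⟨n, hn, hp⟩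
  · have := n0 (D.path ω 0)
    rw [Metric.mem_closedBall, dist_eq_norm] at this
    exact ⟨0, Nat.zero_le _, this⟩
  · have : ‖center (D.path ω (n + 1)).1.1 - center (D.path ω n).1.1‖ ≤ 2 := by
      rw [path_succ, explore]
      split_ifs
      · simp
      · rcases cw_cases (D.path ω n).1.2 (D.path ω n).1.1 (D.path ω n).2 with h | ⟨k, h, _⟩
        · rw [show (D.path ω n).cw.1.1 = (D.path ω n).1.1 from h]; simp
        · rw [show (D.path ω n).cw.1.1 = (D.path ω n).1.1 + dir k from h]
          exact norm_center_add_dir _ _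
    have := (convex_closedBall _ _).segment_subset (n0 (D.path ω n)) (near _ _ this) hp
    rw [Metric.mem_closedBall, dist_eq_norm] at this
    exact ⟨n, hn.le, this⟩

theorem norm_block {h h' : Hex} (hh : h' ∈ M.block h) : ‖center h' - center h‖ ≤ 4 := by
  rcases hh with rfl | ⟨i, _, h1, h2⟩
  · simp
  · have a1 := norm_center_near (mem_flower.1 h1)
    have a2 := norm_center_near (mem_flower.1 h2)
    rw [norm_sub_rev] at a1
    have := norm_add_le (center h' - center i) (center i - center h)
    rw [sub_add_sub_cancel] at this
    linarith

theorem comp_subset : D.comp ⊆ M.latticeDomain Ω ε := by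
  obtain ⟨h₀, h1, h2⟩ := D.isComponent
  intro h hh
  rw [h2] at hh
  rcases Relation.ReflTransGen.cases_tail hh with rfl | ⟨_, _, h3⟩
  · exact h1
  · exact h3.1

theorem vertex_mem {h : Hex} (hh : h ∈ D.comp) : (ε : ℂ) * vertex h 0 ∈ Ω :=
  D.comp_subset hh h (Or.inl rfl) _ (subset_convexHull _ _ ⟨0, rfl⟩)

/-- The lattice boundary is close to the boundary of the domain. -/
theorem boundary_near (hε : 0 ≤ ε) {h : Hex} (hh : h ∈ M.latticeBoundary D.comp) :
    ∃ w ∈ frontier Ω, ‖w - ε * center h‖ ≤ 12 * ε := by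
  obtain ⟨h', hb, hc, k, hk⟩ := hh
  have hk' : h' + dir k ∉ M.latticeDomain Ω ε := by
    obtain ⟨h₀, h1, h2⟩ := D.isComponent
    intro hcon
    rw [h2] at hc hk
    exact hk (Relation.ReflTransGen.tail hc ⟨hcon, k, rfl⟩)
  simp only [FlowerModel.latticeDomain, Set.mem_ofPred_eq] at hk'
  push Not at hk'
  obtain ⟨g, hg, z, hz, hzΩ⟩ := hk'
  have b1 := norm_block hb
  have b2 := norm_block hg
  have b3 := norm_center_add_dir h' k
  have b4 := norm_cell hz
  have b5 := norm_vertex h' 0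
  have ball : ∀ u : ℂ, ‖u - center h‖ ≤ 12 →
      (ε : ℂ) * u ∈ Metric.closedBall ((ε : ℂ) * center h) (12 * ε) := by
    intro u hu
    rw [Metric.mem_closedBall, dist_eq_norm, ← mul_sub, norm_mul, Complex.norm_real,
      Real.norm_of_nonneg hε, mul_comm]
    exact mul_le_mul_of_nonneg_right hu hε
  have m1 := ball (vertex h' 0) (by
    have := norm_add_le (vertex h' 0 - center h') (center h' - center h)
    rw [sub_add_sub_cancel] at this
    linarith)
  have m2 := ball z (by
    have a1 := norm_add_le (z - center g) (center g - center (h' + dir k))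
    have a2 := norm_add_le (z - center (h' + dir k)) (center (h' + dir k) - center h')
    have a3 := norm_add_le (z - center h') (center h' - center h)
    rw [sub_add_sub_cancel] at a1 a2 a3
    linarith)
  obtain ⟨w, hw, hwf⟩ := exists_mem_frontier
    (convex_segment ((ε : ℂ) * vertex h' 0) ((ε : ℂ) * z)).isPreconnected
    (left_mem_segment ℝ _ _) (D.vertex_mem hc) (right_mem_segment ℝ _ _) hzΩ
  have := (convex_closedBall _ _).segment_subset m1 m2 hw
  rw [Metric.mem_closedBall, dist_eq_norm] at this
  exact ⟨w, hwf, this⟩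

/-- The path stays close to the domain. -/
theorem trace_bounded (hε : 0 ≤ ε) {p : ℂ} (hp : p ∈ D.trace ω) :
    ∃ w ∈ Ω, ‖p - w‖ ≤ 10 * ε := by
  obtain ⟨n, hn, h1⟩ := D.trace_near hε hp
  obtain ⟨h, hh, h2⟩ : ∃ h ∈ D.comp, ‖center (D.path ω n).1.1 - center h‖ ≤ 4 := by
    rcases D.path_mem ω hn with h | h
    · obtain ⟨h', hb, hc, _⟩ := D.yellow_subset _ D.start_yellow
      rw [h]
      exact ⟨h', hc, by rw [norm_sub_rev]; exact norm_block hb⟩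
    · exact ⟨_, h, by simp⟩
  refine ⟨_, D.vertex_mem hh, ?_⟩
  have h3 := norm_vertex h 0
  rw [norm_sub_rev] at h3
  have h4 := norm_add_le (center (D.path ω n).1.1 - center h) (center h - vertex h 0)
  rw [sub_add_sub_cancel] at h4
  have h5 : ‖(ε : ℂ) * center (D.path ω n).1.1 - ε * vertex h 0‖ ≤ ε * 6 := by
    rw [← mul_sub, norm_mul, Complex.norm_real, Real.norm_of_nonneg hε]
    exact mul_le_mul_of_nonneg_left (by linarith) hε
  have h6 := norm_add_le (p - ε * center (D.path ω n).1.1)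
    (ε * center (D.path ω n).1.1 - ε * vertex h 0)
  rw [sub_add_sub_cancel] at h6
  linarith

end AdmissibleDiscretization

/-! ### The probability that the exploration path comes close to an inner point -/

theorem isOpen_hits {U : Set ℂ} (hU : IsOpen U) :
    IsOpen {K : NonemptyCompacts ℂ | ((K : Set ℂ) ∩ U).Nonempty} :=
  NonemptyCompacts.isOpen_inter_nonempty_of_isOpen hU

namespace FlowerModel

variable {M : FlowerModel}

theorem mem_hexDom_of_norm {h x : Hex} {r : ℤ} (hr : 2 * ‖center h - center x‖ + 1 ≤ r) :
    h ∈ M.hexDom x r := by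
  rw [← center_sub] at hr
  obtain ⟨h1, h2, h3⟩ := coord_le_norm_center (h - x)
  have b := coord_base (M := M) h
  have key : ∀ t : ℤ, |(t : ℝ)| ≤ 2 * ‖center (h - x)‖ → -(r - 1) ≤ t ∧ t ≤ r - 1 := by
    intro t ht
    have := abs_le.1 (ht.trans (by linarith : _ ≤ (r : ℝ) - 1))
    exact ⟨by exact_mod_cast this.1, by exact_mod_cast this.2⟩
  have k1 := key _ h1
  have k2 := key _ h2
  have k3 := key ((h - x).1 + (h - x).2) (by push_cast; exact h3)
  simp only [hexDom, Set.mem_ofPred_eq, InHexagon, Prod.fst_sub, Prod.snd_sub] at k1 k2 k3 ⊢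
  omega

theorem norm_le_of_mem_hexDom {h x : Hex} {R : ℤ} (hh : h ∈ M.hexDom x R) :
    ‖center h - center x‖ ≤ 2 * (R + 1) := by
  rw [← center_sub]
  refine (norm_center_le _).trans ?_
  have b := coord_base (M := M) h
  simp only [hexDom, Set.mem_ofPred_eq, InHexagon, Prod.fst_sub, Prod.snd_sub] at hh
  have key : ∀ t : ℤ, -(R + 1) ≤ t → t ≤ R + 1 → |(t : ℝ)| ≤ R + 1 := fun t h1 h2 =>
    abs_le.2 ⟨by exact_mod_cast h1, by exact_mod_cast h2⟩
  have k1 := key (h - x).1 (by simp only [Prod.fst_sub]; omega) (by simp only [Prod.fst_sub]; omega)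
  have k2 := key (h - x).2 (by simp only [Prod.snd_sub]; omega) (by simp only [Prod.snd_sub]; omega)
  linarith

end FlowerModel

theorem measurableSet_boundaryEvent (B Y : Set Kite) : MeasurableSet (boundaryEvent B Y) := by
  have h : ∀ (q : Kite) (b : Bool), MeasurableSet {ω : Config | blueAt ω q = b} := fun q b =>
    (measurable_pi_apply (X := fun _ : Hex => HexState) q.1)
      (MeasurableSet.of_discrete (s := {σ : HexState | σ.isBlue q.2 = b}))
  have e : boundaryEvent B Y = (⋂ q ∈ B, {ω : Config | blueAt ω q = true}) ∩
      ⋂ q ∈ Y, {ω : Config | blueAt ω q = false} := by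
    ext ω; simp [boundaryEvent]
  rw [e]
  exact (MeasurableSet.biInter B.to_countable fun q _ => h q _).inter
    (MeasurableSet.biInter Y.to_countable fun q _ => h q _)

theorem local_boundaryEvent {B Y : Set Kite} {S : Set Hex} (hB : ∀ q ∈ B, q.1 ∈ S)
    (hY : ∀ q ∈ Y, q.1 ∈ S) : Local (boundaryEvent B Y) S := by
  intro ω ω' e
  refine propext (and_congr (forall₂_congr fun q hq => ?_) (forall₂_congr fun q hq => ?_))
  · rw [blueAt, blueAt, e _ (hB q hq)]
  · rw [blueAt, blueAt, e _ (hY q hq)]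

namespace AdmissibleDiscretization

variable {M : FlowerModel} {Ω : Set ℂ} {ε : ℝ}

/-- An event that does not look at the boundary keeps its probability under the conditioning. -/
theorem explorationLaw_le (D : AdmissibleDiscretization M Ω ε) {A : Set (NonemptyCompacts ℂ)}
    (hA : MeasurableSet A) {N : Set Config} {S : Set Hex} (hS : M.Saturated S) (hf : S.Finite)
    (hN : Local N S) (hD : ∀ h ∈ M.latticeBoundary D.comp, h ∉ S)
    (h : ∀ ω, M.Proper ω → ω ∈ boundaryEvent D.blue D.yellow → D.trace ω ∈ A → ω ∈ N) :
    (D.explorationLaw : Measure (NonemptyCompacts ℂ)).real A ≤ M.law.real N := by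
  set E := boundaryEvent D.blue D.yellow with hE
  have mE : MeasurableSet E := measurableSet_boundaryEvent _ _
  have lE : Local E Sᶜ := local_boundaryEvent (fun q hq => hD _ (D.blue_subset q hq))
    (fun q hq => hD _ (D.yellow_subset q hq))
  have hE0 : M.law.real E ≠ 0 := by
    rw [measureReal_def, ENNReal.toReal_ne_zero]
    exact ⟨D.pos_prob, measure_ne_top _ _⟩
  have := cond_isProbabilityMeasure D.pos_prob
  have e1 : (D.explorationLaw : Measure (NonemptyCompacts ℂ)).real A
      = (M.law[|E]).real (D.trace ⁻¹' A) := map_measureReal_apply D.measurable_trace hA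
  have e2 : (M.law[|E]).real (D.trace ⁻¹' A) ≤ (M.law[|E]).real N := by
    refine ENNReal.toReal_mono (measure_ne_top _ _) (measure_mono_ae ?_)
    filter_upwards [ae_cond_mem (μ := M.law) mE,
      (cond_absolutelyContinuous (μ := M.law) (s := E)).ae_le M.law_proper] with ω h1 h2 h3
    exact h ω h2 h1 h3
  have e3 : (M.law[|E]).real N = M.law.real N := by
    rw [measureReal_def, cond_apply mE, ENNReal.toReal_mul, ENNReal.toReal_inv, ← measureReal_def,
      ← measureReal_def, Set.inter_comm, FlowerModel.indep hS hf hN mE lE, mul_comm, mul_assoc,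
      mul_inv_cancel₀ hE0, mul_one]
  rw [e1, ← e3]
  exact e2

end AdmissibleDiscretization

/-- If `w` has distance at least `d` from the boundary of the domain, then the path meets the ball of
radius `ρ` about `w` only if a yellow arm joins the scale `ρ` to the scale `d`. -/
theorem FlowerModel.law_hits (M : FlowerModel) : ∃ C ψ : ℝ, 0 < C ∧ 0 < ψ ∧
    ∀ (Ω : Set ℂ) (ε : ℝ) (D : AdmissibleDiscretization M Ω ε) (w : ℂ) (ρ d : ℝ), 0 < ε → ε ≤ ρ →
      2 * ρ ≤ d → 100 * ε ≤ d → (∀ f ∈ frontier Ω, d ≤ ‖f - w‖) →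
      (D.explorationLaw : Measure (NonemptyCompacts ℂ)).real
        {K | ((K : Set ℂ) ∩ Metric.ball w ρ).Nonempty} ≤ C * (ρ / d) ^ ψ := by
  obtain ⟨C, ψ, hC, hψ, harm⟩ := M.one_arm
  refine ⟨C * 100 ^ ψ, ψ, by positivity, hψ, ?_⟩
  intro Ω ε D w ρ d hε hερ hρd hεd hf
  have hρ : 0 < ρ := hε.trans_le hερ
  have hd : 0 < d := by linarith
  obtain ⟨x, hx⟩ := exists_hex_near ((ε : ℂ)⁻¹ * w)
  have hεc : (ε : ℂ) ≠ 0 := by exact_mod_cast hε.ne'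
  -- distances in lattice units
  have scale : ∀ (p c : ℂ) (t : ℝ), ‖p - ε * c‖ ≤ t * ε ↔ ‖(ε : ℂ)⁻¹ * p - c‖ ≤ t := by
    intro p c t
    have : p - ε * c = ε * ((ε : ℂ)⁻¹ * p - c) := by field_simp
    rw [this, norm_mul, Complex.norm_real, Real.norm_of_nonneg hε.le, mul_comm,
      mul_le_mul_iff_left₀ hε]
  have scale' : ∀ p : ℂ, ‖(ε : ℂ)⁻¹ * p - (ε : ℂ)⁻¹ * w‖ = ‖p - w‖ / ε := by
    intro p
    rw [← mul_sub, norm_mul, norm_inv, Complex.norm_real, Real.norm_of_nonneg hε.le]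
    field_simp
  set u := ρ / ε with hu
  set v := d / ε with hv
  have hu1 : 1 ≤ u := (one_le_div hε).2 hερ
  have hv1 : 100 ≤ v := (le_div_iff₀ hε).2 hεd
  have huv : 2 * u ≤ v := by rw [hu, hv, ← mul_div_assoc]; gcongr
  -- the coordinates of a hexagon are at most twice its norm, and the norm at most twice the
  -- coordinates; the constants `17` and `4` leave room for the sizes of hexagons and flowers
  set r := ⌈2 * u + 17⌉ with hr
  set R := ⌊v / 4⌋ with hR
  have r1 : 2 * u + 17 ≤ r := Int.le_ceil _
  have r2 : (r : ℝ) < 2 * u + 17 + 1 := Int.ceil_lt_add_one _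
  have R1 : (R : ℝ) ≤ v / 4 := Int.floor_le _
  have R2 : v / 4 < R + 1 := Int.lt_floor_add_one _
  have r0 : 1 ≤ r := by
    have : (1 : ℝ) ≤ r := by linarith
    exact_mod_cast this
  have R0 : 1 ≤ R := by
    have : (1 : ℝ) ≤ R := by linarith
    exact_mod_cast this
  obtain ⟨N, ⟨⟨S, hS, hSf, hSR, hN⟩, hA⟩, hNr⟩ := harm x r R r0 R0
  have far : ∀ h ∈ M.latticeBoundary D.comp, v - 14 ≤ ‖center h - center x‖ := by
    intro h hh
    obtain ⟨f, hfΩ, hfh⟩ := D.boundary_near hε.le hh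
    rw [scale] at hfh
    have h1 : v ≤ ‖(ε : ℂ)⁻¹ * f - (ε : ℂ)⁻¹ * w‖ := by
      rw [scale', hv]; gcongr; exact hf f hfΩ
    have h2 := norm_add_le ((ε : ℂ)⁻¹ * f - center h) (center h - center x)
    have h3 := norm_add_le ((ε : ℂ)⁻¹ * f - center x) (center x - (ε : ℂ)⁻¹ * w)
    rw [sub_add_sub_cancel] at h2 h3
    linarith
  have out : ∀ h, v - 16 ≤ ‖center h - center x‖ → h ∉ M.hexDom x R := by
    intro h hh hin
    have := FlowerModel.norm_le_of_mem_hexDom hin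
    linarith
  refine (D.explorationLaw_le (isOpen_hits Metric.isOpen_ball).measurableSet hS hSf hN
    (fun h hh hin => out h (by linarith [far h hh]) (hSR hin)) ?_).trans (hNr.trans ?_)
  · rintro ω hω hE ⟨p, hp, hpw⟩
    obtain ⟨n, _, hn⟩ := D.trace_near hε.le hp
    rw [scale] at hn
    have near : ‖center (D.path ω n).1.1 - center x‖ ≤ u + 6 := by
      have h1 : ‖(ε : ℂ)⁻¹ * p - (ε : ℂ)⁻¹ * w‖ ≤ u := by
        rw [scale', hu]; gcongr; exact (mem_ball_iff_norm.1 hpw).le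
      have h2 := norm_add_le (center (D.path ω n).1.1 - (ε : ℂ)⁻¹ * p)
        ((ε : ℂ)⁻¹ * p - center x)
      have h3 := norm_add_le ((ε : ℂ)⁻¹ * p - (ε : ℂ)⁻¹ * w) ((ε : ℂ)⁻¹ * w - center x)
      rw [sub_add_sub_cancel] at h2 h3
      rw [norm_sub_rev] at hn hx
      linarith
    -- the start of the path lies on the boundary, so that the visited hexagon is not the start
    have hs := far _ (D.yellow_subset _ D.start_yellow)
    rcases (D.path_attached hω hE n).2.near with h | ⟨a, b, ha, hb, hab⟩
    · rw [h] at near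
      linarith
    · refine hA ω b a Set.univ (FlowerModel.mem_hexDom_of_norm ?_) (out a ?_) hab.symm
      · have h1 := norm_center_near hb
        have h2 := norm_add_le (center b - center (D.path ω n).1.1)
          (center (D.path ω n).1.1 - center x)
        rw [sub_add_sub_cancel] at h2
        linarith
      · have h1 := norm_center_near ha
        rw [norm_sub_rev] at h1
        have h2 := norm_add_le (center D.start.1 - center a) (center a - center x)
        rw [sub_add_sub_cancel] at h2
        linarith
  · rw [mul_assoc, ← Real.mul_rpow (by norm_num) (by positivity)]
    have hR' : (0 : ℝ) < R := by linarith
    have e : 100 * (ρ / d) = 20 * u / (v / 5) := by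
      rw [hu, hv]; field_simp; norm_num
    gcongr
    rw [e]
    gcongr <;> linarith

/-! ### Box counting -/

theorem boxCount_le {S : Set ℂ} {r : ℝ} {W : Finset ℂ} (h : S ⊆ ⋃ w ∈ W, box w r) :
    boxCount S r ≤ W.card := Nat.sInf_le ⟨W, rfl, h⟩

theorem ball_subset_box (y : ℂ) (r : ℝ) : Metric.ball y (r / 2) ⊆ box (y - ⟨r / 2, r / 2⟩) r := by
  intro z hz
  have h := (mem_ball_iff_norm.1 hz).le
  have h1 := abs_le.1 ((Complex.abs_re_le_norm (z - y)).trans h)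
  have h2 := abs_le.1 ((Complex.abs_im_le_norm (z - y)).trans h)
  simp only [Complex.sub_re, Complex.sub_im] at h1 h2
  simp only [box, Set.mem_ofPred_eq, Complex.sub_re, Complex.sub_im]
  refine ⟨?_, ?_, ?_, ?_⟩ <;> linarith

theorem exists_boxes {S : Set ℂ} (hS : Bornology.IsBounded S) {r : ℝ} (hr : 0 < r) :
    ∃ W : Finset ℂ, W.card = boxCount S r ∧ S ⊆ ⋃ w ∈ W, box w r := by
  classical
  refine Nat.sInf_mem (s := {n : ℕ | ∃ W : Finset ℂ, W.card = n ∧ S ⊆ ⋃ w ∈ W, box w r}) ?_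
  obtain ⟨t, ht, hSt⟩ := Metric.totallyBounded_iff.1 (hS.isCompact_closure.totallyBounded.subset
    subset_closure) (r / 2) (half_pos hr)
  refine ⟨_, ht.toFinset.image fun y => y - ⟨r / 2, r / 2⟩, rfl, fun z hz => ?_⟩
  obtain ⟨y, hy, hzy⟩ := Set.mem_iUnion₂.1 (hSt hz)
  exact Set.mem_iUnion₂.2 ⟨_, Finset.mem_image_of_mem _ (ht.mem_toFinset.2 hy),
    ball_subset_box y r hzy⟩

theorem boxCount_mono {S T : Set ℂ} (hT : Bornology.IsBounded T) (h : S ⊆ T) {r : ℝ} (hr : 0 < r) :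
    boxCount S r ≤ boxCount T r := by
  obtain ⟨W, hW, hc⟩ := exists_boxes hT hr
  exact hW ▸ boxCount_le (h.trans hc)

theorem boxCount_union_le {S T : Set ℂ} (hS : Bornology.IsBounded S) (hT : Bornology.IsBounded T)
    {r : ℝ} (hr : 0 < r) : boxCount (S ∪ T) r ≤ boxCount S r + boxCount T r := by
  classical
  obtain ⟨W, hW, hc⟩ := exists_boxes hS hr
  obtain ⟨W', hW', hc'⟩ := exists_boxes hT hr
  rw [← hW, ← hW']
  refine (boxCount_le ?_).trans (Finset.card_union_le W W')
  rw [Finset.set_biUnion_union]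
  exact Set.union_subset_union hc hc'

theorem boxCount_anti {S : Set ℂ} (hS : Bornology.IsBounded S) {r r' : ℝ} (hr : 0 < r)
    (h : r ≤ r') : boxCount S r' ≤ boxCount S r := by
  obtain ⟨W, hW, hc⟩ := exists_boxes hS hr
  rw [← hW]
  refine boxCount_le (hc.trans (Set.iUnion₂_mono fun w _ z hz => ?_))
  obtain ⟨h1, h2, h3, h4⟩ := hz
  exact ⟨h1, by linarith, h3, by linarith⟩

theorem upperMinkowskiDim_le {S : Set ℂ} {C τ τ' : ℝ} (hτ : τ < τ') (hτ' : 0 ≤ τ')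
    (h : ∀ᶠ r : ℝ in 𝓝[>] 0, (boxCount S r : ℝ) ≤ C * r ^ (-τ)) :
    upperMinkowskiDim S ≤ (τ' : EReal) := by
  have h0 : Tendsto (fun r : ℝ => C * r ^ (τ' - τ)) (𝓝[>] 0) (𝓝 0) := by
    have := ((Real.continuousAt_rpow_const 0 (τ' - τ) (Or.inr (by linarith))).tendsto.const_mul
      C).mono_left (nhdsWithin_le_nhds (s := Set.Ioi 0))
    rwa [Real.zero_rpow (by linarith), mul_zero] at this
  refine limsup_le_of_le (by isBoundedDefault) ?_
  filter_upwards [h, h0.eventually (gt_mem_nhds one_pos), self_mem_nhdsWithin,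
    nhdsWithin_le_nhds (gt_mem_nhds one_pos)] with r h1 h2 h3 h4
  rw [Set.mem_Ioi] at h3
  have hl : 0 < Real.log (1 / r) := Real.log_pos (by rw [lt_div_iff₀ h3]; linarith)
  rw [EReal.coe_le_coe_iff, div_le_iff₀ hl]
  rcases Nat.eq_zero_or_pos (boxCount S r) with hb | hb
  · rw [hb, Nat.cast_zero, Real.log_zero]; positivity
  have hb' : (0 : ℝ) < boxCount S r := by exact_mod_cast hb
  rw [← Real.log_rpow (by positivity)]
  refine Real.log_le_log hb' (h1.trans ?_)
  have e : (1 / r) ^ τ' = r ^ (-τ') := by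
    rw [one_div, Real.inv_rpow h3.le, Real.rpow_neg h3.le]
  have e' : C * r ^ (-τ) = C * r ^ (τ' - τ) * r ^ (-τ') := by
    rw [mul_assoc, ← Real.rpow_add h3]; congr 2; ring
  rw [e, e']
  exact mul_le_of_le_one_left (by positivity) h2.le

theorem exists_boxCount_le {S : Set ℂ} (h : upperMinkowskiDim S < 2) :
    ∃ τ : ℝ, 0 < τ ∧ τ < 2 ∧ ∀ᶠ r : ℝ in 𝓝[>] 0, (boxCount S r : ℝ) ≤ r ^ (-τ) := by
  obtain ⟨t, h1, h2⟩ := EReal.lt_iff_exists_real_btwn.1 h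
  have h2' : t < 2 := EReal.coe_lt_coe_iff.1 h2
  refine ⟨max t 1, by positivity, max_lt h2' (by norm_num), ?_⟩
  filter_upwards [eventually_lt_of_limsup_lt h1 (by isBoundedDefault), self_mem_nhdsWithin,
    nhdsWithin_le_nhds (gt_mem_nhds one_pos)] with r h3 h4 h5
  rw [Set.mem_Ioi] at h4
  have hl : 0 < Real.log (1 / r) := Real.log_pos (by rw [lt_div_iff₀ h4]; linarith)
  rw [EReal.coe_lt_coe_iff, div_lt_iff₀ hl] at h3
  rcases Nat.eq_zero_or_pos (boxCount S r) with hb | hb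
  · rw [hb, Nat.cast_zero]; positivity
  have hb' : (0 : ℝ) < boxCount S r := by exact_mod_cast hb
  have : (boxCount S r : ℝ) ≤ r ^ (-t) := by
    rw [Real.rpow_neg h4.le, ← Real.inv_rpow h4.le, ← one_div, ← Real.log_le_log_iff hb'
      (by positivity), Real.log_rpow (by positivity)]
    exact h3.le
  refine this.trans (Real.rpow_le_rpow_of_exponent_ge h4 h5.le ?_)
  exact neg_le_neg (le_max_left _ _)

/-- It suffices to count the boxes at the scales `4 ^ (-k)`. -/
theorem boxCount_of_scales {S : Set ℂ} (hS : Bornology.IsBounded S) {A τ : ℝ} (hτ : 0 ≤ τ)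
    (hA : 0 ≤ A)
    (h : ∀ᶠ k : ℕ in atTop, (boxCount S ((1 / 4 : ℝ) ^ k) : ℝ) ≤ A * ((4 : ℝ) ^ k) ^ τ) :
    ∀ᶠ r : ℝ in 𝓝[>] 0, (boxCount S r : ℝ) ≤ A * 4 ^ τ * r ^ (-τ) := by
  obtain ⟨k₀, hk⟩ := eventually_atTop.1 h
  filter_upwards [self_mem_nhdsWithin, nhdsWithin_le_nhds (gt_mem_nhds one_pos), nhdsWithin_le_nhds
    (gt_mem_nhds (show (0 : ℝ) < (1 / 4) ^ k₀ by positivity))] with r h1 h2 h3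
  rw [Set.mem_Ioi] at h1
  obtain ⟨n, hn, hn'⟩ := exists_nat_pow_near_of_lt_one h1 h2.le (show (0 : ℝ) < 1 / 4 by norm_num)
    (by norm_num)
  have hkn : k₀ ≤ n + 1 := by
    by_contra! hcon
    have : (1 / 4 : ℝ) ^ k₀ ≤ (1 / 4) ^ (n + 1) :=
      pow_le_pow_of_le_one (by norm_num) (by norm_num) hcon.le
    linarith
  have h4 : (boxCount S r : ℝ) ≤ boxCount S ((1 / 4 : ℝ) ^ (n + 1)) := by
    exact_mod_cast boxCount_anti hS (by positivity) hn.le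
  refine h4.trans ((hk _ hkn).trans ?_)
  rw [Real.rpow_neg h1.le, ← Real.inv_rpow h1.le, mul_assoc,
    ← Real.mul_rpow (by norm_num) (by positivity)]
  gcongr
  rw [pow_succ, mul_comm]
  gcongr
  rw [one_div, inv_pow] at hn'
  exact (le_inv_comm₀ h1 (by positivity)).1 hn'

/-! ### Boxes of a grid -/

/-- The corner of the square lattice of mesh `θ` with the coordinates `ij`. -/
def gridPt (θ : ℝ) (ij : ℤ × ℤ) : ℂ := ⟨θ * ij.1, θ * ij.2⟩

/-- The coordinates between `-n` and `n`. -/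
def gridIdx (n : ℕ) : Finset (ℤ × ℤ) := Finset.Icc (-n : ℤ) n ×ˢ Finset.Icc (-n : ℤ) n

theorem card_gridIdx (n : ℕ) : (gridIdx n).card = (2 * n + 1) ^ 2 := by
  rw [gridIdx, Finset.card_product, Int.card_Icc, sq]
  congr 1 <;> omega

open Classical in
/-- A bounded set is covered by the boxes of a grid with a corner close to the set. -/
theorem boxCount_le_hits {S : Set ℂ} {θ : ℝ} (hθ : 0 < θ) {n : ℕ}
    (hS : S ⊆ Metric.closedBall 0 (n * θ)) :
    boxCount S θ ≤
      ((gridIdx n).filter fun ij => (S ∩ Metric.ball (gridPt θ ij) (2 * θ)).Nonempty).card := by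
  refine (boxCount_le (W := Finset.image (gridPt θ) _) fun z hz => ?_).trans Finset.card_image_le
  have hn := mem_closedBall_zero_iff.1 (hS hz)
  have n1 := abs_le.1 ((Complex.abs_re_le_norm z).trans hn)
  have n2 := abs_le.1 ((Complex.abs_im_le_norm z).trans hn)
  have key : ∀ x : ℝ, -(n * θ) ≤ x ∧ x ≤ n * θ → θ * ⌊x / θ⌋ ≤ x ∧ x < θ * ⌊x / θ⌋ + θ ∧
      ⌊x / θ⌋ ∈ Finset.Icc (-n : ℤ) n := by
    intro x hx
    have a1 := Int.floor_le (x / θ)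
    have a2 := Int.lt_floor_add_one (x / θ)
    rw [le_div_iff₀ hθ] at a1
    rw [div_lt_iff₀ hθ] at a2
    refine ⟨by linarith, by linarith, Finset.mem_Icc.2 ⟨Int.le_floor.2 ?_, ?_⟩⟩
    · rw [le_div_iff₀ hθ]; push_cast; linarith
    · have : (⌊x / θ⌋ : ℝ) ≤ n := by nlinarith
      exact_mod_cast this
  obtain ⟨a1, a2, a3⟩ := key _ n1
  obtain ⟨b1, b2, b3⟩ := key _ n2
  refine Set.mem_iUnion₂.2 ⟨gridPt θ (⌊z.re / θ⌋, ⌊z.im / θ⌋), Finset.mem_image_of_mem _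
    (Finset.mem_filter.2 ⟨Finset.mem_product.2 ⟨a3, b3⟩, z, hz, ?_⟩), a1, a2.le, b1, b2.le⟩
  rw [mem_ball_iff_norm]
  refine (Complex.norm_le_abs_re_add_abs_im _).trans_lt ?_
  simp only [Complex.sub_re, Complex.sub_im, gridPt]
  rw [abs_of_nonneg (by linarith), abs_of_nonneg (by linarith)]
  linarith

theorem card_Icc_le {a b : ℝ} (hab : a ≤ b) : ((Finset.Icc ⌈a⌉ ⌊b⌋).card : ℝ) ≤ b - a + 1 := by
  rw [Int.card_Icc]
  have h : (⌊b⌋ + 1 - ⌈a⌉ : ℝ) ≤ b - a + 1 := by linarith [Int.floor_le b, Int.le_ceil a]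
  rcases le_total 0 (⌊b⌋ + 1 - ⌈a⌉) with h0 | h0
  · have : (((⌊b⌋ + 1 - ⌈a⌉).toNat : ℤ) : ℝ) = ⌊b⌋ + 1 - ⌈a⌉ := by
      rw [Int.toNat_of_nonneg h0]; push_cast; ring
    rw [Int.cast_natCast] at this
    linarith
  · rw [Int.toNat_of_nonpos h0, Nat.cast_zero]; linarith

open Classical in
/-- Few grid points are close to a set of small dimension. -/
theorem card_near_le {S : Set ℂ} (hS : Bornology.IsBounded S) {θ d : ℝ} (hθ : 0 < θ) (hd : θ ≤ d)
    (F : Finset (ℤ × ℤ)) :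
    ((F.filter fun ij => ∃ f ∈ S, ‖f - gridPt θ ij‖ < d).card : ℝ) ≤
      (4 * (d / θ)) ^ 2 * boxCount S d := by
  obtain ⟨W, hW, hc⟩ := exists_boxes hS (hθ.trans_le hd)
  set I : ℝ → Finset ℤ := fun x => Finset.Icc ⌈(x - d) / θ⌉ ⌊(x + 2 * d) / θ⌋ with hI
  have cI : ∀ x, ((I x).card : ℝ) ≤ 4 * (d / θ) := by
    intro x
    have h1 : 1 ≤ d / θ := (one_le_div hθ).2 hd
    have h2 : (x + 2 * d) / θ - (x - d) / θ = 3 * (d / θ) := by field_simp; ring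
    refine (card_Icc_le (by gcongr; linarith)).trans ?_
    linarith
  have mI : ∀ x f : ℝ, ∀ i : ℤ, x ≤ f → f ≤ x + d → |f - θ * i| ≤ d → i ∈ I x := by
    intro x f i h1 h2 h3
    have h4 := abs_le.1 h3
    refine Finset.mem_Icc.2 ⟨Int.ceil_le.2 ?_, Int.le_floor.2 ?_⟩
    · rw [div_le_iff₀ hθ]; linarith
    · rw [le_div_iff₀ hθ]; linarith
  have hsub : (F.filter fun ij => ∃ f ∈ S, ‖f - gridPt θ ij‖ < d) ⊆
      W.biUnion fun w => I w.re ×ˢ I w.im := by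
    intro ij hij
    obtain ⟨_, f, hf, hfd⟩ := Finset.mem_filter.1 hij
    obtain ⟨w, hw, h1, h2, h3, h4⟩ := Set.mem_iUnion₂.1 (hc hf)
    have e1 := (Complex.abs_re_le_norm (f - gridPt θ ij)).trans hfd.le
    have e2 := (Complex.abs_im_le_norm (f - gridPt θ ij)).trans hfd.le
    simp only [Complex.sub_re, Complex.sub_im, gridPt] at e1 e2
    exact Finset.mem_biUnion.2 ⟨w, hw, Finset.mem_product.2
      ⟨mI _ _ _ h1 h2 e1, mI _ _ _ h3 h4 e2⟩⟩
  have h1 : ((F.filter fun ij => ∃ f ∈ S, ‖f - gridPt θ ij‖ < d).card : ℝ) ≤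
      ∑ w ∈ W, ((I w.re ×ˢ I w.im).card : ℝ) := by
    exact_mod_cast (Finset.card_le_card hsub).trans Finset.card_biUnion_le
  refine h1.trans ((Finset.sum_le_sum (g := fun _ => (4 * (d / θ)) ^ 2) fun w _ => ?_).trans ?_)
  · rw [Finset.card_product, Nat.cast_mul, sq]
    exact mul_le_mul (cI _) (cI _) (Nat.cast_nonneg _) ((Nat.cast_nonneg _).trans (cI w.re))
  · rw [Finset.sum_const, nsmul_eq_mul, hW, mul_comm]

/-! ### The dimension of the limiting path -/

open Classical in
/-- The Markov inequality for the number of events that occur. -/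
theorem measureReal_card_lt {X ι : Type*} [MeasurableSpace X] (μ : Measure X)
    [IsProbabilityMeasure μ] (F : Finset ι) {A : ι → Set X} (hA : ∀ i, MeasurableSet (A i)) {p t : ℝ}
    (hp : ∀ i ∈ F, μ.real (A i) ≤ p) (ht : 0 < t) :
    μ.real {x | t < (F.filter fun i => x ∈ A i).card} ≤ F.card * p / t := by
  have e : ∀ x, ((F.filter fun i => x ∈ A i).card : ℝ) = ∑ i ∈ F, (A i).indicator 1 x := by
    intro x
    rw [Finset.card_filter, Nat.cast_sum]
    refine Finset.sum_congr rfl fun i _ => ?_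
    by_cases h : x ∈ A i <;> simp [h]
  have hi : ∀ i ∈ F, Integrable ((A i).indicator (1 : X → ℝ)) μ := fun i _ =>
    (integrable_const 1).indicator (hA i)
  have h1 := mul_meas_ge_le_integral_of_nonneg (μ := μ)
    (f := fun x => ∑ i ∈ F, (A i).indicator (1 : X → ℝ) x)
    (Eventually.of_forall fun x => Finset.sum_nonneg fun i _ =>
      Set.indicator_nonneg (fun _ _ => zero_le_one) x) (integrable_finsetSum F hi) t
  rw [integral_finsetSum F hi] at h1
  simp only [integral_indicator_one (hA _)] at h1
  have h2 : ∑ i ∈ F, μ.real (A i) ≤ F.card * p := by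
    rw [← nsmul_eq_mul]; exact Finset.sum_le_card_nsmul _ _ _ hp
  rw [le_div_iff₀ ht, mul_comm]
  refine (mul_le_mul_of_nonneg_left (measureReal_mono fun x hx => ?_) ht.le).trans (h1.trans h2)
  simp only [Set.mem_ofPred_eq, e] at hx ⊢
  exact hx.le

open Classical in
theorem isOpen_card_lt {X ι : Type*} [TopologicalSpace X] (F : Finset ι) {A : ι → Set X}
    (hA : ∀ i, IsOpen (A i)) (t : ℝ) :
    IsOpen {x | t < ((F.filter fun i => x ∈ A i).card : ℝ)} := by
  rw [isOpen_iff_mem_nhds]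
  intro x hx
  have : ∀ᶠ y in 𝓝 x, ∀ i ∈ F.filter (fun i => x ∈ A i), y ∈ A i :=
    (Filter.eventually_all_finset _).2 fun i hi => (hA i).mem_nhds (Finset.mem_filter.1 hi).2
  filter_upwards [this] with y hy
  refine lt_of_lt_of_le (show t < _ from hx) ?_
  exact_mod_cast Finset.card_le_card fun i hi =>
    Finset.mem_filter.2 ⟨(Finset.mem_filter.1 hi).1, hy i hi⟩

/-- Bounds for the probability of an open set pass to limit points of laws. -/
theorem measureReal_le_of_mapClusterPt {X : Type*} [TopologicalSpace X] [MeasurableSpace X]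
    [OpensMeasurableSpace X] [HasOuterApproxClosed X] {μ : ProbabilityMeasure X}
    {μs : ℕ → ProbabilityMeasure X} (h : MapClusterPt μ atTop μs) {G : Set X} (hG : IsOpen G) {p : ℝ}
    (hp : 0 ≤ p) (hle : ∀ᶠ n in atTop, (μs n : Measure X).real G ≤ p) :
    (μ : Measure X).real G ≤ p := by
  obtain ⟨U, hU, ht⟩ := mapClusterPt_iff_ultrafilter.1 h
  have h1 := ProbabilityMeasure.le_liminf_measure_open_of_tendsto ht hG
  have h2 : liminf (fun n => (μs n : Measure X) G) (U : Filter ℕ) ≤ ENNReal.ofReal p := by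
    refine (liminf_le_limsup (by isBoundedDefault) (by isBoundedDefault)).trans
      (limsup_le_of_le (by isBoundedDefault) ?_)
    filter_upwards [hU hle] with n hn
    rw [measureReal_def] at hn
    exact (ENNReal.le_ofReal_iff_toReal_le (measure_ne_top _ _) hp).2 hn
  rw [measureReal_def]
  exact ENNReal.toReal_le_of_le_ofReal hp (h1.trans h2)

/-- Components of the open set `Ω \ L` are open and closed in it, so a frontier point lies outside. -/
theorem frontier_connectedComponentIn_subset {X : Type*} [TopologicalSpace X]
    [LocallyConnectedSpace X] {Ω L : Set X} (hΩ : IsOpen Ω) (hL : IsClosed L) (z : X) :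
    frontier (connectedComponentIn (Ω \ L) z) ⊆ L ∪ frontier Ω := by
  intro p hp
  have ho : IsOpen (Ω \ L) := hΩ.sdiff hL
  rw [ho.connectedComponentIn.frontier_eq] at hp
  by_contra hcon
  rw [Set.mem_union, not_or] at hcon
  have hpΩ : p ∈ Ω := by
    by_contra h
    refine hcon.2 ?_
    rw [hΩ.frontier_eq]
    exact ⟨closure_mono ((connectedComponentIn_subset _ _).trans Set.sdiff_subset) hp.1, h⟩
  have hm := mem_connectedComponentIn (show p ∈ Ω \ L from ⟨hpΩ, hcon.1⟩)
  obtain ⟨y, hy, hy'⟩ := mem_closure_iff.1 hp.1 _ (ho.connectedComponentIn (x := p)) hm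
  refine hp.2 ?_
  rw [connectedComponentIn_eq hy', ← connectedComponentIn_eq hy]
  exact hm

theorem two_pow_rpow_two_mul (k : ℕ) (s : ℝ) : ((2 : ℝ) ^ k) ^ (2 * s) = ((4 : ℝ) ^ k) ^ s := by
  rw [Real.rpow_mul (by positivity), Real.rpow_two, ← pow_mul, mul_comm, pow_mul]
  norm_num

variable {M : FlowerModel} {Ω : Set ℂ} {ε : ℕ → ℝ}

/-- A limiting path is contained in a ball that contains the domain. -/
theorem ae_subset_closedBall {R : ℝ} (hR : Ω ⊆ Metric.closedBall 0 R) (hε : ∀ n, 0 < ε n)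
    (hε0 : Tendsto ε atTop (𝓝 0)) (D : ∀ n, AdmissibleDiscretization M Ω (ε n))
    {μ : ProbabilityMeasure (NonemptyCompacts ℂ)}
    (hμ : MapClusterPt μ atTop fun n => (D n).explorationLaw) :
    ∀ᵐ K : NonemptyCompacts ℂ ∂(μ : Measure (NonemptyCompacts ℂ)),
      (K : Set ℂ) ⊆ Metric.closedBall 0 (R + 10) := by
  have hG : IsOpen {K : NonemptyCompacts ℂ | ((K : Set ℂ) ∩ (Metric.closedBall 0 (R + 10))ᶜ).Nonempty} :=
    isOpen_hits Metric.isClosed_closedBall.isOpen_compl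
  have h := measureReal_le_of_mapClusterPt hμ hG le_rfl (by
    filter_upwards [hε0.eventually (gt_mem_nhds one_pos)] with n hn
    refine le_of_eq ?_
    rw [measureReal_def, show ((D n).explorationLaw : Measure (NonemptyCompacts ℂ)) =
      (M.law[|boundaryEvent (D n).blue (D n).yellow]).map (D n).trace from rfl,
      Measure.map_apply (D n).measurable_trace hG.measurableSet]
    rw [show (D n).trace ⁻¹' _ = ∅ from ?_, measure_empty, ENNReal.toReal_zero]
    refine Set.eq_empty_of_forall_notMem fun ω ⟨p, hp, hpR⟩ => hpR ?_
    obtain ⟨w, hw, hpw⟩ := (D n).trace_bounded (hε n).le hp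
    have h1 := mem_closedBall_zero_iff.1 (hR hw)
    have h2 := norm_add_le (p - w) w
    rw [sub_add_cancel] at h2
    exact mem_closedBall_zero_iff.2 (by linarith))
  rw [ae_iff]
  have h0 := (measureReal_eq_zero_iff).1 (le_antisymm h measureReal_nonneg)
  refine measure_mono_null (fun K hK => ?_) h0
  obtain ⟨p, hp, hp'⟩ := Set.not_subset.1 hK
  exact ⟨p, hp, hp'⟩

open Classical in
/-- The number of boxes at distance at least `2 ^ (-k)` from the boundary of the domain, at the scale
`4 ^ (-k)`, that are met by a limiting path. -/
def farHits (Ω : Set ℂ) (n k : ℕ) (K : NonemptyCompacts ℂ) : ℕ :=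
  (((gridIdx (n * 4 ^ k)).filter fun ij =>
    ¬ ∃ f ∈ frontier Ω, ‖f - gridPt ((1 / 4) ^ k) ij‖ < (1 / 2) ^ k).filter fun ij =>
      K ∈ {K : NonemptyCompacts ℂ |
        ((K : Set ℂ) ∩ Metric.ball (gridPt ((1 / 4) ^ k) ij) (2 * (1 / 4) ^ k)).Nonempty}).card

theorem isOpen_lt_farHits (Ω : Set ℂ) (n k : ℕ) (t : ℝ) :
    IsOpen {K : NonemptyCompacts ℂ | t < farHits Ω n k K} :=
  isOpen_card_lt _ (fun _ => isOpen_hits Metric.isOpen_ball) t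

/-- Far from the boundary of the domain, few boxes are met with high probability. -/
theorem measureReal_farHits_le {C ψ : ℝ} (hC : 0 < C)
    (hlaw : ∀ (Ω : Set ℂ) (ε : ℝ) (D : AdmissibleDiscretization M Ω ε) (w : ℂ) (ρ d : ℝ), 0 < ε →
      ε ≤ ρ → 2 * ρ ≤ d → 100 * ε ≤ d → (∀ f ∈ frontier Ω, d ≤ ‖f - w‖) →
      (D.explorationLaw : Measure (NonemptyCompacts ℂ)).real
        {K | ((K : Set ℂ) ∩ Metric.ball w ρ).Nonempty} ≤ C * (ρ / d) ^ ψ)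
    (hε : ∀ n, 0 < ε n) (hε0 : Tendsto ε atTop (𝓝 0)) (D : ∀ n, AdmissibleDiscretization M Ω (ε n))
    {μ : ProbabilityMeasure (NonemptyCompacts ℂ)}
    (hμ : MapClusterPt μ atTop fun n => (D n).explorationLaw) {n : ℕ} (hn : 1 ≤ n) {k : ℕ}
    (hk : 2 ≤ k) :
    (μ : Measure (NonemptyCompacts ℂ)).real
      {K | ((2 : ℝ) ^ k) ^ (4 - ψ / 2) < farHits Ω n k K} ≤
        (9 * n ^ 2 * C * 2 ^ ψ) * ((2 : ℝ) ^ (-(ψ / 2))) ^ k := by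
  classical
  set x : ℝ := 2 ^ k with hx
  have hx0 : 0 < x := by positivity
  have hx4 : 4 ≤ x := by
    rw [hx, show (4 : ℝ) = 2 ^ 2 by norm_num]; exact pow_le_pow_right₀ (by norm_num) hk
  have e2 : (1 / 2 : ℝ) ^ k = x⁻¹ := by rw [hx, one_div, inv_pow]
  have e4 : (1 / 4 : ℝ) ^ k = x⁻¹ * x⁻¹ := by
    rw [← e2, ← mul_pow]; norm_num
  have hρ : 2 * (2 * (1 / 4 : ℝ) ^ k) ≤ (1 / 2) ^ k := by
    rw [e2, e4]
    have : 4 * x⁻¹ ≤ 1 := by rw [← div_eq_mul_inv, div_le_one hx0]; exact hx4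
    nlinarith [inv_pos.2 hx0]
  have e : ((2 : ℝ) ^ (-(ψ / 2))) ^ k = x ^ (-(ψ / 2)) := by
    rw [hx, ← Real.rpow_natCast, ← Real.rpow_natCast, ← Real.rpow_mul (by norm_num),
      ← Real.rpow_mul (by norm_num), mul_comm]
  refine measureReal_le_of_mapClusterPt hμ (isOpen_lt_farHits _ _ _ _) (by positivity) ?_
  filter_upwards [hε0.eventually (gt_mem_nhds (show (0 : ℝ) < 2 * (1 / 4) ^ k by positivity)),
    hε0.eventually (gt_mem_nhds (show (0 : ℝ) < (1 / 2) ^ k / 100 by positivity))] with m h1 h2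
  refine (measureReal_card_lt _ _ (fun ij => (isOpen_hits Metric.isOpen_ball).measurableSet)
    (p := C * (2 * x⁻¹) ^ ψ) (fun ij hij => ?_) (by positivity)).trans ?_
  · have hfar := (Finset.mem_filter.1 hij).2
    push Not at hfar
    refine (hlaw Ω _ (D m) _ _ _ (hε m) h1.le hρ (by linarith) hfar).trans (le_of_eq ?_)
    rw [e2, e4]
    congr 2
    field_simp
  · have hcard : (((gridIdx (n * 4 ^ k)).filter fun ij =>
        ¬ ∃ f ∈ frontier Ω, ‖f - gridPt ((1 / 4) ^ k) ij‖ < (1 / 2) ^ k).card : ℝ) ≤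
        9 * n ^ 2 * x ^ (4 : ℝ) := by
      refine (Nat.cast_le.2 (Finset.card_filter_le _ _)).trans ?_
      rw [card_gridIdx]
      have hx2 : (4 : ℝ) ^ k = x ^ 2 := by rw [hx, ← pow_mul, mul_comm, pow_mul]; norm_num
      push_cast
      rw [hx2, show x ^ (4 : ℝ) = x ^ 4 by exact_mod_cast Real.rpow_natCast x 4]
      have : (1 : ℝ) ≤ n * x ^ 2 := by
        have : (1 : ℝ) ≤ n := by exact_mod_cast hn
        nlinarith
      nlinarith
    rw [div_le_iff₀ (by positivity), e]
    refine (mul_le_mul_of_nonneg_right hcard (by positivity)).trans (le_of_eq ?_)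
    rw [Real.mul_rpow (by norm_num) (by positivity), Real.inv_rpow hx0.le, ← Real.rpow_neg hx0.le]
    have : x ^ (4 : ℝ) * x ^ (-ψ) = x ^ (-(ψ / 2)) * x ^ (4 - ψ / 2) := by
      rw [← Real.rpow_add hx0, ← Real.rpow_add hx0]; congr 1; ring
    linear_combination (9 * n ^ 2 * C * 2 ^ ψ) * this

/-- Box counts of a limiting path and of the boundary of the domain. The boxes close to the boundary
are controlled by the dimension of the boundary, the others by `measureReal_farHits_le`. -/
theorem exists_boxCount_le_ae (M : FlowerModel) {Ω : Set ℂ} (hb : Bornology.IsBounded Ω)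
    (hdim : upperMinkowskiDim (frontier Ω) < 2) :
    ∃ τ : ℝ, 0 < τ ∧ τ < 2 ∧ (∀ᶠ r : ℝ in 𝓝[>] 0, (boxCount (frontier Ω) r : ℝ) ≤ r ^ (-τ)) ∧
      ∀ (ε : ℕ → ℝ), (∀ n, 0 < ε n) → Tendsto ε atTop (𝓝 0) →
      ∀ (D : ∀ n, AdmissibleDiscretization M Ω (ε n)) (μ : ProbabilityMeasure (NonemptyCompacts ℂ)),
        MapClusterPt μ atTop (fun n => (D n).explorationLaw) →
        ∀ᵐ K : NonemptyCompacts ℂ ∂(μ : Measure (NonemptyCompacts ℂ)),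
          ∃ C : ℝ, ∀ᶠ r : ℝ in 𝓝[>] 0, (boxCount (K : Set ℂ) r : ℝ) ≤ C * r ^ (-τ) := by
  classical
  obtain ⟨τ₀, h0, h2, hτ₀⟩ := exists_boxCount_le hdim
  obtain ⟨C, ψ, hC, hψ, hlaw⟩ := M.law_hits
  have hfb : Bornology.IsBounded (frontier Ω) := hb.closure.subset frontier_subset_closure
  -- with `x = 2 ^ k` and boxes of side `x ^ (-2)`, there are of the order of `x ^ (2 + τ₀)` boxes close
  -- to the boundary, and at most `x ^ (4 - ψ / 2)` boxes far from it; both are at most `x ^ (2 * τ)`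
  set τ := max (1 + τ₀ / 2) (2 - ψ / 4) with hτ
  have t1 : 1 + τ₀ / 2 ≤ τ := le_max_left _ _
  have t2 : 2 - ψ / 4 ≤ τ := le_max_right _ _
  refine ⟨τ, by linarith, max_lt (by linarith) (by linarith), ?_, ?_⟩
  · filter_upwards [hτ₀, self_mem_nhdsWithin, nhdsWithin_le_nhds (gt_mem_nhds one_pos)]
      with r h1 h2 h3
    exact h1.trans (Real.rpow_le_rpow_of_exponent_ge h2 h3.le (by linarith))
  intro ε hε hε0 D μ hμ
  obtain ⟨R, hR⟩ := hb.subset_closedBall 0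
  obtain ⟨n, hn⟩ := exists_nat_ge (max 1 (R + 10))
  have hn1 : 1 ≤ n := by exact_mod_cast (le_max_left _ _).trans hn
  -- far from the boundary
  set q : ℝ := (2 : ℝ) ^ (-(ψ / 2)) with hq
  have hq1 : q < 1 := Real.rpow_lt_one_of_one_lt_of_neg (by norm_num) (by linarith)
  have hsum : ∑' k, (μ : Measure (NonemptyCompacts ℂ))
      {K | ((2 : ℝ) ^ (k + 2)) ^ (4 - ψ / 2) < farHits Ω n (k + 2) K} ≠ ⊤ := by
    have hs : Summable fun k : ℕ => (9 * n ^ 2 * C * 2 ^ ψ) * q ^ (k + 2) :=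
      (((summable_geometric_of_lt_one (by positivity) hq1).comp_injective
        (add_left_injective 2))).mul_left _
    refine ne_top_of_le_ne_top hs.tsum_ofReal_ne_top (ENNReal.tsum_le_tsum fun k => ?_)
    have := measureReal_farHits_le hC hlaw hε hε0 D hμ hn1 (show 2 ≤ k + 2 by omega)
    rw [measureReal_def] at this
    exact (ENNReal.le_ofReal_iff_toReal_le (measure_ne_top _ _) (by positivity)).2 this
  filter_upwards [ae_eventually_notMem hsum, ae_subset_closedBall hR hε hε0 D hμ] with K h1 h3
  refine ⟨17 * 4 ^ τ, boxCount_of_scales K.isCompact.isBounded (by linarith) (by norm_num) ?_⟩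
  have hhalf : Tendsto (fun k : ℕ => (1 / 2 : ℝ) ^ k) atTop (𝓝[>] 0) :=
    tendsto_nhdsWithin_iff.2 ⟨tendsto_pow_atTop_nhds_zero_of_lt_one (by norm_num) (by norm_num),
      Eventually.of_forall fun k => by simp⟩
  filter_upwards [hhalf.eventually hτ₀, (tendsto_sub_atTop_nat 2).eventually h1,
    eventually_ge_atTop 2] with k k1 k2 k3
  rw [not_lt, Nat.sub_add_cancel k3] at k2
  set x : ℝ := 2 ^ k with hx
  have hx0 : 0 < x := by positivity
  have hx1 : 1 ≤ x := one_le_pow₀ (by norm_num)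
  have e2 : (1 / 2 : ℝ) ^ k = x⁻¹ := by rw [hx, one_div, inv_pow]
  have e4 : (1 / 4 : ℝ) ^ k = x⁻¹ * x⁻¹ := by
    rw [← e2, ← mul_pow]; norm_num
  have hle : (1 / 4 : ℝ) ^ k ≤ (1 / 2) ^ k := pow_le_pow_left₀ (by norm_num) (by norm_num) k
  rw [← two_pow_rpow_two_mul]
  have hKn : (K : Set ℂ) ⊆ Metric.closedBall 0 ((n * 4 ^ k : ℕ) * (1 / 4) ^ k) := by
    refine h3.trans (Metric.closedBall_subset_closedBall ?_)
    push_cast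
    rw [mul_assoc, ← mul_pow]
    norm_num
    exact (le_max_right _ _).trans hn
  have hcount := boxCount_le_hits (by positivity) hKn
  have hnear := card_near_le hfb (by positivity) hle (gridIdx (n * 4 ^ k))
  have hsplit : ((gridIdx (n * 4 ^ k)).filter fun ij => ((K : Set ℂ) ∩ Metric.ball
      (gridPt ((1 / 4) ^ k) ij) (2 * (1 / 4) ^ k)).Nonempty).card ≤
      ((gridIdx (n * 4 ^ k)).filter fun ij => ∃ f ∈ frontier Ω,
        ‖f - gridPt ((1 / 4) ^ k) ij‖ < (1 / 2) ^ k).card + farHits Ω n k K := by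
    refine (Finset.card_le_card fun ij hij => ?_).trans (Finset.card_union_le _ _)
    obtain ⟨m1, m2⟩ := Finset.mem_filter.1 hij
    rw [Finset.mem_union]
    by_cases hc : ∃ f ∈ frontier Ω, ‖f - gridPt ((1 / 4) ^ k) ij‖ < (1 / 2) ^ k
    · exact Or.inl (Finset.mem_filter.2 ⟨m1, hc⟩)
    · exact Or.inr (Finset.mem_filter.2 ⟨Finset.mem_filter.2 ⟨m1, hc⟩, m2⟩)
  have b1 : (4 * ((1 / 2 : ℝ) ^ k / (1 / 4) ^ k)) ^ 2 * (boxCount (frontier Ω) ((1 / 2) ^ k) : ℝ) ≤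
      16 * x ^ (2 * τ) := by
    have e : (4 * ((1 / 2 : ℝ) ^ k / (1 / 4) ^ k)) ^ 2 = 16 * x ^ (2 : ℝ) := by
      rw [e2, e4, Real.rpow_two]; field_simp; norm_num
    have k1' : (boxCount (frontier Ω) ((1 / 2) ^ k) : ℝ) ≤ x ^ τ₀ := by
      refine k1.trans (le_of_eq ?_)
      rw [e2, Real.inv_rpow hx0.le, Real.rpow_neg hx0.le, inv_inv]
    rw [e, mul_assoc]
    refine mul_le_mul_of_nonneg_left ((mul_le_mul_of_nonneg_left k1' (by positivity)).trans ?_)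
      (by norm_num)
    rw [← Real.rpow_add hx0]
    exact Real.rpow_le_rpow_of_exponent_le hx1 (by linarith)
  have b2 : x ^ (4 - ψ / 2) ≤ x ^ (2 * τ) := Real.rpow_le_rpow_of_exponent_le hx1 (by linarith)
  have hc : (boxCount (K : Set ℂ) ((1 / 4) ^ k) : ℝ) ≤ _ := Nat.cast_le.2 (hcount.trans hsplit)
  push_cast at hc
  linarith

end BondTriangular

end

theorem mainTheorem6 (M : BondTriangular.FlowerModel) (Ω : Set ℂ) (hΩo : IsOpen Ω)
    (hΩc : IsConnected Ω) (hΩb : Bornology.IsBounded Ω)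
    (hdim : BondTriangular.upperMinkowskiDim (frontier Ω) < 2) :
    ∃ ψ' : ℝ, 0 < ψ' ∧
      ∀ (ε : ℕ → ℝ), (∀ n, 0 < ε n) → Tendsto ε atTop (𝓝 0) →
      ∀ (D : ∀ n, BondTriangular.AdmissibleDiscretization M Ω (ε n))
        (μ' : ProbabilityMeasure (NonemptyCompacts ℂ)),
        MapClusterPt μ' atTop (fun n => (D n).explorationLaw) →
        ∀ᵐ K : NonemptyCompacts ℂ ∂(μ' : Measure (NonemptyCompacts ℂ)),
          BondTriangular.upperMinkowskiDim (K : Set ℂ) < ((2 - ψ' : ℝ) : EReal) ∧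
          ∀ L : Set ℂ, L ⊆ (K : Set ℂ) → IsClosed L → ∀ z ∈ Ω \ L,
            BondTriangular.upperMinkowskiDim (frontier (connectedComponentIn (Ω \ L) z)) <
              ((2 - ψ' : ℝ) : EReal) := by
  obtain ⟨τ, h0, h2, hΩτ, hae⟩ := BondTriangular.exists_boxCount_le_ae M hΩb hdim
  -- the bounds of order `r ^ (-τ)` give dimensions below `2 - (2 - τ) / 2`, hence strictly below
  -- `2 - (2 - τ) / 3`
  refine ⟨(2 - τ) / 3, by linarith, ?_⟩
  intro ε hε hε0 D μ hμ
  have key : ∀ (S : Set ℂ) (C : ℝ),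
      (∀ᶠ r : ℝ in 𝓝[>] 0, (BondTriangular.boxCount S r : ℝ) ≤ C * r ^ (-τ)) →
      BondTriangular.upperMinkowskiDim S < ((2 - (2 - τ) / 3 : ℝ) : EReal) := fun S C hS =>
    (BondTriangular.upperMinkowskiDim_le (τ' := 2 - (2 - τ) / 2) (by linarith) (by linarith)
      hS).trans_lt (EReal.coe_lt_coe_iff.2 (by linarith))
  filter_upwards [hae ε hε hε0 D μ hμ] with K hK
  obtain ⟨C, hC⟩ := hK
  refine ⟨key _ _ hC, fun L hL hLc z _ => key _ (C + 1) ?_⟩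
  filter_upwards [hC, hΩτ, self_mem_nhdsWithin] with r h3 h4 h5
  have hK := K.isCompact.isBounded
  have hf : Bornology.IsBounded (frontier Ω) := hΩb.closure.subset frontier_subset_closure
  have h6 := (BondTriangular.boxCount_mono (hK.union hf)
    ((BondTriangular.frontier_connectedComponentIn_subset hΩo hLc z).trans
      (Set.union_subset_union_left _ hL)) h5).trans (BondTriangular.boxCount_union_le hK hf h5)
  have h7 : (BondTriangular.boxCount (frontier (connectedComponentIn (Ω \ L) z)) r : ℝ) ≤ _ :=
    Nat.cast_le.2 h6
  push_cast at h7
  linarith
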